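/- Let $k$ be a field of characteristic zero and let $X=\operatorname{Spec} A$ be a smooth affine variety over $k$ (that is, $A$ is a smooth commutative $k$-algebra). Let $\mathcal D_X$ be the $k$-algebra of (Grothendieck) differential operators on $A$. Let $\mathbf{DR}_X=\operatorname{Sym}_A(\Omega^1_A[-1])=\bigoplus_p\Omega_A^p$, with $\Omega_A^p$ in weight $p$ and cohomological degree $p$, with zero cohomological differential, regarded as a graded mixed cdga with the de Rham differential as mixed structure. A *graded $\mathbf{DR}_X$-dg-module* is a $\mathbf{DR}_X$-module $M=\bigoplus_{p,n\in\mathbb Z}M^{p,n}$, compatibly bigraded by weight $p$ and cohomological degree $n$, with a differential $d$ of weight $0$ and degree $1$ such that $d(\omega x)=(-1)^{|\omega|}\omega\,dx$. A *graded mixed $\mathbf{DR}_X$-dg-module* is in addition equipped with a map $\epsilon$ of weight $1$ and degree $1$ such that $\epsilon^2=0$, $d\epsilon+\epsilon d=0$ and $\epsilon(\omega x)=d_{dR}(\omega)x+(-1)^{|\omega|}\omega\,\epsilon(x)$. Morphisms preserve all the structure, and quasi-isomorphisms are the morphisms inducing isomorphisms on $d$-cohomology. For graded mixed modules $M,N$,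 let $\underline{\operatorname{Hom}}_{\epsilon}(M,N)$ be the complex whose degree $n$ part consists of the maps of weight $0$ and degree $n$ that commute, up to the Koszul signs, with $\mathbf{DR}_X$ and $\epsilon$. Call $Q$ *K-projective* if $\underline{\operatorname{Hom}}_\epsilon(Q,N)$ is acyclic for every acyclic $N$, and similarly for complexes of $\mathcal D_X$-modules. For a complex $E$ of left $\mathcal D_X$-modules, with flat connection $\nabla$, let $\mathbf{DR}(E)=\mathbf{DR}_X\otimes_A E$ with $d(\omega\otimes e)=(-1)^{|\omega|}\omega\otimes de$ and $\epsilon(\omega\otimes e)=d_{dR}\omega\otimes e+(-1)^{|\omega|}\omega\wedge\nabla e$. This defines a functor $\mathbf{DR}$, acting on complexes of maps as well. Then: 1. $\mathbf{DR}$ is fully faithful on dg-categories: if $E$ and $F$ are complexes of left $\mathcal D_X$-modules and $E$ is K-projective, then there is a quasi-isomorphism $q:Q\to\mathbf{DR}(E)$ with $Q$ K-projective, and for every such $q$ the map $$\underline{\operatorname{Hom}}_{\mathcal D_X}(E,F)\longrightarrow\underline{\operatorname{Hom}}_\epsilon(Q,\mathbf{DR}(F)),\qquad f\mapsto\mathbf{DR}(f)\circ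 q,$$ is a quasi-isomorphism of complexes. 2. $\mathbf{DR}$ sends quasi-isomorphisms to morphisms that are invertible up to quasi-isomorphism, and the induced functor $\Phi$ from the derived category of left $\mathcal D_X$-modules to the localization of graded mixed $\mathbf{DR}_X$-dg-modules at the quasi-isomorphisms is full and faithful. 3. A graded mixed $\mathbf{DR}_X$-dg-module $M$ lies in the essential image of $\Phi$ if and only if it is free as a graded dg-module, that is: there is a complex $E_0$ of $A$-modules such that the graded $\mathbf{DR}_X$-dg-module underlying $M$ is isomorphic to $\mathbf{DR}_X\otimes_A E_0$ (with $E_0$ in weight $0$) in the localization of graded $\mathbf{DR}_X$-dg-modules at the quasi-isomorphisms. -/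

import Mathlib

open CategoryTheory
open scoped TensorProduct DirectSum KaehlerDifferential

universe w v u

namespace DeRhamMixed

section Forms

variable (k : Type v) (A : Type u) [Field k] [CommRing A] [Algebra k A]

/-- The graded algebra of algebraic differential forms of `A` over `k`; its part of weight `q` and
cohomological degree `q` is `⋀[A]^q Ω[A⁄k]`. -/
abbrev Forms : Type u := ExteriorAlgebra A Ω[A⁄k]

/-- The universal derivation, with values in the one-forms inside `Forms k A`. -/
noncomputable def dOne (a : A) : Forms k A := ExteriorAlgebra.ι A (KaehlerDifferential.D k A a)

/-- The grading involution of the forms. -/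
noncomputable def sgn : Forms k A →ₐ[A] Forms k A := CliffordAlgebra.involute

variable {k A}

lemma sgn_iota (m : Ω[A⁄k]) : sgn k A (ExteriorAlgebra.ι A m) = -ExteriorAlgebra.ι A m :=
  CliffordAlgebra.involute_ι m

lemma sgn_dOne (a : A) : sgn k A (dOne k A a) = -dOne k A a := sgn_iota _

lemma sgn_sgn (x : Forms k A) : sgn k A (sgn k A x) = x := CliffordAlgebra.involute_involute x

lemma dOne_add (a b : A) : dOne k A (a + b) = dOne k A a + dOne k A b := by simp [dOne]

lemma dOne_mul (a b : A) : dOne k A (a * b) = a • dOne k A b + b • dOne k A a := by simp [dOne]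

lemma dOne_algebraMap (c : k) : dOne k A (algebraMap k A c) = 0 := by simp [dOne]

lemma iota_anticomm (m m' : Ω[A⁄k]) :
    ExteriorAlgebra.ι A m * ExteriorAlgebra.ι A m' =
      -(ExteriorAlgebra.ι A m' * ExteriorAlgebra.ι A m) :=
  eq_neg_of_add_eq_zero_left (ExteriorAlgebra.ι_add_mul_swap m m')

variable (k A)

/-- Upper triangular matrices over the forms. -/
noncomputable def tri (x y z : Forms k A) : Matrix (Fin 2) (Fin 2) (Forms k A) := !![x, y; 0, z]

variable {k A}

lemma tri_mul (x y z x' y' z' : Forms k A) :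
    tri k A x y z * tri k A x' y' z' = tri k A (x * x') (x * y' + y * z') (z * z') := by
  simp only [tri, Matrix.mul_fin_two, mul_zero, zero_mul, zero_add, add_zero]

lemma tri_add (x y z x' y' z' : Forms k A) :
    tri k A x y z + tri k A x' y' z' = tri k A (x + x') (y + y') (z + z') := by
  ext i j; fin_cases i <;> fin_cases j <;> simp [tri]

lemma tri_one : tri k A 1 0 1 = 1 := by
  ext i j; fin_cases i <;> fin_cases j <;> simp [tri]

lemma tri_zero : tri k A 0 0 0 = 0 := by
  ext i j; fin_cases i <;> fin_cases j <;> simp [tri]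

variable (k A)

/-- The ring homomorphism `a ↦ !![a, da; 0, a]`. -/
noncomputable def dMat : A →+* Matrix (Fin 2) (Fin 2) (Forms k A) where
  toFun a := tri k A (algebraMap A _ a) (dOne k A a) (algebraMap A _ a)
  map_one' := by
    rw [show dOne k A 1 = 0 by simp [dOne], map_one, tri_one]
  map_zero' := by
    rw [show dOne k A 0 = 0 by simp [dOne], map_zero, tri_zero]
  map_add' a b := by
    rw [tri_add, map_add, dOne_add]
  map_mul' a b := by
    rw [tri_mul, map_mul, dOne_mul, Algebra.smul_def, Algebra.smul_def,
      Algebra.commutes b (dOne k A a)]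

/-- The matrices over the forms which commute with all `!![a, da; 0, a]`. -/
noncomputable abbrev DMat : Subring (Matrix (Fin 2) (Fin 2) (Forms k A)) :=
  Subring.centralizer (Set.range (dMat k A))

/-- The map `a ↦ !![a, da; 0, a]`, with values in its own centralizer. -/
noncomputable def dMat' : A →+* DMat k A :=
  (dMat k A).codRestrict (DMat k A) (by
    rintro a _ ⟨b, rfl⟩
    rw [← map_mul, ← map_mul, mul_comm])

noncomputable instance : Algebra A (DMat k A) :=
  (dMat' k A).toAlgebra' (fun a x => Subtype.ext (x.2 _ ⟨a, rfl⟩))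

noncomputable instance : Algebra k (DMat k A) :=
  ((dMat' k A).comp (algebraMap k A)).toAlgebra'
    (fun c x => Subtype.ext (x.2 _ ⟨algebraMap k A c, rfl⟩))

instance : IsScalarTower k A (DMat k A) := IsScalarTower.of_algebraMap_eq' rfl

lemma dMat_smul (a : A) (x : DMat k A) : (a • x).1 = dMat k A a * x.1 := rfl

lemma dMat_smul' (c : k) (x : DMat k A) : (c • x).1 = dMat k A (algebraMap k A c) * x.1 := rfl

lemma dMat_apply (a : A) :
    dMat k A a = tri k A (algebraMap A _ a) (dOne k A a) (algebraMap A _ a) := rfl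

/-- The matrix `!![-db, 0; 0, db]`. -/
noncomputable def dDerFun (b : A) : DMat k A :=
  ⟨tri k A (-dOne k A b) 0 (dOne k A b), by
    rintro _ ⟨a, rfl⟩
    rw [dMat_apply, tri_mul, tri_mul, Algebra.commutes a (dOne k A b),
      Algebra.commutes a (-dOne k A b), mul_zero, zero_add, zero_mul, add_zero, neg_mul]
    congr 1
    rw [neg_mul]
    exact iota_anticomm _ _⟩

lemma dDerFun_coe (b : A) : (dDerFun k A b).1 = tri k A (-dOne k A b) 0 (dOne k A b) := rfl

lemma dDerFun_mul (a b : A) :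
    dDerFun k A (a * b) = a • dDerFun k A b + b • dDerFun k A a := by
  apply Subtype.ext
  rw [Subring.coe_add, dMat_smul, dMat_smul, dDerFun_coe, dDerFun_coe, dDerFun_coe, dMat_apply,
    dMat_apply, tri_mul, tri_mul, tri_add, dOne_mul, Algebra.smul_def, Algebra.smul_def, mul_zero,
    mul_zero, zero_add, zero_add, mul_neg, mul_neg, neg_add]
  congr 1
  rw [dOne, dOne, iota_anticomm, neg_add_cancel]

lemma dDerFun_add (a b : A) : dDerFun k A (a + b) = dDerFun k A a + dDerFun k A b := by
  apply Subtype.ext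
  rw [Subring.coe_add, dDerFun_coe, dDerFun_coe, dDerFun_coe, tri_add, dOne_add, neg_add, add_zero]

lemma dDerFun_smul (c : k) (b : A) : dDerFun k A (c • b) = c • dDerFun k A b := by
  have h : dDerFun k A (algebraMap k A c) = 0 := by
    apply Subtype.ext
    rw [dDerFun_coe, dOne_algebraMap, neg_zero, tri_zero]; rfl
  rw [Algebra.smul_def, dDerFun_mul, h, smul_zero, add_zero, algebraMap_smul]

/-- The derivation `b ↦ !![-db, 0; 0, db]`. -/
noncomputable def dDer : Derivation k A (DMat k A) :=
  Derivation.mk' { toFun := dDerFun k A, map_add' := dDerFun_add k A, map_smul' := dDerFun_smul k A }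
    (dDerFun_mul k A)

/-- The shape of the matrix attached to a one-form `m`. -/
lemma dDer_shape (m : Ω[A⁄k]) : ∃ y, (∀ n : Ω[A⁄k], ExteriorAlgebra.ι A n * y =
      y * ExteriorAlgebra.ι A n) ∧ ((dDer k A).liftKaehlerDifferential m).1 =
    tri k A (-ExteriorAlgebra.ι A m) y (ExteriorAlgebra.ι A m) := by
  have hm : m ∈ Submodule.span A (Set.range (KaehlerDifferential.D k A)) := by
    rw [KaehlerDifferential.span_range_derivation]; trivial
  induction hm using Submodule.span_induction with
  | mem x hx =>
    obtain ⟨b, rfl⟩ := hx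
    rw [Derivation.liftKaehlerDifferential_comp_D]
    exact ⟨0, fun n => by rw [mul_zero, zero_mul], rfl⟩
  | zero =>
    exact ⟨0, fun n => by rw [mul_zero, zero_mul], by rw [map_zero, map_zero, neg_zero, tri_zero]; rfl⟩
  | add x y _ _ hx hy =>
    obtain ⟨z, hz', hz⟩ := hx
    obtain ⟨w, hw', hw⟩ := hy
    exact ⟨z + w, fun n => by rw [mul_add, add_mul, hz', hw'],
      by rw [map_add, Subring.coe_add, hz, hw, tri_add, map_add, neg_add]⟩
  | smul a x _ hx =>
    obtain ⟨z, hz', hz⟩ := hx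
    refine ⟨algebraMap A _ a * z + dOne k A a * ExteriorAlgebra.ι A x, fun n => ?_, ?_⟩
    · have h : ExteriorAlgebra.ι A n * (dOne k A a * ExteriorAlgebra.ι A x) =
          dOne k A a * ExteriorAlgebra.ι A x * ExteriorAlgebra.ι A n := by
        rw [dOne, ← mul_assoc, iota_anticomm n, neg_mul, mul_assoc, iota_anticomm n, mul_neg,
          neg_neg, mul_assoc]
      rw [mul_add, add_mul, h, ← mul_assoc, ← Algebra.commutes, mul_assoc, hz', ← mul_assoc]
    · rw [map_smul, dMat_smul, hz, dMat_apply, tri_mul, mul_neg, map_smul, Algebra.smul_def]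

/-- The algebra map `ω ↦ !![σ ω, dω; 0, ω]` from which the de Rham differential is read off. -/
noncomputable def dHom : Forms k A →ₐ[A] DMat k A :=
  ExteriorAlgebra.lift A ⟨(dDer k A).liftKaehlerDifferential, fun m => by
    obtain ⟨y, hy, h⟩ := dDer_shape k A m
    apply Subtype.ext
    rw [Subring.coe_mul, h, tri_mul, ← hy, neg_mul_neg, neg_mul, neg_add_cancel,
      ExteriorAlgebra.ι_sq_zero, tri_zero]
    rfl⟩

/-- The de Rham differential on algebraic differential forms. -/
noncomputable def dR : Forms k A →+ Forms k A where
  toFun ω := (dHom k A ω).1 0 1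
  map_zero' := by rw [map_zero]; rfl
  map_add' x y := by rw [map_add]; rfl

lemma dHom_coe (ω : Forms k A) : (dHom k A ω).1 = tri k A (sgn k A ω) (dR k A ω) ω := by
  have key : ∃ y, (dHom k A ω).1 = tri k A (sgn k A ω) y ω := by
    induction ω using ExteriorAlgebra.induction with
    | algebraMap r =>
      refine ⟨dOne k A r, ?_⟩
      rw [AlgHom.commutes, AlgHom.commutes]
      rfl
    | ι m =>
      obtain ⟨y, -, h⟩ := dDer_shape k A m
      refine ⟨y, ?_⟩
      rw [dHom, ExteriorAlgebra.lift_ι_apply, h, sgn_iota]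
    | mul x y hx hy =>
      obtain ⟨z, hz⟩ := hx
      obtain ⟨w, hw⟩ := hy
      exact ⟨_, by rw [map_mul, Subring.coe_mul, hz, hw, tri_mul, map_mul]⟩
    | add x y hx hy =>
      obtain ⟨z, hz⟩ := hx
      obtain ⟨w, hw⟩ := hy
      exact ⟨_, by rw [map_add, Subring.coe_add, hz, hw, tri_add, map_add]⟩
  obtain ⟨y, h⟩ := key
  have : dR k A ω = y := by
    change (dHom k A ω).1 0 1 = y
    rw [h]; rfl
  rw [h, this]

lemma dR_mul (x y : Forms k A) : dR k A (x * y) = dR k A x * y + sgn k A x * dR k A y := by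
  have h := dHom_coe k A (x * y)
  rw [map_mul, Subring.coe_mul, dHom_coe, dHom_coe, tri_mul] at h
  have := congrFun (congrFun h 0) 1
  exact this.symm.trans (add_comm _ _)

lemma dR_algebraMap (a : A) : dR k A (algebraMap A _ a) = dOne k A a := by
  change (dHom k A _).1 0 1 = _
  rw [AlgHom.commutes]; rfl

lemma dR_dOne (a : A) : dR k A (dOne k A a) = 0 := by
  change (dHom k A _).1 0 1 = _
  rw [dHom, dOne, ExteriorAlgebra.lift_ι_apply, Derivation.liftKaehlerDifferential_comp_D]; rfl

lemma dR_smul (a : A) (x : Forms k A) : dR k A (a • x) = dOne k A a * x + a • dR k A x := by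
  rw [Algebra.smul_def, dR_mul, dR_algebraMap, AlgHom.commutes, ← Algebra.smul_def]

lemma sgn_dR (x : Forms k A) : sgn k A (dR k A x) = -dR k A (sgn k A x) := by
  induction x using ExteriorAlgebra.induction with
  | algebraMap r => rw [AlgHom.commutes, dR_algebraMap, sgn_dOne]
  | ι m =>
    have hm : m ∈ Submodule.span A (Set.range (KaehlerDifferential.D k A)) := by
      rw [KaehlerDifferential.span_range_derivation]; trivial
    induction hm using Submodule.span_induction with
    | mem x hx =>
      obtain ⟨b, rfl⟩ := hx
      change sgn k A (dR k A (dOne k A b)) = -dR k A (sgn k A (dOne k A b))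
      rw [sgn_dOne, map_neg, dR_dOne, map_zero, neg_zero, neg_zero]
    | zero => simp only [map_zero, neg_zero]
    | add x y _ _ hx hy => simp only [map_add, hx, hy, neg_add]
    | smul a x _ hx =>
      rw [map_smul, dR_smul, map_add, map_mul, sgn_dOne, sgn_iota, neg_mul_neg, map_smul, hx,
        map_smul, dR_smul, sgn_iota, mul_neg, map_neg, neg_add, neg_neg, smul_neg, neg_neg,
          neg_neg]
  | mul x y hx hy =>
    rw [dR_mul, map_add, map_mul, map_mul, hx, hy, map_mul, dR_mul, neg_add, neg_mul, mul_neg]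
  | add x y hx hy => simp only [map_add, hx, hy, neg_add]

lemma dR_dR (x : Forms k A) : dR k A (dR k A x) = 0 := by
  induction x using ExteriorAlgebra.induction with
  | algebraMap r => rw [dR_algebraMap, dR_dOne]
  | ι m =>
    have hm : m ∈ Submodule.span A (Set.range (KaehlerDifferential.D k A)) := by
      rw [KaehlerDifferential.span_range_derivation]; trivial
    induction hm using Submodule.span_induction with
    | mem x hx =>
      obtain ⟨b, rfl⟩ := hx
      change dR k A (dR k A (dOne k A b)) = 0
      rw [dR_dOne, map_zero]
    | zero => simp only [map_zero]
    | add x y _ _ hx hy => simp only [map_add, hx, hy, add_zero]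
    | smul a x _ hx =>
      rw [map_smul, dR_smul, map_add, dR_mul, dR_dOne, zero_mul, sgn_dOne, zero_add, dR_smul, hx,
        smul_zero, add_zero, neg_mul, neg_add_cancel]
  | mul x y hx hy =>
    rw [dR_mul, map_add, dR_mul, dR_mul, hx, hy, sgn_sgn, zero_mul, mul_zero, zero_add, add_zero,
      sgn_dR, neg_mul, neg_add_cancel]
  | add x y hx hy => simp only [map_add, hx, hy, add_zero]

lemma sgn_of_mem {q : ℕ} {x : Forms k A} (hx : x ∈ ⋀[A]^q Ω[A⁄k]) :
    sgn k A x = (-1 : ℤ) ^ q • x := by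
  induction hx using Submodule.pow_induction_on_left' with
  | algebraMap r => rw [AlgHom.commutes, pow_zero, one_smul]
  | add x y i hx hy h1 h2 => rw [map_add, h1, h2, smul_add]
  | mem_mul m hm i x hx ih =>
    obtain ⟨m, rfl⟩ := hm
    rw [map_mul, ih, sgn_iota, pow_succ, mul_smul, neg_smul, one_smul, smul_neg, neg_mul,
      mul_smul_comm]

lemma iota_mem (m : Ω[A⁄k]) : ExteriorAlgebra.ι A m ∈ ⋀[A]^1 Ω[A⁄k] := by
  change _ ∈ LinearMap.range (ExteriorAlgebra.ι A) ^ 1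
  rw [pow_one]; exact ⟨_, rfl⟩

lemma dOne_mem (a : A) : dOne k A a ∈ ⋀[A]^1 Ω[A⁄k] := iota_mem _ _ _

lemma forms_mul_mem {p q : ℕ} {x y : Forms k A} (hx : x ∈ ⋀[A]^p Ω[A⁄k])
    (hy : y ∈ ⋀[A]^q Ω[A⁄k]) : x * y ∈ ⋀[A]^(p + q) Ω[A⁄k] := by
  change _ ∈ LinearMap.range (ExteriorAlgebra.ι A) ^ (p + q)
  rw [pow_add]; exact Submodule.mul_mem_mul hx hy

lemma dR_mem {q : ℕ} {x : Forms k A} (hx : x ∈ ⋀[A]^q Ω[A⁄k]) :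
    dR k A x ∈ ⋀[A]^(q + 1) Ω[A⁄k] := by
  induction hx using Submodule.pow_induction_on_left' with
  | algebraMap r => rw [dR_algebraMap]; exact dOne_mem _ _ r
  | add x y i hx hy h1 h2 => rw [map_add]; exact add_mem h1 h2
  | mem_mul m hm i x hx ih =>
    obtain ⟨m, rfl⟩ := hm
    have h2 : dR k A (ExteriorAlgebra.ι A m) ∈ ⋀[A]^2 Ω[A⁄k] := by
      have hm : m ∈ Submodule.span A (Set.range (KaehlerDifferential.D k A)) := by
        rw [KaehlerDifferential.span_range_derivation]; trivial
      induction hm using Submodule.span_induction with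
      | mem x hx =>
        obtain ⟨b, rfl⟩ := hx
        change dR k A (dOne k A b) ∈ _
        rw [dR_dOne]; exact zero_mem _
      | zero => rw [map_zero, map_zero]; exact zero_mem _
      | add x y _ _ hx hy => rw [map_add, map_add]; exact add_mem hx hy
      | smul a x _ hx =>
        rw [map_smul, dR_smul]
        refine add_mem ?_ (Submodule.smul_mem _ _ hx)
        refine forms_mul_mem k A (p := 1) (q := 1) (dOne_mem _ _ a) ?_
        exact iota_mem _ _ _
    rw [dR_mul, sgn_iota]
    refine add_mem ?_ ?_
    · have := forms_mul_mem k A h2 hx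
      rwa [show 2 + i = i.succ + 1 by omega] at this
    · have := forms_mul_mem k A (p := 1) (x := -ExteriorAlgebra.ι A m)
        (neg_mem (iota_mem _ _ _)) ih
      rwa [show 1 + (i + 1) = i.succ + 1 by omega] at this

end Forms

section DiffOps

variable (k : Type v) (A : Type u) [Field k] [CommRing A] [Algebra k A]

/-- The differential operators of order `< n` on `A` over `k`, in the sense of Grothendieck. -/
def diffOpLT : ℕ → Submodule k (Module.End k A)
  | 0 => ⊥
  | n + 1 =>
    { carrier := {P | ∀ a : A, P * Algebra.lmul k A a - Algebra.lmul k A a * P ∈ diffOpLT n}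
      zero_mem' := fun a => by rw [zero_mul, mul_zero, sub_zero]; exact zero_mem _
      add_mem' := fun {P Q} hP hQ a => by
        have := add_mem (hP a) (hQ a)
        rwa [sub_add_sub_comm, ← add_mul, ← mul_add] at this
      smul_mem' := fun c P hP a => by
        have := Submodule.smul_mem _ c (hP a)
        rwa [smul_sub, ← smul_mul_assoc, ← mul_smul_comm] at this }

variable {k A}

lemma mem_diffOpLT_succ {n : ℕ} {P : Module.End k A} : P ∈ diffOpLT k A (n + 1) ↔
    ∀ a : A, P * Algebra.lmul k A a - Algebra.lmul k A a * P ∈ diffOpLT k A n := Iff.rfl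

lemma diffOpLT_le_succ (n : ℕ) : diffOpLT k A n ≤ diffOpLT k A (n + 1) := by
  induction n with
  | zero => exact bot_le
  | succ n ih => exact fun P hP a => ih (hP a)

lemma diffOpLT_mono : Monotone (diffOpLT k A) := monotone_nat_of_le_succ diffOpLT_le_succ

lemma lmul_mem_diffOpLT (a : A) : Algebra.lmul k A a ∈ diffOpLT k A 1 := fun b => by
  rw [← map_mul, ← map_mul, mul_comm, sub_self]; exact zero_mem _

lemma derivation_mem_diffOpLT (θ : Derivation k A A) :
    ((θ : A →ₗ[k] A) : Module.End k A) ∈ diffOpLT k A 2 := fun a => by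
  have : ((θ : A →ₗ[k] A) : Module.End k A) * Algebra.lmul k A a
      - Algebra.lmul k A a * ((θ : A →ₗ[k] A) : Module.End k A) = Algebra.lmul k A (θ a) := by
    ext b
    simp [mul_comm]
  rw [this]
  exact lmul_mem_diffOpLT _

lemma mul_mem_diffOpLT {m n : ℕ} {P Q : Module.End k A} (hP : P ∈ diffOpLT k A m)
    (hQ : Q ∈ diffOpLT k A n) : P * Q ∈ diffOpLT k A (m + n) := by
  obtain ⟨N, hN⟩ : ∃ N, N = m + n := ⟨_, rfl⟩
  induction N generalizing m n P Q with
  | zero =>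
    obtain rfl : m = 0 := by omega
    rw [show P = 0 from hP, zero_mul]; exact zero_mem _
  | succ N ih =>
    rcases m with _ | m
    · rw [show P = 0 from hP, zero_mul]; exact zero_mem _
    rcases n with _ | n
    · rw [show Q = 0 from hQ, mul_zero]; exact zero_mem _
    rw [show m + 1 + (n + 1) = (m + 1 + n) + 1 by omega]
    intro a
    have h1 := ih hP (hQ a) (by omega)
    have h2 := ih (hP a) hQ (by omega)
    rw [show m + (n + 1) = m + 1 + n by omega] at h2
    convert add_mem h1 h2 using 1
    simp only [mul_sub, sub_mul, mul_assoc]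
    abel

variable (k A)

/-- The `k`-algebra of global differential operators on `Spec A`. -/
def DiffOps : Subalgebra k (Module.End k A) where
  carrier := {P | ∃ n, P ∈ diffOpLT k A n}
  mul_mem' := fun ⟨_, hP⟩ ⟨_, hQ⟩ => ⟨_, mul_mem_diffOpLT hP hQ⟩
  add_mem' := fun ⟨m, hP⟩ ⟨n, hQ⟩ => ⟨max m n, add_mem (diffOpLT_mono (le_max_left m n) hP)
    (diffOpLT_mono (le_max_right m n) hQ)⟩
  algebraMap_mem' := fun c => ⟨1, by
    convert lmul_mem_diffOpLT (k := k) (algebraMap k A c) using 1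
    ext b
    simp [Algebra.smul_def]⟩

/-- Functions are differential operators. -/
def ofFun : A →+* DiffOps k A :=
  (Algebra.lmul k A : A →+* Module.End k A).codRestrict (DiffOps k A)
    (fun a => ⟨1, lmul_mem_diffOpLT a⟩)

variable {k A}

/-- Derivations are differential operators. -/
def ofDer (θ : Derivation k A A) : DiffOps k A :=
  ⟨(θ : A →ₗ[k] A), ⟨2, derivation_mem_diffOpLT θ⟩⟩

lemma ofDer_mul_ofFun (θ : Derivation k A A) (a : A) :
    ofDer θ * ofFun k A a = ofFun k A a * ofDer θ + ofFun k A (θ a) := by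
  apply Subtype.ext
  ext b
  change θ (a * b) = a * θ b + θ a * b
  rw [Derivation.leibniz, smul_eq_mul, smul_eq_mul, mul_comm b]

/-- Functions `x i` and derivations `θ i` such that `da = ∑ i, θ i (a) dx i` for all `a`. -/
structure DualCoords (k : Type v) (A : Type u) [Field k] [CommRing A] [Algebra k A] where
  /-- the number of functions -/
  card : ℕ
  /-- the functions -/
  x : Fin card → A
  /-- the derivations -/
  θ : Fin card → Derivation k A A
  D_eq : ∀ a : A, KaehlerDifferential.D k A a = ∑ i, θ i a • KaehlerDifferential.D k A (x i)

lemma DualCoords.derivation_eq (c : DualCoords k A) (η : Derivation k A A) :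
    η = ∑ i, η (c.x i) • c.θ i := by
  ext a
  have := congrArg η.liftKaehlerDifferential (c.D_eq a)
  rw [Derivation.liftKaehlerDifferential_comp_D, map_sum] at this
  have h : (∑ i, η (c.x i) • c.θ i) a = ∑ i, (η (c.x i) • c.θ i) a :=
    (congrFun (map_sum (Derivation.coeFnAddMonoidHom (R := k) (A := A) (M := A)) _ _) a).trans (Finset.sum_apply _ _ _)
  rw [this, h]
  refine Finset.sum_congr rfl fun i _ => ?_
  rw [map_smul, Derivation.liftKaehlerDifferential_comp_D, Derivation.smul_apply, smul_eq_mul,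
    smul_eq_mul, mul_comm]

variable (k A)

instance nonempty_dualCoords [Algebra.Smooth k A] : Nonempty (DualCoords k A) := by
  have hfg : (Submodule.span A (Set.range (KaehlerDifferential.D k A))).FG := by
    rw [KaehlerDifferential.span_range_derivation]
    exact Module.Finite.fg_top
  obtain ⟨s, hs, hspan⟩ := (Submodule.fg_span_iff_fg_span_finset_subset _).1 hfg
  rw [KaehlerDifferential.span_range_derivation] at hspan
  let e := s.equivFin.symm
  choose x hx using fun i => hs (e i).2
  let π : (Fin s.card → A) →ₗ[A] Ω[A⁄k] := Fintype.linearCombination A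
    (fun i => KaehlerDifferential.D k A (x i))
  have hπ : Function.Surjective π := by
    rw [← LinearMap.range_eq_top, Fintype.range_linearCombination, hspan]
    congr 1
    ext y
    constructor
    · rintro ⟨i, rfl⟩
      simp only [hx]
      exact (e i).2
    · intro hy
      exact ⟨e.symm ⟨y, hy⟩, by simp [hx]⟩
  obtain ⟨σ, hσ⟩ := Module.projective_lifting_property π LinearMap.id hπ
  refine ⟨⟨s.card, x, fun i => ((LinearMap.proj i).comp σ).compDer (KaehlerDifferential.D k A),
    fun a => ?_⟩⟩
  have := LinearMap.congr_fun hσ (KaehlerDifferential.D k A a)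
  rw [LinearMap.comp_apply, LinearMap.id_apply, Fintype.linearCombination_apply] at this
  exact this.symm

/-- A choice of dual coordinates on a smooth affine variety. -/
noncomputable def dualCoords [Algebra.Smooth k A] : DualCoords k A :=
  Classical.choice (nonempty_dualCoords k A)

end DiffOps

section Modules

variable (k : Type v) (A : Type u) [Field k] [CommRing A] [Algebra k A]

/-- A graded dg-module over the graded cdga `Forms k A` (with zero cohomological differential):
a module which is the direct sum of its parts `comp p n` of weight `p` and cohomological degree
`n`, with a compatible action of the forms and a cohomological differential `d`. -/
structure GrMod where
  /-- the underlying module -/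
  carrier : Type u
  [addCommGroup : AddCommGroup carrier]
  [module : Module (Forms k A) carrier]
  /-- the part of weight `p` and cohomological degree `n` -/
  comp : ℤ → ℤ → AddSubgroup carrier
  isInternal : DirectSum.IsInternal (fun i : ℤ × ℤ => comp i.1 i.2)
  smul_mem : ∀ {q : ℕ} {ω : Forms k A} {p n : ℤ} {x : carrier}, ω ∈ ⋀[A]^q Ω[A⁄k] →
    x ∈ comp p n → ω • x ∈ comp (p + q) (n + q)
  /-- the cohomological differential -/
  d : carrier →+ carrier
  d_mem : ∀ {p n : ℤ} {x : carrier}, x ∈ comp p n → d x ∈ comp p (n + 1)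
  d_d : ∀ x, d (d x) = 0
  d_smul : ∀ {q : ℕ} {ω : Forms k A} (x : carrier), ω ∈ ⋀[A]^q Ω[A⁄k] →
    d (ω • x) = (-1 : ℤ) ^ q • ω • d x

attribute [instance] GrMod.addCommGroup GrMod.module

/-- A graded mixed dg-module over the de Rham algebra of `A`, that is over the graded mixed cdga
`Forms k A` with the de Rham differential `dR k A` as mixed structure. -/
structure MixedMod extends GrMod k A where
  /-- the mixed structure, of weight `1` and cohomological degree `1` -/
  ε : carrier →+ carrier
  ε_mem : ∀ {p n : ℤ} {x : carrier}, x ∈ comp p n → ε x ∈ comp (p + 1) (n + 1)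
  ε_ε : ∀ x, ε (ε x) = 0
  d_ε : ∀ x, d (ε x) + ε (d x) = 0
  ε_smul : ∀ {q : ℕ} {ω : Forms k A} (x : carrier), ω ∈ ⋀[A]^q Ω[A⁄k] →
    ε (ω • x) = dR k A ω • x + (-1 : ℤ) ^ q • ω • ε x

variable {k A}

/-- Morphisms of graded dg-modules. -/
@[ext]
structure GrMod.Hom (M N : GrMod k A) where
  /-- the underlying linear map -/
  lin : M.carrier →ₗ[Forms k A] N.carrier
  map_mem : ∀ {p n : ℤ} {x : M.carrier}, x ∈ M.comp p n → lin x ∈ N.comp p n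
  map_d : ∀ x, lin (M.d x) = N.d (lin x)

noncomputable instance : Category (GrMod k A) where
  Hom := GrMod.Hom
  id M := ⟨LinearMap.id, fun h => h, fun _ => rfl⟩
  comp f g := ⟨g.lin ∘ₗ f.lin, fun h => g.map_mem (f.map_mem h), fun x => by
    simp only [LinearMap.comp_apply, f.map_d, g.map_d]⟩

/-- Morphisms of graded mixed dg-modules. -/
@[ext]
structure MixedMod.Hom (M N : MixedMod k A) extends GrMod.Hom M.toGrMod N.toGrMod where
  map_ε : ∀ x, lin (M.ε x) = N.ε (lin x)

noncomputable instance : Category (MixedMod k A) where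
  Hom := MixedMod.Hom
  id M := ⟨⟨LinearMap.id, fun h => h, fun _ => rfl⟩, fun _ => rfl⟩
  comp f g := ⟨⟨g.lin ∘ₗ f.lin, fun h => g.map_mem (f.map_mem h), fun x => by
    simp only [LinearMap.comp_apply, f.map_d, g.map_d]⟩, fun x => by
    simp only [LinearMap.comp_apply, f.map_ε, g.map_ε]⟩

/-- The linear map underlying a morphism of graded dg-modules. -/
noncomputable def GrMod.lin {M N : GrMod k A} (f : M ⟶ N) : M.carrier →ₗ[Forms k A] N.carrier :=
  GrMod.Hom.lin f

/-- The linear map underlying a morphism of graded mixed dg-modules. -/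
noncomputable def MixedMod.lin {M N : MixedMod k A} (f : M ⟶ N) : M.carrier →ₗ[Forms k A] N.carrier :=
  (MixedMod.Hom.toHom f).lin

variable (k A)

/-- The functor which forgets the mixed structure. -/
noncomputable def MixedMod.forget : MixedMod k A ⥤ GrMod k A where
  obj M := M.toGrMod
  map f := f.toHom

/-- The quasi-isomorphisms of graded dg-modules: the morphisms which are bijective on the
cohomology `ker d / im d` (which is the direct sum of its parts of each weight and degree). -/
noncomputable def GrMod.qis : MorphismProperty (GrMod k A) := fun M N f =>
  (∀ x : M.carrier, M.d x = 0 → (∃ y, N.d y = GrMod.lin f x) → ∃ x', M.d x' = x) ∧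
    ∀ y : N.carrier, N.d y = 0 →
      ∃ x, M.d x = 0 ∧ ∃ y', N.d y' = y - GrMod.lin f x

/-- The quasi-isomorphisms of graded mixed dg-modules. -/
noncomputable def MixedMod.qis : MorphismProperty (MixedMod k A) :=
  (GrMod.qis k A).inverseImage (MixedMod.forget k A)

variable {k A}

/-- The maps of weight `0` and cohomological degree `n` between graded mixed dg-modules which are
compatible, up to Koszul signs, with the action of the forms and with the mixed structures. -/
noncomputable def MixedMod.homDeg (M N : MixedMod k A) (n : ℤ) : AddSubgroup (M.carrier →+ N.carrier) where
  carrier := {f | (∀ (p m : ℤ), ∀ x ∈ M.comp p m, f x ∈ N.comp p (m + n)) ∧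
    (∀ (q : ℕ), ∀ ω ∈ ⋀[A]^q Ω[A⁄k], ∀ x : M.carrier,
      f (ω • x) = (n * q).negOnePow • ω • f x) ∧
    ∀ x : M.carrier, f (M.ε x) = n.negOnePow • N.ε (f x)}
  zero_mem' := ⟨fun _ _ _ _ => zero_mem _, fun _ _ _ _ => by
    simp only [AddMonoidHom.zero_apply, smul_zero], fun _ => by
    simp only [AddMonoidHom.zero_apply, map_zero, smul_zero]⟩
  add_mem' := fun {f g} hf hg => ⟨fun p m x hx => add_mem (hf.1 p m x hx) (hg.1 p m x hx),
    fun q ω hω x => by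
      simp only [AddMonoidHom.add_apply, smul_add, hf.2.1 q ω hω x, hg.2.1 q ω hω x], fun x => by
      simp only [AddMonoidHom.add_apply, smul_add, map_add, hf.2.2 x, hg.2.2 x]⟩
  neg_mem' := fun {f} hf => ⟨fun p m x hx => neg_mem (hf.1 p m x hx), fun q ω hω x => by
      simp only [AddMonoidHom.neg_apply, smul_neg, hf.2.1 q ω hω x], fun x => by
      simp only [AddMonoidHom.neg_apply, smul_neg, map_neg, hf.2.2 x]⟩

lemma MixedMod.ε_d (M : MixedMod k A) (x : M.carrier) : M.ε (M.d x) = -M.d (M.ε x) :=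
  eq_neg_of_add_eq_zero_right (M.d_ε x)

lemma MixedMod.diff_mem (M N : MixedMod k A) {n m : ℤ} (h : n + 1 = m) {f : M.carrier →+ N.carrier}
    (hf : f ∈ M.homDeg N n) :
    N.d.comp f - n.negOnePow • f.comp M.d ∈ M.homDeg N m := by
  subst h
  refine ⟨fun p m x hx => ?_, fun q ω hω x => ?_, fun x => ?_⟩
  · refine sub_mem ?_ ?_
    · have := N.d_mem (hf.1 p m x hx)
      rwa [add_assoc] at this
    · have := hf.1 p (m + 1) (M.d x) (M.d_mem hx)
      rw [add_right_comm, add_assoc] at this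
      change n.negOnePow • f (M.d x) ∈ _
      rw [Units.smul_def]
      exact AddSubgroup.zsmul_mem _ this _
  · simp only [AddMonoidHom.sub_apply, AddMonoidHom.comp_apply, AddMonoidHom.smul_apply]
    rw [hf.2.1 q ω hω, M.d_smul x hω, map_zsmul, hf.2.1 q ω hω]
    simp only [Units.smul_def, map_zsmul]
    rw [N.d_smul _ hω]
    rw [smul_sub, show ω • (n.negOnePow : ℤ) • f (M.d x) = (n.negOnePow : ℤ) • ω • f (M.d x) from
      map_zsmul (DistribSMul.toAddMonoidHom _ ω) _ _]
    simp only [smul_sub, smul_smul]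
    rw [add_mul, one_mul, Int.negOnePow_add]
    have : ((q : ℤ).negOnePow : ℤ) = (-1) ^ q := by
      rw [Int.negOnePow_def, zpow_natCast, Units.val_pow_eq_pow_val, Units.val_neg, Units.val_one]
    rw [Units.val_mul, this]
    congr 2
    ring
  · simp only [AddMonoidHom.sub_apply, AddMonoidHom.comp_apply, AddMonoidHom.smul_apply]
    rw [hf.2.2, ← neg_neg (M.d (M.ε x)), ← M.ε_d, map_neg, hf.2.2]
    simp only [Units.smul_def, map_zsmul, map_sub, N.ε_d, Int.negOnePow_succ, Units.val_neg]
    simp only [smul_sub, smul_neg, neg_smul, neg_neg, sub_neg_eq_add]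

/-- The complex of maps between two graded mixed dg-modules, with differential
`D f = d ∘ f - (-1) ^ n • f ∘ d` on the maps `f` of degree `n`. -/
noncomputable def MixedMod.homComplex (M N : MixedMod k A) : CochainComplex AddCommGrpCat.{u} ℤ where
  X n := AddCommGrpCat.of (M.homDeg N n)
  d n m := if h : n + 1 = m then AddCommGrpCat.ofHom
    { toFun := fun f => ⟨N.d.comp f.1 - n.negOnePow • f.1.comp M.d, M.diff_mem N h f.2⟩
      map_zero' := by
        apply Subtype.ext
        ext x
        simp
      map_add' := fun f g => by
        apply Subtype.ext
        ext x
        simp only [AddSubgroup.coe_add, AddMonoidHom.sub_apply, AddMonoidHom.comp_apply,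
          AddMonoidHom.smul_apply, AddMonoidHom.add_apply, map_add, smul_add]
        abel } else 0
  shape n m h := dif_neg h
  d_comp_d' n m l hnm hml := by
    obtain rfl : n + 1 = m := hnm
    obtain rfl : n + 1 + 1 = l := hml
    rw [dif_pos rfl, dif_pos rfl]
    ext f x
    change N.d (N.d (f.1 x) - n.negOnePow • f.1 (M.d x)) - (n + 1).negOnePow •
      (N.d (f.1 (M.d x)) - n.negOnePow • f.1 (M.d (M.d x))) = 0
    simp only [map_sub, N.d_d, M.d_d, map_zero, smul_zero, sub_zero, Units.smul_def, map_zsmul,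
      Int.negOnePow_succ, Units.val_neg, neg_smul]
    abel

/-- A graded mixed dg-module is acyclic if its cohomology vanishes. -/
noncomputable def MixedMod.IsAcyclic (M : MixedMod k A) : Prop := ∀ x, M.d x = 0 → ∃ y, M.d y = x

/-- A graded mixed dg-module `Q` is K-projective if the complex of maps from `Q` to any acyclic
graded mixed dg-module is acyclic. -/
noncomputable def MixedMod.IsKProjective (Q : MixedMod k A) : Prop :=
  ∀ N : MixedMod k A, N.IsAcyclic → (Q.homComplex N).Acyclic

lemma MixedMod.comp_mem_homDeg {Q M N : MixedMod k A} (q : Q ⟶ M) {n : ℤ}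
    {f : M.carrier →+ N.carrier} (hf : f ∈ M.homDeg N n) :
    f.comp (MixedMod.lin q).toAddMonoidHom ∈ Q.homDeg N n :=
  ⟨fun p m x hx => hf.1 p m _ ((MixedMod.Hom.toHom q).map_mem hx), fun r ω hω x => by
    change f (MixedMod.lin q (ω • x)) = _ • ω • f (MixedMod.lin q x)
    rw [map_smul, hf.2.1 r ω hω], fun x => by
    change f (MixedMod.lin q (Q.ε x)) = _ • N.ε (f (MixedMod.lin q x))
    rw [show MixedMod.lin q (Q.ε x) = M.ε (MixedMod.lin q x) from MixedMod.Hom.map_ε q x, hf.2.2]⟩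

/-- Precomposition with a morphism of graded mixed dg-modules, on complexes of maps. -/
noncomputable def MixedMod.precomp {Q M : MixedMod k A} (q : Q ⟶ M) (N : MixedMod k A) :
    M.homComplex N ⟶ Q.homComplex N where
  f n := AddCommGrpCat.ofHom
    { toFun := fun f => ⟨f.1.comp (MixedMod.lin q).toAddMonoidHom,
        MixedMod.comp_mem_homDeg q f.2⟩
      map_zero' := rfl
      map_add' := fun _ _ => rfl }
  comm' n m h := by
    obtain rfl : n + 1 = m := h
    simp only [MixedMod.homComplex, dif_pos]
    ext f x
    change N.d (f.1 (MixedMod.lin q x)) - n.negOnePow • f.1 (MixedMod.lin q (Q.d x)) =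
      N.d (f.1 (MixedMod.lin q x)) - n.negOnePow • f.1 (M.d (MixedMod.lin q x))
    rw [show MixedMod.lin q (Q.d x) = M.d (MixedMod.lin q x) from (MixedMod.Hom.toHom q).map_d x]

end Modules

section Free

lemma isInternal_of_proj {ι : Type*} {G : Type*} [DecidableEq ι] [AddCommGroup G]
    (C : ι → AddSubgroup G) (π : ι → G →+ G) (h1 : ∀ i, ∀ x ∈ C i, π i x = x)
    (h2 : ∀ i j, i ≠ j → ∀ x ∈ C j, π i x = 0) (h3 : ∀ H : AddSubgroup G, (∀ i, C i ≤ H) → H = ⊤) :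
    DirectSum.IsInternal C := by
  constructor
  · rw [injective_iff_map_eq_zero]
    intro x hx
    have key : ∀ i, (π i).comp (DirectSum.coeAddMonoidHom C) =
        (C i).subtype.comp (DFinsupp.evalAddMonoidHom i) := by
      intro i
      refine DirectSum.addHom_ext' fun j => ?_
      ext y
      change π i (DirectSum.coeAddMonoidHom C (DirectSum.of _ j y)) =
        ((DirectSum.of (fun j => C j) j y) i : G)
      rw [DirectSum.coeAddMonoidHom_of]
      by_cases h : i = j
      · subst h
        rw [h1 i _ y.2, DirectSum.of_eq_same]
      · rw [h2 i j h _ y.2, DirectSum.of_eq_of_ne _ _ _ h, ZeroMemClass.coe_zero]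
    refine DFinsupp.ext fun i => ?_
    have := DFunLike.congr_fun (key i) x
    rw [AddMonoidHom.comp_apply, hx, map_zero] at this
    exact Subtype.ext this.symm
  · rw [← AddMonoidHom.range_eq_top]
    refine h3 _ fun i x hx => ⟨DirectSum.of (fun j => C j) i ⟨x, hx⟩, ?_⟩
    rw [DirectSum.coeAddMonoidHom_of]

variable (k : Type v) {A : Type u} [Field k] [CommRing A] [Algebra k A]

/-- The direct sum of all terms of a complex of `A`-modules. -/
abbrev Tot (E : CochainComplex (ModuleCat.{u} A) ℤ) : Type u := ⨁ n : ℤ, (E.X n : Type u)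

/-- A linear map of degree `n` between the direct sums of the terms of two complexes. -/
noncomputable def totMap {E F : CochainComplex (ModuleCat.{u} A) ℤ} (n : ℤ)
    (z : ∀ m : ℤ, E.X m →ₗ[A] F.X (m + n)) : Tot E →ₗ[A] Tot F :=
  DirectSum.toModule A ℤ _ fun m => DirectSum.lof A ℤ (fun j => (F.X j : Type u)) (m + n) ∘ₗ z m

lemma totMap_lof {E F : CochainComplex (ModuleCat.{u} A) ℤ} (n : ℤ)
    (z : ∀ m : ℤ, E.X m →ₗ[A] F.X (m + n)) (m : ℤ) (e : E.X m) :
    totMap n z (DirectSum.lof A ℤ (fun j => (E.X j : Type u)) m e) =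
      DirectSum.lof A ℤ (fun j => (F.X j : Type u)) (m + n) (z m e) := by
  rw [totMap, DirectSum.toModule_lof, LinearMap.comp_apply]

/-- The differential on the direct sum of all terms of a complex of `A`-modules. -/
noncomputable def totD (E : CochainComplex (ModuleCat.{u} A) ℤ) : Tot E →ₗ[A] Tot E :=
  totMap 1 fun m => (E.d m (m + 1)).hom

lemma totD_totD (E : CochainComplex (ModuleCat.{u} A) ℤ) (x : Tot E) : totD E (totD E x) = 0 := by
  induction x using DirectSum.induction_on with
  | zero => rw [map_zero, map_zero]
  | add x y hx hy => rw [map_add, map_add, hx, hy, add_zero]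
  | of m e =>
    change totD E (totD E (DirectSum.lof A ℤ (fun j => (E.X j : Type u)) m e)) = 0
    have h : (E.d (m + 1) (m + 1 + 1)).hom ((E.d m (m + 1)).hom e) = 0 := by
      rw [← LinearMap.comp_apply, ← ModuleCat.hom_comp, E.d_comp_d]; rfl
    rw [totD, totMap_lof, totMap_lof, h, map_zero]

/-- The part of weight `p` and cohomological degree `n` of `Forms k A ⊗[A] Tot E`: it is spanned
by the `ω ⊗ e` with `ω` a `p`-form and `e` in the term of degree `n - p` of `E`. -/
noncomputable def freeComp (E : CochainComplex (ModuleCat.{u} A) ℤ) (p n : ℤ) :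
    AddSubgroup (Forms k A ⊗[A] Tot E) :=
  AddSubgroup.closure {t | ∃ (q : ℕ) (m : ℤ), p = q ∧ n = m + q ∧ ∃ ω ∈ ⋀[A]^q Ω[A⁄k],
    ∃ e : E.X m, t = ω ⊗ₜ DirectSum.lof A ℤ (fun j => (E.X j : Type u)) m e}

variable {k}

lemma tmul_mem_freeComp {E : CochainComplex (ModuleCat.{u} A) ℤ} {p n m : ℤ} {q : ℕ}
    (hp : p = q) (hn : n = m + q) {ω : Forms k A} (hω : ω ∈ ⋀[A]^q Ω[A⁄k]) (e : E.X m) :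
    ω ⊗ₜ DirectSum.lof A ℤ (fun j => (E.X j : Type u)) m e ∈ freeComp k E p n :=
  AddSubgroup.subset_closure ⟨q, m, hp, hn, ω, hω, e, rfl⟩

/-- To map the homogeneous parts of a free module into additive subgroups, it suffices to check
on the generators. -/
lemma freeComp_map {E : CochainComplex (ModuleCat.{u} A) ℤ} {p n : ℤ} {G : Type*} [AddCommGroup G]
    (f : Forms k A ⊗[A] Tot E →+ G) (H : AddSubgroup G)
    (h : ∀ (q : ℕ) (m : ℤ), p = q → n = m + q → ∀ ω ∈ ⋀[A]^q Ω[A⁄k], ∀ e : E.X m,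
      f (ω ⊗ₜ DirectSum.lof A ℤ (fun j => (E.X j : Type u)) m e) ∈ H)
    {x : Forms k A ⊗[A] Tot E} (hx : x ∈ freeComp k E p n) : f x ∈ H := by
  have : freeComp k E p n ≤ H.comap f := by
    refine (AddSubgroup.closure_le _).2 ?_
    rintro _ ⟨q, m, hp, hn, ω, hω, e, rfl⟩
    exact h q m hp hn ω hω e
  exact this hx

variable (k)

lemma freeComp_isInternal (E : CochainComplex (ModuleCat.{u} A) ℤ) :
    DirectSum.IsInternal (fun i : ℤ × ℤ => freeComp k E i.1 i.2) := by
  let pr (i : ℤ × ℤ) : Forms k A →ₗ[A] Forms k A :=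
    if 0 ≤ i.1 then GradedAlgebra.proj (fun q : ℕ => ⋀[A]^q Ω[A⁄k]) i.1.toNat else 0
  let pt (i : ℤ × ℤ) : Tot E →ₗ[A] Tot E :=
    DirectSum.lof A ℤ (fun j => (E.X j : Type u)) (i.2 - i.1) ∘ₗ
      DirectSum.component A ℤ (fun j => (E.X j : Type u)) (i.2 - i.1)
  refine isInternal_of_proj _ (fun i => (TensorProduct.map (pr i) (pt i)).toAddMonoidHom) ?_ ?_ ?_
  · rintro ⟨p, n⟩ x hx
    refine sub_eq_zero.1 (freeComp_map ((TensorProduct.map (pr (p, n)) (pt (p, n))).toAddMonoidHom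
      - AddMonoidHom.id _) ⊥ ?_ hx)
    rintro q m rfl rfl ω hω e
    have h1 : pr ((q : ℤ), m + q) ω = ω := by
      simp only [pr, Nat.cast_nonneg, if_true, Int.toNat_natCast, GradedAlgebra.proj_apply]
      exact DirectSum.decompose_of_mem_same _ hω
    have h2 : pt ((q : ℤ), m + q) (DirectSum.lof A ℤ (fun j => (E.X j : Type u)) m e) =
        DirectSum.lof A ℤ (fun j => (E.X j : Type u)) m e := by
      have (j : ℤ) (hj : j = m) : DirectSum.lof A ℤ (fun j => (E.X j : Type u)) j
          (DirectSum.component A ℤ (fun j => (E.X j : Type u)) j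
            (DirectSum.lof A ℤ (fun j => (E.X j : Type u)) m e)) =
          DirectSum.lof A ℤ (fun j => (E.X j : Type u)) m e := by
        subst hj
        rw [DirectSum.component.lof_self]
      exact this _ (add_sub_cancel_right _ _)
    refine AddSubgroup.mem_bot.2 ?_
    rw [AddMonoidHom.sub_apply, AddMonoidHom.id_apply, LinearMap.toAddMonoidHom_coe,
      TensorProduct.map_tmul, h1, h2]
    exact sub_self _
  · rintro ⟨p, n⟩ ⟨p', n'⟩ hne x hx
    refine freeComp_map (TensorProduct.map (pr (p, n)) (pt (p, n))).toAddMonoidHom ⊥ ?_ hx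
    rintro q m rfl rfl ω hω e
    refine AddSubgroup.mem_bot.2 ?_
    rw [LinearMap.toAddMonoidHom_coe, TensorProduct.map_tmul]
    by_cases hp : p = q
    · subst hp
      have h2 : pt ((q : ℤ), n) (DirectSum.lof A ℤ (fun j => (E.X j : Type u)) m e) = 0 := by
        have : m ≠ n - q := by
          rintro rfl
          exact hne (by simp)
        simp only [pt, LinearMap.comp_apply]
        rw [DirectSum.component.of, dif_neg this, map_zero]
      rw [h2, TensorProduct.tmul_zero]
    · have h1 : pr (p, n) ω = 0 := by
        by_cases h0 : 0 ≤ p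
        · simp only [pr, h0, if_true, GradedAlgebra.proj_apply]
          exact DirectSum.decompose_of_mem_ne _ hω (by omega)
        · simp only [pr, h0, if_false, LinearMap.zero_apply]
      rw [h1, TensorProduct.zero_tmul]
  · intro H hH
    rw [eq_top_iff]
    rintro x -
    induction x using TensorProduct.induction_on with
    | zero => exact zero_mem _
    | add x y hx hy => exact add_mem hx hy
    | tmul ω e =>
      induction ω using DirectSum.Decomposition.inductionOn (fun q : ℕ => ⋀[A]^q Ω[A⁄k]) with
      | zero => rw [TensorProduct.zero_tmul]; exact zero_mem _
      | add x y hx hy => rw [TensorProduct.add_tmul]; exact add_mem hx hy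
      | @homogeneous q ω =>
        induction e using DirectSum.induction_on with
        | zero => rw [TensorProduct.tmul_zero]; exact zero_mem _
        | add x y hx hy => rw [TensorProduct.tmul_add]; exact add_mem hx hy
        | of m e => exact hH ((q : ℤ), m + q) (tmul_mem_freeComp rfl rfl ω.2 e)

variable {k}

/-- The differential `ω ⊗ e ↦ (-1) ^ |ω| ω ⊗ d e`. -/
noncomputable def freeD (k : Type v) [Field k] [Algebra k A]
    (E : CochainComplex (ModuleCat.{u} A) ℤ) :
    Forms k A ⊗[A] Tot E →ₗ[A] Forms k A ⊗[A] Tot E :=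
  TensorProduct.map (sgn k A).toLinearMap (totD E)

lemma freeD_tmul (E : CochainComplex (ModuleCat.{u} A) ℤ) (ω : Forms k A) (t : Tot E) :
    freeD k E (ω ⊗ₜ t) = sgn k A ω ⊗ₜ totD E t := rfl

lemma freeD_smul (E : CochainComplex (ModuleCat.{u} A) ℤ) (ω : Forms k A)
    (x : Forms k A ⊗[A] Tot E) : freeD k E (ω • x) = sgn k A ω • freeD k E x := by
  induction x using TensorProduct.induction_on with
  | zero => simp only [smul_zero, map_zero]
  | add x y hx hy => simp only [smul_add, map_add, hx, hy]
  | tmul ω' e =>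
    rw [TensorProduct.smul_tmul', freeD_tmul, freeD_tmul, TensorProduct.smul_tmul', smul_eq_mul,
      smul_eq_mul, map_mul]

lemma freeD_freeD (E : CochainComplex (ModuleCat.{u} A) ℤ) (x : Forms k A ⊗[A] Tot E) :
    freeD k E (freeD k E x) = 0 := by
  induction x using TensorProduct.induction_on with
  | zero => simp only [map_zero]
  | add x y hx hy => rw [map_add, map_add, hx, hy, add_zero]
  | tmul ω e => rw [freeD_tmul, freeD_tmul, totD_totD, TensorProduct.tmul_zero]

lemma smul_mem_freeComp (E : CochainComplex (ModuleCat.{u} A) ℤ) {r : ℕ} {ω : Forms k A} {p n : ℤ}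
    {x : Forms k A ⊗[A] Tot E} (hω : ω ∈ ⋀[A]^r Ω[A⁄k]) (hx : x ∈ freeComp k E p n) :
    ω • x ∈ freeComp k E (p + r) (n + r) := by
  refine freeComp_map (DistribSMul.toAddMonoidHom _ ω) _ (fun q m hp hn ω' hω' e => ?_) hx
  simp only [DistribSMul.toAddMonoidHom_apply, TensorProduct.smul_tmul', smul_eq_mul]
  exact tmul_mem_freeComp (by rw [hp]; push_cast; ring) (by rw [hn]; push_cast; ring)
    (forms_mul_mem k A hω hω') e

lemma freeD_mem_freeComp (E : CochainComplex (ModuleCat.{u} A) ℤ) {p n : ℤ}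
    {x : Forms k A ⊗[A] Tot E} (hx : x ∈ freeComp k E p n) :
    freeD k E x ∈ freeComp k E p (n + 1) := by
  refine freeComp_map (freeD k E).toAddMonoidHom _ (fun q m hp hn ω hω e => ?_) hx
  rw [LinearMap.toAddMonoidHom_coe, freeD_tmul, totD, totMap_lof]
  refine tmul_mem_freeComp hp (by rw [hn]; ring) ?_ _
  rw [sgn_of_mem k A hω]
  exact zsmul_mem hω _

lemma zsmul_smul_assoc {T : Type u} [AddCommGroup T] [Module A T] (n : ℤ) (ω : Forms k A)
    (x : Forms k A ⊗[A] T) : (n • ω) • x = n • ω • x :=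
  map_zsmul (AddMonoidHom.flip (AddMonoidHom.mk'
    (fun ω : Forms k A => DistribSMul.toAddMonoidHom (Forms k A ⊗[A] T) ω)
    fun ω ω' => AddMonoidHom.ext fun x => add_smul ω ω' x) x) n ω

lemma smul_zsmul_comm {T : Type u} [AddCommGroup T] [Module A T] (n : ℤ) (ω : Forms k A)
    (x : Forms k A ⊗[A] T) : ω • n • x = n • ω • x :=
  map_zsmul (DistribSMul.toAddMonoidHom (Forms k A ⊗[A] T) ω) n x

variable (k)

/-- The free graded dg-module `Forms k A ⊗[A] E` on a complex `E` of `A`-modules in weight `0`. -/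
noncomputable def freeMod (E : CochainComplex (ModuleCat.{u} A) ℤ) : GrMod k A where
  carrier := Forms k A ⊗[A] Tot E
  comp := freeComp k E
  isInternal := freeComp_isInternal k E
  smul_mem := smul_mem_freeComp E
  d := (freeD k E).toAddMonoidHom
  d_mem := freeD_mem_freeComp E
  d_d := freeD_freeD E
  d_smul := fun x hω => by
    rw [← zsmul_smul_assoc, ← sgn_of_mem k A hω]
    exact freeD_smul E _ x

end Free

section DeRham

variable {k : Type v} {A : Type u} [Field k] [CommRing A] [Algebra k A]

lemma ofDer_sum {ι : Type*} (s : Finset ι) (a : ι → A) (θ : ι → Derivation k A A) :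
    ofDer (∑ i ∈ s, a i • θ i) = ∑ i ∈ s, ofFun k A (a i) * ofDer (θ i) := by
  classical
  induction s using Finset.induction_on with
  | empty => rw [Finset.sum_empty, Finset.sum_empty]; rfl
  | insert i s hi ih =>
    rw [Finset.sum_insert hi, Finset.sum_insert hi, ← ih]; rfl

lemma ofDer_lie (θ η : Derivation k A A) :
    ofDer ⁅θ, η⁆ = ofDer θ * ofDer η - ofDer η * ofDer θ := by
  apply Subtype.ext
  ext a
  exact Derivation.commutator_apply (D1 := θ) (D2 := η) a

/-- The complex of `A`-modules underlying a complex of left modules over the differential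
operators. -/
noncomputable abbrev resA (E : CochainComplex (ModuleCat.{u} (DiffOps k A)) ℤ) :
    CochainComplex (ModuleCat.{u} A) ℤ :=
  ((ModuleCat.restrictScalars (ofFun k A)).mapHomologicalComplex (ComplexShape.up ℤ)).obj E

/-- An element of the term of degree `m` of `E`, in the direct sum of all terms. -/
noncomputable def inTot (E : CochainComplex (ModuleCat.{u} (DiffOps k A)) ℤ) (m : ℤ) :
    E.X m →+ Tot (resA E) :=
  DirectSum.of (fun j => ((resA E).X j : Type u)) m

lemma tot_induction {E : CochainComplex (ModuleCat.{u} (DiffOps k A)) ℤ} {C : Tot (resA E) → Prop}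
    (h0 : C 0) (ha : ∀ x y, C x → C y → C (x + y)) (h : ∀ m e, C (inTot E m e)) (x : Tot (resA E)) :
    C x :=
  DirectSum.induction_on x h0 h ha

/-- The action of the differential operators on the direct sum of all terms of `E`. -/
noncomputable def opAct (E : CochainComplex (ModuleCat.{u} (DiffOps k A)) ℤ) :
    DiffOps k A →+* AddMonoid.End (Tot (resA E)) where
  toFun P := DirectSum.map fun m => (DistribSMul.toAddMonoidHom (E.X m) P : E.X m →+ E.X m)
  map_one' := by
    refine AddMonoidHom.ext fun x => DFinsupp.ext fun m => ?_
    exact one_smul (DiffOps k A) (show E.X m from x m)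
  map_zero' := by
    refine AddMonoidHom.ext fun x => DFinsupp.ext fun m => ?_
    exact zero_smul (DiffOps k A) (show E.X m from x m)
  map_mul' P Q := by
    refine AddMonoidHom.ext fun x => DFinsupp.ext fun m => ?_
    exact mul_smul P Q (show E.X m from x m)
  map_add' P Q := by
    refine AddMonoidHom.ext fun x => DFinsupp.ext fun m => ?_
    exact add_smul P Q (show E.X m from x m)

lemma opAct_inTot (E : CochainComplex (ModuleCat.{u} (DiffOps k A)) ℤ) (P : DiffOps k A) (m : ℤ)
    (e : E.X m) : opAct E P (inTot E m e) = inTot E m (P • e) :=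
  DirectSum.map_of _ _ _

lemma opAct_ofFun (E : CochainComplex (ModuleCat.{u} (DiffOps k A)) ℤ) (a : A)
    (x : Tot (resA E)) : opAct E (ofFun k A a) x = a • x :=
  DFinsupp.ext fun _ => rfl

lemma opAct_mul (E : CochainComplex (ModuleCat.{u} (DiffOps k A)) ℤ) (P Q : DiffOps k A)
    (x : Tot (resA E)) : opAct E (P * Q) x = opAct E P (opAct E Q x) := by rw [map_mul]; rfl

lemma opAct_add (E : CochainComplex (ModuleCat.{u} (DiffOps k A)) ℤ) (P Q : DiffOps k A)
    (x : Tot (resA E)) : opAct E (P + Q) x = opAct E P x + opAct E Q x := by rw [map_add]; rfl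

lemma opAct_sub (E : CochainComplex (ModuleCat.{u} (DiffOps k A)) ℤ) (P Q : DiffOps k A)
    (x : Tot (resA E)) : opAct E (P - Q) x = opAct E P x - opAct E Q x := by
  rw [eq_sub_iff_add_eq, ← opAct_add]
  exact congrArg (fun R => opAct E R x) (sub_add_cancel P Q)

lemma opAct_sum (E : CochainComplex (ModuleCat.{u} (DiffOps k A)) ℤ) {ι : Type*} (s : Finset ι)
    (P : ι → DiffOps k A) (x : Tot (resA E)) :
    opAct E (∑ i ∈ s, P i) x = ∑ i ∈ s, opAct E (P i) x := by
  classical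
  induction s using Finset.induction_on with
  | empty => rw [Finset.sum_empty, Finset.sum_empty, map_zero]; rfl
  | insert i s hi ih => rw [Finset.sum_insert hi, Finset.sum_insert hi, opAct_add, ih]

lemma opAct_totD (E : CochainComplex (ModuleCat.{u} (DiffOps k A)) ℤ) (P : DiffOps k A)
    (x : Tot (resA E)) : opAct E P (totD (resA E) x) = totD (resA E) (opAct E P x) := by
  have h (m : ℤ) (e : E.X m) :
      totD (resA E) (inTot E m e) = inTot E (m + 1) ((E.d m (m + 1)).hom e) := totMap_lof _ _ _ _
  induction x using tot_induction with
  | h0 => simp only [map_zero]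
  | ha x y hx hy => simp only [map_add, hx, hy]
  | h m e => rw [h, opAct_inTot, opAct_inTot, h, (E.d m (m + 1)).hom.map_smul]

/-- The flat connection of a module over the differential operators, in the given coordinates. -/
noncomputable def nablaOf (c : DualCoords k A) (E : CochainComplex (ModuleCat.{u} (DiffOps k A)) ℤ) :
    Tot (resA E) →+ Forms k A ⊗[A] Tot (resA E) :=
  ∑ i, (TensorProduct.mk A _ _ (dOne k A (c.x i))).toAddMonoidHom.comp (opAct E (ofDer (c.θ i)))

lemma nablaOf_apply (c : DualCoords k A) (E : CochainComplex (ModuleCat.{u} (DiffOps k A)) ℤ)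
    (t : Tot (resA E)) :
    nablaOf c E t = ∑ i, dOne k A (c.x i) ⊗ₜ[A] opAct E (ofDer (c.θ i)) t := by
  rw [nablaOf, AddMonoidHom.finsetSum_apply]; rfl

lemma DualCoords.dOne_eq (c : DualCoords k A) (a : A) :
    dOne k A a = ∑ i, c.θ i a • dOne k A (c.x i) := by
  rw [dOne, c.D_eq, map_sum]
  simp only [map_smul, dOne]

lemma opAct_derivation (c : DualCoords k A) (E : CochainComplex (ModuleCat.{u} (DiffOps k A)) ℤ)
    (η : Derivation k A A) (t : Tot (resA E)) :
    opAct E (ofDer η) t = ∑ i, η (c.x i) • opAct E (ofDer (c.θ i)) t := by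
  conv_lhs => rw [c.derivation_eq η, ofDer_sum, opAct_sum]
  refine Finset.sum_congr rfl fun i _ => ?_
  rw [opAct_mul, opAct_ofFun]

/-- The flat connection does not depend on the coordinates. -/
lemma nablaOf_eq (c c' : DualCoords k A) (E : CochainComplex (ModuleCat.{u} (DiffOps k A)) ℤ) :
    nablaOf c E = nablaOf c' E := by
  refine AddMonoidHom.ext fun t => ?_
  rw [nablaOf_apply, nablaOf_apply]
  simp only [opAct_derivation c' E (c.θ _), TensorProduct.tmul_sum, TensorProduct.tmul_smul]
  rw [Finset.sum_comm]
  refine Finset.sum_congr rfl fun j _ => ?_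
  rw [c.dOne_eq (c'.x j), TensorProduct.sum_tmul]
  simp only [TensorProduct.smul_tmul']

lemma nablaOf_smul (c : DualCoords k A) (E : CochainComplex (ModuleCat.{u} (DiffOps k A)) ℤ)
    (a : A) (t : Tot (resA E)) :
    nablaOf c E (a • t) = dOne k A a ⊗ₜ[A] t + a • nablaOf c E t := by
  rw [nablaOf_apply, nablaOf_apply, c.dOne_eq a, TensorProduct.sum_tmul, Finset.smul_sum,
    ← Finset.sum_add_distrib]
  refine Finset.sum_congr rfl fun i _ => ?_
  have : opAct E (ofDer (c.θ i)) (a • t) = a • opAct E (ofDer (c.θ i)) t + c.θ i a • t := by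
    rw [← opAct_ofFun, ← opAct_ofFun, ← opAct_ofFun]
    rw [← opAct_mul, ofDer_mul_ofFun, opAct_add, opAct_mul]
  rw [this, TensorProduct.tmul_add, TensorProduct.tmul_smul, TensorProduct.tmul_smul,
    TensorProduct.smul_tmul', TensorProduct.smul_tmul', add_comm]

/-- The mixed structure `ω ⊗ t ↦ dω ⊗ t + (-1) ^ |ω| ω ∧ ∇ t`, in the given coordinates. -/
noncomputable def epsOf (c : DualCoords k A) (E : CochainComplex (ModuleCat.{u} (DiffOps k A)) ℤ) :
    Forms k A ⊗[A] Tot (resA E) →+ Forms k A ⊗[A] Tot (resA E) :=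
  TensorProduct.liftAddHom
    (AddMonoidHom.mk' (fun ω => (TensorProduct.mk A _ _ (dR k A ω)).toAddMonoidHom +
        (DistribSMul.toAddMonoidHom _ (sgn k A ω)).comp (nablaOf c E)) fun ω ω' => by
      ext t
      simp only [map_add, LinearMap.add_apply, AddMonoidHom.add_apply, AddMonoidHom.comp_apply,
        LinearMap.toAddMonoidHom_coe, DistribSMul.toAddMonoidHom_apply, add_smul]
      abel)
    (fun a ω t => by
      change dR k A (a • ω) ⊗ₜ[A] t + sgn k A (a • ω) • nablaOf c E t =
        dR k A ω ⊗ₜ[A] (a • t) + sgn k A ω • nablaOf c E (a • t)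
      have h : dOne k A a * ω = sgn k A ω * dOne k A a := by
        induction ω using ExteriorAlgebra.induction with
        | algebraMap r => rw [AlgHom.commutes, Algebra.commutes]
        | ι m => rw [sgn_iota, neg_mul, dOne, iota_anticomm]
        | mul x y hx hy => rw [← mul_assoc, hx, mul_assoc, hy, map_mul, mul_assoc]
        | add x y hx hy => rw [mul_add, hx, hy, map_add, add_mul]
      rw [nablaOf_smul, smul_add, dR_smul, TensorProduct.add_tmul, h, map_smul,
        TensorProduct.smul_tmul', smul_eq_mul, TensorProduct.tmul_smul, TensorProduct.smul_tmul',
        smul_assoc, smul_comm (sgn k A ω) a]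
      abel)

lemma epsOf_tmul (c : DualCoords k A) (E : CochainComplex (ModuleCat.{u} (DiffOps k A)) ℤ)
    (ω : Forms k A) (t : Tot (resA E)) :
    epsOf c E (ω ⊗ₜ t) = dR k A ω ⊗ₜ t + sgn k A ω • nablaOf c E t := rfl

lemma epsOf_smul (c : DualCoords k A) (E : CochainComplex (ModuleCat.{u} (DiffOps k A)) ℤ)
    (ω : Forms k A) (x : Forms k A ⊗[A] Tot (resA E)) :
    epsOf c E (ω • x) = dR k A ω • x + sgn k A ω • epsOf c E x := by
  induction x using TensorProduct.induction_on with
  | zero => simp only [smul_zero, map_zero, add_zero]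
  | add x y hx hy => simp only [smul_add, map_add, hx, hy]; abel
  | tmul ω' t =>
    rw [TensorProduct.smul_tmul', smul_eq_mul, epsOf_tmul, epsOf_tmul, dR_mul, map_mul,
      TensorProduct.add_tmul, smul_add, TensorProduct.smul_tmul', TensorProduct.smul_tmul',
      smul_eq_mul, smul_eq_mul, mul_smul, add_assoc]

/-- The contraction of second derivatives of the coordinates against two-forms vanishes. -/
lemma DualCoords.sum_second (c : DualCoords k A) (l : Fin c.card) :
    ∑ i, ∑ j, c.θ j (c.θ i (c.x l)) • (dOne k A (c.x i) * dOne k A (c.x j)) = 0 := by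
  have h := dR_dOne k A (c.x l)
  rw [c.dOne_eq (c.x l), map_sum] at h
  simp only [dR_smul, dR_dOne, smul_zero, add_zero] at h
  rw [← neg_eq_zero, ← h, ← Finset.sum_neg_distrib]
  refine Finset.sum_congr rfl fun i _ => ?_
  rw [c.dOne_eq (c.θ i (c.x l)), Finset.sum_mul, ← Finset.sum_neg_distrib]
  refine Finset.sum_congr rfl fun j _ => ?_
  rw [smul_mul_assoc, ← smul_neg, dOne, dOne, iota_anticomm, neg_neg]

/-- The connection of a module over the differential operators is flat. -/
lemma epsOf_nablaOf [CharZero k] (c : DualCoords k A)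
    (E : CochainComplex (ModuleCat.{u} (DiffOps k A)) ℤ) (t : Tot (resA E)) :
    epsOf c E (nablaOf c E t) = 0 := by
  set S : Forms k A ⊗[A] Tot (resA E) := ∑ i, ∑ j, (dOne k A (c.x i) * dOne k A (c.x j)) ⊗ₜ[A]
    opAct E (ofDer (c.θ j)) (opAct E (ofDer (c.θ i)) t) with hS
  have h1 : epsOf c E (nablaOf c E t) = -S := by
    rw [nablaOf_apply, map_sum, hS, ← Finset.sum_neg_distrib]
    refine Finset.sum_congr rfl fun i _ => ?_
    rw [epsOf_tmul, dR_dOne, TensorProduct.zero_tmul, zero_add, sgn_dOne, nablaOf_apply, Finset.smul_sum,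
      ← Finset.sum_neg_distrib]
    refine Finset.sum_congr rfl fun j _ => ?_
    rw [TensorProduct.smul_tmul', smul_eq_mul, neg_mul, TensorProduct.neg_tmul]
  have h2 : S + S = 0 := by
    have hS' : S = -∑ i, ∑ j, (dOne k A (c.x i) * dOne k A (c.x j)) ⊗ₜ[A]
        opAct E (ofDer (c.θ i)) (opAct E (ofDer (c.θ j)) t) := by
      rw [hS, Finset.sum_comm, ← Finset.sum_neg_distrib]
      refine Finset.sum_congr rfl fun i _ => ?_
      rw [← Finset.sum_neg_distrib]
      refine Finset.sum_congr rfl fun j _ => ?_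
      rw [← TensorProduct.neg_tmul, dOne, dOne, ← iota_anticomm]
    have h3 : S + S = ∑ i, ∑ j, (dOne k A (c.x i) * dOne k A (c.x j)) ⊗ₜ[A]
        opAct E (ofDer ⁅c.θ j, c.θ i⁆) t := by
      nth_rw 2 [hS']
      rw [hS, ← sub_eq_add_neg, ← Finset.sum_sub_distrib]
      refine Finset.sum_congr rfl fun i _ => ?_
      rw [← Finset.sum_sub_distrib]
      refine Finset.sum_congr rfl fun j _ => ?_
      rw [← TensorProduct.tmul_sub, ofDer_lie, opAct_sub, opAct_mul, opAct_mul]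
    have h4 (l : Fin c.card) : ∑ i, ∑ j, c.θ i (c.θ j (c.x l)) •
        (dOne k A (c.x i) * dOne k A (c.x j)) = 0 := by
      rw [Finset.sum_comm, ← neg_eq_zero, ← c.sum_second l, ← Finset.sum_neg_distrib]
      refine Finset.sum_congr rfl fun i _ => ?_
      rw [← Finset.sum_neg_distrib]
      refine Finset.sum_congr rfl fun j _ => ?_
      rw [← smul_neg, dOne, dOne, ← iota_anticomm]
    rw [h3]
    simp only [opAct_derivation c E ⁅_, _⁆, TensorProduct.tmul_sum]
    have : ∀ l : Fin c.card, ∑ i, ∑ j, (dOne k A (c.x i) * dOne k A (c.x j)) ⊗ₜ[A]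
        (⁅c.θ j, c.θ i⁆ (c.x l) • opAct E (ofDer (c.θ l)) t) = 0 := fun l => by
      have h5 := congrArg (fun w : Forms k A => w ⊗ₜ[A] opAct E (ofDer (c.θ l)) t)
        ((congrArg₂ (· - ·) (c.sum_second l) (h4 l)).trans (sub_zero 0))
      simp only [TensorProduct.zero_tmul] at h5
      rw [← h5, ← Finset.sum_sub_distrib, TensorProduct.sum_tmul]
      refine Finset.sum_congr rfl fun i _ => ?_
      rw [← Finset.sum_sub_distrib, TensorProduct.sum_tmul]
      refine Finset.sum_congr rfl fun j _ => ?_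
      rw [← sub_smul, TensorProduct.tmul_smul, TensorProduct.smul_tmul',
        Derivation.commutator_apply]
    have h6 : ∑ l, ∑ i, ∑ j, (dOne k A (c.x i) * dOne k A (c.x j)) ⊗ₜ[A]
        (⁅c.θ j, c.θ i⁆ (c.x l) • opAct E (ofDer (c.θ l)) t) = 0 :=
      Finset.sum_eq_zero fun l _ => this l
    rw [← h6]
    exact (Finset.sum_congr rfl fun i _ => Finset.sum_comm).trans Finset.sum_comm
  rw [h1, neg_eq_zero]
  have h7 : algebraMap k A 2 • S = 0 := by
    rw [map_ofNat, two_smul, h2]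
  have h8 := congrArg (fun x => algebraMap k A 2⁻¹ • x) h7
  simp only [smul_zero, smul_smul, ← map_mul] at h8
  rwa [inv_mul_cancel₀ two_ne_zero, map_one, one_smul] at h8

end DeRham

section Functor

variable {k : Type v} {A : Type u} [Field k] [CommRing A] [Algebra k A]

lemma freeD_nablaOf (c : DualCoords k A)
    (E : CochainComplex (ModuleCat.{u} (DiffOps k A)) ℤ) (t : Tot (resA E)) :
    freeD k (resA E) (nablaOf c E t) = -nablaOf c E (totD (resA E) t) := by
  rw [nablaOf_apply, nablaOf_apply, map_sum, ← Finset.sum_neg_distrib]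
  refine Finset.sum_congr rfl fun i _ => ?_
  rw [freeD_tmul, sgn_dOne, TensorProduct.neg_tmul, opAct_totD]

lemma epsOf_mem (c : DualCoords k A) (E : CochainComplex (ModuleCat.{u} (DiffOps k A)) ℤ) {p n : ℤ}
    {x : Forms k A ⊗[A] Tot (resA E)} (hx : x ∈ freeComp k (resA E) p n) :
    epsOf c E x ∈ freeComp k (resA E) (p + 1) (n + 1) := by
  refine freeComp_map (epsOf c E) _ (fun q m hp hn ω hω e => ?_) hx
  rw [epsOf_tmul]
  refine add_mem (tmul_mem_freeComp (q := q + 1) (by rw [hp]; push_cast; ring)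
    (by rw [hn]; push_cast; ring) (dR_mem k A hω) e) ?_
  rw [nablaOf_apply, Finset.smul_sum]
  refine sum_mem fun i _ => ?_
  rw [TensorProduct.smul_tmul', smul_eq_mul,
    show opAct E (ofDer (c.θ i)) (DirectSum.lof A ℤ (fun j => ((resA E).X j : Type u)) m e) =
      inTot E m (ofDer (c.θ i) • (show E.X m from e)) from opAct_inTot E _ m e]
  refine tmul_mem_freeComp (q := q + 1) (by rw [hp]; push_cast; ring)
    (by rw [hn]; push_cast; ring) (forms_mul_mem k A ?_ (dOne_mem k A _)) _
  rw [sgn_of_mem k A hω]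
  exact zsmul_mem hω _

lemma epsOf_epsOf [CharZero k] (c : DualCoords k A)
    (E : CochainComplex (ModuleCat.{u} (DiffOps k A)) ℤ) (x : Forms k A ⊗[A] Tot (resA E)) :
    epsOf c E (epsOf c E x) = 0 := by
  induction x using TensorProduct.induction_on with
  | zero => simp only [map_zero]
  | add x y hx hy => simp only [map_add, hx, hy, add_zero]
  | tmul ω t =>
    rw [epsOf_tmul, map_add, epsOf_tmul, epsOf_smul, epsOf_nablaOf, dR_dR, smul_zero, add_zero,
      TensorProduct.zero_tmul, zero_add, sgn_dR, ← add_smul, neg_add_cancel, zero_smul]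

lemma freeD_epsOf (c : DualCoords k A) (E : CochainComplex (ModuleCat.{u} (DiffOps k A)) ℤ)
    (x : Forms k A ⊗[A] Tot (resA E)) :
    freeD k (resA E) (epsOf c E x) + epsOf c E (freeD k (resA E) x) = 0 := by
  induction x using TensorProduct.induction_on with
  | zero => simp only [map_zero, add_zero]
  | add x y hx hy =>
    simp only [map_add]
    rw [add_add_add_comm, hx, hy, add_zero]
  | tmul ω t =>
    rw [epsOf_tmul, map_add, freeD_smul, freeD_nablaOf, freeD_tmul, freeD_tmul, epsOf_tmul,
      sgn_dR, TensorProduct.neg_tmul, smul_neg]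
    abel

/-- The de Rham complex `Forms k A ⊗[A] E` of a complex `E` of left modules over the differential
operators. Its mixed structure is `ω ⊗ e ↦ dω ⊗ e + (-1) ^ |ω| ω ∧ ∇ e`, where `∇` is the connection
given by the action of the derivations; it does not depend on the chosen coordinates. -/
noncomputable def deRhamObj [CharZero k] (c : DualCoords k A)
    (E : CochainComplex (ModuleCat.{u} (DiffOps k A)) ℤ) : MixedMod k A where
  toGrMod := freeMod k (resA E)
  ε := epsOf c E
  ε_mem := epsOf_mem c E
  ε_ε := epsOf_epsOf c E
  d_ε := freeD_epsOf c E
  ε_smul := fun {q ω} x hω => by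
    refine (epsOf_smul c E ω x).trans ?_
    rw [sgn_of_mem k A hω, zsmul_smul_assoc]
    rfl

/-- A morphism of complexes of left modules over the differential operators, on the direct sums of
all terms. -/
noncomputable def resMap {E F : CochainComplex (ModuleCat.{u} (DiffOps k A)) ℤ} (f : E ⟶ F) :
    Tot (resA E) →ₗ[A] Tot (resA F) where
  __ := (DirectSum.map fun m => ((f.f m).hom.toAddMonoidHom : E.X m →+ F.X m) :
    Tot (resA E) →+ Tot (resA F))
  map_smul' a t := DFinsupp.ext fun m => (f.f m).hom.map_smul (ofFun k A a) (show E.X m from t m)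

lemma resMap_inTot {E F : CochainComplex (ModuleCat.{u} (DiffOps k A)) ℤ} (f : E ⟶ F) (m : ℤ)
    (e : E.X m) : resMap f (inTot E m e) = inTot F m ((f.f m).hom e) :=
  DirectSum.map_of _ _ _

/-- A cochain of degree `n` between complexes of left modules over the differential operators, on
the direct sums of all terms. -/
noncomputable def resCochain {E F : CochainComplex (ModuleCat.{u} (DiffOps k A)) ℤ} {n : ℤ}
    (z : CochainComplex.HomComplex.Cochain E F n) : Tot (resA E) →ₗ[A] Tot (resA F) :=
  totMap (E := resA E) (F := resA F) n fun m =>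
    ((z.map (ModuleCat.restrictScalars (ofFun k A))).v m (m + n) rfl).hom

lemma resCochain_inTot' {E F : CochainComplex (ModuleCat.{u} (DiffOps k A)) ℤ} {n : ℤ}
    (z : CochainComplex.HomComplex.Cochain E F n) (m : ℤ) (e : E.X m) :
    resCochain z (inTot E m e) = inTot F (m + n) ((z.v m (m + n) rfl).hom e) :=
  totMap_lof _ _ _ _

lemma resCochain_inTot {E F : CochainComplex (ModuleCat.{u} (DiffOps k A)) ℤ} {n : ℤ}
    (z : CochainComplex.HomComplex.Cochain E F n) (m m' : ℤ) (h : m + n = m') (e : E.X m) :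
    resCochain z (inTot E m e) = inTot F m' ((z.v m m' h).hom e) := by
  subst h
  exact resCochain_inTot' z m e

lemma totD_inTot (E : CochainComplex (ModuleCat.{u} (DiffOps k A)) ℤ) (m m' : ℤ) (h : m + 1 = m')
    (e : E.X m) : totD (resA E) (inTot E m e) = inTot E m' ((E.d m m').hom e) := by
  subst h
  exact totMap_lof _ _ _ _

lemma resCochain_opAct {E F : CochainComplex (ModuleCat.{u} (DiffOps k A)) ℤ} {n : ℤ}
    (z : CochainComplex.HomComplex.Cochain E F n) (P : DiffOps k A) (t : Tot (resA E)) :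
    resCochain z (opAct E P t) = opAct F P (resCochain z t) := by
  induction t using tot_induction with
  | h0 => rw [map_zero, map_zero, map_zero]
  | ha x y hx hy => rw [map_add, map_add, map_add, map_add, hx, hy]
  | h m e =>
    rw [opAct_inTot, resCochain_inTot _ _ _ rfl, resCochain_inTot _ _ _ rfl, opAct_inTot,
      (z.v m (m + n) rfl).hom.map_smul]

lemma resMap_opAct {E F : CochainComplex (ModuleCat.{u} (DiffOps k A)) ℤ} (f : E ⟶ F)
    (P : DiffOps k A) (t : Tot (resA E)) :
    resMap f (opAct E P t) = opAct F P (resMap f t) := by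
  induction t using tot_induction with
  | h0 => rw [map_zero, map_zero, map_zero]
  | ha x y hx hy => rw [map_add, map_add, map_add, map_add, hx, hy]
  | h m e => rw [opAct_inTot, resMap_inTot, resMap_inTot, opAct_inTot, (f.f m).hom.map_smul]

lemma resMap_totD {E F : CochainComplex (ModuleCat.{u} (DiffOps k A)) ℤ} (f : E ⟶ F)
    (t : Tot (resA E)) : resMap f (totD (resA E) t) = totD (resA F) (resMap f t) := by
  induction t using tot_induction with
  | h0 => rw [map_zero, map_zero, map_zero]
  | ha x y hx hy => rw [map_add, map_add, map_add, map_add, hx, hy]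
  | h m e =>
    rw [totD_inTot _ _ _ rfl, resMap_inTot, resMap_inTot, totD_inTot _ _ _ rfl,
      ← LinearMap.comp_apply, ← LinearMap.comp_apply, ← ModuleCat.hom_comp, ← ModuleCat.hom_comp,
      f.comm]

/-- The map `id ⊗ f` of de Rham complexes. -/
noncomputable def formsMap {E F : CochainComplex (ModuleCat.{u} (DiffOps k A)) ℤ} (f : E ⟶ F) :
    Forms k A ⊗[A] Tot (resA E) →ₗ[Forms k A] Forms k A ⊗[A] Tot (resA F) :=
  TensorProduct.AlgebraTensorModule.map (LinearMap.id : Forms k A →ₗ[Forms k A] Forms k A)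
    (resMap f)

lemma formsMap_tmul {E F : CochainComplex (ModuleCat.{u} (DiffOps k A)) ℤ} (f : E ⟶ F)
    (ω : Forms k A) (t : Tot (resA E)) : formsMap f (ω ⊗ₜ t) = ω ⊗ₜ resMap f t := rfl

lemma formsMap_mem {E F : CochainComplex (ModuleCat.{u} (DiffOps k A)) ℤ} (f : E ⟶ F) {p n : ℤ}
    {x : Forms k A ⊗[A] Tot (resA E)} (hx : x ∈ freeComp k (resA E) p n) :
    formsMap f x ∈ freeComp k (resA F) p n := by
  refine freeComp_map (formsMap f).toAddMonoidHom _ (fun q m hp hn ω hω e => ?_) hx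
  rw [LinearMap.toAddMonoidHom_coe, formsMap_tmul,
    show resMap f (DirectSum.lof A ℤ (fun j => ((resA E).X j : Type u)) m e) =
      inTot F m ((f.f m).hom e) from resMap_inTot f m e]
  exact tmul_mem_freeComp hp hn hω _

lemma formsMap_freeD {E F : CochainComplex (ModuleCat.{u} (DiffOps k A)) ℤ} (f : E ⟶ F)
    (x : Forms k A ⊗[A] Tot (resA E)) :
    formsMap f (freeD k (resA E) x) = freeD k (resA F) (formsMap f x) := by
  induction x using TensorProduct.induction_on with
  | zero => simp only [map_zero]
  | add x y hx hy => simp only [map_add, hx, hy]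
  | tmul ω t => rw [freeD_tmul, formsMap_tmul, formsMap_tmul, freeD_tmul, resMap_totD]

lemma formsMap_epsOf (c : DualCoords k A) {E F : CochainComplex (ModuleCat.{u} (DiffOps k A)) ℤ}
    (f : E ⟶ F) (x : Forms k A ⊗[A] Tot (resA E)) :
    formsMap f (epsOf c E x) = epsOf c F (formsMap f x) := by
  induction x using TensorProduct.induction_on with
  | zero => simp only [map_zero]
  | add x y hx hy => simp only [map_add, hx, hy]
  | tmul ω t =>
    rw [epsOf_tmul, map_add, map_smul, formsMap_tmul, formsMap_tmul, epsOf_tmul, nablaOf_apply,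
      nablaOf_apply, map_sum]
    simp only [formsMap_tmul, resMap_opAct]

/-- The morphism `id ⊗ f` of de Rham complexes. -/
noncomputable def deRhamMap [CharZero k] (c : DualCoords k A)
    {E F : CochainComplex (ModuleCat.{u} (DiffOps k A)) ℤ} (f : E ⟶ F) :
    deRhamObj c E ⟶ deRhamObj c F where
  lin := formsMap f
  map_mem := formsMap_mem f
  map_d := formsMap_freeD f
  map_ε := formsMap_epsOf c f

variable (k A) in
/-- The de Rham functor, from complexes of left modules over the differential operators to graded
mixed dg-modules over the de Rham algebra. -/
noncomputable def deRham [CharZero k] [Algebra.Smooth k A] :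
    CochainComplex (ModuleCat.{u} (DiffOps k A)) ℤ ⥤ MixedMod k A where
  obj E := deRhamObj (dualCoords k A) E
  map f := deRhamMap (dualCoords k A) f
  map_id E := by
    refine MixedMod.Hom.ext (LinearMap.ext fun x => ?_)
    change formsMap (𝟙 E) x = x
    induction x using TensorProduct.induction_on with
    | zero => rw [map_zero]
    | add x y hx hy => rw [map_add, hx, hy]
    | tmul ω t =>
      rw [formsMap_tmul]
      congr 1
      induction t using tot_induction with
      | h0 => rw [map_zero]
      | ha x y hx hy => rw [map_add, hx, hy]
      | h m e => rw [resMap_inTot]; rfl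
  map_comp {E F G} f g := by
    refine MixedMod.Hom.ext (LinearMap.ext fun x => ?_)
    change formsMap (f ≫ g) x = formsMap g (formsMap f x)
    induction x using TensorProduct.induction_on with
    | zero => simp only [map_zero]
    | add x y hx hy => simp only [map_add, hx, hy]
    | tmul ω t =>
      rw [formsMap_tmul, formsMap_tmul, formsMap_tmul]
      congr 1
      induction t using tot_induction with
      | h0 => simp only [map_zero]
      | ha x y hx hy => rw [map_add, map_add, map_add, hx, hy]
      | h m e => rw [resMap_inTot, resMap_inTot, resMap_inTot]; rfl

variable (k A) in
/-- The sign `(-1) ^ (n * q)` on the forms of degree `q`. -/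
noncomputable def sgnPow (n : ℤ) : Forms k A →ₐ[A] Forms k A :=
  if Even n then AlgHom.id A _ else sgn k A

lemma sgnPow_of_mem (n : ℤ) {q : ℕ} {ω : Forms k A} (hω : ω ∈ ⋀[A]^q Ω[A⁄k]) :
    sgnPow k A n ω = (n * q).negOnePow • ω := by
  rw [sgnPow]
  split_ifs with h
  · rw [Int.negOnePow_even _ (h.mul_right _), one_smul]; rfl
  · rw [sgn_of_mem k A hω, Units.smul_def]
    congr 1
    have h' : Odd n := Int.not_even_iff_odd.1 h
    rcases Nat.even_or_odd q with hq | hq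
    · rw [hq.neg_one_pow, Int.negOnePow_even _ (((Int.even_coe_nat q).2 hq).mul_left _),
        Units.val_one]
    · rw [hq.neg_one_pow, Int.negOnePow_odd _ (h'.mul ((Int.odd_coe_nat q).2 hq)), Units.val_neg,
        Units.val_one]

lemma sgnPow_dOne (n : ℤ) (a : A) : sgnPow k A n (dOne k A a) = n.negOnePow • dOne k A a := by
  rw [sgnPow_of_mem n (dOne_mem k A a), Nat.cast_one, mul_one]

lemma sgnPow_sgn (n : ℤ) (ω : Forms k A) :
    sgnPow k A n (sgn k A ω) = sgn k A (sgnPow k A n ω) := by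
  rw [sgnPow]
  split_ifs <;> rfl

lemma sgnPow_dR (n : ℤ) (ω : Forms k A) :
    sgnPow k A n (dR k A ω) = n.negOnePow • dR k A (sgnPow k A n ω) := by
  rw [sgnPow]
  split_ifs with h
  · rw [Int.negOnePow_even _ h, one_smul]; rfl
  · rw [Int.negOnePow_odd _ (Int.not_even_iff_odd.1 h), Units.neg_smul, one_smul, sgn_dR]

/-- The map of degree `n` between de Rham complexes given by a cochain `z` of degree `n`, that is
`ω ⊗ e ↦ (-1) ^ (n * |ω|) ω ⊗ z e`. -/
noncomputable def deRhamCochain {E F : CochainComplex (ModuleCat.{u} (DiffOps k A)) ℤ} {n : ℤ}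
    (z : CochainComplex.HomComplex.Cochain E F n) :
    Forms k A ⊗[A] Tot (resA E) →ₗ[A] Forms k A ⊗[A] Tot (resA F) :=
  TensorProduct.map (sgnPow k A n).toLinearMap (resCochain z)

lemma deRhamCochain_tmul {E F : CochainComplex (ModuleCat.{u} (DiffOps k A)) ℤ} {n : ℤ}
    (z : CochainComplex.HomComplex.Cochain E F n) (ω : Forms k A) (t : Tot (resA E)) :
    deRhamCochain z (ω ⊗ₜ t) = sgnPow k A n ω ⊗ₜ resCochain z t := rfl

lemma deRhamCochain_smul {E F : CochainComplex (ModuleCat.{u} (DiffOps k A)) ℤ} {n : ℤ}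
    (z : CochainComplex.HomComplex.Cochain E F n) (ω : Forms k A)
    (x : Forms k A ⊗[A] Tot (resA E)) :
    deRhamCochain z (ω • x) = sgnPow k A n ω • deRhamCochain z x := by
  induction x using TensorProduct.induction_on with
  | zero => simp only [smul_zero, map_zero]
  | add x y hx hy => simp only [smul_add, map_add, hx, hy]
  | tmul ω' t =>
    rw [TensorProduct.smul_tmul', deRhamCochain_tmul, deRhamCochain_tmul,
      TensorProduct.smul_tmul', smul_eq_mul, smul_eq_mul, map_mul]

lemma tmul_units_smul {T : Type u} [AddCommGroup T] [Module A T] (n : ℤˣ) (ω : Forms k A) (t : T) :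
    (n • ω) ⊗ₜ[A] t = n • (ω ⊗ₜ[A] t) := by
  rcases Int.units_eq_one_or n with rfl | rfl
  · rw [one_smul, one_smul]
  · rw [Units.neg_smul, one_smul, Units.neg_smul, one_smul, TensorProduct.neg_tmul]

lemma deRhamCochain_mem [CharZero k] (c : DualCoords k A)
    {E F : CochainComplex (ModuleCat.{u} (DiffOps k A)) ℤ} {n : ℤ}
    (z : CochainComplex.HomComplex.Cochain E F n) :
    (deRhamCochain z).toAddMonoidHom ∈ (deRhamObj c E).homDeg (deRhamObj c F) n := by
  refine ⟨fun p m x hx => ?_, fun q ω hω x => ?_, fun x => ?_⟩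
  · refine freeComp_map (deRhamCochain z).toAddMonoidHom (freeComp k (resA F) p (m + n))
      (fun q j hp hn ω hω e => ?_) hx
    rw [LinearMap.toAddMonoidHom_coe, deRhamCochain_tmul, sgnPow_of_mem n hω,
      show resCochain z (DirectSum.lof A ℤ (fun j => ((resA E).X j : Type u)) j e) =
        inTot F (j + n) ((z.v j (j + n) rfl).hom e) from resCochain_inTot z j _ rfl e]
    refine tmul_mem_freeComp hp (by rw [hn]; ring) ?_ _
    rw [Units.smul_def]
    exact zsmul_mem hω _
  · refine (deRhamCochain_smul z ω x).trans ?_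
    rw [sgnPow_of_mem n hω, Units.smul_def, Units.smul_def, zsmul_smul_assoc]
    rfl
  · change deRhamCochain z (epsOf c E x) = n.negOnePow • epsOf c F (deRhamCochain z x)
    have hn (t : Tot (resA E)) :
        deRhamCochain z (nablaOf c E t) = n.negOnePow • nablaOf c F (resCochain z t) := by
      rw [nablaOf_apply, nablaOf_apply, map_sum, Finset.smul_sum]
      refine Finset.sum_congr rfl fun i _ => ?_
      rw [deRhamCochain_tmul, sgnPow_dOne, resCochain_opAct, tmul_units_smul]
    induction x using TensorProduct.induction_on with
    | zero => simp only [map_zero, smul_zero]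
    | add x y hx hy => simp only [map_add, smul_add, hx, hy]
    | tmul ω t =>
      rw [epsOf_tmul, map_add, deRhamCochain_tmul, deRhamCochain_smul, deRhamCochain_tmul,
        epsOf_tmul, hn, sgnPow_dR, sgnPow_sgn, tmul_units_smul, smul_add, Units.smul_def,
        Units.smul_def, Units.smul_def]
      congr 1
      exact smul_zsmul_comm _ _ _

lemma resCochain_δ {E F : CochainComplex (ModuleCat.{u} (DiffOps k A)) ℤ} {n : ℤ}
    (z : CochainComplex.HomComplex.Cochain E F n) (t : Tot (resA E)) :
    resCochain (CochainComplex.HomComplex.δ n (n + 1) z) t =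
      totD (resA F) (resCochain z t) - n.negOnePow • resCochain z (totD (resA E) t) := by
  induction t using tot_induction with
  | h0 => simp only [map_zero, smul_zero, sub_zero]
  | ha x y hx hy => rw [map_add, map_add, map_add, map_add, map_add, smul_add, hx, hy]; abel
  | h m e =>
    rw [resCochain_inTot _ m (m + (n + 1)) rfl, resCochain_inTot z m (m + n) rfl,
      totD_inTot F (m + n) (m + (n + 1)) (by ring), totD_inTot E m (m + 1) rfl,
      resCochain_inTot z (m + 1) (m + (n + 1)) (by ring),
      CochainComplex.HomComplex.δ_v n (n + 1) rfl z m (m + (n + 1)) rfl (m + n) (m + 1)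
      (by ring) rfl, Int.negOnePow_succ]
    rw [ModuleCat.hom_add, LinearMap.add_apply, map_add]
    refine (congrArg₂ (· + ·) rfl ?_).trans (sub_eq_add_neg _ _).symm
    rw [Units.neg_smul, ModuleCat.hom_neg, LinearMap.neg_apply, map_neg]
    congr 1
    rcases Int.units_eq_one_or n.negOnePow with h | h
    · rw [h, one_smul, one_smul]; rfl
    · rw [h, Units.neg_smul, one_smul, Units.neg_smul, one_smul, ModuleCat.hom_neg,
        LinearMap.neg_apply, map_neg]
      rfl

lemma deRhamCochain_δ {E F : CochainComplex (ModuleCat.{u} (DiffOps k A)) ℤ} {n : ℤ}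
    (z : CochainComplex.HomComplex.Cochain E F n) (x : Forms k A ⊗[A] Tot (resA E)) :
    deRhamCochain (CochainComplex.HomComplex.δ n (n + 1) z) x =
      freeD k (resA F) (deRhamCochain z x) -
        n.negOnePow • deRhamCochain z (freeD k (resA E) x) := by
  induction x using TensorProduct.induction_on with
  | zero => simp only [map_zero, smul_zero, sub_zero]
  | add x y hx hy => rw [map_add, map_add, map_add, map_add, map_add, smul_add, hx, hy]; abel
  | tmul ω t =>
    rw [deRhamCochain_tmul, deRhamCochain_tmul, freeD_tmul, freeD_tmul, deRhamCochain_tmul,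
      resCochain_δ, sgnPow_sgn]
    have h : sgnPow k A (n + 1) ω = sgn k A (sgnPow k A n ω) := by
      simp only [sgnPow, Int.even_add_one]
      by_cases h : Even n
      · simp only [h, not_true_eq_false, if_false, if_true]; rfl
      · simp only [h, not_false_eq_true, if_false, if_true, sgn_sgn]; rfl
    rw [h, TensorProduct.tmul_sub]
    congr 1
    rcases Int.units_eq_one_or n.negOnePow with h | h
    · rw [h, one_smul, one_smul]
    · rw [h, Units.neg_smul, one_smul, Units.neg_smul, one_smul, TensorProduct.tmul_neg]

lemma resCochain_add {E F : CochainComplex (ModuleCat.{u} (DiffOps k A)) ℤ} {n : ℤ}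
    (z w : CochainComplex.HomComplex.Cochain E F n) (t : Tot (resA E)) :
    resCochain (z + w) t = resCochain z t + resCochain w t := by
  induction t using tot_induction with
  | h0 => simp only [map_zero, add_zero]
  | ha x y hx hy => rw [map_add, map_add, map_add, hx, hy]; abel
  | h m e =>
    rw [resCochain_inTot _ m _ rfl, resCochain_inTot _ m _ rfl, resCochain_inTot _ m _ rfl,
      CochainComplex.HomComplex.Cochain.add_v, ModuleCat.hom_add, LinearMap.add_apply, map_add]

lemma deRhamCochain_add {E F : CochainComplex (ModuleCat.{u} (DiffOps k A)) ℤ} {n : ℤ}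
    (z w : CochainComplex.HomComplex.Cochain E F n) (x : Forms k A ⊗[A] Tot (resA E)) :
    deRhamCochain (z + w) x = deRhamCochain z x + deRhamCochain w x := by
  induction x using TensorProduct.induction_on with
  | zero => simp only [map_zero, add_zero]
  | add x y hx hy => rw [map_add, map_add, map_add, hx, hy]; abel
  | tmul ω t =>
    rw [deRhamCochain_tmul, deRhamCochain_tmul, deRhamCochain_tmul, resCochain_add,
      TensorProduct.tmul_add]

/-- On the morphisms of complexes, seen as cochains of degree `0`, one recovers the de Rham
functor. -/
lemma deRhamCochain_ofHom {E F : CochainComplex (ModuleCat.{u} (DiffOps k A)) ℤ} (f : E ⟶ F)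
    (x : Forms k A ⊗[A] Tot (resA E)) :
    deRhamCochain (CochainComplex.HomComplex.Cochain.ofHom f) x = formsMap f x := by
  induction x using TensorProduct.induction_on with
  | zero => simp only [map_zero]
  | add x y hx hy => simp only [map_add, hx, hy]
  | tmul ω t =>
    rw [deRhamCochain_tmul, formsMap_tmul]
    have h : sgnPow k A 0 ω = ω := by simp only [sgnPow, Even.zero, if_true]; rfl
    rw [h]
    congr 1
    induction t using tot_induction with
    | h0 => rw [map_zero, map_zero]
    | ha x y hx hy => rw [map_add, map_add, hx, hy]
    | h m e =>
      rw [resCochain_inTot _ m m (add_zero m), resMap_inTot,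
        CochainComplex.HomComplex.Cochain.ofHom_v]

/-- The de Rham functor on complexes of maps. -/
noncomputable def deRhamHom [CharZero k] [Algebra.Smooth k A]
    (E F : CochainComplex (ModuleCat.{u} (DiffOps k A)) ℤ) :
    CochainComplex.HomComplex E F ⟶
      MixedMod.homComplex ((deRham k A).obj E) ((deRham k A).obj F) where
  f n := AddCommGrpCat.ofHom (AddMonoidHom.mk'
    (fun z : CochainComplex.HomComplex.Cochain E F n =>
      (⟨(deRhamCochain z).toAddMonoidHom, deRhamCochain_mem _ z⟩ :
        MixedMod.homDeg ((deRham k A).obj E) ((deRham k A).obj F) n))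
    (fun z w => Subtype.ext (AddMonoidHom.ext (deRhamCochain_add z w))))
  comm' n m h := by
    obtain rfl : n + 1 = m := h
    simp only [MixedMod.homComplex, dif_pos]
    refine AddCommGrpCat.hom_ext (AddMonoidHom.ext fun z => Subtype.ext (AddMonoidHom.ext fun x => ?_))
    exact (deRhamCochain_δ z x).symm

end Functor

end DeRhamMixed

/-! Write `D` for `DiffOps k A`. The proof builds a derived right adjoint of `deRham` out of jets. A
morphism `f` from the de Rham complex of `E` to a graded mixed module `M` is determined by its
restriction to `1 ⊗ E`, hence by the `D`-linear map sending `e` to the jet `P ↦ f (1 ⊗ P e)` in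
`Hom_A(D, M)`. Compatibility with the mixed structures says that these jets are killed by `del`,
that is by `φ ↦ (P ↦ ε (φ P) - ∑ i, dx i ∧ φ (θ i * P))`. This operator squares to zero, raises the
weight by one, anticommutes with `d` and commutes with `D` acting by right multiplication on the
argument. The derived adjoint is therefore the total complex `jetsObj`: sequences of jets with
values in the weights 0, 1, 2, ..., with differential `d + del`. On the other side,
`MixedMod.telescope` resolves the de Rham complex so that the maps out of the resolution are exactly
the cochains from `E` to the complex of jets (`ofCochain`, `toCochain`).

Two facts compute the cohomology of the complex of jets. First, `D` is projective over `A`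
(`DualCoords.projective`), so that jets commute with `d`-cohomology and preserve acyclicity and
quasi-isomorphisms. Second, there is a formal Poincaré lemma: if `W` carries interior products by
the `θ j` (a `Contraction`), then `del` is exact in positive weight, and in weight zero a jet in its
kernel is determined by its value at `1` (`Contraction.exists_del_eq`,
`Contraction.eq_zero_of_del_eq_zero`). The homotopy contracts with `θ j` and takes the commutator
with `x j`. The resulting Laplacian acts on symbols of order `m` in weight `p` as `p + m`, which in
characteristic zero is invertible unless `p + m = 0`. Hence, if the cohomology of `M` has
contractions, evaluation at `1` identifies the cohomology of its jets with the part of weight zero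
of the cohomology of `M`.

The cohomology of a free module has contractions, so the unit from `E` to the jets of its de Rham
complex is a quasi-isomorphism (`quasiIso_unitHom`). A morphism between modules with contractions is
bijective as soon as it is so in weight zero (`Contraction.bijective_of_weight_zero`), so the counit
at `M` is a quasi-isomorphism once the cohomology of `M` has contractions (`qis_counitHom`). Since
contractions involve only the graded module and not `ε`, they can be transported to `M` from a free
module that is isomorphic to it after forgetting the mixed structure. This gives the essential
image. An invertible unit and one triangle identity give full faithfulness on derived categories
(`full_and_faithful_lift_of_unit`).

For the complexes of maps, let `E` be K-projective. The resolution of its de Rham complex is then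
K-projective, because jets of acyclic modules are acyclic. The comparison map becomes
postcomposition with the unit (`toCochain_deRhamCochain`), which is a quasi-isomorphism by
K-projectivity. An arbitrary K-projective `Q` is compared with the resolution up to homotopy. -/

namespace DeRhamMixed

/-! ### Graded dg-modules: projections to homogeneous parts and signs by weight. -/

section GradedModules

variable {k : Type v} {A : Type u} [Field k] [CommRing A] [Algebra k A]

namespace GrMod

/-- The `A`-module underlying a graded dg-module. -/
noncomputable instance moduleBase (M : GrMod k A) : Module A M.carrier :=
  Module.compHom M.carrier (algebraMap A (Forms k A))

variable (M : GrMod k A)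

lemma base_smul (a : A) (x : M.carrier) : a • x = algebraMap A (Forms k A) a • x := rfl

instance : IsScalarTower A (Forms k A) M.carrier :=
  ⟨fun a ω x => by rw [Algebra.smul_def, mul_smul]; rfl⟩

lemma smul_comm_base (a : A) (ω : Forms k A) (x : M.carrier) : ω • a • x = a • ω • x := by
  rw [base_smul, base_smul, ← mul_smul, ← mul_smul, Algebra.commutes]

/-- A graded dg-module as the direct sum of its homogeneous parts. -/
noncomputable def decomp : (⨁ i : ℤ × ℤ, M.comp i.1 i.2) ≃+ M.carrier :=
  AddEquiv.ofBijective (DirectSum.coeAddMonoidHom fun i : ℤ × ℤ => M.comp i.1 i.2) M.isInternal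

variable {M}

lemma decomp_symm_of_mem {p n : ℤ} {x : M.carrier} (hx : x ∈ M.comp p n) :
    M.decomp.symm x = DirectSum.of (fun i : ℤ × ℤ => M.comp i.1 i.2) (p, n) ⟨x, hx⟩ := by
  rw [AddEquiv.symm_apply_eq]
  exact (DirectSum.coeAddMonoidHom_of (fun i : ℤ × ℤ => M.comp i.1 i.2) (p, n) ⟨x, hx⟩).symm

variable (M) in
/-- The projection to the part of weight `p` and degree `n`. -/
noncomputable def pr (p n : ℤ) : M.carrier →+ M.carrier :=
  (M.comp p n).subtype.comp
    ((DFinsupp.evalAddMonoidHom (β := fun i : ℤ × ℤ => M.comp i.1 i.2) (p, n)).comp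
      M.decomp.symm.toAddMonoidHom)

lemma pr_mem (p n : ℤ) (x : M.carrier) : M.pr p n x ∈ M.comp p n :=
  (M.decomp.symm x (p, n)).2

lemma pr_of_mem {p n : ℤ} {x : M.carrier} (hx : x ∈ M.comp p n) : M.pr p n x = x := by
  change ((M.decomp.symm x (p, n) : M.comp p n) : M.carrier) = x
  rw [decomp_symm_of_mem hx, DirectSum.of_eq_same]

lemma pr_of_mem_ne {p n p' n' : ℤ} {x : M.carrier} (hx : x ∈ M.comp p' n')
    (h : (p, n) ≠ (p', n')) : M.pr p n x = 0 := by
  change ((M.decomp.symm x (p, n) : M.comp p n) : M.carrier) = 0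
  rw [decomp_symm_of_mem hx, DirectSum.of_eq_of_ne _ _ _ h, ZeroMemClass.coe_zero]

lemma induction {C : M.carrier → Prop} (h0 : C 0) (ha : ∀ x y, C x → C y → C (x + y))
    (h : ∀ p n, ∀ x ∈ M.comp p n, C x) (x : M.carrier) : C x := by
  obtain ⟨y, rfl⟩ := M.decomp.surjective x
  induction y using DirectSum.induction_on with
  | zero => rwa [map_zero]
  | add x y hx hy => rw [map_add]; exact ha _ _ hx hy
  | of i y =>
    have : M.decomp (DirectSum.of (fun i : ℤ × ℤ => M.comp i.1 i.2) i y) = y :=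
      DirectSum.coeAddMonoidHom_of _ _ _
    rw [this]
    exact h _ _ _ y.2

lemma eq_zero_of_pr {x : M.carrier} (h : ∀ p n, M.pr p n x = 0) : x = 0 := by
  rw [← M.decomp.symm.map_eq_zero_iff]
  exact DFinsupp.ext fun i => Subtype.ext (h i.1 i.2)

/-- An additive map of weight `a` and degree `b` commutes with the projections. -/
lemma pr_map {N : GrMod k A} (f : M.carrier →+ N.carrier) (a b : ℤ)
    (hf : ∀ p n, ∀ x ∈ M.comp p n, f x ∈ N.comp (p + a) (n + b)) (p n : ℤ) (x : M.carrier) :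
    N.pr (p + a) (n + b) (f x) = f (M.pr p n x) := by
  induction x using GrMod.induction with
  | h0 => simp only [map_zero]
  | ha x y hx hy => simp only [map_add, hx, hy]
  | h p' n' x hx =>
    by_cases h : (p, n) = (p', n')
    · obtain ⟨rfl, rfl⟩ := Prod.mk.inj h
      rw [pr_of_mem hx, pr_of_mem (hf _ _ _ hx)]
    · rw [pr_of_mem_ne hx h, map_zero, pr_of_mem_ne (hf _ _ _ hx)]
      intro h'
      obtain ⟨h1, h2⟩ := Prod.mk.inj h'
      exact h (Prod.ext (add_right_cancel h1) (add_right_cancel h2))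

variable (M) in
/-- The involution given by `(-1) ^ p` on the part of weight `p`. -/
noncomputable def inv : M.carrier →+ M.carrier :=
  (DirectSum.toAddMonoid fun i : ℤ × ℤ =>
    (DistribSMul.toAddMonoidHom M.carrier (i.1.negOnePow : ℤ)).comp
      (M.comp i.1 i.2).subtype).comp M.decomp.symm.toAddMonoidHom

lemma inv_of_mem {p n : ℤ} {x : M.carrier} (hx : x ∈ M.comp p n) :
    M.inv x = (p.negOnePow : ℤ) • x := by
  rw [inv, AddMonoidHom.comp_apply]
  refine (congrArg _ (decomp_symm_of_mem hx)).trans ?_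
  rw [DirectSum.toAddMonoid_of]
  rfl

lemma inv_mem {p n : ℤ} {x : M.carrier} (hx : x ∈ M.comp p n) : M.inv x ∈ M.comp p n := by
  rw [inv_of_mem hx]; exact zsmul_mem hx _

lemma inv_inv (x : M.carrier) : M.inv (M.inv x) = x := by
  induction x using GrMod.induction with
  | h0 => simp only [map_zero]
  | ha x y hx hy => simp only [map_add, hx, hy]
  | h p n x hx =>
    rw [inv_of_mem hx, map_zsmul, inv_of_mem hx, smul_smul, ← Units.val_mul, ← Int.negOnePow_add,
      Int.negOnePow_even _ ⟨p, rfl⟩, Units.val_one, one_smul]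

lemma forms_induction {C : Forms k A → Prop} (ha : ∀ x y, C x → C y → C (x + y))
    (h : ∀ (q : ℕ), ∀ ω ∈ ⋀[A]^q Ω[A⁄k], C ω) (ω : Forms k A) : C ω := by
  induction ω using DirectSum.Decomposition.inductionOn (fun q : ℕ => ⋀[A]^q Ω[A⁄k]) with
  | zero => exact h 0 _ (zero_mem _)
  | add x y hx hy => exact ha _ _ hx hy
  | @homogeneous q ω => exact h q _ ω.2

lemma zsmul_forms_smul (n : ℤ) (ω : Forms k A) (x : M.carrier) : (n • ω) • x = n • ω • x :=
  map_zsmul ((smulAddHom (Forms k A) M.carrier).flip x) n ω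

lemma forms_smul_zsmul (n : ℤ) (ω : Forms k A) (x : M.carrier) : ω • n • x = n • ω • x :=
  map_zsmul (smulAddHom (Forms k A) M.carrier ω) n x

lemma d_forms_smul (ω : Forms k A) (x : M.carrier) : M.d (ω • x) = sgn k A ω • M.d x := by
  induction ω using forms_induction with
  | ha x y hx hy => rw [add_smul, map_add, hx, hy, map_add, add_smul]
  | h q ω hω => rw [M.d_smul x hω, sgn_of_mem k A hω, zsmul_forms_smul]

lemma d_base_smul (a : A) (x : M.carrier) : M.d (a • x) = a • M.d x := by
  rw [base_smul, d_forms_smul, AlgHom.commutes]; rfl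

lemma negOnePow_natCast (q : ℕ) : ((q : ℤ).negOnePow : ℤ) = (-1) ^ q := by
  rw [Int.negOnePow_def, zpow_natCast, Units.val_pow_eq_pow_val, Units.val_neg, Units.val_one]

/-- The `q`-forms have weight and degree both equal to `q`, so Koszul signs for forms can be read
off from weights. The involution `inv` obeys the sign rule of an odd map with respect to forms and
`ε`, but commutes with `d`. Cones and resolutions use it to absorb the signs of a degree shift. -/
lemma inv_forms_smul (ω : Forms k A) (x : M.carrier) : M.inv (ω • x) = sgn k A ω • M.inv x := by
  induction ω using forms_induction with
  | ha x y hx hy => rw [add_smul, map_add, hx, hy, map_add, add_smul]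
  | h q ω hω =>
    induction x using GrMod.induction with
    | h0 => simp only [map_zero, smul_zero]
    | ha x y hx hy => simp only [map_add, smul_add, hx, hy]
    | h p n x hx =>
      rw [inv_of_mem (M.smul_mem hω hx), inv_of_mem hx, sgn_of_mem k A hω, zsmul_forms_smul,
        forms_smul_zsmul, smul_smul, Int.negOnePow_add, Units.val_mul, negOnePow_natCast, mul_comm]

lemma inv_base_smul (a : A) (x : M.carrier) : M.inv (a • x) = a • M.inv x := by
  rw [base_smul, inv_forms_smul, AlgHom.commutes]; rfl

lemma inv_d (x : M.carrier) : M.inv (M.d x) = M.d (M.inv x) := by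
  induction x using GrMod.induction with
  | h0 => simp only [map_zero]
  | ha x y hx hy => simp only [map_add, hx, hy]
  | h p n x hx => rw [inv_of_mem hx, map_zsmul, inv_of_mem (M.d_mem hx)]

lemma base_mem_zero (a : A) : algebraMap A (Forms k A) a ∈ ⋀[A]^0 Ω[A⁄k] := by
  change _ ∈ LinearMap.range (ExteriorAlgebra.ι A) ^ 0
  rw [pow_zero]
  exact Submodule.mem_one.2 ⟨a, rfl⟩

lemma base_smul_mem (a : A) {p n : ℤ} {x : M.carrier} (hx : x ∈ M.comp p n) :
    a • x ∈ M.comp p n := by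
  have := M.smul_mem (base_mem_zero (k := k) a) hx
  rwa [Nat.cast_zero, add_zero, add_zero] at this

lemma dOne_smul_mem (a : A) {p n : ℤ} {x : M.carrier} (hx : x ∈ M.comp p n) :
    dOne k A a • x ∈ M.comp (p + 1) (n + 1) :=
  M.smul_mem (dOne_mem k A a) hx

variable (M) in
/-- The homogeneous parts, as `A`-submodules. -/
noncomputable def compBase (p n : ℤ) : Submodule A M.carrier :=
  { M.comp p n with smul_mem' := fun a _ hx => base_smul_mem a hx }

variable (M) in
/-- The differential, as an `A`-linear map. -/
noncomputable def dBase : M.carrier →ₗ[A] M.carrier :=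
  { M.d with map_smul' := d_base_smul }

@[simp] lemma dBase_apply (x : M.carrier) : M.dBase x = M.d x := rfl

lemma lin_mem {N : GrMod k A} (f : M ⟶ N) {p n : ℤ} {x : M.carrier} (hx : x ∈ M.comp p n) :
    GrMod.lin f x ∈ N.comp p n := GrMod.Hom.map_mem f hx

lemma lin_d {N : GrMod k A} (f : M ⟶ N) (x : M.carrier) :
    GrMod.lin f (M.d x) = N.d (GrMod.lin f x) := GrMod.Hom.map_d f x

lemma lin_base_smul {N : GrMod k A} (f : M.carrier →ₗ[Forms k A] N.carrier) (a : A)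
    (x : M.carrier) : f (a • x) = a • f x := map_smul f _ x

lemma lin_inv {N : GrMod k A} (f : M ⟶ N) (x : M.carrier) :
    GrMod.lin f (M.inv x) = N.inv (GrMod.lin f x) := by
  induction x using GrMod.induction with
  | h0 => simp only [map_zero]
  | ha x y hx hy => simp only [map_add, hx, hy]
  | h p n x hx => rw [inv_of_mem hx, map_zsmul, inv_of_mem (lin_mem f hx)]

lemma lin_pr {N : GrMod k A} (f : M ⟶ N) (p n : ℤ) (x : M.carrier) :
    N.pr p n (GrMod.lin f x) = GrMod.lin f (M.pr p n x) := by
  have := pr_map (GrMod.lin f).toAddMonoidHom 0 0 (fun p n x hx => by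
    rw [add_zero, add_zero]; exact lin_mem f hx) p n x
  rwa [add_zero, add_zero] at this

lemma d_pr (p n : ℤ) (x : M.carrier) : M.pr p (n + 1) (M.d x) = M.d (M.pr p n x) := by
  have := pr_map M.d 0 1 (fun p n x hx => by rw [add_zero]; exact M.d_mem hx) p n x
  rwa [add_zero] at this

lemma lin_id (x : M.carrier) : GrMod.lin (𝟙 M) x = x := rfl

lemma lin_comp {N K : GrMod k A} (f : M ⟶ N) (g : N ⟶ K) (x : M.carrier) :
    GrMod.lin (f ≫ g) x = GrMod.lin g (GrMod.lin f x) := rfl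

lemma hom_ext {N : GrMod k A} {f g : M ⟶ N} (h : ∀ x, GrMod.lin f x = GrMod.lin g x) : f = g :=
  GrMod.Hom.ext (LinearMap.ext h)

end GrMod

namespace MixedMod

variable {M : MixedMod k A}

lemma ε_forms_smul (ω : Forms k A) (x : M.carrier) :
    M.ε (ω • x) = dR k A ω • x + sgn k A ω • M.ε x := by
  induction ω using GrMod.forms_induction with
  | ha x y hx hy =>
    rw [add_smul, map_add, hx, hy, map_add, map_add, add_smul, add_smul]; abel
  | h q ω hω => rw [M.ε_smul x hω, sgn_of_mem k A hω, GrMod.zsmul_forms_smul]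

lemma ε_base_smul (a : A) (x : M.carrier) : M.ε (a • x) = dOne k A a • x + a • M.ε x := by
  rw [GrMod.base_smul, ε_forms_smul, AlgHom.commutes, dR_algebraMap]; rfl

lemma ε_dOne_smul (a : A) (x : M.carrier) : M.ε (dOne k A a • x) = -(dOne k A a • M.ε x) := by
  rw [ε_forms_smul, dR_dOne, zero_smul, zero_add, sgn_dOne, neg_smul]

lemma inv_ε (x : M.carrier) : M.inv (M.ε x) = -M.ε (M.inv x) := by
  induction x using GrMod.induction with
  | h0 => simp only [map_zero, neg_zero]
  | ha x y hx hy => simp only [map_add, hx, hy, neg_add]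
  | h p n x hx =>
    rw [GrMod.inv_of_mem hx, map_zsmul, GrMod.inv_of_mem (M.ε_mem hx), Int.negOnePow_succ,
      Units.val_neg, neg_smul]

lemma lin_mem {N : MixedMod k A} (f : M ⟶ N) {p n : ℤ} {x : M.carrier} (hx : x ∈ M.comp p n) :
    MixedMod.lin f x ∈ N.comp p n := GrMod.Hom.map_mem f.toHom hx

lemma lin_d {N : MixedMod k A} (f : M ⟶ N) (x : M.carrier) :
    MixedMod.lin f (M.d x) = N.d (MixedMod.lin f x) := GrMod.Hom.map_d f.toHom x

lemma lin_ε {N : MixedMod k A} (f : M ⟶ N) (x : M.carrier) :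
    MixedMod.lin f (M.ε x) = N.ε (MixedMod.lin f x) := MixedMod.Hom.map_ε f x

lemma lin_inv {N : MixedMod k A} (f : M ⟶ N) (x : M.carrier) :
    MixedMod.lin f (M.inv x) = N.inv (MixedMod.lin f x) :=
  GrMod.lin_inv ((MixedMod.forget k A).map f) x

lemma lin_id (x : M.carrier) : MixedMod.lin (𝟙 M) x = x := rfl

lemma lin_comp {N K : MixedMod k A} (f : M ⟶ N) (g : N ⟶ K) (x : M.carrier) :
    MixedMod.lin (f ≫ g) x = MixedMod.lin g (MixedMod.lin f x) := rfl

lemma hom_ext {N : MixedMod k A} {f g : M ⟶ N} (h : ∀ x, MixedMod.lin f x = MixedMod.lin g x) :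
    f = g :=
  MixedMod.Hom.ext (LinearMap.ext h)

end MixedMod

end GradedModules

end DeRhamMixed

namespace DeRhamMixed

/-! ### Differential operators: the order filtration, Euler operators, projectivity over `A`. -/

section DiffOpsStructure

variable {k : Type v} {A : Type u} [Field k] [CommRing A] [Algebra k A]

scoped instance diffOpsRing : Ring (DiffOps k A) := Subalgebra.toRing (DiffOps k A)

scoped instance : Semiring (DiffOps k A) := diffOpsRing.toSemiring

scoped instance : AddCommGroup (DiffOps k A) := diffOpsRing.toAddCommGroup

scoped instance : AddGroup (DiffOps k A) := diffOpsRing.toAddCommGroup.toAddGroup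

scoped instance : AddCommMonoid (DiffOps k A) := diffOpsRing.toAddCommGroup.toAddCommMonoid

scoped instance : AddMonoid (DiffOps k A) := diffOpsRing.toAddCommGroup.toAddMonoid

scoped instance : Sub (DiffOps k A) := diffOpsRing.toSub

scoped instance : Mul (DiffOps k A) := diffOpsRing.toMul

scoped instance : Zero (DiffOps k A) := diffOpsRing.toZero

/-- The differential operators as a left module over the functions. -/
noncomputable scoped instance diffOpsBase : Module A (DiffOps k A) :=
  Module.compHom (DiffOps k A) (ofFun k A)

lemma diffOps_base_smul (a : A) (P : DiffOps k A) : a • P = ofFun k A a * P := rfl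

lemma ofFun_algebraMap (c : k) : ofFun k A (algebraMap k A c) = algebraMap k (DiffOps k A) c := by
  apply Subtype.ext
  ext b
  change algebraMap k A c * b = (algebraMap k (Module.End k A) c) b
  rw [Module.algebraMap_end_apply, Algebra.smul_def]

scoped instance : IsScalarTower k A (DiffOps k A) :=
  ⟨fun c a P => by
    rw [diffOps_base_smul, diffOps_base_smul, Algebra.smul_def, map_mul, ofFun_algebraMap,
      mul_assoc, Algebra.smul_def]⟩

lemma base_smul_mul (a : A) (P Q : DiffOps k A) : (a • P) * Q = a • (P * Q) := mul_assoc _ _ _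

/-- Right multiplication, as a map of left modules over the functions. -/
noncomputable def mulRight (Q : DiffOps k A) : DiffOps k A →ₗ[A] DiffOps k A where
  toFun P := P * Q
  map_add' P P' := add_mul P P' Q
  map_smul' a P := base_smul_mul a P Q

@[simp] lemma mulRight_apply (P Q : DiffOps k A) : mulRight Q P = P * Q := rfl

/-- The commutator with a function, as a map of left modules over the functions. -/
noncomputable def commFun (a : A) : DiffOps k A →ₗ[A] DiffOps k A where
  toFun P := P * ofFun k A a - ofFun k A a * P
  map_add' P P' := by rw [add_mul, mul_add]; abel
  map_smul' b P := by
    rw [RingHom.id_apply, diffOps_base_smul, diffOps_base_smul, mul_sub, ← mul_assoc (ofFun k A a),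
      ← map_mul, mul_comm a b, map_mul, mul_assoc, mul_assoc]

lemma commFun_apply (a : A) (P : DiffOps k A) :
    commFun a P = P * ofFun k A a - ofFun k A a * P := rfl

lemma mul_ofFun (P : DiffOps k A) (a : A) : P * ofFun k A a = commFun a P + a • P := by
  rw [commFun_apply, diffOps_base_smul, sub_add_cancel]

lemma commFun_mul (a : A) (P Q : DiffOps k A) :
    commFun a (P * Q) = commFun a P * Q + P * commFun a Q := by
  simp only [commFun_apply, sub_mul, mul_sub, mul_assoc]; abel

lemma commFun_ofDer (a : A) (θ : Derivation k A A) :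
    commFun a (ofDer θ) = ofFun k A (θ a) := by
  rw [commFun_apply, ofDer_mul_ofFun, add_sub_cancel_left]

lemma commutator_comm {R : Type*} [Ring R] {a b : R} (h : a * b = b * a) (P : R) :
    (P * b - b * P) * a - a * (P * b - b * P) = (P * a - a * P) * b - b * (P * a - a * P) := by
  have h' : a * (b * P) = b * (a * P) := by rw [← mul_assoc, h, mul_assoc]
  simp only [sub_mul, mul_sub, mul_assoc]
  rw [h, h']
  abel

lemma commFun_comm (a b : A) (P : DiffOps k A) :
    commFun a (commFun b P) = commFun b (commFun a P) :=
  commutator_comm (by rw [← map_mul, mul_comm, map_mul]) P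

lemma commFun_one (a : A) : commFun a (1 : DiffOps k A) = 0 := by
  rw [commFun_apply, one_mul, mul_one, sub_self]

variable (k A) in
/-- The differential operators of order `< n`, as a left module over the functions. -/
def ordLT (n : ℕ) : Submodule A (DiffOps k A) where
  carrier := {P | P.1 ∈ diffOpLT k A n}
  zero_mem' := Submodule.zero_mem (diffOpLT k A n)
  add_mem' := fun h h' => Submodule.add_mem (diffOpLT k A n) h h'
  smul_mem' := fun a P h => by
    change Algebra.lmul k A a * P.1 ∈ diffOpLT k A n
    replace h : P.1 ∈ diffOpLT k A n := h
    generalize P.1 = P at h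
    induction n generalizing P with
    | zero => rw [show P = 0 from h, mul_zero]; exact zero_mem _
    | succ n ih =>
      intro b
      have := ih _ (h b)
      rw [mul_sub, ← mul_assoc (Algebra.lmul k A a) (Algebra.lmul k A b), ← map_mul, mul_comm a b,
        map_mul, mul_assoc (Algebra.lmul k A b)] at this
      rwa [mul_assoc]

lemma ordLT_zero {P : DiffOps k A} (h : P ∈ ordLT k A 0) : P = 0 := Subtype.ext h

lemma mem_ordLT_succ {n : ℕ} {P : DiffOps k A} :
    P ∈ ordLT k A (n + 1) ↔ ∀ a, commFun a P ∈ ordLT k A n := Iff.rfl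

lemma commFun_mem {n : ℕ} {P : DiffOps k A} (h : P ∈ ordLT k A (n + 1)) (a : A) :
    commFun a P ∈ ordLT k A n := mem_ordLT_succ.1 h a

lemma ordLT_mono {m n : ℕ} (h : m ≤ n) : ordLT k A m ≤ ordLT k A n :=
  fun _ hP => diffOpLT_mono h hP

lemma exists_mem_ordLT (P : DiffOps k A) : ∃ n, P ∈ ordLT k A n := P.2

lemma one_mem_ordLT : (1 : DiffOps k A) ∈ ordLT k A 1 := by
  rw [mem_ordLT_succ]
  intro a
  rw [commFun_one]
  exact zero_mem _

/-- Being in `ordLT k A 1`, that is of order zero, means commuting with all functions. Applying `P b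
= b P` to the function `1` gives `P.1 b = b * P.1 1`. -/
lemma eq_smul_one_of_mem_ordLT_one {P : DiffOps k A} (h : P ∈ ordLT k A 1) :
    P = (P.1 1 : A) • (1 : DiffOps k A) := by
  apply Subtype.ext
  ext b
  have := congrArg (fun Q : DiffOps k A => (Q.1 1 : A)) (ordLT_zero (commFun_mem h b))
  change P.1 (b * 1) - b * P.1 1 = 0 at this
  rw [mul_one, sub_eq_zero] at this
  change P.1 b = P.1 1 * b
  rw [this, mul_comm]

lemma mul_ofDer_mem {n : ℕ} {P : DiffOps k A} (h : P ∈ ordLT k A n) (θ : Derivation k A A) :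
    P * ofDer θ ∈ ordLT k A (n + 1) := by
  induction n generalizing P with
  | zero => rw [ordLT_zero h, zero_mul]; exact zero_mem _
  | succ n ih =>
    rw [mem_ordLT_succ]
    intro a
    rw [commFun_mul, commFun_ofDer, mul_ofFun]
    exact add_mem (ih (commFun_mem h a))
      (add_mem (ordLT_mono n.le_succ (commFun_mem h _)) (Submodule.smul_mem _ _ h))

/-- The symbol of an operator is determined by its values on the coordinates. -/
lemma DualCoords.commFun_sub_sum_mem (c : DualCoords k A) {m : ℕ} {P : DiffOps k A}
    (hP : P ∈ ordLT k A (m + 2)) (a : A) :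
    commFun a P - ∑ j, c.θ j a • commFun (c.x j) P ∈ ordLT k A m := by
  -- Modulo operators of order `< m` the map `a ↦ [P, a]` is a derivation: its defect from the
  -- Leibniz rule is the double commutator `[[P, a], b]`. It therefore factors through the Kähler
  -- differentials, where `c.D_eq` expands `da`.
  let q := (ordLT k A m).mkQ
  let f : Derivation k A (DiffOps k A ⧸ ordLT k A m) := Derivation.mk'
    { toFun := fun a => q (commFun a P)
      map_add' := fun a b => by
        rw [← map_add]; congr 1
        simp only [commFun_apply, map_add, mul_add, add_mul]; abel
      map_smul' := fun r a => by
        rw [RingHom.id_apply, ← algebraMap_smul A r, ← algebraMap_smul A r, ← map_smul]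
        congr 1
        rw [smul_eq_mul, commFun_apply, commFun_apply, map_mul, ofFun_algebraMap,
          diffOps_base_smul, ofFun_algebraMap, mul_sub, ← mul_assoc, ← Algebra.commutes r P,
          mul_assoc, mul_assoc] } (fun a b => by
      change q _ = _ • q _ + _ • q _
      rw [← map_smul q, ← map_smul q, ← map_add, ← sub_eq_zero, ← map_sub]
      refine (Submodule.Quotient.mk_eq_zero _).2 ?_
      have : commFun (a * b) P - (a • commFun b P + b • commFun a P) = commFun b (commFun a P) := by
        have e : ofFun k A b * (ofFun k A a * P) = ofFun k A a * (ofFun k A b * P) := by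
          rw [← mul_assoc, ← map_mul, mul_comm b a, map_mul, mul_assoc]
        simp only [commFun_apply, map_mul, diffOps_base_smul, sub_mul, mul_sub, mul_assoc]
        rw [e]
        abel
      rw [this]
      exact commFun_mem (commFun_mem hP a) b)
  have h := congrArg f.liftKaehlerDifferential (c.D_eq a)
  rw [Derivation.liftKaehlerDifferential_comp_D, map_sum] at h
  simp only [map_smul, Derivation.liftKaehlerDifferential_comp_D] at h
  change q _ = ∑ j, _ • q _ at h
  simp only [← map_smul q] at h
  rw [← map_sum, ← sub_eq_zero, ← map_sub] at h
  exact (Submodule.Quotient.mk_eq_zero _).1 h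

lemma nsmul_one_succ_sub {G : Type*} [AddCommGroup G] (m : ℕ) (x y z : G) :
    x + y - (m + 1) • z = (x - m • z) + (y - z) := by
  rw [succ_nsmul]; abel

/-- The Euler operator multiplies the symbols of order `m` by `m`. -/
lemma DualCoords.euler_left (c : DualCoords k A) (m : ℕ) {P : DiffOps k A}
    (hP : P ∈ ordLT k A (m + 1)) :
    ∑ j, ofDer (c.θ j) * commFun (c.x j) P - m • P ∈ ordLT k A m := by
  induction m generalizing P with
  | zero =>
    rw [zero_smul, sub_zero]
    refine sum_mem fun j _ => ?_
    rw [ordLT_zero (commFun_mem hP _), mul_zero]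
    exact zero_mem _
  | succ m ih =>
    rw [mem_ordLT_succ]
    intro a
    -- By the Leibniz rule, the commutator of the Euler sum with `a` is the Euler sum of `[P, a]`,
    -- contributing `m` by induction, plus `∑ j, θ j (a) [P, x j]`, which is `[P, a]` up to lower
    -- order and contributes the remaining `1`.
    have h1 := ih (commFun_mem hP a)
    have h2 := c.commFun_sub_sum_mem hP a
    rw [map_sub, map_sum, map_nsmul]
    simp only [commFun_mul, commFun_ofDer, Finset.sum_add_distrib]
    rw [add_comm, nsmul_one_succ_sub]
    refine add_mem ?_ ?_
    · simpa only [commFun_comm a] using h1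
    · rw [← neg_sub] at h2
      exact neg_mem_iff.1 h2

/-- The induction of `DualCoords.euler_left`, with the derivations on the right. This form is the
one compatible with lifting `A`-linear maps, since right multiplication by `θ j` is left `A`-linear.
-/
lemma DualCoords.euler_right (c : DualCoords k A) (m : ℕ) {P : DiffOps k A}
    (hP : P ∈ ordLT k A (m + 1)) :
    ∑ j, commFun (c.x j) P * ofDer (c.θ j) - m • P ∈ ordLT k A m := by
  induction m generalizing P with
  | zero =>
    rw [zero_smul, sub_zero]
    refine sum_mem fun j _ => ?_
    rw [ordLT_zero (commFun_mem hP _), zero_mul]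
    exact zero_mem _
  | succ m ih =>
    rw [mem_ordLT_succ]
    intro a
    have h1 := ih (commFun_mem hP a)
    have h2 := c.commFun_sub_sum_mem hP a
    rw [map_sub, map_sum, map_nsmul]
    simp only [commFun_mul, commFun_ofDer, Finset.sum_add_distrib]
    rw [nsmul_one_succ_sub]
    refine add_mem ?_ ?_
    · simpa only [commFun_comm a] using h1
    -- Moving the function `θ j (a)` to the left of `[P, x j]` costs a double commutator, which has
    -- lower order.
    · have h3 : ∑ j, commFun (c.x j) P * ofFun k A (c.θ j a) - commFun a P =
          ∑ j, commFun (c.θ j a) (commFun (c.x j) P) -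
            (commFun a P - ∑ j, c.θ j a • commFun (c.x j) P) := by
        simp only [mul_ofFun, Finset.sum_add_distrib]; abel
      rw [h3]
      exact sub_mem (sum_mem fun j _ => commFun_mem (commFun_mem hP _) _) h2

/-- Maps out of the differential operators may be glued along the filtration by the order. -/
lemma exists_glue {X : Type*} [AddCommGroup X] [Module A X] (ψ : ℕ → DiffOps k A →ₗ[A] X)
    (h : ∀ m, ∀ P ∈ ordLT k A m, ψ (m + 1) P = ψ m P) :
    ∃ φ : DiffOps k A →ₗ[A] X, ∀ m, ∀ P ∈ ordLT k A m, φ P = ψ m P := by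
  have h' : ∀ m n, m ≤ n → ∀ P ∈ ordLT k A m, ψ n P = ψ m P := fun m n hmn P hP => by
    induction n, hmn using Nat.le_induction with
    | base => rfl
    | succ n hmn ih => rw [h n P (ordLT_mono hmn hP), ih]
  -- Each operator is evaluated with the map attached to some bound for its order; `key` shows that
  -- the choice is immaterial.
  choose ν hν using exists_mem_ordLT (k := k) (A := A)
  have key : ∀ m, ∀ P ∈ ordLT k A m, ψ (ν P) P = ψ m P := fun m P hP => by
    rcases le_total m (ν P) with hm | hm
    · exact h' _ _ hm P hP
    · exact (h' _ _ hm P (hν P)).symm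
  refine ⟨{ toFun := fun P => ψ (ν P) P, map_add' := fun P Q => ?_, map_smul' := fun a P => ?_ },
    key⟩
  · have hP := ordLT_mono (le_max_left (ν P) (ν Q)) (hν P)
    have hQ := ordLT_mono (le_max_right (ν P) (ν Q)) (hν Q)
    rw [key _ _ hP, key _ _ hQ, key _ _ (add_mem hP hQ), map_add]
  · rw [key _ _ (Submodule.smul_mem _ a (hν P)), map_smul, RingHom.id_apply]

/-- This lifts a map on symbols of order `m`. In order zero the operators are the multiples of `1`.
In order `m + 1` the Euler relation writes `(m + 1) P` as `∑ j, [P, x j] θ j` modulo operators on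
which `φ` vanishes. It then suffices to lift the maps `P ↦ φ (P θ j)` one order lower, to reassemble
them and to divide by `m + 1`. -/
lemma exists_lift_step [CharZero k] (c : DualCoords k A) {X Y : Type u} [AddCommGroup X]
    [Module A X] [AddCommGroup Y] [Module A Y] (g : X →ₗ[A] Y) (hg : Function.Surjective g) (m : ℕ)
    (φ : DiffOps k A →ₗ[A] Y) (hφ : ∀ P ∈ ordLT k A m, φ P = 0) :
    ∃ l : DiffOps k A →ₗ[A] X, (∀ P ∈ ordLT k A m, l P = 0) ∧
      ∀ P ∈ ordLT k A (m + 1), g (l P) = φ P := by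
  induction m generalizing φ with
  | zero =>
    obtain ⟨x, hx⟩ := hg (φ 1)
    let ev : DiffOps k A →ₗ[A] A :=
      { toFun := fun P => P.1 1, map_add' := fun _ _ => rfl, map_smul' := fun _ _ => rfl }
    refine ⟨(LinearMap.toSpanSingleton A X x).comp ev, fun P hP => ?_, fun P hP => ?_⟩
    · rw [ordLT_zero hP, map_zero]
    · rw [LinearMap.comp_apply, LinearMap.toSpanSingleton_apply, map_smul, hx, ← map_smul]
      exact congrArg φ (eq_smul_one_of_mem_ordLT_one hP).symm
  | succ m ih =>
    have h (j : Fin c.card) : ∃ l : DiffOps k A →ₗ[A] X, (∀ P ∈ ordLT k A m, l P = 0) ∧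
        ∀ P ∈ ordLT k A (m + 1), g (l P) = φ (P * ofDer (c.θ j)) := by
      refine ih (φ.comp (mulRight (ofDer (c.θ j)))) fun P hP => hφ _ ?_
      exact mul_ofDer_mem hP _
    choose l hl hgl using h
    let r : A := algebraMap k A ((m + 1 : ℕ) : k)⁻¹
    have hr (y : Y) : r • (m + 1) • y = y := by
      rw [← Nat.cast_smul_eq_nsmul A (m + 1), smul_smul, ← map_natCast (algebraMap k A), ← map_mul,
        inv_mul_cancel₀ (Nat.cast_ne_zero.2 (Nat.succ_ne_zero m)), map_one, one_smul]
    refine ⟨r • ∑ j, (l j).comp (commFun (c.x j)), fun P hP => ?_, fun P hP => ?_⟩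
    · rw [LinearMap.smul_apply, LinearMap.sum_apply, Finset.sum_eq_zero, smul_zero]
      exact fun j _ => hl j _ (commFun_mem hP _)
    · have h := hφ _ (c.euler_right (m + 1) hP)
      rw [map_sub, map_sum, map_nsmul, sub_eq_zero] at h
      rw [← hr (φ P), ← h, LinearMap.smul_apply, map_smul, LinearMap.sum_apply, map_sum]
      congr 1
      exact Finset.sum_congr rfl fun j _ => hgl j _ (commFun_mem hP _)

/-- On a smooth affine variety in characteristic zero, the differential operators are projective
over the functions. -/
lemma DualCoords.projective [CharZero k] (c : DualCoords k A) :
    Module.Projective A (DiffOps k A) := by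
  refine Module.Projective.of_lifting_property fun {X Y} _ _ _ _ g φ hg => ?_
  -- A lift that is correct in order `< m` is corrected on symbols of order `m` by a map vanishing
  -- in lower order. The successive lifts thus stabilise on every operator and can be glued.
  have step (m : ℕ) (l : {l : DiffOps k A →ₗ[A] X // ∀ P ∈ ordLT k A m, g (l P) = φ P}) :
      ∃ l' : {l : DiffOps k A →ₗ[A] X // ∀ P ∈ ordLT k A (m + 1), g (l P) = φ P},
        ∀ P ∈ ordLT k A m, l'.1 P = l.1 P := by
    obtain ⟨l, hl⟩ := l
    obtain ⟨l', h0, h⟩ := exists_lift_step c g hg m (φ - g.comp l) (fun P hP => by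
      rw [LinearMap.sub_apply, LinearMap.comp_apply, hl P hP, sub_self])
    refine ⟨⟨l + l', fun P hP => ?_⟩, fun P hP => ?_⟩
    · rw [LinearMap.add_apply, map_add, h P hP, LinearMap.sub_apply, LinearMap.comp_apply,
        add_sub_cancel]
    · rw [LinearMap.add_apply, h0 P hP, add_zero]
  choose next hnext using step
  let ψ (m : ℕ) : {l : DiffOps k A →ₗ[A] X // ∀ P ∈ ordLT k A m, g (l P) = φ P} :=
    Nat.rec ⟨0, fun P hP => by rw [ordLT_zero hP, map_zero, map_zero, map_zero]⟩ (fun m l => next m l) m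
  obtain ⟨l, hl⟩ := exists_glue (fun m => (ψ m).1) (fun m P hP => hnext m (ψ m) P hP)
  refine ⟨l, LinearMap.ext fun P => ?_⟩
  obtain ⟨m, hm⟩ := exists_mem_ordLT P
  rw [LinearMap.comp_apply, hl m P hm, (ψ m).2 P hm]

end DiffOpsStructure

end DeRhamMixed

namespace DeRhamMixed

/-! ### Jets with values in a mixed module, and the formal Poincaré lemma. -/

section Poincare

variable {k : Type v} {A : Type u} [Field k] [CommRing A] [Algebra k A]

lemma exists_smul_zsmul_eq [CharZero k] {p : ℤ} (hp : p ≠ 0) :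
    ∃ r : A, ∀ (M : GrMod k A) (x : M.carrier), r • p • x = x :=
  ⟨algebraMap k A (p : k)⁻¹, fun M x => by
    rw [← Int.cast_smul_eq_zsmul A, smul_smul, ← map_intCast (algebraMap k A), ← map_mul,
      inv_mul_cancel₀ (Int.cast_ne_zero.2 hp), map_one, one_smul]⟩

lemma GrMod.eq_zero_of_zsmul [CharZero k] {M : GrMod k A} {p : ℤ} (hp : p ≠ 0) {x : M.carrier}
    (h : p • x = 0) : x = 0 := by
  obtain ⟨r, hr⟩ := exists_smul_zsmul_eq (k := k) (A := A) hp
  rw [← hr M x, h, smul_zero]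

lemma map_ofDer_mul (c : DualCoords k A) {X : Type*} [AddCommGroup X] [Module A X]
    (f : DiffOps k A →ₗ[A] X) (η : Derivation k A A) (P : DiffOps k A) :
    f (ofDer η * P) = ∑ l, η (c.x l) • f (ofDer (c.θ l) * P) := by
  conv_lhs => rw [c.derivation_eq η, ofDer_sum]
  rw [← mulRight_apply, ← LinearMap.comp_apply]
  refine (map_sum (f.comp (mulRight P)) _ _).trans (Finset.sum_congr rfl fun l _ => ?_)
  exact map_smul (f.comp (mulRight P)) (η (c.x l)) (ofDer (c.θ l))

lemma map_ofDer_smul {X : Type*} [AddCommGroup X] [Module A X]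
    (f : DiffOps k A →ₗ[A] X) (θ : Derivation k A A) (a : A) (P : DiffOps k A) :
    f (ofDer θ * (a • P)) = a • f (ofDer θ * P) + θ a • f P := by
  rw [← map_smul, ← map_smul, ← map_add, diffOps_base_smul, diffOps_base_smul, diffOps_base_smul,
    ← mul_assoc, ← mul_assoc, ← add_mul]
  exact congrArg (fun Q => f (Q * P)) (ofDer_mul_ofFun θ a)

/-- The linear maps with values in the part of weight `p` and degree `n`. -/
noncomputable def jets (M : GrMod k A) (p n : ℤ) : AddSubgroup (DiffOps k A →ₗ[A] M.carrier) where
  carrier := {φ | ∀ P, φ P ∈ M.comp p n}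
  zero_mem' := fun _ => zero_mem _
  add_mem' := fun h h' P => add_mem (h P) (h' P)
  neg_mem' := fun h P => neg_mem (h P)

/-- The differential `φ ↦ (P ↦ ε (φ P) - ∑ i, dx i ∧ φ (θ i * P))`. -/
noncomputable def del (c : DualCoords k A) (M : MixedMod k A) :
    (DiffOps k A →ₗ[A] M.carrier) →+ (DiffOps k A →ₗ[A] M.carrier) where
  toFun φ :=
    { toFun := fun P => M.ε (φ P) - ∑ i, dOne k A (c.x i) • φ (ofDer (c.θ i) * P)
      map_add' := fun P Q => by
        simp only [mul_add, map_add, smul_add, Finset.sum_add_distrib]; abel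
      -- Neither term is `A`-linear on its own. Both deviate by `da ∧ φ P`: the first because `ε`
      -- differentiates `a`, the second because `∑ i, θ i (a) dx i = da`.
      map_smul' := fun a P => by
        simp only [map_ofDer_smul, smul_add, Finset.sum_add_distrib, map_smul, RingHom.id_apply,
          MixedMod.ε_base_smul, smul_sub, Finset.smul_sum, GrMod.smul_comm_base]
        rw [c.dOne_eq a, Finset.sum_smul]
        simp only [smul_assoc]
        abel }
  map_zero' := by
    ext P
    simp
  map_add' φ ψ := by
    ext P
    simp only [LinearMap.add_apply, LinearMap.coe_mk, AddHom.coe_mk, map_add, smul_add,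
      Finset.sum_add_distrib]
    abel

lemma del_apply (c : DualCoords k A) (M : MixedMod k A) (φ : DiffOps k A →ₗ[A] M.carrier)
    (P : DiffOps k A) :
    del c M φ P = M.ε (φ P) - ∑ i, dOne k A (c.x i) • φ (ofDer (c.θ i) * P) := rfl

lemma dOne_mul_dOne_comm (a b : A) : dOne k A a * dOne k A b = -(dOne k A b * dOne k A a) :=
  iota_anticomm _ _

/-- The second covariant derivatives commute. -/
lemma sum_dOne_mul_dOne_smul [CharZero k] (c : DualCoords k A) (M : GrMod k A)
    (φ : DiffOps k A →ₗ[A] M.carrier) (P : DiffOps k A) :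
    ∑ i, ∑ j, (dOne k A (c.x i) * dOne k A (c.x j)) •
      φ (ofDer (c.θ j) * (ofDer (c.θ i) * P)) = 0 := by
  set S := ∑ i, ∑ j, (dOne k A (c.x i) * dOne k A (c.x j)) •
      φ (ofDer (c.θ j) * (ofDer (c.θ i) * P)) with hS
  have hS' : S = -∑ i, ∑ j, (dOne k A (c.x i) * dOne k A (c.x j)) •
      φ (ofDer (c.θ i) * (ofDer (c.θ j) * P)) := by
    rw [hS, Finset.sum_comm, ← Finset.sum_neg_distrib]
    refine Finset.sum_congr rfl fun i _ => ?_
    rw [← Finset.sum_neg_distrib]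
    refine Finset.sum_congr rfl fun j _ => ?_
    rw [dOne_mul_dOne_comm, neg_smul]
  -- Antisymmetry of `dx i ∧ dx j` turns twice the sum into a sum over the commutators `⁅θ j, θ i⁆`.
  -- Expanding these in the `θ l`, the coefficient of each `θ l` vanishes by `h5`, which comes from
  -- `d (dx l) = 0`.
  have h3 : S + S = ∑ i, ∑ j, (dOne k A (c.x i) * dOne k A (c.x j)) •
      φ (ofDer ⁅c.θ j, c.θ i⁆ * P) := by
    nth_rw 2 [hS']
    rw [hS, ← sub_eq_add_neg, ← Finset.sum_sub_distrib]
    refine Finset.sum_congr rfl fun i _ => ?_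
    rw [← Finset.sum_sub_distrib]
    refine Finset.sum_congr rfl fun j _ => ?_
    rw [← smul_sub, ← map_sub, ← mul_assoc, ← mul_assoc, ← sub_mul]
    congr 3
  have h4 (l : Fin c.card) : ∑ i, ∑ j, c.θ i (c.θ j (c.x l)) •
      (dOne k A (c.x i) * dOne k A (c.x j)) = 0 := by
    rw [Finset.sum_comm, ← neg_eq_zero, ← c.sum_second l, ← Finset.sum_neg_distrib]
    refine Finset.sum_congr rfl fun i _ => ?_
    rw [← Finset.sum_neg_distrib]
    refine Finset.sum_congr rfl fun j _ => ?_
    rw [← smul_neg, dOne_mul_dOne_comm, neg_neg]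
  have h5 (l : Fin c.card) : ∑ i, ∑ j, ⁅c.θ j, c.θ i⁆ (c.x l) •
      (dOne k A (c.x i) * dOne k A (c.x j)) = 0 := by
    simp only [Derivation.commutator_apply, sub_smul, Finset.sum_sub_distrib]
    rw [c.sum_second l, h4 l, sub_zero]
  have h6 : S + S = ∑ l, (∑ i, ∑ j, ⁅c.θ j, c.θ i⁆ (c.x l) •
      (dOne k A (c.x i) * dOne k A (c.x j))) • φ (ofDer (c.θ l) * P) := by
    rw [h3]
    simp only [map_ofDer_mul c φ ⁅_, _⁆, Finset.smul_sum, Finset.sum_smul]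
    symm
    refine Finset.sum_comm.trans (Finset.sum_congr rfl fun i _ => Finset.sum_comm.trans
      (Finset.sum_congr rfl fun j _ => Finset.sum_congr rfl fun l _ => ?_))
    rw [smul_assoc, GrMod.smul_comm_base]
  simp only [h5, zero_smul, Finset.sum_const_zero] at h6
  exact GrMod.eq_zero_of_zsmul (p := 2) two_ne_zero (by rw [two_zsmul, h6])

lemma del_del [CharZero k] (c : DualCoords k A) (M : MixedMod k A)
    (φ : DiffOps k A →ₗ[A] M.carrier) : del c M (del c M φ) = 0 := by
  refine LinearMap.ext fun P => ?_
  rw [del_apply, del_apply, map_sub, M.ε_ε, map_sum]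
  simp only [MixedMod.ε_dOne_smul, del_apply, smul_sub, Finset.sum_sub_distrib, Finset.smul_sum,
    Finset.sum_neg_distrib, ← mul_smul]
  rw [sum_dOne_mul_dOne_smul, LinearMap.zero_apply]
  abel

lemma del_mem (c : DualCoords k A) {M : MixedMod k A} {φ : DiffOps k A →ₗ[A] M.carrier} {p n : ℤ}
    (hφ : φ ∈ jets M.toGrMod p n) : del c M φ ∈ jets M.toGrMod (p + 1) (n + 1) := fun P =>
  sub_mem (M.ε_mem (hφ P)) (sum_mem fun _ _ => GrMod.dOne_smul_mem _ (hφ _))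

lemma dBase_comp_del (c : DualCoords k A) (M : MixedMod k A) (φ : DiffOps k A →ₗ[A] M.carrier) :
    M.dBase ∘ₗ del c M φ + del c M (M.dBase ∘ₗ φ) = 0 := by
  refine LinearMap.ext fun P => ?_
  rw [LinearMap.add_apply, LinearMap.comp_apply, del_apply, del_apply, GrMod.dBase_apply, map_sub,
    map_sum]
  simp only [GrMod.d_forms_smul, sgn_dOne, neg_smul, Finset.sum_neg_distrib, LinearMap.comp_apply,
    GrMod.dBase_apply, M.ε_d, LinearMap.zero_apply]
  abel

lemma del_comp_lin (c : DualCoords k A) {M N : MixedMod k A} (f : M ⟶ N)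
    (φ : DiffOps k A →ₗ[A] M.carrier) :
    del c N ((MixedMod.lin f).restrictScalars A ∘ₗ φ) =
      (MixedMod.lin f).restrictScalars A ∘ₗ del c M φ := by
  refine LinearMap.ext fun P => ?_
  simp only [del_apply, LinearMap.comp_apply, LinearMap.restrictScalars_apply, map_sub, map_sum,
    map_smul, MixedMod.lin_ε]

/-- Contractions by the derivations of a system of dual coordinates. -/
structure Contraction (c : DualCoords k A) (W : GrMod k A) where
  /-- the contraction by `θ j` -/
  ι : Fin c.card → W.carrier →ₗ[A] W.carrier
  -- No compatibility with `ε` or with `d` is required, so the structure moves along any isomorphism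
  -- of graded modules. The excluded negative weights make induction on the weight start at zero.
  ι_mem : ∀ (j : Fin c.card) {p n : ℤ} {x : W.carrier},
    x ∈ W.comp p n → ι j x ∈ W.comp (p - 1) (n - 1)
  ι_dOne : ∀ (j : Fin c.card) (a : A) (x : W.carrier),
    ι j (dOne k A a • x) = c.θ j a • x - dOne k A a • ι j x
  euler : ∀ {p n : ℤ} {x : W.carrier}, x ∈ W.comp p n → ∑ j, dOne k A (c.x j) • ι j x = p • x
  eq_zero : ∀ {p n : ℤ} {x : W.carrier}, x ∈ W.comp p n → p < 0 → x = 0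

variable {c : DualCoords k A}

namespace Contraction

section

variable {W : MixedMod k A} (K : Contraction c W.toGrMod)

/-- The homotopy `φ ↦ (P ↦ ∑ j, ι j (φ [P, x j]))`. -/
noncomputable def htpy :
    (DiffOps k A →ₗ[A] W.carrier) →+ (DiffOps k A →ₗ[A] W.carrier) where
  toFun φ := ∑ j, K.ι j ∘ₗ φ ∘ₗ commFun (c.x j)
  map_zero' := by simp
  map_add' φ ψ := by
    rw [← Finset.sum_add_distrib]
    refine Finset.sum_congr rfl fun j _ => LinearMap.ext fun P => ?_
    simp

lemma htpy_apply (φ : DiffOps k A →ₗ[A] W.carrier) (P : DiffOps k A) :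
    K.htpy φ P = ∑ j, K.ι j (φ (commFun (c.x j) P)) := by
  change (∑ j, K.ι j ∘ₗ φ ∘ₗ commFun (c.x j)) P = _
  rw [LinearMap.sum_apply]; rfl

lemma htpy_mem {φ : DiffOps k A →ₗ[A] W.carrier} {p n : ℤ} (hφ : φ ∈ jets W.toGrMod p n) :
    K.htpy φ ∈ jets W.toGrMod (p - 1) (n - 1) := fun P => by
  rw [htpy_apply]
  exact sum_mem fun j _ => K.ι_mem j (hφ _)

/-- The operator which is inverted to solve `del ψ = φ`. -/
noncomputable def lap : (DiffOps k A →ₗ[A] W.carrier) →+ (DiffOps k A →ₗ[A] W.carrier) :=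
  -((del c W).comp K.htpy + K.htpy.comp (del c W))

lemma lap_def (φ : DiffOps k A →ₗ[A] W.carrier) :
    K.lap φ = -(del c W (K.htpy φ) + K.htpy (del c W φ)) := rfl

/-- The double sums containing `θ l * [P, x j]` occur in both `del ∘ htpy` and `htpy ∘ del` with
opposite signs. What survives are two Euler operators, one measuring the order of `P` and one
measuring the weight of the value, and terms which see `P` only through `[P, x j]`. -/
lemma lap_apply (φ : DiffOps k A →ₗ[A] W.carrier) (P : DiffOps k A) :
    K.lap φ P = φ (∑ j, ofDer (c.θ j) * commFun (c.x j) P) + ∑ j, dOne k A (c.x j) • K.ι j (φ P) -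
      ∑ j, (K.ι j (W.ε (φ (commFun (c.x j) P))) + W.ε (K.ι j (φ (commFun (c.x j) P)))) := by
  have h1 : K.htpy (del c W φ) P = ∑ j, K.ι j (W.ε (φ (commFun (c.x j) P))) -
      (φ (∑ j, ofDer (c.θ j) * commFun (c.x j) P) -
        ∑ j, ∑ l, dOne k A (c.x l) • K.ι j (φ (ofDer (c.θ l) * commFun (c.x j) P))) := by
    rw [htpy_apply, map_sum, ← Finset.sum_sub_distrib, ← Finset.sum_sub_distrib]
    refine Finset.sum_congr rfl fun j _ => ?_
    rw [del_apply, map_sub, map_sum, map_ofDer_mul c φ (c.θ j), ← Finset.sum_sub_distrib]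
    simp only [K.ι_dOne]
  have h2 : del c W (K.htpy φ) P = ∑ j, W.ε (K.ι j (φ (commFun (c.x j) P))) -
      (∑ j, dOne k A (c.x j) • K.ι j (φ P) +
        ∑ j, ∑ l, dOne k A (c.x l) • K.ι j (φ (ofDer (c.θ l) * commFun (c.x j) P))) := by
    have h (j : Fin c.card) : dOne k A (c.x j) • K.ι j (φ P) =
        ∑ l, dOne k A (c.x l) • K.ι j (φ (c.θ l (c.x j) • P)) := by
      rw [c.dOne_eq (c.x j), Finset.sum_smul]
      refine Finset.sum_congr rfl fun l _ => ?_
      rw [map_smul, map_smul, GrMod.smul_comm_base, smul_assoc]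
    rw [del_apply, htpy_apply, map_sum]
    simp only [htpy_apply, commFun_mul, commFun_ofDer, map_add, smul_add, Finset.smul_sum,
      Finset.sum_add_distrib, h, diffOps_base_smul]
    congr 2
    · exact Finset.sum_comm
    · exact Finset.sum_comm
  rw [lap_def, LinearMap.neg_apply, LinearMap.add_apply, h1, h2, Finset.sum_add_distrib]
  abel

lemma lap_mem {φ : DiffOps k A →ₗ[A] W.carrier} {p n : ℤ} (hφ : φ ∈ jets W.toGrMod p n) :
    K.lap φ ∈ jets W.toGrMod p n := by
  have h1 := K.htpy_mem (del_mem c hφ)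
  have h2 := del_mem c (K.htpy_mem hφ)
  rw [add_sub_cancel_right, add_sub_cancel_right] at h1
  rw [sub_add_cancel, sub_add_cancel] at h2
  exact neg_mem (add_mem h2 h1)

/-- On the leading symbol the first Euler operator of `lap_apply` gives `m` and the second gives
`p`. The remaining terms evaluate `φ` on commutators, which have order `< m`, and so vanish. -/
lemma lap_sub_mem {φ : DiffOps k A →ₗ[A] W.carrier} {p n : ℤ} (hφ : φ ∈ jets W.toGrMod p n)
    {m : ℕ} (h0 : ∀ P ∈ ordLT k A m, φ P = 0) {P : DiffOps k A} (hP : P ∈ ordLT k A (m + 1)) :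
    K.lap φ P = (p + m) • φ P := by
  have h1 := h0 _ (c.euler_left m hP)
  rw [map_sub, map_nsmul, sub_eq_zero] at h1
  rw [lap_apply, h1, K.euler (hφ P), Finset.sum_eq_zero, sub_zero, add_smul, natCast_zsmul,
    add_comm]
  intro j _
  rw [h0 _ (commFun_mem hP _), map_zero, map_zero, map_zero, add_zero]

variable [CharZero k]

/-- Induction on the order: the Laplacian multiplies the next symbol of `φ` by the nonzero integer
`p + m`. The starting order `m₀` serves to avoid the degenerate case `p + m = 0`. -/
lemma eq_zero_of_lap {φ : DiffOps k A →ₗ[A] W.carrier} {p n : ℤ} (hφ : φ ∈ jets W.toGrMod p n)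
    {m₀ : ℕ} (hm : ∀ m, m₀ ≤ m → p + m ≠ 0) (h0 : ∀ P ∈ ordLT k A m₀, φ P = 0)
    (h : K.lap φ = 0) : φ = 0 := by
  have key (m : ℕ) : ∀ P ∈ ordLT k A (m₀ + m), φ P = 0 := by
    induction m with
    | zero => exact h0
    | succ m ih =>
      intro P hP
      have := K.lap_sub_mem hφ ih hP
      rw [h, LinearMap.zero_apply] at this
      exact GrMod.eq_zero_of_zsmul (hm _ (Nat.le_add_right _ _)) this.symm
  refine LinearMap.ext fun P => ?_
  obtain ⟨m, hP⟩ := exists_mem_ordLT P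
  exact key m P (ordLT_mono (Nat.le_add_left _ _) hP)

/-- The equation is solved order by order. The error of an approximate solution vanishes in low
order, so the Laplacian multiplies its leading symbol by `p + m`, and adding the error divided by `p
+ m` removes that symbol. The corrections leave lower orders unchanged, and the approximations glue.
-/
lemma exists_lap_eq {χ : DiffOps k A →ₗ[A] W.carrier} {p n : ℤ} (hχ : χ ∈ jets W.toGrMod p n)
    {m₀ : ℕ} (hm : ∀ m, m₀ ≤ m → p + m ≠ 0) (h0 : ∀ P ∈ ordLT k A m₀, χ P = 0) :
    ∃ ψ ∈ jets W.toGrMod p n, (∀ P ∈ ordLT k A m₀, ψ P = 0) ∧ K.lap ψ = χ := by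
  have step (m : ℕ) (l : {l : DiffOps k A →ₗ[A] W.carrier // l ∈ jets W.toGrMod p n ∧
        (∀ P ∈ ordLT k A m₀, l P = 0) ∧ ∀ P ∈ ordLT k A (m₀ + m), K.lap l P = χ P}) :
      ∃ l' : {l : DiffOps k A →ₗ[A] W.carrier // l ∈ jets W.toGrMod p n ∧
        (∀ P ∈ ordLT k A m₀, l P = 0) ∧ ∀ P ∈ ordLT k A (m₀ + (m + 1)), K.lap l P = χ P},
        ∀ P ∈ ordLT k A (m₀ + m), l'.1 P = l.1 P := by
    obtain ⟨l, hl, hl0, hlm⟩ := l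
    obtain ⟨r, hr⟩ := exists_smul_zsmul_eq (k := k) (A := A)
      (hm (m₀ + m) (Nat.le_add_right _ _))
    have hu : r • (χ - K.lap l) ∈ jets W.toGrMod p n := fun P =>
      GrMod.base_smul_mem r (sub_mem (hχ P) (K.lap_mem hl P))
    have hu0 : ∀ P ∈ ordLT k A (m₀ + m), (r • (χ - K.lap l)) P = 0 := fun P hP => by
      rw [LinearMap.smul_apply, LinearMap.sub_apply, hlm P hP, sub_self, smul_zero]
    refine ⟨⟨l + r • (χ - K.lap l), add_mem hl hu, fun P hP => ?_, fun P hP => ?_⟩, fun P hP => ?_⟩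
    · rw [LinearMap.add_apply, hl0 P hP, hu0 P (ordLT_mono (Nat.le_add_right _ _) hP), add_zero]
    · rw [map_add, LinearMap.add_apply, K.lap_sub_mem hu hu0 hP, LinearMap.smul_apply,
        smul_comm, hr, LinearMap.sub_apply, add_sub_cancel]
    · rw [LinearMap.add_apply, hu0 P hP, add_zero]
  choose next hnext using step
  let ψ (m : ℕ) : {l : DiffOps k A →ₗ[A] W.carrier // l ∈ jets W.toGrMod p n ∧
        (∀ P ∈ ordLT k A m₀, l P = 0) ∧ ∀ P ∈ ordLT k A (m₀ + m), K.lap l P = χ P} :=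
    Nat.rec ⟨0, zero_mem _, fun _ _ => rfl, fun P hP => by rw [map_zero, h0 P hP, LinearMap.zero_apply]⟩
      (fun m l => next m l) m
  obtain ⟨l, hl⟩ := exists_glue (fun m => (ψ m).1) (fun m P hP => hnext m (ψ m) P
    (ordLT_mono (Nat.le_add_left _ _) hP))
  have hlj : l ∈ jets W.toGrMod p n := fun P => by
    obtain ⟨m, hm⟩ := exists_mem_ordLT P
    rw [hl m P hm]
    exact (ψ m).2.1 P
  refine ⟨l, hlj, fun P hP => (hl m₀ P hP).trans ((ψ m₀).2.2.1 P hP), LinearMap.ext fun P => ?_⟩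
  obtain ⟨m, hm⟩ := exists_mem_ordLT P
  -- The Laplacian is not known to preserve agreement on a single operator. It does preserve
  -- agreement on all orders `< m`, since the difference then has zero symbol there.
  have h1 := K.lap_sub_mem (sub_mem hlj (ψ m).2.1) (m := m) (fun Q hQ => by
    rw [LinearMap.sub_apply, hl m Q hQ, sub_self]) (ordLT_mono m.le_succ hm)
  rw [LinearMap.sub_apply, hl m P hm, sub_self, smul_zero, map_sub, LinearMap.sub_apply,
    sub_eq_zero] at h1
  rw [h1, (ψ m).2.2.2 P (ordLT_mono (Nat.le_add_left _ _) hm)]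

end

/-- The formal Poincaré lemma in degree zero. -/
lemma eq_zero_of_del_eq_zero [CharZero k] {W : MixedMod k A} (K : Contraction c W.toGrMod)
    {φ : DiffOps k A →ₗ[A] W.carrier} {n : ℤ}
    (hφ : φ ∈ jets W.toGrMod 0 n) (h1 : φ 1 = 0) (h : del c W φ = 0) : φ = 0 := by
  -- In weight zero the Laplacian is degenerate only in order zero, where `φ` is controlled by `φ 1
  -- = 0`. The term `htpy φ` has negative weight and so vanishes.
  refine K.eq_zero_of_lap hφ (m₀ := 1) (fun m hm => by omega) (fun P hP => ?_) ?_
  · rw [eq_smul_one_of_mem_ordLT_one hP, map_smul, h1, smul_zero]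
  · have : K.htpy φ = 0 := LinearMap.ext fun P => K.eq_zero (K.htpy_mem hφ P) (by norm_num)
    rw [lap_def, h, this, map_zero, map_zero, add_zero, neg_zero]

/-- The formal Poincaré lemma. -/
lemma exists_del_eq [CharZero k] {W : MixedMod k A} (K : Contraction c W.toGrMod)
    {φ : DiffOps k A →ₗ[A] W.carrier} {p n : ℤ} (hp : 0 < p)
    (hφ : φ ∈ jets W.toGrMod p n) (h : del c W φ = 0) :
    ∃ ψ ∈ jets W.toGrMod (p - 1) (n - 1), ψ 1 = 0 ∧ del c W ψ = φ := by
  have h1 : ∀ P ∈ ordLT k A 1, K.htpy φ P = 0 := fun P hP => by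
    rw [htpy_apply, Finset.sum_eq_zero]
    intro j _
    rw [ordLT_zero (commFun_mem hP _), map_zero, map_zero]
  -- In weight `p - 1`, which may be zero, the Laplacian is inverted on jets vanishing in order
  -- zero. The jet `htpy φ` is one, because commutators with functions kill operators of order zero.
  obtain ⟨ψ, hψ, hψ0, hψ'⟩ := K.exists_lap_eq (neg_mem (K.htpy_mem hφ)) (m₀ := 1)
    (fun m hm => by omega) (fun P hP => by rw [LinearMap.neg_apply, h1 P hP, neg_zero])
  -- The Laplacian commutes with `del` because `del` squares to zero. Since `del φ = 0`, both sides
  -- equal `-del (htpy φ)`, and injectivity of the Laplacian in weight `p > 0` will give `del ψ =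
  -- φ`.
  have hlap : K.lap (del c W ψ) = K.lap φ := by
    have e : K.lap (del c W ψ) = del c W (K.lap ψ) := by
      simp only [lap_def, del_del, map_add, map_neg, map_zero, zero_add, add_zero]
    rw [e, hψ', lap_def, h, map_zero, add_zero, map_neg]
  have hdel : del c W ψ = φ := by
    have hmem := del_mem c hψ
    rw [sub_add_cancel, sub_add_cancel] at hmem
    rw [← sub_eq_zero]
    refine K.eq_zero_of_lap (sub_mem hmem hφ) (m₀ := 0) (fun m _ => by omega)
      (fun P hP => by rw [ordLT_zero hP, map_zero]) ?_
    rw [map_sub, hlap, sub_self]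
  exact ⟨ψ, hψ, hψ0 1 one_mem_ordLT, hdel⟩

end Contraction

end Poincare

end DeRhamMixed

namespace DeRhamMixed

/-! ### Cohomology of graded dg-modules, and its contractions. -/

section Cohomology

variable {k : Type v} {A : Type u} [Field k] [CommRing A] [Algebra k A]

namespace GrMod

variable (M : GrMod k A)

/-- The cycles of a graded dg-module. -/
noncomputable def cyc : Submodule (Forms k A) M.carrier where
  carrier := {x | M.d x = 0}
  zero_mem' := map_zero _
  add_mem' := fun {x y} hx hy => by
    rw [Set.mem_ofPred_eq] at *
    rw [map_add, hx, hy, add_zero]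
  smul_mem' := fun ω x hx => by
    rw [Set.mem_ofPred_eq] at *
    rw [d_forms_smul, hx, smul_zero]

/-- The boundaries of a graded dg-module, inside the cycles. -/
noncomputable def bdry : Submodule (Forms k A) M.cyc where
  carrier := {x | ∃ y, M.d y = x}
  zero_mem' := ⟨0, map_zero _⟩
  add_mem' := fun {x y} ⟨x', hx⟩ ⟨y', hy⟩ => ⟨x' + y', by rw [map_add, hx, hy]; rfl⟩
  smul_mem' := fun ω x ⟨y, hy⟩ => ⟨sgn k A ω • y, by
    rw [d_forms_smul, sgn_sgn, hy]; rfl⟩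

/-- The cohomology of a graded dg-module. -/
abbrev hCarrier : Type u := M.cyc ⧸ M.bdry

variable {M}

/-- The class of a cycle. -/
noncomputable def cl (x : M.carrier) (hx : M.d x = 0) : M.hCarrier := M.bdry.mkQ ⟨x, hx⟩

lemma cl_surjective (h : M.hCarrier) : ∃ x hx, cl (M := M) x hx = h := by
  obtain ⟨⟨x, hx⟩, rfl⟩ := M.bdry.mkQ_surjective h
  exact ⟨x, hx, rfl⟩

lemma cl_eq_zero {x : M.carrier} {hx : M.d x = 0} : cl x hx = 0 ↔ ∃ y, M.d y = x :=
  Submodule.Quotient.mk_eq_zero _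

lemma cl_congr {x y : M.carrier} (hx : M.d x = 0) (h : x = y) :
    cl x hx = cl y (by rw [← h]; exact hx) := by
  subst h; rfl

lemma cl_zero : cl (0 : M.carrier) (map_zero _) = 0 := cl_eq_zero.2 ⟨0, map_zero _⟩

lemma cl_add {x y : M.carrier} (hx : M.d x = 0) (hy : M.d y = 0) :
    cl (x + y) (by rw [map_add, hx, hy, add_zero]) = cl x hx + cl y hy := rfl

lemma cl_sub {x y : M.carrier} (hx : M.d x = 0) (hy : M.d y = 0) :
    cl (x - y) (by rw [map_sub, hx, hy, sub_zero]) = cl x hx - cl y hy := rfl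

lemma cl_smul (ω : Forms k A) {x : M.carrier} (hx : M.d x = 0) :
    cl (ω • x) (M.cyc.smul_mem ω hx) = ω • cl x hx := rfl

lemma cl_eq_cl {x y : M.carrier} {hx : M.d x = 0} {hy : M.d y = 0} :
    cl x hx = cl y hy ↔ ∃ z, M.d z = x - y := by
  rw [← sub_eq_zero, ← cl_sub, cl_eq_zero]

/-- The map on cohomology induced by an additive map preserving cycles and boundaries. -/
noncomputable def hAddMap {N : GrMod k A} (f : M.carrier →+ N.carrier)
    (hz : ∀ x, M.d x = 0 → N.d (f x) = 0) (hb : ∀ x, ∃ y, N.d y = f (M.d x)) :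
    M.hCarrier →+ N.hCarrier :=
  QuotientAddGroup.map M.bdry.toAddSubgroup N.bdry.toAddSubgroup
    ((f.comp M.cyc.subtype.toAddMonoidHom).codRestrict N.cyc.toAddSubgroup fun x => hz x.1 x.2) (by
      rintro ⟨_, hx⟩ ⟨y, rfl⟩
      exact hb y)

variable (M) in
/-- The classes of the homogeneous cycles. -/
noncomputable def hComp (p n : ℤ) : AddSubgroup M.hCarrier :=
  ((M.comp p n).comap M.cyc.subtype.toAddMonoidHom).map M.bdry.mkQ.toAddMonoidHom

lemma mem_hComp {p n : ℤ} {h : M.hCarrier} :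
    h ∈ M.hComp p n ↔ ∃ x hx, x ∈ M.comp p n ∧ cl x hx = h := by
  constructor
  · rintro ⟨⟨x, hx⟩, hx', rfl⟩
    exact ⟨x, hx, hx', rfl⟩
  · rintro ⟨x, hx, hx', rfl⟩
    exact ⟨⟨x, hx⟩, hx', rfl⟩

lemma cl_mem {p n : ℤ} {x : M.carrier} (hx : M.d x = 0) (h : x ∈ M.comp p n) :
    cl x hx ∈ M.hComp p n := mem_hComp.2 ⟨x, hx, h, rfl⟩

lemma d_pr_eq_zero {x : M.carrier} (hx : M.d x = 0) (p n : ℤ) : M.d (M.pr p n x) = 0 := by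
  rw [← d_pr, hx, map_zero]

/-- The projections commute with `d` and so act on cohomology. For generation, a cycle has finitely
many nonzero homogeneous parts, each again a cycle, and these are split off one at a time. -/
lemma hComp_isInternal : DirectSum.IsInternal (fun i : ℤ × ℤ => M.hComp i.1 i.2) := by
  refine isInternal_of_proj _ (fun i => hAddMap (M.pr i.1 i.2) (fun x hx => d_pr_eq_zero hx _ _)
    fun x => ⟨M.pr i.1 (i.2 - 1) x, by rw [← d_pr, sub_add_cancel]⟩) ?_ ?_ ?_
  · rintro ⟨p, n⟩ h hh
    obtain ⟨x, hx, hx', rfl⟩ := mem_hComp.1 hh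
    exact cl_congr _ (pr_of_mem hx')
  · rintro ⟨p, n⟩ ⟨p', n'⟩ hne h hh
    obtain ⟨x, hx, hx', rfl⟩ := mem_hComp.1 hh
    exact (cl_congr _ (pr_of_mem_ne hx' hne)).trans cl_zero
  · intro H hH
    rw [eq_top_iff]
    rintro h -
    obtain ⟨x, hx, rfl⟩ := cl_surjective h
    have key (s : Finset (ℤ × ℤ)) (x : M.carrier) (hx : M.d x = 0)
        (hs : ∀ i, i ∉ s → M.pr i.1 i.2 x = 0) : cl x hx ∈ H := by
      induction s using Finset.induction_on generalizing x with
      | empty =>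
        have : x = 0 := eq_zero_of_pr fun p n => hs (p, n) (Finset.notMem_empty _)
        rw [cl_congr hx this, cl_zero]
        exact zero_mem _
      | insert i s hi ih =>
        have h1 := ih (x - M.pr i.1 i.2 x) (by rw [map_sub, hx, d_pr_eq_zero hx, sub_zero]) (by
          intro j hj
          by_cases hji : j = i
          · subst hji
            rw [map_sub, pr_of_mem (pr_mem _ _ x), sub_self]
          · rw [map_sub, pr_of_mem_ne (pr_mem i.1 i.2 x) hji, hs j (by simp [hji, hj]), sub_zero])
        have h2 := hH i (cl_mem (d_pr_eq_zero hx i.1 i.2) (pr_mem i.1 i.2 x))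
        rw [cl_sub hx (d_pr_eq_zero hx i.1 i.2)] at h1
        have := add_mem h1 h2
        rwa [sub_add_cancel] at this
    classical
    refine key (DFinsupp.support (M.decomp.symm x)) x hx fun i hi => ?_
    rw [DFinsupp.notMem_support_iff] at hi
    exact congrArg Subtype.val hi

variable (M) in
/-- The cohomology of a graded dg-module, as a graded dg-module with zero differential. -/
noncomputable def hMod : GrMod k A where
  carrier := M.hCarrier
  comp := M.hComp
  isInternal := hComp_isInternal
  smul_mem := by
    intro q ω p n h hω hh
    obtain ⟨x, hx, hx', rfl⟩ := mem_hComp.1 hh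
    exact cl_mem _ (M.smul_mem hω hx')
  d := 0
  d_mem := fun _ => zero_mem _
  d_d := fun _ => rfl
  d_smul := fun _ _ => by simp only [AddMonoidHom.zero_apply, smul_zero]

/-- The map on cohomology induced by a morphism. -/
noncomputable def hLin {N : GrMod k A} (f : M ⟶ N) : M.hCarrier →ₗ[Forms k A] N.hCarrier :=
  { hAddMap (GrMod.lin f).toAddMonoidHom (fun x hx => by
        rw [LinearMap.toAddMonoidHom_coe, ← lin_d, hx, map_zero])
      (fun x => ⟨GrMod.lin f x, (lin_d f x).symm⟩) with
    map_smul' := fun ω h => by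
      obtain ⟨x, hx, rfl⟩ := cl_surjective h
      exact cl_congr _ (map_smul (GrMod.lin f) ω x) }

lemma hLin_cl {N : GrMod k A} (f : M ⟶ N) (x : M.carrier) (hx : M.d x = 0) :
    hLin f (cl x hx) = cl (GrMod.lin f x) (by rw [← lin_d, hx, map_zero]) := rfl

variable (k A) in
/-- The cohomology functor. -/
noncomputable def hFun : GrMod k A ⥤ GrMod k A where
  obj M := M.hMod
  map {M N} f :=
    { lin := hLin f
      map_mem := fun hh => by
        obtain ⟨x, hx, hx', rfl⟩ := mem_hComp.1 hh
        exact cl_mem _ (lin_mem f hx')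
      map_d := fun _ => map_zero (hLin f) }
  map_id M := hom_ext fun h => by
    obtain ⟨x, hx, rfl⟩ := cl_surjective h
    rfl
  map_comp f g := hom_ext fun h => by
    obtain ⟨x, hx, rfl⟩ := cl_surjective h
    rfl

lemma qis_iff {N : GrMod k A} (f : M ⟶ N) :
    GrMod.qis k A f ↔ Function.Bijective (hLin f) := by
  constructor
  · rintro ⟨h1, h2⟩
    refine ⟨(injective_iff_map_eq_zero _).2 fun h hh => ?_, fun h => ?_⟩
    · obtain ⟨x, hx, rfl⟩ := cl_surjective h
      exact cl_eq_zero.2 (h1 x hx (cl_eq_zero.1 hh))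
    · obtain ⟨y, hy, rfl⟩ := cl_surjective h
      obtain ⟨x, hx, y', hy'⟩ := h2 y hy
      refine ⟨cl x hx, ?_⟩
      rw [hLin_cl, cl_eq_cl]
      exact ⟨-y', by rw [map_neg, hy', neg_sub]⟩
  · rintro ⟨h1, h2⟩
    refine ⟨fun x hx hy => cl_eq_zero.1 (h1 (?_ : hLin f (cl x hx) = hLin f 0)), fun y hy => ?_⟩
    · rw [map_zero, hLin_cl]
      exact cl_eq_zero.2 hy
    · obtain ⟨h, hh⟩ := h2 (cl y hy)
      obtain ⟨x, hx, rfl⟩ := cl_surjective h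
      obtain ⟨z, hz⟩ := cl_eq_cl.1 hh.symm
      exact ⟨x, hx, z, hz⟩

/-- A bijective morphism of graded dg-modules is an isomorphism. -/
lemma isIso_of_bijective {N : GrMod k A} (f : M ⟶ N) (h : Function.Bijective (GrMod.lin f)) :
    IsIso f := by
  let e := LinearEquiv.ofBijective (GrMod.lin f) h
  have he (x : M.carrier) : e x = GrMod.lin f x := rfl
  let g : N ⟶ M :=
    { lin := e.symm.toLinearMap
      map_mem := fun {p n y} hy => by
        have : e.symm y = M.pr p n (e.symm y) := by
          apply e.injective
          rw [he (M.pr p n _), ← lin_pr, ← he, e.apply_symm_apply, pr_of_mem hy]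
        change e.symm y ∈ _
        rw [this]
        exact pr_mem _ _ _
      map_d := fun y => by
        apply e.injective
        change e (e.symm (N.d y)) = e (M.d (e.symm y))
        rw [e.apply_symm_apply, he, lin_d, ← he, e.apply_symm_apply] }
  exact ⟨g, hom_ext fun x => e.symm_apply_apply x, hom_ext fun y => e.apply_symm_apply y⟩

/-- Cohomology thus factors through the localization, and an isomorphism there, possibly given by a
zigzag, induces one of graded modules on cohomology. -/
lemma isInvertedBy_hFun : (GrMod.qis k A).IsInvertedBy (hFun k A) := fun _ _ f hf =>
  isIso_of_bijective _ ((qis_iff f).1 hf)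

lemma bijective_of_isIso {N : GrMod k A} (f : M ⟶ N) [IsIso f] :
    Function.Bijective (GrMod.lin f) :=
  Function.bijective_iff_has_inverse.2 ⟨GrMod.lin (CategoryTheory.inv f),
    fun x => by rw [← lin_comp, IsIso.hom_inv_id, lin_id],
    fun x => by rw [← lin_comp, IsIso.inv_hom_id, lin_id]⟩

end GrMod

namespace MixedMod

/-- The cohomology of a graded mixed dg-module. -/
noncomputable def hMixed (M : MixedMod k A) : MixedMod k A where
  toGrMod := M.toGrMod.hMod
  ε := GrMod.hAddMap M.ε (fun x hx => by
      have := M.d_ε x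
      rwa [hx, map_zero, add_zero] at this)
    (fun x => ⟨-M.ε x, by rw [map_neg, M.ε_d]⟩)
  ε_mem := fun hh => by
    obtain ⟨x, hx, hx', rfl⟩ := GrMod.mem_hComp.1 hh
    exact GrMod.cl_mem _ (M.ε_mem hx')
  ε_ε := fun h => by
    obtain ⟨x, hx, rfl⟩ := GrMod.cl_surjective h
    exact (GrMod.cl_congr _ (M.ε_ε x)).trans GrMod.cl_zero
  d_ε := fun h => by
    change 0 + GrMod.hAddMap M.ε _ _ 0 = 0
    rw [map_zero, add_zero]
  ε_smul := fun {q ω} h hω => by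
    obtain ⟨x, hx, rfl⟩ := GrMod.cl_surjective h
    exact GrMod.cl_congr _ (M.ε_smul x hω)

end MixedMod

variable {c : DualCoords k A}

namespace Contraction

/-- The contractions induced on cohomology. -/
noncomputable def toCohomology {M : GrMod k A} (K : Contraction c M)
    (h : ∀ j x, K.ι j (M.d x) = -M.d (K.ι j x)) : Contraction c M.hMod where
  ι j :=
    { GrMod.hAddMap (M := M) (N := M) (K.ι j).toAddMonoidHom (fun x hx => by
          rw [LinearMap.toAddMonoidHom_coe, ← neg_eq_zero, ← h, hx, map_zero])
        (fun x => ⟨-K.ι j x, by rw [map_neg, LinearMap.toAddMonoidHom_coe, h]⟩) with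
      map_smul' := fun a h => by
        obtain ⟨x, hx, rfl⟩ := GrMod.cl_surjective h
        exact GrMod.cl_congr _ (map_smul (K.ι j) a x) }
  ι_mem j := fun hh => by
    obtain ⟨x, hx, hx', rfl⟩ := GrMod.mem_hComp.1 hh
    exact GrMod.cl_mem _ (K.ι_mem j hx')
  ι_dOne j a h := by
    obtain ⟨x, hx, rfl⟩ := GrMod.cl_surjective h
    exact GrMod.cl_congr _ (K.ι_dOne j a x)
  euler := fun {p n x} hh => by
    obtain ⟨x, hx, hx', rfl⟩ := GrMod.mem_hComp.1 hh
    have e := K.euler hx'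
    have hd (j : Fin c.card) : M.d (K.ι j x) = 0 := by rw [← neg_eq_zero, ← h, hx, map_zero]
    change ∑ j, dOne k A (c.x j) • M.bdry.mkQ ⟨K.ι j x, hd j⟩ = p • M.bdry.mkQ ⟨x, hx⟩
    rw [← map_zsmul]
    simp only [← map_smul]
    rw [← map_sum]
    congr 1
    apply Subtype.ext
    rw [AddSubmonoidClass.coe_finsetSum]
    exact e
  eq_zero := fun hh hp => by
    obtain ⟨x, hx, hx', rfl⟩ := GrMod.mem_hComp.1 hh
    exact (GrMod.cl_congr hx (K.eq_zero hx' hp)).trans GrMod.cl_zero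

/-- The contractions transported along an isomorphism. -/
noncomputable def ofIso {W W' : GrMod k A} (K : Contraction c W) (e : W ≅ W') :
    Contraction c W' where
  ι j := (GrMod.lin e.hom).restrictScalars A ∘ₗ K.ι j ∘ₗ (GrMod.lin e.inv).restrictScalars A
  ι_mem j := fun hx => GrMod.lin_mem _ (K.ι_mem j (GrMod.lin_mem _ hx))
  ι_dOne j a x := by
    simp only [LinearMap.comp_apply, LinearMap.restrictScalars_apply, map_smul, K.ι_dOne, map_sub]
    rw [← GrMod.lin_comp, e.inv_hom_id]
    rfl
  euler := fun {p n x} hx => by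
    simp only [LinearMap.comp_apply, LinearMap.restrictScalars_apply, ← map_smul]
    rw [← map_sum, K.euler (GrMod.lin_mem e.inv hx), map_zsmul, ← GrMod.lin_comp, e.inv_hom_id]
    rfl
  eq_zero := fun {p n x} hx hp => by
    have := K.eq_zero (GrMod.lin_mem e.inv hx) hp
    have h2 : GrMod.lin e.hom (GrMod.lin e.inv x) = x := by
      rw [← GrMod.lin_comp, e.inv_hom_id]; rfl
    rw [← h2, this, map_zero]

variable [CharZero k] {W W' : GrMod k A} (K : Contraction c W) (K' : Contraction c W') (f : W ⟶ W')

-- Contractions are forced by the Euler relation and the Leibniz rule, so every morphism respects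
-- them. In weight zero both sides have negative weight. In weight `p + 1`, replacing `(p + 1) x` by
-- `∑ l, dx l ∧ ι l x` reduces the claim to the elements `ι l x` of weight `p`.
include K K' in
lemma lin_ι (p : ℕ) (n : ℤ) (j : Fin c.card) {x : W.carrier} (hx : x ∈ W.comp p n) :
    GrMod.lin f (K.ι j x) = K'.ι j (GrMod.lin f x) := by
  induction p generalizing n x j with
  | zero =>
    rw [K.eq_zero (K.ι_mem j hx) (by norm_num),
      K'.eq_zero (K'.ι_mem j (GrMod.lin_mem f hx)) (by norm_num), map_zero]
  | succ p ih =>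
    have hp : ((p + 1 : ℕ) : ℤ) ≠ 0 := by positivity
    have hm (l : Fin c.card) : K.ι l x ∈ W.comp p (n - 1) := by
      have := K.ι_mem l hx
      rwa [Nat.cast_succ, add_sub_cancel_right] at this
    rw [← sub_eq_zero]
    refine GrMod.eq_zero_of_zsmul hp ?_
    rw [smul_sub, ← map_zsmul, ← map_zsmul, ← map_zsmul, ← map_zsmul, ← K.euler hx, map_sum,
      map_sum, map_sum, map_sum, sub_eq_zero]
    refine Finset.sum_congr rfl fun l _ => ?_
    rw [K.ι_dOne, map_smul (GrMod.lin f), K'.ι_dOne, map_sub, GrMod.lin_base_smul,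
      map_smul (GrMod.lin f), ih _ _ (hm l)]

include K K' in
/-- A morphism between modules with contractions is bijective if it is so in weight zero. -/
lemma bijective_of_weight_zero
    (hinj : ∀ n, ∀ x ∈ W.comp 0 n, GrMod.lin f x = 0 → x = 0)
    (hsurj : ∀ n, ∀ y ∈ W'.comp 0 n, ∃ x ∈ W.comp 0 n, GrMod.lin f x = y) :
    Function.Bijective (GrMod.lin f) := by
  -- If `x` is in the kernel then so is each `ι j x`, by `lin_ι`. These vanish by induction, and
  -- then the Euler relation gives `(p + 1) x = 0`.
  have h1 (p : ℕ) (n : ℤ) (x : W.carrier) (hx : x ∈ W.comp p n) (h0 : GrMod.lin f x = 0) :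
      x = 0 := by
    induction p generalizing n x with
    | zero => exact hinj n x hx h0
    | succ p ih =>
      have hp : ((p + 1 : ℕ) : ℤ) ≠ 0 := by positivity
      refine GrMod.eq_zero_of_zsmul hp ?_
      rw [← K.euler hx]
      refine Finset.sum_eq_zero fun j _ => ?_
      have hm := K.ι_mem j hx
      rw [Nat.cast_succ, add_sub_cancel_right] at hm
      rw [ih _ _ hm, smul_zero]
      rw [lin_ι K K' f _ _ _ hx, h0, map_zero]
  -- Preimages `x j` of the contractions `ι j y` exist by induction, and `∑ j, dx j ∧ x j` divided
  -- by the weight is a preimage of `y` by the Euler relation.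
  have h2 (p : ℕ) (n : ℤ) (y : W'.carrier) (hy : y ∈ W'.comp p n) :
      ∃ x ∈ W.comp p n, GrMod.lin f x = y := by
    induction p generalizing n y with
    | zero => exact hsurj n y hy
    | succ p ih =>
      have hp : ((p + 1 : ℕ) : ℤ) ≠ 0 := by positivity
      have hm (j : Fin c.card) := K'.ι_mem j hy
      simp only [Nat.cast_succ, add_sub_cancel_right] at hm
      choose x hx hxy using fun j => ih _ _ (hm j)
      obtain ⟨r, hr⟩ := exists_smul_zsmul_eq (k := k) (A := A) hp
      refine ⟨r • ∑ j, dOne k A (c.x j) • x j, GrMod.base_smul_mem r (sum_mem fun j _ => ?_), ?_⟩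
      · have := GrMod.dOne_smul_mem (c.x j) (hx j)
        rwa [sub_add_cancel] at this
      · rw [GrMod.lin_base_smul, map_sum]
        simp only [map_smul, hxy]
        rw [K'.euler hy, hr]
  refine ⟨(injective_iff_map_eq_zero _).2 fun x hx => GrMod.eq_zero_of_pr fun p n => ?_, fun y => ?_⟩
  · by_cases hp : p < 0
    · exact K.eq_zero (GrMod.pr_mem _ _ _) hp
    · obtain ⟨p, rfl⟩ := Int.eq_ofNat_of_zero_le (not_lt.1 hp)
      exact h1 p n _ (GrMod.pr_mem _ _ _) (by rw [← GrMod.lin_pr, hx, map_zero])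
  · induction y using GrMod.induction with
    | h0 => exact ⟨0, map_zero _⟩
    | ha x y hx hy =>
      obtain ⟨x', rfl⟩ := hx
      obtain ⟨y', rfl⟩ := hy
      exact ⟨x' + y', map_add _ _ _⟩
    | h p n y hy =>
      by_cases hp : p < 0
      · exact ⟨0, by rw [map_zero, K'.eq_zero hy hp]⟩
      · obtain ⟨p, rfl⟩ := Int.eq_ofNat_of_zero_le (not_lt.1 hp)
        obtain ⟨x, -, hx⟩ := h2 p n y hy
        exact ⟨x, hx⟩

end Contraction

end Cohomology

end DeRhamMixed

namespace DeRhamMixed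

/-! ### Interior products on forms and on free modules. -/

section FreeContraction

variable {k : Type v} {A : Type u} [Field k] [CommRing A] [Algebra k A]

namespace DualCoords

variable (c : DualCoords k A)

/-- The contraction of forms by the derivation `θ j`. -/
noncomputable def contr (j : Fin c.card) : Forms k A →ₗ[A] Forms k A :=
  CliffordAlgebra.contractLeft (c.θ j).liftKaehlerDifferential

lemma contr_iota_mul (j : Fin c.card) (m : Ω[A⁄k]) (ω : Forms k A) :
    c.contr j (ExteriorAlgebra.ι A m * ω) =
      (c.θ j).liftKaehlerDifferential m • ω - ExteriorAlgebra.ι A m * c.contr j ω :=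
  CliffordAlgebra.contractLeft_ι_mul _ _ _

lemma contr_algebraMap (j : Fin c.card) (a : A) : c.contr j (algebraMap A _ a) = 0 :=
  CliffordAlgebra.contractLeft_algebraMap _ _ _

lemma contr_dOne_mul (j : Fin c.card) (a : A) (ω : Forms k A) :
    c.contr j (dOne k A a * ω) = c.θ j a • ω - dOne k A a * c.contr j ω := by
  rw [dOne, contr_iota_mul, Derivation.liftKaehlerDifferential_comp_D]

/-- The contraction lowers the degree by one. Weight zero is a separate clause because exterior
powers are indexed by natural numbers. -/
lemma contr_mem (j : Fin c.card) {q : ℕ} {ω : Forms k A} (hω : ω ∈ ⋀[A]^q Ω[A⁄k]) :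
    (q = 0 → c.contr j ω = 0) ∧ ∀ r, q = r + 1 → c.contr j ω ∈ ⋀[A]^r Ω[A⁄k] := by
  induction hω using Submodule.pow_induction_on_left' with
  | algebraMap r => exact ⟨fun _ => c.contr_algebraMap j r, fun r h => by omega⟩
  | add x y i hx hy h1 h2 =>
    refine ⟨fun h => ?_, fun r h => ?_⟩
    · rw [map_add, h1.1 h, h2.1 h, add_zero]
    · rw [map_add]; exact add_mem (h1.2 r h) (h2.2 r h)
  | mem_mul m hm i x hx ih =>
    obtain ⟨m, rfl⟩ := hm
    refine ⟨fun h => by simp at h, fun r h => ?_⟩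
    obtain rfl : i = r := Nat.succ_injective h
    rw [contr_iota_mul]
    refine sub_mem (Submodule.smul_mem _ _ hx) ?_
    rcases i with _ | i
    · rw [ih.1 rfl, mul_zero]; exact zero_mem _
    · have := forms_mul_mem k A (iota_mem k A m) (ih.2 i rfl)
      rwa [add_comm 1 i] at this

lemma contr_sgn (j : Fin c.card) (ω : Forms k A) :
    c.contr j (sgn k A ω) = -sgn k A (c.contr j ω) := by
  induction ω using GrMod.forms_induction with
  | ha x y hx hy => simp only [map_add, hx, hy, neg_add]
  | h q ω hω =>
    rw [sgn_of_mem k A hω, map_zsmul]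
    rcases q with _ | q
    · rw [(c.contr_mem j hω).1 rfl, map_zero, smul_zero, neg_zero]
    · rw [sgn_of_mem k A ((c.contr_mem j hω).2 q rfl), pow_succ, mul_neg, mul_one, neg_smul]

/-- The `dx j` and `θ j` form a dual generating system, not necessarily a basis. The defining
identity for the forms `da` extends to all one-forms by the universal property of the Kähler
differentials. -/
lemma iota_eq (m : Ω[A⁄k]) :
    ExteriorAlgebra.ι A m = ∑ j, (c.θ j).liftKaehlerDifferential m • dOne k A (c.x j) := by
  have h : (LinearMap.id : Ω[A⁄k] →ₗ[A] Ω[A⁄k]) = ∑ j, (LinearMap.toSpanSingleton A _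
      (KaehlerDifferential.D k A (c.x j))).comp (c.θ j).liftKaehlerDifferential := by
    apply Derivation.liftKaehlerDifferential_unique
    ext a
    change KaehlerDifferential.D k A a = (∑ j, (LinearMap.toSpanSingleton A _
      (KaehlerDifferential.D k A (c.x j))).comp (c.θ j).liftKaehlerDifferential)
        (KaehlerDifferential.D k A a)
    simp only [LinearMap.sum_apply, LinearMap.comp_apply, LinearMap.toSpanSingleton_apply,
      Derivation.liftKaehlerDifferential_comp_D]
    exact c.D_eq a
  have := congrArg (fun f : Ω[A⁄k] →ₗ[A] Ω[A⁄k] => ExteriorAlgebra.ι A (f m)) h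
  simp only [LinearMap.id_apply, LinearMap.sum_apply, LinearMap.comp_apply,
    LinearMap.toSpanSingleton_apply, map_sum, map_smul] at this
  exact this

/-- For a product `m ∧ x`, contracting `m` and wedging back gives `m ∧ x` once, by `iota_eq`.
Contracting `x` gives its degree by induction, and the sign of the contraction cancels the one from
moving `dx j` past `m`. -/
lemma contr_euler {q : ℕ} {ω : Forms k A} (hω : ω ∈ ⋀[A]^q Ω[A⁄k]) :
    ∑ j, dOne k A (c.x j) * c.contr j ω = q • ω := by
  induction hω using Submodule.pow_induction_on_left' with
  | algebraMap r =>
    rw [zero_smul]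
    exact Finset.sum_eq_zero fun j _ => by rw [contr_algebraMap, mul_zero]
  | add x y i hx hy h1 h2 =>
    simp only [map_add, mul_add, Finset.sum_add_distrib, h1, h2, smul_add]
  | mem_mul m hm i x hx ih =>
    obtain ⟨m, rfl⟩ := hm
    simp only [contr_iota_mul, mul_sub, Finset.sum_sub_distrib]
    have h1 : ∑ j, dOne k A (c.x j) * (c.θ j).liftKaehlerDifferential m • x =
        ExteriorAlgebra.ι A m * x := by
      rw [c.iota_eq m, Finset.sum_mul]
      exact Finset.sum_congr rfl fun j _ => by rw [mul_smul_comm, smul_mul_assoc]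
    have h2 : ∑ j, dOne k A (c.x j) * (ExteriorAlgebra.ι A m * c.contr j x) =
        -(i • (ExteriorAlgebra.ι A m * x)) := by
      rw [← mul_smul_comm, ← ih, Finset.mul_sum, ← Finset.sum_neg_distrib]
      refine Finset.sum_congr rfl fun j _ => ?_
      rw [← mul_assoc, dOne, iota_anticomm, neg_mul, mul_assoc]
    rw [h1, h2, sub_neg_eq_add, succ_nsmul, add_comm]

end DualCoords

lemma freeMod_base_smul (E : CochainComplex (ModuleCat.{u} A) ℤ) (a : A)
    (x : Forms k A ⊗[A] Tot E) :
    algebraMap A (Forms k A) a • x = a • x := by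
  induction x using TensorProduct.induction_on with
  | zero => rw [smul_zero, smul_zero]
  | add x y hx hy => rw [smul_add, smul_add, hx, hy]
  | tmul ω t =>
    rw [TensorProduct.smul_tmul', TensorProduct.smul_tmul', smul_eq_mul, Algebra.smul_def]

variable (c : DualCoords k A)

/-- The contraction of the first factor of a free module. -/
noncomputable def freeContr (E : CochainComplex (ModuleCat.{u} A) ℤ) (j : Fin c.card) :
    Forms k A ⊗[A] Tot E →ₗ[A] Forms k A ⊗[A] Tot E :=
  TensorProduct.map (c.contr j) LinearMap.id

lemma freeContr_tmul (E : CochainComplex (ModuleCat.{u} A) ℤ) (j : Fin c.card) (ω : Forms k A)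
    (t : Tot E) : freeContr c E j (ω ⊗ₜ t) = c.contr j ω ⊗ₜ t := rfl

lemma freeContr_base_smul (E : CochainComplex (ModuleCat.{u} A) ℤ) (j : Fin c.card) (a : A)
    (x : Forms k A ⊗[A] Tot E) :
    freeContr c E j (algebraMap A (Forms k A) a • x) =
      algebraMap A (Forms k A) a • freeContr c E j x := by
  rw [freeMod_base_smul, map_smul, freeMod_base_smul]

lemma freeContr_dOne (E : CochainComplex (ModuleCat.{u} A) ℤ) (j : Fin c.card) (a : A)
    (x : Forms k A ⊗[A] Tot E) :
    freeContr c E j (dOne k A a • x) =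
      algebraMap A (Forms k A) (c.θ j a) • x - dOne k A a • freeContr c E j x := by
  rw [freeMod_base_smul]
  induction x using TensorProduct.induction_on with
  | zero => simp only [smul_zero, map_zero, sub_zero]
  | add x y hx hy => rw [smul_add, map_add, hx, hy, smul_add, map_add, smul_add]; abel
  | tmul ω t =>
    rw [TensorProduct.smul_tmul', freeContr_tmul, freeContr_tmul, smul_eq_mul, c.contr_dOne_mul,
      TensorProduct.sub_tmul, TensorProduct.smul_tmul', TensorProduct.smul_tmul', smul_eq_mul]

lemma freeContr_euler (E : CochainComplex (ModuleCat.{u} A) ℤ) {p n : ℤ}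
    {x : Forms k A ⊗[A] Tot E} (hx : x ∈ freeComp k E p n) :
    ∑ j, dOne k A (c.x j) • freeContr c E j x = p • x := by
  let f : Forms k A ⊗[A] Tot E →+ Forms k A ⊗[A] Tot E :=
    (∑ j, (DistribSMul.toAddMonoidHom (Forms k A ⊗[A] Tot E) (dOne k A (c.x j))).comp
      (freeContr c E j).toAddMonoidHom) - DistribSMul.toAddMonoidHom _ p
  have hf : ∀ x, f x = ∑ j, dOne k A (c.x j) • freeContr c E j x - p • x := fun x => by
    rw [AddMonoidHom.sub_apply, AddMonoidHom.finsetSum_apply]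
    rfl
  have h : f x ∈ (⊥ : AddSubgroup (Forms k A ⊗[A] Tot E)) := by
    refine freeComp_map f ⊥ (fun q m hp hn ω hω e => ?_) hx
    rw [AddSubgroup.mem_bot, hf, sub_eq_zero]
    simp only [freeContr_tmul, TensorProduct.smul_tmul', smul_eq_mul]
    rw [← TensorProduct.sum_tmul, c.contr_euler hω, hp, natCast_zsmul]
  rw [AddSubgroup.mem_bot, hf, sub_eq_zero] at h
  exact h

/-- The contractions of a free module. -/
noncomputable def freeContraction (E : CochainComplex (ModuleCat.{u} A) ℤ) :
    Contraction c (freeMod k E) where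
  ι j := { (freeContr c E j).toAddMonoidHom with map_smul' := freeContr_base_smul c E j }
  ι_mem j {p n x} hx := by
    refine freeComp_map (freeContr c E j).toAddMonoidHom (freeComp k E (p - 1) (n - 1))
      (fun q m hp hn ω hω e => ?_) hx
    rw [LinearMap.toAddMonoidHom_coe, freeContr_tmul]
    rcases q with _ | q
    · rw [(c.contr_mem j hω).1 rfl, TensorProduct.zero_tmul]
      exact zero_mem _
    · refine tmul_mem_freeComp (q := q) ?_ ?_ ((c.contr_mem j hω).2 q rfl) e
      · rw [hp]; push_cast; ring
      · rw [hn]; push_cast; ring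
  ι_dOne := freeContr_dOne c E
  euler hx := freeContr_euler c E hx
  eq_zero {p n x} hx hp := by
    refine freeComp_map (AddMonoidHom.id _) (⊥ : AddSubgroup (Forms k A ⊗[A] Tot E))
      (fun q m hp' hn ω hω e => ?_) hx
    omega

lemma freeContr_freeD (E : CochainComplex (ModuleCat.{u} A) ℤ) (j : Fin c.card)
    (x : Forms k A ⊗[A] Tot E) :
    freeContr c E j (freeD k E x) = -freeD k E (freeContr c E j x) := by
  induction x using TensorProduct.induction_on with
  | zero => simp only [map_zero, neg_zero]
  | add x y hx hy => simp only [map_add, hx, hy, neg_add]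
  | tmul ω t => rw [freeD_tmul, freeContr_tmul, freeContr_tmul, freeD_tmul, c.contr_sgn,
      TensorProduct.neg_tmul]

/-- The contractions of the cohomology of a free module. -/
noncomputable def freeCohomologyContraction (E : CochainComplex (ModuleCat.{u} A) ℤ) :
    Contraction c (freeMod k E).hMod :=
  (freeContraction c E).toCohomology (freeContr_freeD c E)

/-- The retraction `ω ⊗ t ↦ ω₀ t` of a free module to its generators. -/
noncomputable def freeRetr (E : CochainComplex (ModuleCat.{u} A) ℤ) :
    Forms k A ⊗[A] Tot E →ₗ[A] Tot E :=
  TensorProduct.lid A (Tot E) ∘ₗ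
    TensorProduct.map (ExteriorAlgebra.algebraMapInv (R := A) (M := Ω[A⁄k])).toLinearMap
      LinearMap.id

lemma freeRetr_one_tmul (E : CochainComplex (ModuleCat.{u} A) ℤ) (t : Tot E) :
    freeRetr E ((1 : Forms k A) ⊗ₜ t) = t := by
  rw [freeRetr, LinearMap.comp_apply, TensorProduct.map_tmul, AlgHom.toLinearMap_apply, map_one,
    LinearMap.id_apply]
  exact TensorProduct.lid_tmul _ _ |>.trans (one_smul _ _)

lemma mem_freeComp_zero {E : CochainComplex (ModuleCat.{u} A) ℤ} {n : ℤ}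
    {x : Forms k A ⊗[A] Tot E} (hx : x ∈ freeComp k E 0 n) :
    ∃ e : E.X n, x = 1 ⊗ₜ DirectSum.lof A ℤ (fun j => (E.X j : Type u)) n e := by
  let H : AddSubgroup (Forms k A ⊗[A] Tot E) :=
    ((TensorProduct.mk A (Forms k A) (Tot E) 1).toAddMonoidHom.comp
      (DirectSum.lof A ℤ (fun j => (E.X j : Type u)) n).toAddMonoidHom).range
  have : x ∈ H := by
    refine freeComp_map (AddMonoidHom.id _) H (fun q m hp hn ω hω e => ?_) hx
    obtain rfl : q = 0 := by omega
    obtain rfl : n = m := by rw [hn]; simp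
    have hω' : ω ∈ (1 : Submodule A (Forms k A)) := by
      rw [← pow_zero (LinearMap.range (ExteriorAlgebra.ι A))]; exact hω
    obtain ⟨a, rfl⟩ := Submodule.mem_one.1 hω'
    refine ⟨a • e, ?_⟩
    change (1 : Forms k A) ⊗ₜ[A] DirectSum.lof A ℤ (fun j => (E.X j : Type u)) n (a • e) = _
    rw [map_smul, TensorProduct.tmul_smul, TensorProduct.smul_tmul', Algebra.algebraMap_eq_smul_one]
    rfl
  obtain ⟨e, he⟩ := this
  exact ⟨e, he.symm⟩

lemma one_tmul_mem (E : CochainComplex (ModuleCat.{u} A) ℤ) (n : ℤ) (e : E.X n) :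
    (1 : Forms k A) ⊗ₜ[A] DirectSum.lof A ℤ (fun j => (E.X j : Type u)) n e ∈ freeComp k E 0 n :=
  tmul_mem_freeComp (q := 0) rfl (by simp) (by
    have := GrMod.base_mem_zero (k := k) (1 : A)
    rwa [map_one] at this) e

lemma one_tmul_injective (E : CochainComplex (ModuleCat.{u} A) ℤ) {t t' : Tot E}
    (h : (1 : Forms k A) ⊗ₜ[A] t = 1 ⊗ₜ[A] t') : t = t' := by
  rw [← freeRetr_one_tmul (k := k) E t, h, freeRetr_one_tmul]

end FreeContraction

end DeRhamMixed

namespace DeRhamMixed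

/-! ### The total complex of jets: exactness by recursion on the weight. -/

section TotalJets

variable {k : Type v} {A : Type u} [Field k] [CommRing A] [Algebra k A]

lemma exists_lift {R D X Y : Type*} [CommRing R] [AddCommGroup D] [Module R D]
    [Module.Projective R D] [AddCommGroup X] [Module R X] [AddCommGroup Y] [Module R Y]
    (g : X →ₗ[R] Y) (φ : D →ₗ[R] Y) (h : ∀ P, ∃ s, g s = φ P) :
    ∃ l : D →ₗ[R] X, ∀ P, g (l P) = φ P := by
  obtain ⟨l, hl⟩ := Module.projective_lifting_property g.rangeRestrict
    (φ.codRestrict (LinearMap.range g) h) g.surjective_rangeRestrict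
  exact ⟨l, fun P => congrArg Subtype.val (LinearMap.congr_fun hl P)⟩

/-- A row-wise criterion for the exactness of the product total complex of a half-plane double
complex. -/
lemma exists_total_eq {U : Type*} [AddCommGroup U] (d δ : U →+ U)
    (hδδ : ∀ x, δ (δ x) = 0) (hdδ : ∀ x, d (δ x) + δ (d x) = 0) (B C : ℕ → AddSubgroup U)
    (h0 : ∀ x ∈ C 0, d x = 0 → (∃ w, d w = δ x) → ∃ z ∈ B 0, d z = x)
    (h1 : ∀ i, ∀ x ∈ C (i + 1), d x = 0 → (∃ w, d w = δ x) →
      ∃ y ∈ B i, ∃ z ∈ B (i + 1), d y = 0 ∧ δ y + d z = x)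
    (hδ : ∀ i, ∀ x ∈ B i, δ x ∈ C (i + 1))
    (φ : ℕ → U) (hφ : ∀ i, φ i ∈ C i) (hφ0 : d (φ 0) = 0)
    (hφ1 : ∀ i, d (φ (i + 1)) + δ (φ i) = 0) :
    ∃ ψ : ℕ → U, (∀ i, ψ i ∈ B i) ∧ d (ψ 0) = φ 0 ∧ ∀ i, d (ψ (i + 1)) + δ (ψ i) = φ (i + 1) := by
  have hw (i : ℕ) : d (-φ (i + 1)) = δ (φ i) := by
    rw [map_neg, neg_eq_iff_add_eq_zero, hφ1]
  obtain ⟨z₀, hz₀, hz₀'⟩ := h0 (φ 0) (hφ 0) hφ0 ⟨_, hw 0⟩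
  -- The invariant `δ (d z) = δ (φ i)` makes `φ (i + 1) - δ z` a `d`-cycle, and its image under `δ`
  -- is the boundary of `-φ (i + 2)`. So `h1` applies; the resulting `y` is a `d`-cycle used to
  -- correct `z` itself.
  have step (i : ℕ) (z : {z : U // z ∈ B i ∧ δ (d z) = δ (φ i)}) :
      ∃ (z' : {z : U // z ∈ B (i + 1) ∧ δ (d z) = δ (φ (i + 1))}), ∃ y ∈ B i, d y = 0 ∧
        δ y + d z'.1 = φ (i + 1) - δ z.1 := by
    obtain ⟨z, hz, hz'⟩ := z
    obtain ⟨y, hy, z', hz'B, hdy, h⟩ := h1 i (φ (i + 1) - δ z) (sub_mem (hφ _) (hδ i z hz))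
      (by rw [map_sub, sub_eq_zero, eq_neg_of_add_eq_zero_left (hφ1 i), ← hz',
        eq_neg_of_add_eq_zero_left (hdδ z)])
      ⟨-φ (i + 1 + 1), by rw [hw, map_sub, hδδ, sub_zero]⟩
    refine ⟨⟨z', hz'B, ?_⟩, y, hy, hdy, h⟩
    have := congrArg δ h
    rwa [map_add, hδδ, zero_add, map_sub, hδδ, sub_zero] at this
  choose next y hy hdy hnext using step
  let z (i : ℕ) : {z : U // z ∈ B i ∧ δ (d z) = δ (φ i)} :=
    Nat.rec ⟨z₀, hz₀, by rw [hz₀']⟩ (fun i z => next i z) i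
  have hz (i : ℕ) : z (i + 1) = next i (z i) := rfl
  -- Adding the cycle `y i` does not change `d (z i)`, but changes `δ (z i)` by exactly what row `i
  -- + 1` needs. No finiteness is required, since sequences are arbitrary.
  refine ⟨fun i => (z i).1 + y i (z i), fun i => add_mem (z i).2.1 (hy i _), ?_, fun i => ?_⟩
  · rw [map_add, hdy, add_zero]
    exact hz₀'
  · have := hnext i (z i)
    rw [map_add, hdy, add_zero, hz, map_add, ← add_sub_cancel_left (δ (y i (z i))) (d _), this]
    abel

section Lifts

variable (c : DualCoords k A) {M : GrMod k A}

-- Jets of boundaries are boundaries of jets: projectivity of the differential operators lifts `x`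
-- along `d`, and pointwise primitives may be replaced by their homogeneous parts of the right
-- weight and degree.
include c in
lemma exists_jets_d_eq [CharZero k] {p n m : ℤ} (hm : n + 1 = m) {x : DiffOps k A →ₗ[A] M.carrier}
    (hx : x ∈ jets M p m) (h : ∀ P, ∃ w, M.d w = x P) :
    ∃ z ∈ jets M p n, M.dBase ∘ₗ z = x := by
  subst hm
  have : Module.Projective A (DiffOps k A) := c.projective
  obtain ⟨l, hl⟩ := exists_lift (M.dBase ∘ₗ (M.compBase p n).subtype) x fun P => by
    obtain ⟨w, hw⟩ := h P
    refine ⟨⟨M.pr p n w, GrMod.pr_mem p n w⟩, ?_⟩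
    change M.d (M.pr p n w) = x P
    rw [← GrMod.d_pr, hw, GrMod.pr_of_mem (hx P)]
  exact ⟨(M.compBase p n).subtype ∘ₗ l, fun P => (l P).2, LinearMap.ext hl⟩

variable (M) in
/-- The homogeneous cycles, as a module over the functions. -/
noncomputable def cycBase (p n : ℤ) : Submodule A M.carrier :=
  M.compBase p n ⊓ LinearMap.ker M.dBase

variable (M) in
/-- The class of a homogeneous cycle. -/
noncomputable def cycCl (p n : ℤ) : cycBase M p n →ₗ[A] M.hMod.carrier where
  toFun x := GrMod.cl x.1 x.2.2
  map_add' x y := GrMod.cl_add x.2.2 y.2.2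
  map_smul' a x := GrMod.cl_smul (algebraMap A (Forms k A) a) x.2.2

-- Projectivity again: the map from homogeneous cycles to their classes is lifted along. With
-- `exists_jets_d_eq` this says that the cohomology of jets is the jets of the cohomology.
include c in
lemma exists_jets_cl_eq [CharZero k] {p n : ℤ} {x : DiffOps k A →ₗ[A] M.hMod.carrier}
    (hx : x ∈ jets M.hMod p n) :
    ∃ y ∈ jets M p n, ∃ hy : ∀ P, M.d (y P) = 0, ∀ P, GrMod.cl (y P) (hy P) = x P := by
  have : Module.Projective A (DiffOps k A) := c.projective
  obtain ⟨l, hl⟩ := exists_lift (cycCl M p n) x fun P => by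
    obtain ⟨y, hy, hy', h⟩ := GrMod.mem_hComp.1 (hx P)
    exact ⟨⟨y, hy', hy⟩, h⟩
  exact ⟨(cycBase M p n).subtype ∘ₗ l, fun P => (l P).2.1, fun P => (l P).2.2, hl⟩

/-- The classes of a family of cycles. -/
noncomputable def clMap (x : DiffOps k A →ₗ[A] M.carrier) (hx : ∀ P, M.d (x P) = 0) :
    DiffOps k A →ₗ[A] M.hMod.carrier where
  toFun P := GrMod.cl (x P) (hx P)
  map_add' P Q := (GrMod.cl_congr _ (map_add x P Q)).trans (GrMod.cl_add (hx P) (hx Q))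
  map_smul' a P := (GrMod.cl_congr _ (map_smul x a P)).trans
    (GrMod.cl_smul (algebraMap A (Forms k A) a) (hx P))

lemma clMap_apply (x : DiffOps k A →ₗ[A] M.carrier) (hx : ∀ P, M.d (x P) = 0) (P : DiffOps k A) :
    clMap x hx P = GrMod.cl (x P) (hx P) := rfl

lemma clMap_mem {x : DiffOps k A →ₗ[A] M.carrier} (hx : ∀ P, M.d (x P) = 0) {p n : ℤ}
    (h : x ∈ jets M p n) : clMap x hx ∈ jets M.hMod p n := fun P => GrMod.cl_mem (hx P) (h P)

end Lifts

/-- The map `P ↦ P(1) m`. -/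
noncomputable def constJet {X : Type*} [AddCommGroup X] [Module A X] (m : X) :
    DiffOps k A →ₗ[A] X where
  toFun P := P.1 1 • m
  map_add' P Q := add_smul (P.1 1) (Q.1 1) m
  map_smul' a P := mul_smul a (P.1 1) m

lemma constJet_one {X : Type*} [AddCommGroup X] [Module A X] (m : X) :
    constJet (k := k) (A := A) m 1 = m := one_smul A m

lemma constJet_apply {X : Type*} [AddCommGroup X] [Module A X] (m : X) (P : DiffOps k A) :
    constJet (k := k) (A := A) m P = P.1 1 • m := rfl

lemma constJet_mem {M : GrMod k A} {p n : ℤ} {m : M.carrier} (hm : m ∈ M.comp p n) :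
    constJet m ∈ jets M p n := fun _ => GrMod.base_smul_mem _ hm

lemma d_constJet {M : GrMod k A} (m : M.carrier) (P : DiffOps k A) :
    M.d (constJet (k := k) (A := A) m P) = constJet (k := k) (A := A) (M.d m) P :=
  GrMod.d_base_smul _ _

variable (c : DualCoords k A)

lemma clMap_del {M : MixedMod k A} (x : DiffOps k A →ₗ[A] M.carrier) (hx : ∀ P, M.d (x P) = 0)
    (hx' : ∀ P, M.d (del c M x P) = 0) :
    del c M.hMixed (clMap x hx) = clMap (del c M x) hx' := by
  ext P
  have hd (s : Finset (Fin c.card)) :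
      M.d (∑ i ∈ s, dOne k A (c.x i) • x (ofDer (c.θ i) * P)) = 0 := by
    rw [map_sum]
    exact Finset.sum_eq_zero fun i _ => by rw [GrMod.d_forms_smul, hx, smul_zero]
  have h (s : Finset (Fin c.card)) : GrMod.cl (M := M.toGrMod)
      (∑ i ∈ s, dOne k A (c.x i) • x (ofDer (c.θ i) * P)) (hd s) =
      ∑ i ∈ s, dOne k A (c.x i) • GrMod.cl (M := M.toGrMod) (x (ofDer (c.θ i) * P)) (hx _) := by
    classical
    induction s using Finset.induction_on with
    | empty => exact GrMod.cl_zero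
    | insert i s hi ih =>
      refine (GrMod.cl_congr _ (Finset.sum_insert hi)).trans ?_
      refine (GrMod.cl_add (M.cyc.smul_mem _ (hx _)) (hd s)).trans ?_
      rw [ih, Finset.sum_insert hi]
      rfl
  have hε : M.d (M.ε (x P)) = 0 := by
    have := M.d_ε (x P)
    rwa [hx, map_zero, add_zero] at this
  change GrMod.cl (M.ε (x P)) hε - ∑ i, dOne k A (c.x i) •
    GrMod.cl (M := M.toGrMod) (x (ofDer (c.θ i) * P)) (hx _) = _
  rw [← h]
  rfl

lemma d_del_eq_zero {M : MixedMod k A} {x : DiffOps k A →ₗ[A] M.carrier}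
    (hx : ∀ P, M.d (x P) = 0) (P : DiffOps k A) : M.d (del c M x P) = 0 := by
  have h := LinearMap.congr_fun (dBase_comp_del c M x) P
  have h0 : M.dBase ∘ₗ x = 0 := LinearMap.ext hx
  rw [h0, map_zero, add_zero] at h
  exact h

/-- The sequences of jets with values in the parts of weight `0`, `1`, `2`, ... and of degree `n`. -/
noncomputable def totJets (M : GrMod k A) (n : ℤ) : AddSubgroup (ℕ → DiffOps k A →ₗ[A] M.carrier) where
  carrier := {φ | ∀ i : ℕ, φ i ∈ jets M i n}
  zero_mem' := fun i => zero_mem (jets M i n)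
  add_mem' := fun h h' i => add_mem (h i) (h' i)
  neg_mem' := fun h i => neg_mem (h i)

/-- The total differential on sequences of jets. -/
noncomputable def totDel (M : MixedMod k A) :
    (ℕ → DiffOps k A →ₗ[A] M.carrier) →+ (ℕ → DiffOps k A →ₗ[A] M.carrier) where
  toFun φ
    | 0 => M.dBase ∘ₗ φ 0
    | i + 1 => M.dBase ∘ₗ φ (i + 1) + del c M (φ i)
  map_zero' := by
    funext i
    rcases i with _ | i
    · exact LinearMap.comp_zero _
    · change M.dBase ∘ₗ 0 + del c M 0 = 0
      rw [LinearMap.comp_zero, map_zero, add_zero]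
  map_add' φ ψ := by
    funext i
    rcases i with _ | i
    · exact LinearMap.comp_add _ _ _
    · change M.dBase ∘ₗ (φ (i + 1) + ψ (i + 1)) + del c M (φ i + ψ i) =
        (M.dBase ∘ₗ φ (i + 1) + del c M (φ i)) + (M.dBase ∘ₗ ψ (i + 1) + del c M (ψ i))
      rw [LinearMap.comp_add, map_add]
      abel

variable {M : MixedMod k A}

lemma totDel_zero (φ : ℕ → DiffOps k A →ₗ[A] M.carrier) :
    totDel c M φ 0 = M.dBase ∘ₗ φ 0 := rfl

lemma totDel_succ (φ : ℕ → DiffOps k A →ₗ[A] M.carrier) (i : ℕ) :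
    totDel c M φ (i + 1) = M.dBase ∘ₗ φ (i + 1) + del c M (φ i) := rfl

lemma dBase_dBase (φ : DiffOps k A →ₗ[A] M.carrier) : M.dBase ∘ₗ M.dBase ∘ₗ φ = 0 :=
  LinearMap.ext fun P => M.d_d (φ P)

lemma totDel_totDel [CharZero k] (φ : ℕ → DiffOps k A →ₗ[A] M.carrier) :
    totDel c M (totDel c M φ) = 0 := by
  have h (i : ℕ) := dBase_comp_del c M (φ i)
  funext i
  rcases i with _ | _ | i
  · exact dBase_dBase _
  · rw [totDel_succ, totDel_succ, totDel_zero, LinearMap.comp_add, dBase_dBase, zero_add]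
    exact h 0
  · rw [totDel_succ, totDel_succ, totDel_succ, LinearMap.comp_add, dBase_dBase, zero_add, map_add,
      del_del, add_zero]
    exact h (i + 1)

lemma totDel_mem {φ : ℕ → DiffOps k A →ₗ[A] M.carrier} {n m : ℤ} (hm : n + 1 = m)
    (hφ : φ ∈ totJets M.toGrMod n) : totDel c M φ ∈ totJets M.toGrMod m := by
  subst hm
  intro i
  rcases i with _ | i
  · exact fun P => M.d_mem (hφ 0 P)
  · refine add_mem (fun P => M.d_mem (hφ (i + 1) P)) ?_
    have := del_mem c (hφ i)
    rw [Nat.cast_succ]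
    exact this

lemma del_jets_mem {p n : ℤ} {i : ℕ} {φ : DiffOps k A →ₗ[A] M.carrier}
    (hp : p = i) (hφ : φ ∈ jets M.toGrMod p n) :
    del c M φ ∈ jets M.toGrMod ((i + 1 : ℕ) : ℤ) (n + 1) := by
  subst hp
  rw [Nat.cast_succ]
  exact del_mem c hφ

/-- Postcomposition with the differential, as an additive map. -/
noncomputable def dJet (M : GrMod k A) :
    (DiffOps k A →ₗ[A] M.carrier) →+ (DiffOps k A →ₗ[A] M.carrier) where
  toFun φ := M.dBase ∘ₗ φ
  map_zero' := LinearMap.comp_zero _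
  map_add' φ ψ := LinearMap.comp_add φ ψ M.dBase

/-- By projectivity each row is exact for `d`, so the recursion of `exists_total_eq` runs with all
corrections `y` equal to zero. -/
lemma exists_totDel_eq_of_acyclic [CharZero k] (hM : M.IsAcyclic) {n m : ℤ} (hm : n + 1 = m)
    {φ : ℕ → DiffOps k A →ₗ[A] M.carrier} (hφ : φ ∈ totJets M.toGrMod m)
    (h : totDel c M φ = 0) : ∃ ψ ∈ totJets M.toGrMod n, totDel c M ψ = φ := by
  have key (i : ℕ) (x) (hx : x ∈ jets M.toGrMod i m) (hdx : dJet M.toGrMod x = 0) :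
      ∃ z ∈ jets M.toGrMod i n, dJet M.toGrMod z = x :=
    exists_jets_d_eq c hm hx fun P => hM _ (LinearMap.congr_fun hdx P)
  obtain ⟨ψ, h1, h2, h3⟩ := exists_total_eq (dJet M.toGrMod) (del c M) (del_del c M)
    (dBase_comp_del c M) (fun i => jets M.toGrMod i n) (fun i => jets M.toGrMod i m)
    (fun x hx hdx _ => key 0 x hx hdx)
    (fun i x hx hdx _ => by
      obtain ⟨z, hz, hz'⟩ := key (i + 1) x hx hdx
      exact ⟨0, zero_mem _, z, hz, map_zero _, by rw [map_zero, zero_add, hz']⟩)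
    (fun i x hx => by subst hm; exact del_jets_mem c rfl hx) φ hφ (congrFun h 0)
    (fun i => congrFun h (i + 1))
  refine ⟨ψ, h1, funext fun i => ?_⟩
  rcases i with _ | i
  · exact h2
  · exact h3 i

/-- Passing to `d`-cohomology of the rows leaves jets with values in the cohomology of `M`, with
differential `del`. There the formal Poincaré lemma gives exactness apart from the value at `1` in
weight zero, and `exists_total_eq` carries this back to the total complex. -/
lemma exists_totDel_eq_of_contraction [CharZero k] (K : Contraction c M.toGrMod.hMod) {n m : ℤ}
    (hm : n + 1 = m) {φ : ℕ → DiffOps k A →ₗ[A] M.carrier} (hφ : φ ∈ totJets M.toGrMod m)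
    (h : totDel c M φ = 0) (h1 : φ 0 1 = 0) :
    ∃ ψ ∈ totJets M.toGrMod n, ψ 0 1 = 0 ∧ totDel c M ψ = φ := by
  -- The rows are restricted by vanishing at `1` in weight zero, the only place where the Poincaré
  -- lemma leaves cohomology.
  let C (n : ℤ) (i : ℕ) : AddSubgroup (DiffOps k A →ₗ[A] M.carrier) :=
    { jets M.toGrMod i n with
      carrier := {φ | φ ∈ jets M.toGrMod i n ∧ (i = 0 → φ 1 = 0)}
      zero_mem' := ⟨zero_mem _, fun _ => rfl⟩
      add_mem' := fun {x y} hx hy => ⟨add_mem hx.1 hy.1, fun hi => by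
        rw [LinearMap.add_apply, hx.2 hi, hy.2 hi, add_zero]⟩
      neg_mem' := fun {x} hx => ⟨neg_mem hx.1, fun hi => by
        rw [LinearMap.neg_apply, hx.2 hi, neg_zero]⟩ }
  have hcl {x : DiffOps k A →ₗ[A] M.carrier} (hdx : ∀ P, M.d (x P) = 0)
      (hw : ∃ w, dJet M.toGrMod w = del c M x) : del c M.hMixed (clMap x hdx) = 0 := by
    obtain ⟨w, hw⟩ := hw
    rw [clMap_del c x hdx (d_del_eq_zero c hdx)]
    exact LinearMap.ext fun P => GrMod.cl_eq_zero.2 ⟨w P, LinearMap.congr_fun hw P⟩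
  have hb {p : ℤ} {x : DiffOps k A →ₗ[A] M.carrier} (hx : x ∈ jets M.toGrMod p m)
      (hdx : ∀ P, M.d (x P) = 0) (h0 : clMap x hdx = 0) :
      ∃ z ∈ jets M.toGrMod p n, dJet M.toGrMod z = x :=
    exists_jets_d_eq c hm hx fun P => GrMod.cl_eq_zero.1 (LinearMap.congr_fun h0 P)
  have hconst {m : M.carrier} (hm : M.d m = 0) (P : DiffOps k A) :
      M.d (constJet (k := k) (A := A) m P) = 0 := by
    rw [d_constJet, hm]; exact smul_zero _
  obtain ⟨ψ, g1, g2, g3⟩ := exists_total_eq (dJet M.toGrMod) (del c M) (del_del c M)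
    (dBase_comp_del c M) (C n) (C m)
    (fun x hx hdx hw => by
      have hdx' : ∀ P, M.d (x P) = 0 := LinearMap.congr_fun hdx
      obtain ⟨z, hz, hz'⟩ := hb hx.1 hdx' (K.eq_zero_of_del_eq_zero (W := M.hMixed)
        (clMap_mem hdx' hx.1) 
          ((GrMod.cl_congr _ (hx.2 rfl)).trans GrMod.cl_zero) (hcl hdx' hw))
      have hz1 : M.d (z 1) = 0 := (LinearMap.congr_fun hz' 1).trans (hx.2 rfl)
      -- The primitive need not vanish at `1`. Its value there is a cycle because `x 1 = 0`, so
      -- subtracting the corresponding constant jet does not affect its boundary.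
      refine ⟨z - constJet (z 1), ⟨sub_mem hz (constJet_mem (hz 1)), fun _ => ?_⟩, ?_⟩
      · rw [LinearMap.sub_apply, constJet_one, sub_self]
      · rw [map_sub, hz', sub_eq_self]
        exact LinearMap.ext (hconst hz1))
    (fun i x hx hdx hw => by
      have hdx' : ∀ P, M.d (x P) = 0 := LinearMap.congr_fun hdx
      obtain ⟨ψ, hψ, hψ1, hψ2⟩ := K.exists_del_eq (W := M.hMixed) (by omega)
        (clMap_mem hdx' hx.1) (hcl hdx' hw)
      rw [show ((i + 1 : ℕ) : ℤ) - 1 = i by push_cast; ring, show m - 1 = n by omega] at hψ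
      obtain ⟨y, hy, hdy, hyψ⟩ := exists_jets_cl_eq c hψ
      obtain ⟨b, hb1⟩ := GrMod.cl_eq_zero.1 ((hyψ 1).trans hψ1)
      -- The Poincaré primitive vanishes at `1` in cohomology only, so `y 1` is a boundary `d b`.
      -- Removing the constant jet at `y 1` makes the representative vanish at `1` without changing
      -- its class.
      let y' := y - constJet (y 1)
      have hdy' : ∀ P, M.d (y' P) = 0 := fun P => by
        rw [LinearMap.sub_apply, map_sub, hdy, hconst (hdy 1), sub_zero]
      have hyψ' : clMap y' hdy' = ψ := LinearMap.ext fun P => by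
        rw [← hyψ]
        refine GrMod.cl_eq_cl.2 ⟨-(P.1 1 • b), ?_⟩
        rw [map_neg, GrMod.d_base_smul, hb1, LinearMap.sub_apply, constJet_apply, sub_sub_cancel_left]
      have hy' : y' ∈ jets M.toGrMod i n := sub_mem hy (constJet_mem (hy 1))
      have hx' : ∀ P, M.d ((x - del c M y') P) = 0 := fun P => by
        rw [LinearMap.sub_apply, map_sub, hdx', d_del_eq_zero c hdy', sub_zero]
      obtain ⟨z, hz, hz'⟩ := hb (p := ((i + 1 : ℕ) : ℤ)) (x := x - del c M y')
        (sub_mem hx.1 (by subst hm; exact del_jets_mem c rfl hy')) hx' (by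
          refine LinearMap.ext fun P => ?_
          have e1 := LinearMap.congr_fun hψ2 P
          rw [← hyψ', clMap_del c y' hdy' (d_del_eq_zero c hdy')] at e1
          rw [clMap_apply]
          refine (GrMod.cl_sub (hdx' P) (d_del_eq_zero c hdy' P)).trans ?_
          exact sub_eq_zero.2 e1.symm)
      refine ⟨y', ⟨hy', fun _ => ?_⟩, z, ⟨hz, fun h => by simp at h⟩, LinearMap.ext hdy', ?_⟩
      · rw [LinearMap.sub_apply, constJet_one, sub_self]
      · rw [hz', add_sub_cancel])
    (fun i x hx => ⟨by subst hm; exact del_jets_mem c rfl hx.1, fun h => by simp at h⟩) φ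
    (fun i => ⟨hφ i, fun hi => by subst hi; exact h1⟩) (congrFun h 0) (fun i => congrFun h (i + 1))
  refine ⟨ψ, fun i => (g1 i).1, (g1 0).2 rfl, funext fun i => ?_⟩
  rcases i with _ | i
  · exact g2
  · exact g3 i

end TotalJets

end DeRhamMixed

namespace DeRhamMixed

/-! ### Quasi-isomorphisms and acyclicity tested on elements. -/

section ElementwiseQuasiIso

lemma ab_homologyπ_eq_zero (K : CochainComplex AddCommGrpCat.{u} ℤ) {n m : ℤ} (hm : n + 1 = m)
    (z : K.cycles m) : K.homologyπ m z = 0 ↔ ∃ y : K.X n, K.d n m y = K.iCycles m z := by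
  have hS : (ShortComplex.mk (K.toCycles n m) (K.homologyπ m) (by simp)).Exact :=
    ShortComplex.exact_of_g_is_cokernel _ (K.homologyIsCokernel n m (by simp [← hm]))
  rw [ShortComplex.ab_exact_iff] at hS
  constructor
  · intro h
    obtain ⟨y, hy⟩ := hS z h
    refine ⟨y, ?_⟩
    rw [← hy, ← K.toCycles_i n m]
    rfl
  · rintro ⟨y, hy⟩
    have h : K.toCycles n m y = z := by
      apply (AddCommGrpCat.mono_iff_injective (K.iCycles m)).1 inferInstance
      rw [← hy, ← K.toCycles_i n m]
      rfl
    rw [← h]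
    exact ConcreteCategory.congr_hom (K.toCycles_comp_homologyπ n m) y

lemma ab_d_iCycles (K : CochainComplex AddCommGrpCat.{u} ℤ) (m l : ℤ) (z : K.cycles m) :
    K.d m l (K.iCycles m z) = 0 :=
  ConcreteCategory.congr_hom (K.iCycles_d m l) z

lemma ab_exists_cycle (K : CochainComplex AddCommGrpCat.{u} ℤ) {m l : ℤ} (hl : m + 1 = l)
    (x : K.X m) (hx : K.d m l x = 0) : ∃ z, K.iCycles m z = x := by
  have hS : (ShortComplex.mk (K.iCycles m) (K.d m l) (by simp)).Exact :=
    ShortComplex.exact_of_f_is_kernel _ (K.cyclesIsKernel m l (by simp [← hl]))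
  rw [ShortComplex.ab_exact_iff] at hS
  exact hS x hx

/-- A morphism of complexes of abelian groups is a quasi-isomorphism if and only if it is bijective
on cocycles modulo coboundaries. -/
lemma ab_quasiIso_iff {K L : CochainComplex AddCommGrpCat.{u} ℤ} (f : K ⟶ L) :
    QuasiIso f ↔ ∀ n m l : ℤ, n + 1 = m → m + 1 = l →
      (∀ x : K.X m, K.d m l x = 0 → (∃ y : L.X n, L.d n m y = f.f m x) → ∃ y, K.d n m y = x) ∧
      ∀ y : L.X m, L.d m l y = 0 → ∃ x : K.X m, K.d m l x = 0 ∧ ∃ y', L.d n m y' = y - f.f m x := by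
  have hf (m : ℤ) (z : K.cycles m) :
      L.iCycles m (HomologicalComplex.cyclesMap f m z) = f.f m (K.iCycles m z) :=
    ConcreteCategory.congr_hom (HomologicalComplex.cyclesMap_i f m) z
  have hπ (m : ℤ) (z : K.cycles m) : HomologicalComplex.homologyMap f m (K.homologyπ m z) =
      L.homologyπ m (HomologicalComplex.cyclesMap f m z) :=
    ConcreteCategory.congr_hom (HomologicalComplex.homologyπ_naturality f m) z
  have sK (m : ℤ) : Function.Surjective (K.homologyπ m) :=
    (AddCommGrpCat.epi_iff_surjective _).1 inferInstance
  have sL (m : ℤ) : Function.Surjective (L.homologyπ m) :=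
    (AddCommGrpCat.epi_iff_surjective _).1 inferInstance
  have inj (K : CochainComplex AddCommGrpCat.{u} ℤ) (m : ℤ) : Function.Injective (K.iCycles m) :=
    (AddCommGrpCat.mono_iff_injective _).1 inferInstance
  have hq (m : ℤ) : QuasiIsoAt f m ↔ Function.Bijective (HomologicalComplex.homologyMap f m) := by
    rw [quasiIsoAt_iff_isIso_homologyMap]
    exact ConcreteCategory.isIso_iff_bijective _
  rw [quasiIso_iff]
  simp only [hq]
  constructor
  · rintro h n m l rfl rfl
    obtain ⟨hi, hs⟩ := h (n + 1)
    refine ⟨fun x hx hy => ?_, fun y hy => ?_⟩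
    · obtain ⟨z, rfl⟩ := ab_exists_cycle K rfl x hx
      rw [← hf, ← ab_homologyπ_eq_zero L rfl, ← hπ] at hy
      exact (ab_homologyπ_eq_zero K rfl z).1 (hi (hy.trans (map_zero _).symm))
    · obtain ⟨z, rfl⟩ := ab_exists_cycle L rfl y hy
      obtain ⟨w, hw⟩ := hs (L.homologyπ _ z)
      obtain ⟨z', rfl⟩ := sK _ w
      refine ⟨K.iCycles _ z', ab_d_iCycles _ _ _ _, ?_⟩
      rw [← hf, ← map_sub, ← ab_homologyπ_eq_zero L rfl, map_sub, ← hπ, hw, sub_self]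
  · intro h m
    obtain ⟨hi, hs⟩ := h (m - 1) m (m + 1) (sub_add_cancel _ _) rfl
    refine ⟨?_, fun b => ?_⟩
    · rw [injective_iff_map_eq_zero]
      intro a ha
      obtain ⟨z, rfl⟩ := sK m a
      rw [hπ, ab_homologyπ_eq_zero L (sub_add_cancel m 1), hf] at ha
      exact (ab_homologyπ_eq_zero K (sub_add_cancel m 1) z).2 (hi _ (ab_d_iCycles _ _ _ _) ha)
    · obtain ⟨z, rfl⟩ := sL m b
      obtain ⟨x, hx, hy⟩ := hs _ (ab_d_iCycles L m (m + 1) z)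
      obtain ⟨z', rfl⟩ := ab_exists_cycle K rfl x hx
      refine ⟨K.homologyπ m z', ?_⟩
      rw [← hf, ← map_sub, ← ab_homologyπ_eq_zero L (sub_add_cancel m 1), map_sub, ← hπ,
        sub_eq_zero] at hy
      exact hy.symm

lemma ab_acyclic_iff (K : CochainComplex AddCommGrpCat.{u} ℤ) :
    K.Acyclic ↔ ∀ n m l : ℤ, n + 1 = m → m + 1 = l →
      ∀ x : K.X m, K.d m l x = 0 → ∃ y, K.d n m y = x := by
  constructor
  · rintro h n m l rfl rfl
    have := (HomologicalComplex.exactAt_iff' K n (n + 1) (n + 1 + 1) (by simp) (by simp)).1 (h _)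
    rw [ShortComplex.ab_exact_iff] at this
    exact this
  · intro h m
    rw [HomologicalComplex.exactAt_iff' K (m - 1) m (m + 1) (by simp) (by simp),
      ShortComplex.ab_exact_iff]
    exact h _ _ _ (sub_add_cancel _ _) rfl

variable {R : Type u} [Ring R]

/-- A morphism of complexes of modules is a quasi-isomorphism if and only if it is bijective
on cocycles modulo coboundaries. -/
lemma module_quasiIso_iff {K L : CochainComplex (ModuleCat.{u} R) ℤ} (f : K ⟶ L) :
    QuasiIso f ↔ ∀ n m l : ℤ, n + 1 = m → m + 1 = l →
      (∀ x : K.X m, (K.d m l).hom x = 0 → (∃ y : L.X n, (L.d n m).hom y = (f.f m).hom x) →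
        ∃ y, (K.d n m).hom y = x) ∧
      ∀ y : L.X m, (L.d m l).hom y = 0 →
        ∃ x : K.X m, (K.d m l).hom x = 0 ∧ ∃ y', (L.d n m).hom y' = y - (f.f m).hom x := by
  rw [← HomologicalComplex.quasiIso_map_iff_of_preservesHomology f (forget₂ (ModuleCat.{u} R) AddCommGrpCat.{u}),
    ab_quasiIso_iff]
  rfl

lemma module_acyclic_iff (K : CochainComplex (ModuleCat.{u} R) ℤ) :
    K.Acyclic ↔ ∀ n m l : ℤ, n + 1 = m → m + 1 = l →
      ∀ x : K.X m, (K.d m l).hom x = 0 → ∃ y, (K.d n m).hom y = x := by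
  constructor
  · rintro h n m l rfl rfl
    have := (HomologicalComplex.exactAt_iff' K n (n + 1) (n + 1 + 1) (by simp) (by simp)).1 (h _)
    rw [ShortComplex.moduleCat_exact_iff] at this
    exact this
  · intro h m
    rw [HomologicalComplex.exactAt_iff' K (m - 1) m (m + 1) (by simp) (by simp),
      ShortComplex.moduleCat_exact_iff]
    exact h _ _ _ (sub_add_cancel _ _) rfl

end ElementwiseQuasiIso

end DeRhamMixed

namespace DeRhamMixed

/-! ### The complex of jets as a complex of modules over the differential operators. -/

section JetsFunctor

variable {k : Type v} {A : Type u} [Field k] [CommRing A] [Algebra k A]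

/-- The action of a differential operator on jets. -/
noncomputable def jetAct {X : Type*} [AddCommGroup X] [Module A X] (P : DiffOps k A)
    (φ : DiffOps k A →ₗ[A] X) : DiffOps k A →ₗ[A] X := φ ∘ₗ mulRight P

lemma jetAct_apply {X : Type*} [AddCommGroup X] [Module A X] (P : DiffOps k A)
    (φ : DiffOps k A →ₗ[A] X) (R : DiffOps k A) : jetAct P φ R = φ (R * P) := rfl

/-- Sequences of jets form a module over the differential operators. -/
noncomputable instance totJetsModule (M : GrMod k A) (n : ℤ) :
    Module (DiffOps k A) (totJets M n) where
  smul P φ := ⟨fun i => jetAct P (φ.1 i), fun i R => φ.2 i (R * P)⟩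
  one_smul φ := Subtype.ext (funext fun i => LinearMap.ext fun R => congrArg (φ.1 i) (mul_one R))
  mul_smul P Q φ := Subtype.ext (funext fun i => LinearMap.ext fun R =>
    congrArg (φ.1 i) (mul_assoc R P Q).symm)
  smul_zero _ := rfl
  smul_add _ _ _ := rfl
  add_smul P Q φ := Subtype.ext (funext fun i => LinearMap.ext fun R =>
    (congrArg (φ.1 i) (mul_add R P Q)).trans (map_add (φ.1 i) _ _))
  zero_smul φ := Subtype.ext (funext fun i => LinearMap.ext fun R =>
    (congrArg (φ.1 i) (mul_zero R)).trans (map_zero (φ.1 i)))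

variable (c : DualCoords k A)

/-- The operator `del` multiplies the argument of a jet on the left and the module structure
multiplies it on the right, so the two commute by associativity. -/
lemma del_jetAct (M : MixedMod k A) (P : DiffOps k A) (φ : DiffOps k A →ₗ[A] M.carrier) :
    del c M (jetAct P φ) = jetAct P (del c M φ) := by
  ext R
  rw [jetAct_apply, del_apply, del_apply]
  simp only [jetAct_apply, mul_assoc]


/-- The postcomposition of sequences of jets with a morphism. -/
noncomputable def jetsMapLin {M N : MixedMod k A} (f : M ⟶ N) (n : ℤ) :
    totJets M.toGrMod n →ₗ[DiffOps k A] totJets N.toGrMod n where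
  toFun φ := ⟨fun i => (MixedMod.lin f).restrictScalars A ∘ₗ φ.1 i, fun i P =>
    MixedMod.lin_mem f (φ.2 i P)⟩
  map_add' _ _ := Subtype.ext (funext fun _ => LinearMap.comp_add _ _ _)
  map_smul' _ _ := rfl

lemma dBase_comp_lin {M N : MixedMod k A} (f : M ⟶ N) (φ : DiffOps k A →ₗ[A] M.carrier) :
    N.dBase ∘ₗ (MixedMod.lin f).restrictScalars A ∘ₗ φ =
      (MixedMod.lin f).restrictScalars A ∘ₗ M.dBase ∘ₗ φ :=
  LinearMap.ext fun P => (MixedMod.lin_d f (φ P)).symm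

lemma totDel_jetsMapLin {M N : MixedMod k A} (f : M ⟶ N) (φ : ℕ → DiffOps k A →ₗ[A] M.carrier) :
    totDel c N (fun i => (MixedMod.lin f).restrictScalars A ∘ₗ φ i) =
      fun i => (MixedMod.lin f).restrictScalars A ∘ₗ totDel c M φ i := by
  funext i
  rcases i with _ | i
  · exact dBase_comp_lin f _
  · rw [totDel_succ, totDel_succ, LinearMap.comp_add, dBase_comp_lin, del_comp_lin]

/-- The total differential of the complex of jets. -/
noncomputable def jetsD (M : MixedMod k A) {n m : ℤ} (h : n + 1 = m) :
    totJets M.toGrMod n →ₗ[DiffOps k A] totJets M.toGrMod m where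
  toFun φ := ⟨totDel c M φ.1, totDel_mem c h φ.2⟩
  map_add' φ ψ := Subtype.ext (map_add (totDel c M) φ.1 ψ.1)
  map_smul' P φ := by
    refine Subtype.ext (funext fun i => ?_)
    rcases i with _ | i
    · rfl
    · change M.dBase ∘ₗ jetAct P (φ.1 (i + 1)) + del c M (jetAct P (φ.1 i)) =
        jetAct P (M.dBase ∘ₗ φ.1 (i + 1) + del c M (φ.1 i))
      rw [del_jetAct]
      rfl

/-- The complex of jets of a graded mixed dg-module. -/
noncomputable def jetsObj [CharZero k] (M : MixedMod k A) : CochainComplex (ModuleCat.{u} (DiffOps k A)) ℤ where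
  X n := ModuleCat.of (DiffOps k A) (totJets M.toGrMod n)
  d n m := if h : n + 1 = m then ModuleCat.ofHom (jetsD c M h) else 0
  shape n m h := dif_neg h
  d_comp_d' n m l hnm hml := by
    obtain rfl : n + 1 = m := hnm
    obtain rfl : n + 1 + 1 = l := hml
    rw [dif_pos rfl, dif_pos rfl]
    refine ModuleCat.hom_ext (LinearMap.ext fun φ => Subtype.ext ?_)
    exact totDel_totDel c φ.1

lemma jetsObj_d [CharZero k] (M : MixedMod k A) {n m : ℤ} (h : n + 1 = m) :
    (jetsObj c M).d n m = ModuleCat.ofHom (jetsD c M h) := dif_pos h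

lemma jetsObj_d_apply [CharZero k] (M : MixedMod k A) {n m : ℤ} (h : n + 1 = m) (φ : totJets M.toGrMod n) :
    (((jetsObj c M).d n m).hom φ : totJets M.toGrMod m).1 = totDel c M φ.1 := by
  rw [jetsObj_d c M h]
  rfl

lemma jetsObj_d_eq [CharZero k] (M : MixedMod k A) {n m : ℤ} (h : n + 1 = m) (φ : totJets M.toGrMod n)
    (ψ : totJets M.toGrMod m) :
    ((jetsObj c M).d n m).hom φ = ψ ↔ totDel c M φ.1 = ψ.1 := by
  rw [jetsObj_d c M h]
  exact Subtype.ext_iff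

/-- The functor of jets, from graded mixed dg-modules to complexes of left modules over the
differential operators. -/
noncomputable def jetsFun [CharZero k] : MixedMod k A ⥤ CochainComplex (ModuleCat.{u} (DiffOps k A)) ℤ where
  obj M := jetsObj c M
  map {M N} f :=
    { f := fun n => ModuleCat.ofHom (jetsMapLin f n)
      comm' := fun n m h => by
        rw [jetsObj_d c M h, jetsObj_d c N h]
        exact ModuleCat.hom_ext (LinearMap.ext fun φ => Subtype.ext (totDel_jetsMapLin c f φ.1)) }
  map_id _ := rfl
  map_comp _ _ := rfl

/-- Besides serving for cones, this is what makes the resolution of a de Rham complex K-projective.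
-/
lemma jetsObj_acyclic [CharZero k] {M : MixedMod k A} (hM : M.IsAcyclic) : (jetsObj c M).Acyclic := by
  rw [module_acyclic_iff]
  intro n m l hnm hml φ hφ
  obtain ⟨ψ, hψ, h⟩ := exists_totDel_eq_of_acyclic c hM hnm φ.2 ((jetsObj_d_eq c M hml φ 0).1 hφ)
  exact ⟨⟨ψ, hψ⟩, (jetsObj_d_eq c M hnm _ _).2 h⟩

end JetsFunctor

/-! ### Mapping cones, and jets of quasi-isomorphisms. -/

section Cone

variable {k : Type v} {A : Type u} [Field k] [CommRing A] [Algebra k A]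

namespace MixedMod

variable {X Y : MixedMod k A} (f : X ⟶ Y)

/-- The mapping cone of a morphism of graded mixed dg-modules. -/
noncomputable def cone : MixedMod k A where
  carrier := Y.carrier × X.carrier
  comp p n := (Y.comp p n).prod (X.comp p (n + 1))
  isInternal := by
    refine isInternal_of_proj _ (fun i => (Y.pr i.1 i.2).prodMap (X.pr i.1 (i.2 + 1)))
      ?_ ?_ ?_
    · rintro ⟨p, n⟩ ⟨y, x⟩ ⟨hy, hx⟩
      exact Prod.ext (GrMod.pr_of_mem hy) (GrMod.pr_of_mem hx)
    · rintro ⟨p, n⟩ ⟨p', n'⟩ hne ⟨y, x⟩ ⟨hy, hx⟩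
      refine Prod.ext (GrMod.pr_of_mem_ne hy hne) (GrMod.pr_of_mem_ne hx fun h => hne ?_)
      rw [Prod.mk.injEq] at h ⊢
      exact ⟨h.1, by linarith [h.2]⟩
    · intro H hH
      rw [eq_top_iff]
      rintro ⟨y, x⟩ -
      have h1 : (y, (0 : X.carrier)) ∈ H := by
        induction y using GrMod.induction with
        | h0 => exact zero_mem H
        | ha y y' hy hy' =>
          have := add_mem hy hy'
          rwa [Prod.mk_add_mk, add_zero] at this
        | h p n y hy => exact hH (p, n) ⟨hy, zero_mem _⟩
      have h2 : ((0 : Y.carrier), x) ∈ H := by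
        induction x using GrMod.induction with
        | h0 => exact zero_mem H
        | ha y y' hy hy' =>
          have := add_mem hy hy'
          rwa [Prod.mk_add_mk, add_zero] at this
        | h p n x hx =>
          refine hH (p, n - 1) ⟨zero_mem _, ?_⟩
          change x ∈ X.comp p (n - 1 + 1)
          rwa [sub_add_cancel]
      have := add_mem h1 h2
      rwa [Prod.mk_add_mk, add_zero, zero_add] at this
  smul_mem := fun {q ω p n z} hω hz => ⟨Y.smul_mem hω hz.1, by
    have := X.smul_mem hω hz.2
    rwa [add_right_comm] at this⟩
  -- A shift of `X` would normally twist the action of the forms and `ε` by signs. Here both stay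
  -- untwisted, and the involution `X.inv` in the off-diagonal term carries the signs.
  d := ((Y.d.comp (AddMonoidHom.fst _ _)) + (MixedMod.lin f).toAddMonoidHom.comp
    (X.inv.comp (AddMonoidHom.snd _ _))).prod (-(X.d.comp (AddMonoidHom.snd _ _)))
  d_mem := fun {p n z} hz => ⟨add_mem (Y.d_mem hz.1) (MixedMod.lin_mem f (GrMod.inv_mem hz.2)),
    neg_mem (X.d_mem hz.2)⟩
  d_d z := Prod.ext (by
    change Y.d (Y.d z.1 + MixedMod.lin f (X.inv z.2)) + MixedMod.lin f (X.inv (-X.d z.2)) = 0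
    rw [map_add, Y.d_d, zero_add, ← MixedMod.lin_d, map_neg, GrMod.inv_d, map_neg, add_neg_cancel])
    (by
    change -X.d (-X.d z.2) = 0
    rw [map_neg, X.d_d, neg_zero, neg_zero])
  d_smul := fun {q ω} z hω => Prod.ext (by
    change Y.d (ω • z.1) + MixedMod.lin f (X.inv (ω • z.2)) =
      (-1 : ℤ) ^ q • ω • (Y.d z.1 + MixedMod.lin f (X.inv z.2))
    rw [Y.d_smul _ hω, GrMod.inv_forms_smul, sgn_of_mem k A hω, GrMod.zsmul_forms_smul, map_zsmul,
      map_smul, smul_add, smul_add]) (by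
    change -X.d (ω • z.2) = (-1 : ℤ) ^ q • ω • (-X.d z.2)
    rw [X.d_smul _ hω, smul_neg, smul_neg])
  ε := Y.ε.prodMap X.ε
  ε_mem := fun hz => ⟨Y.ε_mem hz.1, by
    have := X.ε_mem hz.2
    rwa [add_right_comm] at this⟩
  ε_ε z := Prod.ext (Y.ε_ε z.1) (X.ε_ε z.2)
  d_ε z := Prod.ext (by
    change Y.d (Y.ε z.1) + MixedMod.lin f (X.inv (X.ε z.2)) +
      Y.ε (Y.d z.1 + MixedMod.lin f (X.inv z.2)) = 0
    rw [map_add, Y.ε_d, inv_ε, map_neg, MixedMod.lin_ε]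
    abel) (by
    change -X.d (X.ε z.2) + X.ε (-X.d z.2) = 0
    rw [map_neg, X.ε_d, neg_neg, neg_add_cancel])
  ε_smul z hω := Prod.ext (Y.ε_smul z.1 hω) (X.ε_smul z.2 hω)

lemma qis_iff : MixedMod.qis k A f ↔
    (∀ x : X.carrier, X.d x = 0 → (∃ y, Y.d y = MixedMod.lin f x) → ∃ x', X.d x' = x) ∧
      ∀ y : Y.carrier, Y.d y = 0 → ∃ x, X.d x = 0 ∧ ∃ y', Y.d y' = y - MixedMod.lin f x := Iff.rfl

lemma cone_isAcyclic (hf : MixedMod.qis k A f) : (cone f).IsAcyclic := by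
  rintro ⟨y, x⟩ hz
  have hz1 : Y.d y + MixedMod.lin f (X.inv x) = 0 := congrArg Prod.fst hz
  have hz2 : X.d x = 0 := neg_eq_zero.1 (congrArg Prod.snd hz)
  rw [qis_iff] at hf
  obtain ⟨x', hx'⟩ := hf.1 (X.inv x) (by rw [← GrMod.inv_d, hz2, map_zero])
    ⟨-y, by rw [map_neg]; exact neg_eq_of_add_eq_zero_right hz1⟩
  obtain ⟨x'', hx'', y', hy'⟩ := hf.2 (y + MixedMod.lin f x') (by
    rw [map_add, ← MixedMod.lin_d, hx', hz1])
  refine ⟨(y', X.inv (x'' - x')), Prod.ext ?_ ?_⟩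
  · change Y.d y' + MixedMod.lin f (X.inv (X.inv (x'' - x'))) = y
    rw [GrMod.inv_inv, hy', map_sub]
    abel
  · change -X.d (X.inv (x'' - x')) = x
    rw [← GrMod.inv_d, map_sub, hx'', hx', zero_sub, map_neg, neg_neg, GrMod.inv_inv]

end MixedMod

variable (c : DualCoords k A)

/-- The sign by weight, as a linear map over the functions. -/
noncomputable def GrMod.invBase (M : GrMod k A) : M.carrier →ₗ[A] M.carrier :=
  { M.inv with map_smul' := GrMod.inv_base_smul }

lemma del_inv (M : MixedMod k A) (φ : DiffOps k A →ₗ[A] M.carrier) :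
    del c M (M.invBase ∘ₗ φ) = -(M.invBase ∘ₗ del c M φ) := by
  ext P
  change M.ε (M.inv (φ P)) - ∑ i, dOne k A (c.x i) • M.inv (φ (ofDer (c.θ i) * P)) =
    -M.inv (M.ε (φ P) - ∑ i, dOne k A (c.x i) • φ (ofDer (c.θ i) * P))
  rw [map_sub, MixedMod.inv_ε, map_sum, neg_sub', neg_neg, ← Finset.sum_neg_distrib]
  congr 1
  refine Finset.sum_congr rfl fun i _ => ?_
  rw [GrMod.inv_forms_smul, sgn_dOne, neg_smul, neg_neg]

lemma del_comp {M N : MixedMod k A} (g : M.carrier →ₗ[A] N.carrier)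
    (hg : ∀ x, g (M.ε x) = N.ε (g x)) (hg' : ∀ (a : A) x, g (dOne k A a • x) = dOne k A a • g x)
    (φ : DiffOps k A →ₗ[A] M.carrier) : del c N (g ∘ₗ φ) = g ∘ₗ del c M φ := by
  ext P
  rw [LinearMap.comp_apply, del_apply, del_apply, map_sub, map_sum, hg]
  simp only [hg', LinearMap.comp_apply]

section

variable {X Y : MixedMod k A} (f : X ⟶ Y)

/-- The first projection of the mapping cone. -/
noncomputable def coneFst : (MixedMod.cone f).carrier →ₗ[A] Y.carrier where
  toFun z := z.1
  map_add' _ _ := rfl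
  map_smul' _ _ := rfl

/-- The second projection of the mapping cone. -/
noncomputable def coneSnd : (MixedMod.cone f).carrier →ₗ[A] X.carrier where
  toFun z := z.2
  map_add' _ _ := rfl
  map_smul' _ _ := rfl

/-- Sequences of jets of the mapping cone. -/
noncomputable def coneJet (ψ : ℕ → DiffOps k A →ₗ[A] Y.carrier)
    (φ : ℕ → DiffOps k A →ₗ[A] X.carrier) (i : ℕ) :
    DiffOps k A →ₗ[A] (MixedMod.cone f).carrier where
  toFun P := (ψ i P, X.inv (φ i P))
  map_add' P Q := Prod.ext (map_add _ _ _) (by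
    change X.inv (φ i (P + Q)) = X.inv (φ i P) + X.inv (φ i Q)
    rw [map_add, map_add])
  map_smul' a P := Prod.ext (map_smul _ _ _) (by
    change X.inv (φ i (a • P)) = a • X.inv (φ i P)
    rw [map_smul, GrMod.inv_base_smul])

lemma coneFst_coneJet (ψ : ℕ → DiffOps k A →ₗ[A] Y.carrier)
    (φ : ℕ → DiffOps k A →ₗ[A] X.carrier) (i : ℕ) : coneFst f ∘ₗ coneJet f ψ φ i = ψ i := rfl

lemma coneSnd_coneJet (ψ : ℕ → DiffOps k A →ₗ[A] Y.carrier)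
    (φ : ℕ → DiffOps k A →ₗ[A] X.carrier) (i : ℕ) :
    coneSnd f ∘ₗ coneJet f ψ φ i = X.invBase ∘ₗ φ i := rfl

lemma coneJet_ext {φ φ' : DiffOps k A →ₗ[A] (MixedMod.cone f).carrier}
    (h1 : coneFst f ∘ₗ φ = coneFst f ∘ₗ φ') (h2 : coneSnd f ∘ₗ φ = coneSnd f ∘ₗ φ') : φ = φ' :=
  LinearMap.ext fun P => Prod.ext (LinearMap.congr_fun h1 P) (LinearMap.congr_fun h2 P)

lemma invBase_invBase (φ : DiffOps k A →ₗ[A] X.carrier) : X.invBase ∘ₗ X.invBase ∘ₗ φ = φ :=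
  LinearMap.ext fun P => GrMod.inv_inv (φ P)

lemma eq_coneJet (ζ : ℕ → DiffOps k A →ₗ[A] (MixedMod.cone f).carrier) :
    ζ = coneJet f (fun i => coneFst f ∘ₗ ζ i) (fun i => X.invBase ∘ₗ coneSnd f ∘ₗ ζ i) :=
  funext fun i => coneJet_ext f rfl
    ((coneSnd_coneJet f _ _ i).trans (invBase_invBase _)).symm

/-- The sign by weight commutes with `d` and anticommutes with `del`. Twisting the second coordinate
of `coneJet` by it gives both parts of the total differential the same sign, so that the jets of the
cone form the ordinary cone of the map on jets. -/
lemma totDel_coneJet (ψ : ℕ → DiffOps k A →ₗ[A] Y.carrier)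
    (φ : ℕ → DiffOps k A →ₗ[A] X.carrier) :
    totDel c (MixedMod.cone f) (coneJet f ψ φ) =
      coneJet f (totDel c Y ψ + fun i => (MixedMod.lin f).restrictScalars A ∘ₗ φ i)
        (-totDel c X φ) := by
  have e1 (i : ℕ) : coneFst f ∘ₗ (MixedMod.cone f).dBase ∘ₗ coneJet f ψ φ i =
      Y.dBase ∘ₗ ψ i + (MixedMod.lin f).restrictScalars A ∘ₗ φ i := LinearMap.ext fun P => by
    change Y.d (ψ i P) + MixedMod.lin f (X.inv (X.inv (φ i P))) = _
    rw [GrMod.inv_inv]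
    rfl
  have e2 (i : ℕ) : coneSnd f ∘ₗ (MixedMod.cone f).dBase ∘ₗ coneJet f ψ φ i =
      -(X.invBase ∘ₗ X.dBase ∘ₗ φ i) := LinearMap.ext fun P => by
    change -X.d (X.inv (φ i P)) = -X.inv (X.d (φ i P))
    rw [GrMod.inv_d]
  have e3 (i : ℕ) : coneFst f ∘ₗ del c (MixedMod.cone f) (coneJet f ψ φ i) = del c Y (ψ i) :=
    (del_comp c (coneFst f) (fun _ => rfl) (fun _ _ => rfl) _).symm
  have e4 (i : ℕ) : coneSnd f ∘ₗ del c (MixedMod.cone f) (coneJet f ψ φ i) =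
      -(X.invBase ∘ₗ del c X (φ i)) :=
    (del_comp c (coneSnd f) (fun _ => rfl) (fun _ _ => rfl) _).symm.trans (del_inv c X (φ i))
  funext i
  refine coneJet_ext f ?_ ?_
  · rw [coneFst_coneJet]
    rcases i with _ | i
    · exact e1 0
    · rw [totDel_succ, LinearMap.comp_add, e1, e3, Pi.add_apply, totDel_succ]
      abel
  · rw [coneSnd_coneJet, Pi.neg_apply, LinearMap.comp_neg]
    rcases i with _ | i
    · exact e2 0
    · rw [totDel_succ, LinearMap.comp_add, e2, e4, totDel_succ, LinearMap.comp_add, neg_add]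

lemma coneJet_mem {ψ : ℕ → DiffOps k A →ₗ[A] Y.carrier} {φ : ℕ → DiffOps k A →ₗ[A] X.carrier}
    {n m : ℤ} (h : n + 1 = m) (hψ : ψ ∈ totJets Y.toGrMod n) (hφ : φ ∈ totJets X.toGrMod m) :
    coneJet f ψ φ ∈ totJets (MixedMod.cone f).toGrMod n := fun i P =>
  ⟨hψ i P, by subst h; exact GrMod.inv_mem (hφ i P)⟩

lemma coneJet_eq_iff {ψ ψ' : ℕ → DiffOps k A →ₗ[A] Y.carrier}
    {φ φ' : ℕ → DiffOps k A →ₗ[A] X.carrier} :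
    coneJet f ψ φ = coneJet f ψ' φ' ↔ ψ = ψ' ∧ φ = φ' := by
  refine ⟨fun h => ⟨funext fun i => ?_, funext fun i => ?_⟩, fun h => by rw [h.1, h.2]⟩
  · exact congrArg (fun φ => coneFst f ∘ₗ φ) (congrFun h i)
  · have := congrArg (fun φ => coneSnd f ∘ₗ φ) (congrFun h i)
    rw [← invBase_invBase (φ i), ← coneSnd_coneJet f ψ, ← invBase_invBase (φ' i),
      ← coneSnd_coneJet f ψ']
    exact congrArg (fun φ => X.invBase ∘ₗ φ) this

-- This unfolds the acyclicity of the jets of the cone into its two coordinates.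
variable {f} in
lemma exists_coneJet [CharZero k] (hf : MixedMod.qis k A f) {n m l : ℤ} (h : n + 1 = m)
    (hl : m + 1 = l)
    {ψ : ℕ → DiffOps k A →ₗ[A] Y.carrier} {φ : ℕ → DiffOps k A →ₗ[A] X.carrier}
    (hψ : ψ ∈ totJets Y.toGrMod m) (hφ : φ ∈ totJets X.toGrMod l) (h1 : totDel c X φ = 0)
    (h2 : totDel c Y ψ + (fun i => (MixedMod.lin f).restrictScalars A ∘ₗ φ i) = 0) :
    ∃ ψ' ∈ totJets Y.toGrMod n, ∃ φ' ∈ totJets X.toGrMod m,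
      totDel c Y ψ' + (fun i => (MixedMod.lin f).restrictScalars A ∘ₗ φ' i) = ψ ∧
        totDel c X φ' = -φ := by
  obtain ⟨ζ, hζ, h3⟩ := exists_totDel_eq_of_acyclic c (MixedMod.cone_isAcyclic f hf) h
    (coneJet_mem f hl hψ hφ) (by
      rw [totDel_coneJet, h1, h2]
      funext i
      exact coneJet_ext f rfl (by
        rw [coneSnd_coneJet, neg_zero]
        exact (LinearMap.comp_zero _).trans (LinearMap.comp_zero _).symm))
  rw [eq_coneJet f ζ, totDel_coneJet, coneJet_eq_iff] at h3
  refine ⟨_, fun i P => (hζ i P).1, _, fun i P => ?_, h3.1, ?_⟩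
  · have := (hζ i P).2
    rw [h] at this
    exact GrMod.inv_mem this
  · rw [← h3.2, neg_neg]

-- Both halves come from `exists_coneJet`: injectivity on cohomology from the cycle `(-ψ, φ)`,
-- surjectivity from the cycle `(ψ, 0)`.
variable {f} in
lemma quasiIso_jetsFun_map [CharZero k] (hf : MixedMod.qis k A f) :
    QuasiIso ((jetsFun c).map f) := by
  rw [module_quasiIso_iff]
  intro n m l hnm hml
  have zero_comp : (fun i => (MixedMod.lin f).restrictScalars A ∘ₗ
      (0 : ℕ → DiffOps k A →ₗ[A] X.carrier) i) = 0 := funext fun i => LinearMap.comp_zero _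
  refine ⟨fun φ hφ ⟨ψ, hψ⟩ => ?_, fun ψ hψ => ?_⟩
  · replace hφ := (jetsObj_d_eq c X hml φ 0).1 hφ
    replace hψ := (jetsObj_d_eq c Y hnm ψ _).1 hψ
    obtain ⟨ψ', -, φ', hφ', -, h⟩ := exists_coneJet (f := f) c hf (sub_add_cancel n 1) hnm
      (neg_mem ψ.2) φ.2 hφ (by rw [map_neg, hψ]; exact neg_add_cancel _)
    exact ⟨⟨-φ', neg_mem hφ'⟩, (jetsObj_d_eq c X hnm _ _).2 (by rw [map_neg, h, neg_neg])⟩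
  · replace hψ := (jetsObj_d_eq c Y hml ψ 0).1 hψ
    obtain ⟨ψ', hψ', φ', hφ', h1, h2⟩ := exists_coneJet (f := f) c hf hnm hml ψ.2 (zero_mem _)
      (map_zero _) (by rw [hψ, zero_comp]; exact add_zero _)
    refine ⟨⟨φ', hφ'⟩, (jetsObj_d_eq c X hml _ _).2 (by rw [h2, neg_zero]; rfl), ⟨ψ', hψ'⟩,
      (jetsObj_d_eq c Y hnm _ _).2 ?_⟩
    exact eq_sub_of_add_eq h1

end

end Cone

end DeRhamMixed

namespace DeRhamMixed

/-! ### Evaluation at `1` on the cohomology of jets. -/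

section Evaluation

variable {k : Type v} {A : Type u} [Field k] [CommRing A] [Algebra k A]
  (c : DualCoords k A) {M : MixedMod k A}

/-- The sequence with a single non-zero term, in weight zero. -/
noncomputable def zeroJet (φ : DiffOps k A →ₗ[A] M.carrier) :
    ℕ → DiffOps k A →ₗ[A] M.carrier
  | 0 => φ
  | _ + 1 => 0

lemma zeroJet_mem {φ : DiffOps k A →ₗ[A] M.carrier} {n : ℤ} (hφ : φ ∈ jets M.toGrMod 0 n) :
    zeroJet φ ∈ totJets M.toGrMod n
  | 0 => hφ
  | _ + 1 => zero_mem _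

/-- Evaluation at `1` is injective on cohomology. Subtracting the total boundary of a constant jet
at a homogeneous primitive of the value at `1` reduces to cycles vanishing at `1`, where
`exists_totDel_eq_of_contraction` applies. -/
lemma exists_totDel_eq [CharZero k] (K : Contraction c M.toGrMod.hMod) {n m : ℤ} (hm : n + 1 = m)
    {φ : ℕ → DiffOps k A →ₗ[A] M.carrier} (hφ : φ ∈ totJets M.toGrMod m)
    (h : totDel c M φ = 0) {x : M.carrier} (hx : M.d x = φ 0 1) :
    ∃ ψ ∈ totJets M.toGrMod n, totDel c M ψ = φ := by
  have hx' : M.d (M.pr 0 n x) = φ 0 1 := by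
    have h01 : φ 0 1 ∈ M.comp 0 m := hφ 0 1
    rw [← GrMod.d_pr, hx, hm, GrMod.pr_of_mem h01]
  set y := M.pr 0 n x
  have hy : zeroJet (constJet y) ∈ totJets M.toGrMod n :=
    zeroJet_mem (constJet_mem (GrMod.pr_mem 0 n x))
  obtain ⟨ψ, hψ, -, h1⟩ := exists_totDel_eq_of_contraction c K hm
    (sub_mem hφ (totDel_mem c hm hy)) (by rw [map_sub, h, totDel_totDel, sub_zero]) (by
      change φ 0 1 - M.d (constJet y 1) = 0
      rw [constJet_one, hx', sub_self])
  exact ⟨ψ + zeroJet (constJet y), add_mem hψ hy, by rw [map_add, h1, sub_add_cancel]⟩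

/-- Evaluation at `1` is surjective on cohomology. The constant jet at `x` need not be a cycle, but
its total boundary vanishes at `1` and so bounds some `ψ` vanishing at `1`; the difference is a
cycle with value `x`. -/
lemma exists_cycle_of_weight_zero [CharZero k] (K : Contraction c M.toGrMod.hMod) {n : ℤ} {x : M.carrier}
    (hx : x ∈ M.comp 0 n) (hdx : M.d x = 0) :
    ∃ φ ∈ totJets M.toGrMod n, totDel c M φ = 0 ∧ φ 0 1 = x := by
  have hy : zeroJet (constJet x) ∈ totJets M.toGrMod n := zeroJet_mem (constJet_mem hx)
  obtain ⟨ψ, hψ, h0, h1⟩ := exists_totDel_eq_of_contraction c K rfl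
    (totDel_mem c rfl hy) (totDel_totDel c _) (by
      change M.d (constJet x 1) = 0
      rw [constJet_one, hdx])
  refine ⟨zeroJet (constJet x) - ψ, sub_mem hy hψ, by rw [map_sub, h1, sub_self], ?_⟩
  change constJet x 1 - ψ 0 1 = x
  rw [constJet_one, h0, sub_zero]

end Evaluation

/-! ### The unit, from a complex to the jets of its de Rham complex. -/

section Unit

variable {k : Type v} {A : Type u} [Field k] [CommRing A] [Algebra k A]

lemma nablaOf_eq_sum_smul (c : DualCoords k A)
    (E : CochainComplex (ModuleCat.{u} (DiffOps k A)) ℤ) (t : Tot (resA E)) :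
    nablaOf c E t = ∑ i, dOne k A (c.x i) • ((1 : Forms k A) ⊗ₜ[A] opAct E (ofDer (c.θ i)) t) := by
  rw [nablaOf_apply]
  refine Finset.sum_congr rfl fun i _ => ?_
  rw [TensorProduct.smul_tmul', smul_eq_mul, mul_one]

lemma epsOf_one_tmul (c : DualCoords k A)
    (E : CochainComplex (ModuleCat.{u} (DiffOps k A)) ℤ) (t : Tot (resA E)) :
    epsOf c E (1 ⊗ₜ t) = nablaOf c E t := by
  have h : dR k A 1 = 0 := by
    rw [← map_one (algebraMap A (Forms k A)), dR_algebraMap]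
    simp [dOne]
  rw [epsOf_tmul, h, TensorProduct.zero_tmul, zero_add, map_one, one_smul]

lemma inTot_injective (F : CochainComplex (ModuleCat.{u} (DiffOps k A)) ℤ) {n : ℤ} :
    Function.Injective (inTot F n) :=
  DirectSum.of_injective n

variable [CharZero k] (c : DualCoords k A) (F : CochainComplex (ModuleCat.{u} (DiffOps k A)) ℤ)

/-- The map `P ↦ 1 ⊗ P t`. -/
noncomputable def unitJet : Tot (resA F) →+ (DiffOps k A →ₗ[A] (deRhamObj c F).carrier) where
  toFun t :=
    { toFun := fun P => ((1 : Forms k A) ⊗ₜ[A] opAct F P t : Forms k A ⊗[A] Tot (resA F))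
      map_add' := fun P Q => by
        rw [opAct_add]
        exact TensorProduct.tmul_add _ _ _
      map_smul' := fun a P => by
        rw [diffOps_base_smul, opAct_mul, opAct_ofFun, TensorProduct.tmul_smul]
        exact (freeMod_base_smul (resA F) a _).symm }
  map_zero' := LinearMap.ext fun P => (congrArg _ (map_zero _)).trans (TensorProduct.tmul_zero _ _)
  map_add' t s := LinearMap.ext fun P =>
    (congrArg _ (map_add _ _ _)).trans (TensorProduct.tmul_add _ _ _)

lemma unitJet_apply (t : Tot (resA F)) (P : DiffOps k A) :
    unitJet c F t P = ((1 : Forms k A) ⊗ₜ[A] opAct F P t : Forms k A ⊗[A] Tot (resA F)) := rfl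

/-- The mixed structure sends `1 ⊗ s` to `∑ i, dx i ⊗ θ i s`, and for `s = P t` this is the second
term of `del`, where `θ i` multiplies `P` on the left. -/
lemma del_unitJet (t : Tot (resA F)) : del c (deRhamObj c F) (unitJet c F t) = 0 := by
  ext P
  rw [del_apply, sub_eq_zero.2]
  · rfl
  · change epsOf c F (1 ⊗ₜ opAct F P t) = _
    rw [epsOf_one_tmul, nablaOf_eq_sum_smul]
    refine Finset.sum_congr rfl fun i _ => ?_
    rw [unitJet_apply, opAct_mul]
    rfl

lemma dBase_unitJet (t : Tot (resA F)) :
    (deRhamObj c F).dBase ∘ₗ unitJet c F t = unitJet c F (totD (resA F) t) := by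
  ext P
  change freeD k (resA F) (1 ⊗ₜ opAct F P t) = (1 ⊗ₜ opAct F P (totD (resA F) t))
  rw [freeD_tmul, map_one, opAct_totD]

lemma jetAct_unitJet (P : DiffOps k A) (t : Tot (resA F)) :
    jetAct P (unitJet c F t) = unitJet c F (opAct F P t) :=
  LinearMap.ext fun R => by rw [jetAct_apply, unitJet_apply, unitJet_apply, opAct_mul]

lemma unitJet_mem {n : ℤ} (e : F.X n) : unitJet c F (inTot F n e) ∈ jets (deRhamObj c F).toGrMod 0 n :=
  fun P => by
    rw [unitJet_apply, opAct_inTot]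
    exact one_tmul_mem (resA F) n _

/-- The unit `e ↦ (P ↦ 1 ⊗ P e)`. -/
noncomputable def unitHom : F ⟶ jetsObj c (deRhamObj c F) where
  f n := ModuleCat.ofHom
    { toFun := fun e => (⟨zeroJet (unitJet c F (inTot F n e)), zeroJet_mem (unitJet_mem c F e)⟩ :
        totJets (deRhamObj c F).toGrMod n)
      map_add' := fun e e' => by
        refine Subtype.ext (funext fun i => ?_)
        rcases i with _ | i
        · exact (congrArg _ (map_add _ _ _)).trans (map_add _ _ _)
        · exact (add_zero _).symm
      map_smul' := fun P e => by
        refine Subtype.ext (funext fun i => ?_)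
        rcases i with _ | i
        · change unitJet c F (inTot F n (P • e)) = jetAct P (unitJet c F (inTot F n e))
          rw [jetAct_unitJet, opAct_inTot]
        · rfl }
  comm' n m h := by
    refine ModuleCat.hom_ext (LinearMap.ext fun e => ?_)
    refine (jetsObj_d_eq c _ h _ _).2 (funext fun i => ?_)
    rcases i with _ | _ | i
    · change (deRhamObj c F).dBase ∘ₗ unitJet c F (inTot F n e) =
        unitJet c F (inTot F m ((F.d n m).hom e))
      rw [dBase_unitJet, totD_inTot F n m h]
    · change (deRhamObj c F).dBase ∘ₗ 0 + del c _ (unitJet c F (inTot F n e)) = 0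
      rw [del_unitJet, LinearMap.comp_zero, add_zero]
    · change (deRhamObj c F).dBase ∘ₗ 0 + del c _ 0 = 0
      rw [map_zero, LinearMap.comp_zero, add_zero]

lemma unitHom_f_one {n : ℤ} (e : F.X n) :
    (((unitHom c F).f n).hom e : totJets (deRhamObj c F).toGrMod n).1 0 1 =
      ((1 : Forms k A) ⊗ₜ[A] inTot F n e : Forms k A ⊗[A] Tot (resA F)) := by
  change (1 : Forms k A) ⊗ₜ[A] opAct F 1 (inTot F n e) = _
  rw [map_one]
  rfl

/-- Followed by evaluation at `1`, the unit is `e ↦ 1 ⊗ e`, which identifies the complex with the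
weight-zero part of its de Rham complex. Evaluation is bijective on cohomology because the
cohomology of a free module has contractions. -/
lemma quasiIso_unitHom : QuasiIso (unitHom c F) := by
  rw [module_quasiIso_iff]
  intro n m l hnm hml
  have hd (e : F.X m) (h : freeD k (resA F) (1 ⊗ₜ inTot F m e) = 0) : (F.d m l).hom e = 0 := by
    rw [freeD_tmul, map_one, totD_inTot F m l hml] at h
    apply inTot_injective F
    rw [map_zero]
    exact one_tmul_injective (k := k) (resA F) (h.trans (TensorProduct.tmul_zero _ _).symm)
  refine ⟨fun e he ⟨ψ, hψ⟩ => ?_, fun φ hφ => ?_⟩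
  · obtain ⟨f, hf⟩ : ∃ f : F.X n, ψ.1 0 1 =
        ((1 : Forms k A) ⊗ₜ[A] inTot F n f : Forms k A ⊗[A] Tot (resA F)) :=
      mem_freeComp_zero (ψ.2 0 1)
    refine ⟨f, inTot_injective F ?_⟩
    rw [← totD_inTot F n m hnm]
    apply one_tmul_injective (k := k)
    have h1 := LinearMap.congr_fun (congrFun ((jetsObj_d_eq c _ hnm _ _).1 hψ) 0) 1
    rw [unitHom_f_one] at h1
    rw [← h1]
    change _ = freeD k (resA F) (ψ.1 0 1)
    rw [hf, freeD_tmul, map_one]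
  · replace hφ := (jetsObj_d_eq c _ hml φ 0).1 hφ
    obtain ⟨e, he⟩ := mem_freeComp_zero (φ.2 0 1)
    have hde : (F.d m l).hom e = 0 := hd e (by
      refine (congrArg _ he.symm).trans ?_
      exact LinearMap.congr_fun (congrFun hφ 0) 1)
    refine ⟨e, hde, ?_⟩
    have hcyc : totDel c (deRhamObj c F) (((unitHom c F).f m).hom e :
        totJets (deRhamObj c F).toGrMod m).1 = 0 := by
      refine (jetsObj_d_eq c _ hml _ 0).1 ?_
      have := congrArg (fun f => f.hom e) ((unitHom c F).comm m l)
      refine this.trans ?_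
      change ((unitHom c F).f l).hom ((F.d m l).hom e) = 0
      rw [hde]
      exact map_zero _
    -- The cycle `φ` and the unit of `e` have the same value at `1`, so the zero element serves as
    -- the primitive of the value of their difference.
    obtain ⟨ψ, hψ, h⟩ := exists_totDel_eq (M := deRhamObj c F) c
      (freeCohomologyContraction c (resA F)) hnm
      (φ := (φ - ((unitHom c F).f m).hom e : totJets (deRhamObj c F).toGrMod m).1)
      (Subtype.property _) (by
        change totDel c (deRhamObj c F) (φ.1 - (((unitHom c F).f m).hom e :
          totJets (deRhamObj c F).toGrMod m).1) = 0
        rw [map_sub, hφ, hcyc, sub_zero]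
        rfl) (x := 0) (by
        change (deRhamObj c F).d 0 = φ.1 0 1 - (((unitHom c F).f m).hom e :
          totJets (deRhamObj c F).toGrMod m).1 0 1
        refine (map_zero _).trans (sub_eq_zero.2 ?_).symm
        exact he.trans (unitHom_f_one c F e).symm)
    exact ⟨⟨ψ, hψ⟩, (jetsObj_d_eq c _ hnm _ _).2 h⟩

end Unit

end DeRhamMixed

namespace DeRhamMixed

/-! ### Termwise maps and shifts of finitely supported sequences. -/

section FinitelySupported

variable {X Y : Type*} [AddCommGroup X] [AddCommGroup Y]

/-- Termwise application of a sequence of additive maps. -/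
noncomputable def finMap (f : ℕ → X →+ Y) : (ℕ →₀ X) →+ (ℕ →₀ Y) :=
  Finsupp.liftAddHom fun i => (Finsupp.singleAddHom i).comp (f i)

lemma finMap_single (f : ℕ → X →+ Y) (i : ℕ) (x : X) :
    finMap f (Finsupp.single i x) = Finsupp.single i (f i x) :=
  Finsupp.liftAddHom_apply_single _ _ _

lemma finMap_apply (f : ℕ → X →+ Y) (x : ℕ →₀ X) (i : ℕ) : finMap f x i = f i (x i) := by
  induction x using Finsupp.induction_linear with
  | zero => simp only [map_zero, Finsupp.coe_zero, Pi.zero_apply]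
  | add x y hx hy => simp only [map_add, Finsupp.coe_add, Pi.add_apply, hx, hy]
  | single j x =>
    rw [finMap_single]
    by_cases h : j = i
    · subst h
      rw [Finsupp.single_eq_same, Finsupp.single_eq_same]
    · rw [Finsupp.single_eq_of_ne' h, Finsupp.single_eq_of_ne' h, map_zero]

/-- The left shift. -/
noncomputable def finShift : (ℕ →₀ X) →+ (ℕ →₀ X) :=
  Finsupp.liftAddHom fun i => match i with
    | 0 => 0
    | i + 1 => Finsupp.singleAddHom i

lemma finShift_single_zero (x : X) : finShift (Finsupp.single 0 x) = 0 :=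
  Finsupp.liftAddHom_apply_single _ _ _

lemma finShift_single_succ (i : ℕ) (x : X) :
    finShift (Finsupp.single (i + 1) x) = Finsupp.single i x :=
  Finsupp.liftAddHom_apply_single _ _ _

lemma finShift_apply (x : ℕ →₀ X) (i : ℕ) : finShift x i = x (i + 1) := by
  induction x using Finsupp.induction_linear with
  | zero => simp only [map_zero, Finsupp.coe_zero, Pi.zero_apply]
  | add x y hx hy => simp only [map_add, Finsupp.coe_add, Pi.add_apply, hx, hy]
  | single j x =>
    rcases j with _ | j
    · rw [finShift_single_zero, Finsupp.single_eq_of_ne' (Nat.succ_ne_zero i).symm]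
      rfl
    · rw [finShift_single_succ]
      by_cases h : j = i
      · subst h
        rw [Finsupp.single_eq_same, Finsupp.single_eq_same]
      · rw [Finsupp.single_eq_of_ne' h, Finsupp.single_eq_of_ne' (fun h' => h (Nat.succ.inj h'))]

end FinitelySupported

/-! ### A functorial resolution of graded mixed modules. -/

section Telescope

variable {k : Type v} {A : Type u} [Field k] [CommRing A] [Algebra k A]

namespace MixedMod

lemma telescope_ext {X : MixedMod k A} {z z' : (ℕ →₀ X.carrier) × (ℕ →₀ X.carrier)}
    (h1 : ∀ i, z.1 i = z'.1 i) (h2 : ∀ i, z.2 i = z'.2 i) : z = z' :=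
  Prod.ext (Finsupp.ext h1) (Finsupp.ext h2)

/-- The homogeneous parts of the resolution `MixedMod.telescope`. -/
def telescopeComp (X : MixedMod k A) (p n : ℤ) :
    AddSubgroup ((ℕ →₀ X.carrier) × (ℕ →₀ X.carrier)) where
  -- The first copy of index `i` raises the weight by `i` and keeps the degree, while the second
  -- copy raises the weight by `i + 1` and the degree by `1`. The second copy thus has room for both
  -- `ε` of the first copy of index `i` and `d` of the first copy of index `i + 1`.
  carrier := {z | ∀ i : ℕ, z.1 i ∈ X.comp (p - i) n ∧ z.2 i ∈ X.comp (p - i - 1) (n - 1)}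
  zero_mem' _ := ⟨zero_mem _, zero_mem _⟩
  add_mem' hx hy i := ⟨add_mem (hx i).1 (hy i).1, add_mem (hx i).2 (hy i).2⟩
  neg_mem' hx i := ⟨neg_mem (hx i).1, neg_mem (hx i).2⟩

lemma single_fst_mem {X : MixedMod k A} {p n : ℤ} {i : ℕ} {x : X.carrier}
    (hx : x ∈ X.comp (p - i) n) : (Finsupp.single i x, 0) ∈ telescopeComp X p n := fun j => by
  refine ⟨?_, zero_mem _⟩
  by_cases h : i = j
  · subst h
    change Finsupp.single i x i ∈ _
    rwa [Finsupp.single_eq_same]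
  · change Finsupp.single i x j ∈ _
    rw [Finsupp.single_eq_of_ne' h]
    exact zero_mem _

lemma single_snd_mem {X : MixedMod k A} {p n : ℤ} {i : ℕ} {x : X.carrier}
    (hx : x ∈ X.comp (p - i - 1) (n - 1)) : (0, Finsupp.single i x) ∈ telescopeComp X p n :=
  fun j => by
  refine ⟨zero_mem _, ?_⟩
  by_cases h : i = j
  · subst h
    change Finsupp.single i x i ∈ _
    rwa [Finsupp.single_eq_same]
  · change Finsupp.single i x j ∈ _
    rw [Finsupp.single_eq_of_ne' h]
    exact zero_mem _

lemma telescope_hom_ext {X : MixedMod k A} {G : Type*} [AddCommGroup G]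
    {f g : (ℕ →₀ X.carrier) × (ℕ →₀ X.carrier) →+ G}
    (h1 : ∀ i x, f (Finsupp.single i x, 0) = g (Finsupp.single i x, 0))
    (h2 : ∀ i x, f (0, Finsupp.single i x) = g (0, Finsupp.single i x)) : f = g := by
  have e1 : f.comp (AddMonoidHom.inl _ _) = g.comp (AddMonoidHom.inl _ _) := Finsupp.addHom_ext h1
  have e2 : f.comp (AddMonoidHom.inr _ _) = g.comp (AddMonoidHom.inr _ _) := Finsupp.addHom_ext h2
  refine AddMonoidHom.ext fun z => ?_
  have hz : z = (z.1, 0) + (0, z.2) := by rw [Prod.mk_add_mk, add_zero, zero_add]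
  rw [hz, map_add, map_add]
  exact congrArg₂ (· + ·) (DFunLike.congr_fun e1 z.1) (DFunLike.congr_fun e2 z.2)

lemma telescopeComp_isInternal (X : MixedMod k A) :
    DirectSum.IsInternal (fun i : ℤ × ℤ => telescopeComp X i.1 i.2) := by
  refine isInternal_of_proj _ (fun i => (finMap fun j => X.pr (i.1 - j) i.2).prodMap
    (finMap fun j => X.pr (i.1 - j - 1) (i.2 - 1))) ?_ ?_ ?_
  · rintro ⟨p, n⟩ ⟨x, y⟩ h
    refine telescope_ext (fun j => ?_) (fun j => ?_)
    · exact (finMap_apply _ _ _).trans (GrMod.pr_of_mem (h j).1)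
    · exact (finMap_apply _ _ _).trans (GrMod.pr_of_mem (h j).2)
  · rintro ⟨p, n⟩ ⟨p', n'⟩ hne ⟨x, y⟩ h
    refine telescope_ext (fun j => ?_) (fun j => ?_)
    · refine (finMap_apply _ _ _).trans (GrMod.pr_of_mem_ne (h j).1 fun h' => hne ?_)
      rw [Prod.mk.injEq] at h' ⊢
      exact ⟨by linarith [h'.1], h'.2⟩
    · refine (finMap_apply _ _ _).trans (GrMod.pr_of_mem_ne (h j).2 fun h' => hne ?_)
      rw [Prod.mk.injEq] at h' ⊢
      exact ⟨by linarith [h'.1], by linarith [h'.2]⟩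
  · intro H hH
    have h1 (i : ℕ) (x : X.carrier) : (Finsupp.single i x, (0 : ℕ →₀ X.carrier)) ∈ H := by
      induction x using GrMod.induction with
      | h0 => rw [Finsupp.single_zero]; exact zero_mem H
      | ha x y hx hy =>
        have := add_mem hx hy
        rwa [Prod.mk_add_mk, add_zero, ← Finsupp.single_add] at this
      | h p n x hx => exact hH (p + i, n) (single_fst_mem (by rwa [add_sub_cancel_right]))
    have h2 (i : ℕ) (x : X.carrier) : ((0 : ℕ →₀ X.carrier), Finsupp.single i x) ∈ H := by
      induction x using GrMod.induction with
      | h0 => rw [Finsupp.single_zero]; exact zero_mem H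
      | ha x y hx hy =>
        have := add_mem hx hy
        rwa [Prod.mk_add_mk, add_zero, ← Finsupp.single_add] at this
      | h p n x hx =>
        refine hH (p + i + 1, n + 1) (single_snd_mem ?_)
        rwa [add_sub_cancel_right, show p + i + 1 - i - 1 = p by ring]
    have : QuotientAddGroup.mk' H = 0 := telescope_hom_ext
      (fun i x => (QuotientAddGroup.eq_zero_iff _).2 (h1 i x))
      (fun i x => (QuotientAddGroup.eq_zero_iff _).2 (h2 i x))
    rw [eq_top_iff]
    intro z _
    exact (QuotientAddGroup.eq_zero_iff z).1 (DFunLike.congr_fun this z)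

/-- A resolution of a graded mixed dg-module, in which the relation imposed by the mixed structure
is freed: it is spanned by copies `(x, 0)` and `(0, x)` in each index `i : ℕ`, where the copies of
index `i` have weight raised by `i`. -/
noncomputable def telescope (X : MixedMod k A) : MixedMod k A where
  carrier := (ℕ →₀ X.carrier) × (ℕ →₀ X.carrier)
  comp := telescopeComp X
  isInternal := telescopeComp_isInternal X
  smul_mem := fun {q ω p n z} hω hz i => ⟨by
    have := X.smul_mem hω (hz i).1
    rwa [sub_add_eq_add_sub] at this, by
    have := X.smul_mem hω (hz i).2
    rwa [show p - i - 1 + q = p + q - i - 1 by ring, sub_add_eq_add_sub] at this⟩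
  -- Up to sign, the boundary of the first copy of index `i + 1` contains the second copy of index
  -- `i`. On maps out of the resolution this becomes the summand `del` of the total differential on
  -- jets.
  d := ((finMap fun _ => X.d).comp (AddMonoidHom.fst _ _)).prod
    (-((finMap fun _ => X.d).comp (AddMonoidHom.snd _ _)) -
      (finMap fun _ => X.inv).comp (finShift.comp (AddMonoidHom.fst _ _)))
  d_mem := fun {p n z} hz i => ⟨by
    change finMap (fun _ => X.d) z.1 i ∈ _
    rw [finMap_apply]
    exact X.d_mem (hz i).1, by
    change -(finMap (fun _ => X.d) z.2 i) - finMap (fun _ => X.inv) (finShift z.1) i ∈ _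
    rw [finMap_apply, finMap_apply, finShift_apply]
    have h1 := X.d_mem (hz i).2
    have h2 := GrMod.inv_mem (hz (i + 1)).1
    rw [sub_add_eq_add_sub] at h1
    rw [Nat.cast_succ, ← sub_sub] at h2
    refine sub_mem (neg_mem h1) ?_
    rwa [add_sub_cancel_right]⟩
  d_d z := telescope_ext (fun i => by
    change finMap (fun _ => X.d) (finMap (fun _ => X.d) z.1) i = 0
    rw [finMap_apply, finMap_apply, X.d_d]) (fun i => by
    change -(finMap (fun _ => X.d) (-(finMap (fun _ => X.d) z.2) -
      finMap (fun _ => X.inv) (finShift z.1)) i) -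
        finMap (fun _ => X.inv) (finShift (finMap (fun _ => X.d) z.1)) i = 0
    simp only [finMap_apply, finShift_apply, Finsupp.coe_sub, Finsupp.coe_neg, Pi.sub_apply,
      Pi.neg_apply, map_sub, map_neg, X.d_d, GrMod.inv_d]
    abel)
  d_smul := fun {q ω} z hω => telescope_ext (fun i => by
    change finMap (fun _ => X.d) (ω • z.1) i = (-1 : ℤ) ^ q • ω • finMap (fun _ => X.d) z.1 i
    rw [finMap_apply, finMap_apply]
    exact X.d_smul _ hω) (fun i => by
    change -(finMap (fun _ => X.d) (ω • z.2) i) - finMap (fun _ => X.inv) (finShift (ω • z.1)) i =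
      (-1 : ℤ) ^ q • ω • (-(finMap (fun _ => X.d) z.2 i) -
        finMap (fun _ => X.inv) (finShift z.1) i)
    simp only [finMap_apply, finShift_apply, Finsupp.smul_apply]
    rw [X.d_smul _ hω, GrMod.inv_forms_smul, sgn_of_mem k A hω, GrMod.zsmul_forms_smul, smul_sub,
      smul_sub, smul_neg, smul_neg])
  -- The first copies fail to be stable under `ε` exactly by the second copies. A map on first
  -- copies therefore need not respect `ε`, and its failure to do so is its value on the second
  -- copies.
  ε := ((finMap fun _ => X.ε).comp (AddMonoidHom.fst _ _)).prod
    ((finMap fun _ => X.ε).comp (AddMonoidHom.snd _ _) +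
      (finMap fun _ => X.inv).comp (AddMonoidHom.fst _ _))
  ε_mem := fun {p n z} hz i => ⟨by
    change finMap (fun _ => X.ε) z.1 i ∈ _
    rw [finMap_apply]
    have := X.ε_mem (hz i).1
    rwa [sub_add_eq_add_sub] at this, by
    change finMap (fun _ => X.ε) z.2 i + finMap (fun _ => X.inv) z.1 i ∈ _
    rw [finMap_apply, finMap_apply]
    have h1 := X.ε_mem (hz i).2
    have h2 := GrMod.inv_mem (hz i).1
    rw [sub_add_cancel, sub_add_cancel] at h1
    rw [add_sub_cancel_right, show p + 1 - i - 1 = p - i by ring]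
    exact add_mem h1 h2⟩
  ε_ε z := telescope_ext (fun i => by
    change finMap (fun _ => X.ε) (finMap (fun _ => X.ε) z.1) i = 0
    rw [finMap_apply, finMap_apply, X.ε_ε]) (fun i => by
    change finMap (fun _ => X.ε) (finMap (fun _ => X.ε) z.2 + finMap (fun _ => X.inv) z.1) i +
      finMap (fun _ => X.inv) (finMap (fun _ => X.ε) z.1) i = 0
    simp only [finMap_apply, Finsupp.coe_add, Pi.add_apply, map_add, X.ε_ε, inv_ε]
    abel)
  d_ε z := telescope_ext (fun i => by
    change finMap (fun _ => X.d) (finMap (fun _ => X.ε) z.1) i +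
      finMap (fun _ => X.ε) (finMap (fun _ => X.d) z.1) i = 0
    simp only [finMap_apply]
    exact X.d_ε _) (fun i => by
    change -(finMap (fun _ => X.d) (finMap (fun _ => X.ε) z.2 + finMap (fun _ => X.inv) z.1) i) -
        finMap (fun _ => X.inv) (finShift (finMap (fun _ => X.ε) z.1)) i +
      (finMap (fun _ => X.ε) (-(finMap (fun _ => X.d) z.2) -
        finMap (fun _ => X.inv) (finShift z.1)) i +
        finMap (fun _ => X.inv) (finMap (fun _ => X.d) z.1) i) = 0
    simp only [finMap_apply, finShift_apply, Finsupp.coe_sub, Finsupp.coe_neg, Pi.sub_apply,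
      Pi.neg_apply, Finsupp.coe_add, Pi.add_apply, map_add, map_sub, map_neg, X.ε_d, GrMod.inv_d,
      inv_ε]
    abel)
  ε_smul := fun {q ω} z hω => telescope_ext (fun i => by
    change finMap (fun _ => X.ε) (ω • z.1) i =
      dR k A ω • z.1 i + (-1 : ℤ) ^ q • ω • finMap (fun _ => X.ε) z.1 i
    rw [finMap_apply, finMap_apply]
    exact X.ε_smul _ hω) (fun i => by
    change finMap (fun _ => X.ε) (ω • z.2) i + finMap (fun _ => X.inv) (ω • z.1) i =
      dR k A ω • z.2 i + (-1 : ℤ) ^ q • ω • (finMap (fun _ => X.ε) z.2 i +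
        finMap (fun _ => X.inv) z.1 i)
    simp only [finMap_apply, Finsupp.smul_apply]
    rw [X.ε_smul _ hω, GrMod.inv_forms_smul, sgn_of_mem k A hω, GrMod.zsmul_forms_smul, smul_add,
      smul_add, add_assoc])

lemma telescope_d_fst_apply {X : MixedMod k A} (z : X.telescope.carrier) (i : ℕ) :
    (X.telescope.d z).1 i = X.d (z.1 i) := finMap_apply _ _ _

lemma telescope_d_snd_apply {X : MixedMod k A} (z : X.telescope.carrier) (i : ℕ) :
    (X.telescope.d z).2 i = -X.d (z.2 i) - X.inv (z.1 (i + 1)) := by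
  change -(finMap (fun _ => X.d) z.2 i) - finMap (fun _ => X.inv) (finShift z.1) i = _
  rw [finMap_apply, finMap_apply, finShift_apply]

/-- The copy of index `i` of an element. -/
noncomputable def telescopeIn (X : MixedMod k A) (i : ℕ) : X.carrier →+ X.telescope.carrier :=
  (AddMonoidHom.inl _ _).comp (Finsupp.singleAddHom i)

/-- The second copy of index `i` of an element. -/
noncomputable def telescopeIn' (X : MixedMod k A) (i : ℕ) : X.carrier →+ X.telescope.carrier :=
  (AddMonoidHom.inr _ _).comp (Finsupp.singleAddHom i)

lemma telescopeIn_smul {X : MixedMod k A} (i : ℕ) (ω : Forms k A) (x : X.carrier) :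
    X.telescopeIn i (ω • x) = ω • X.telescopeIn i x :=
  Prod.ext (Finsupp.smul_single _ _ _).symm (smul_zero ω).symm

lemma telescopeIn'_smul {X : MixedMod k A} (i : ℕ) (ω : Forms k A) (x : X.carrier) :
    X.telescopeIn' i (ω • x) = ω • X.telescopeIn' i x :=
  Prod.ext (smul_zero ω).symm (Finsupp.smul_single _ _ _).symm

lemma telescopeIn_mem {X : MixedMod k A} {p n : ℤ} (i : ℕ) {x : X.carrier}
    (hx : x ∈ X.comp p n) : X.telescopeIn i x ∈ X.telescope.comp (p + i) n :=
  single_fst_mem (by rwa [add_sub_cancel_right])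

lemma telescopeIn_ε {X : MixedMod k A} (i : ℕ) (x : X.carrier) :
    X.telescope.ε (X.telescopeIn i x) = X.telescopeIn i (X.ε x) + X.telescopeIn' i (X.inv x) :=
  Prod.ext ((finMap_single _ _ _).trans (add_zero _).symm) (by
    change finMap (fun _ => X.ε) 0 + finMap (fun _ => X.inv) (Finsupp.single i x) =
      0 + Finsupp.single i (X.inv x)
    rw [map_zero, finMap_single])

lemma telescopeIn'_ε {X : MixedMod k A} (i : ℕ) (x : X.carrier) :
    X.telescope.ε (X.telescopeIn' i x) = X.telescopeIn' i (X.ε x) :=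
  Prod.ext (map_zero (finMap fun _ => X.ε)) (by
    change finMap (fun _ => X.ε) (Finsupp.single i x) + finMap (fun _ => X.inv) 0 =
      Finsupp.single i (X.ε x)
    rw [map_zero, finMap_single, add_zero])

lemma telescopeIn_zero_d {X : MixedMod k A} (x : X.carrier) :
    X.telescope.d (X.telescopeIn 0 x) = X.telescopeIn 0 (X.d x) :=
  Prod.ext (finMap_single _ _ _) (by
    change -(finMap (fun _ => X.d) 0) - finMap (fun _ => X.inv) (finShift (Finsupp.single 0 x)) = 0
    rw [finShift_single_zero, map_zero, map_zero, neg_zero, sub_zero])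

lemma telescopeIn_succ_d {X : MixedMod k A} (i : ℕ) (x : X.carrier) :
    X.telescope.d (X.telescopeIn (i + 1) x) =
      X.telescopeIn (i + 1) (X.d x) - X.telescopeIn' i (X.inv x) :=
  Prod.ext ((finMap_single _ _ _).trans (sub_zero _).symm) (by
    change -(finMap (fun _ => X.d) 0) -
      finMap (fun _ => X.inv) (finShift (Finsupp.single (i + 1) x)) =
        0 - Finsupp.single i (X.inv x)
    rw [finShift_single_succ, map_zero, finMap_single, neg_zero])

/-- The linear map underlying `MixedMod.telescopeMap`. -/
noncomputable def telescopeLin {X Y : MixedMod k A} (f : X ⟶ Y) :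
    X.telescope.carrier →ₗ[Forms k A] Y.telescope.carrier :=
  (Finsupp.mapRange.linearMap (MixedMod.lin f)).prodMap (Finsupp.mapRange.linearMap (MixedMod.lin f))

/-- Functoriality of the resolution. -/
noncomputable def telescopeMap {X Y : MixedMod k A} (f : X ⟶ Y) : X.telescope ⟶ Y.telescope where
  lin := telescopeLin f
  map_mem hx i := ⟨MixedMod.lin_mem f (hx i).1, MixedMod.lin_mem f (hx i).2⟩
  map_d z := telescope_ext (fun i => by
    refine (congrArg (MixedMod.lin f) (telescope_d_fst_apply z i)).trans ?_
    exact (MixedMod.lin_d f _).trans (telescope_d_fst_apply (telescopeLin f z) i).symm) (fun i => by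
    refine (congrArg (MixedMod.lin f) (telescope_d_snd_apply z i)).trans ?_
    rw [map_sub, map_neg, MixedMod.lin_d, lin_inv]
    exact (telescope_d_snd_apply (telescopeLin f z) i).symm)
  map_ε z := telescope_ext (fun i => by
    change MixedMod.lin f (finMap (fun _ => X.ε) z.1 i) =
      finMap (fun _ => Y.ε) (Finsupp.mapRange.linearMap (MixedMod.lin f) z.1) i
    rw [finMap_apply, finMap_apply, lin_ε]
    rfl) (fun i => by
    change MixedMod.lin f (finMap (fun _ => X.ε) z.2 i + finMap (fun _ => X.inv) z.1 i) =
      finMap (fun _ => Y.ε) (Finsupp.mapRange.linearMap (MixedMod.lin f) z.2) i +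
        finMap (fun _ => Y.inv) (Finsupp.mapRange.linearMap (MixedMod.lin f) z.1) i
    rw [finMap_apply, finMap_apply, finMap_apply, finMap_apply, map_add, lin_ε, lin_inv]
    rfl)

lemma telescopeMap_in {X Y : MixedMod k A} (f : X ⟶ Y) (i : ℕ) (x : X.carrier) :
    MixedMod.lin (telescopeMap f) (X.telescopeIn i x) = Y.telescopeIn i (MixedMod.lin f x) :=
  Prod.ext (Finsupp.mapRange_single (hf := map_zero _)) (Finsupp.mapRange_zero (hf := map_zero _))

variable (k A) in
/-- The functor of the resolutions. -/
noncomputable def telescopeFun : MixedMod k A ⥤ MixedMod k A where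
  obj := telescope
  map := telescopeMap
  map_id _ := hom_ext fun _ => telescope_ext (fun _ => rfl) (fun _ => rfl)
  map_comp _ _ := hom_ext fun _ => telescope_ext (fun _ => rfl) (fun _ => rfl)

/-- The augmentation of the resolution. -/
noncomputable def telescopeProj (X : MixedMod k A) : X.telescope ⟶ X where
  lin := (Finsupp.lapply 0).comp (LinearMap.fst _ _ _)
  map_mem {p n z} hz := by
    have := (hz 0).1
    rwa [Nat.cast_zero, sub_zero] at this
  map_d z := telescope_d_fst_apply z 0
  map_ε z := finMap_apply _ _ _

lemma telescopeProj_in_zero {X : MixedMod k A} (x : X.carrier) :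
    MixedMod.lin X.telescopeProj (X.telescopeIn 0 x) = x := Finsupp.single_eq_same

lemma telescopeProj_in_succ {X : MixedMod k A} (i : ℕ) (x : X.carrier) :
    MixedMod.lin X.telescopeProj (X.telescopeIn (i + 1) x) = 0 :=
  Finsupp.single_eq_of_ne (Nat.succ_ne_zero i).symm

variable (k A) in
/-- The augmentation of the resolutions, as a natural transformation. -/
noncomputable def telescopeProjNat : telescopeFun k A ⟶ 𝟭 (MixedMod k A) where
  app X := X.telescopeProj
  naturality _ _ _ := rfl

/-- The right shift of a finitely supported sequence, with a given first term. -/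
lemma exists_finsupp_cons {X : Type*} [AddCommGroup X] (w : X) (y : ℕ →₀ X) :
    ∃ x : ℕ →₀ X, x 0 = w ∧ ∀ i, x (i + 1) = y i := by
  refine ⟨Finsupp.single 0 w + y.mapDomain Nat.succ, ?_, fun i => ?_⟩
  · rw [Finsupp.coe_add, Pi.add_apply, Finsupp.single_eq_same, Finsupp.mapDomain_of_notMem_range,
      add_zero]
    rintro ⟨i, hi⟩
    exact Nat.succ_ne_zero i hi
  · rw [Finsupp.coe_add, Pi.add_apply, Finsupp.single_eq_of_ne (Nat.succ_ne_zero i), zero_add]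
    exact Finsupp.mapDomain_apply Nat.succ_injective y i

/-- Apart from the first copy of index `0`, the copies cancel in pairs: the differential matches the
first copy of index `i + 1` with the second copy of index `i` through the bijection `inv`. -/
lemma qis_telescopeProj (X : MixedMod k A) : MixedMod.qis k A X.telescopeProj := by
  rw [qis_iff]
  refine ⟨fun z hz ⟨w, hw⟩ => ?_, fun x hx => ⟨X.telescopeIn 0 x, ?_, 0, ?_⟩⟩
  -- A primitive is sought among the first copies alone. Its term of index `0` is the given
  -- primitive `w`, and its later terms are forced by the second coordinates of `z`.
  · obtain ⟨x, h0, h1⟩ := exists_finsupp_cons w (finMap (fun _ => -X.inv) z.2)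
    refine ⟨(x, 0), telescope_ext (fun i => ?_) (fun i => ?_)⟩
    · refine (telescope_d_fst_apply (X := X) _ i).trans ?_
      rcases i with _ | i
      · exact (congrArg _ h0).trans hw
      · have := DFunLike.congr_fun (congrArg Prod.snd hz) i
        rw [telescope_d_snd_apply] at this
        change X.d (x (i + 1)) = z.1 (i + 1)
        rw [h1, finMap_apply, AddMonoidHom.neg_apply, map_neg, ← GrMod.inv_d,
          ← GrMod.inv_inv (z.1 (i + 1)), ← sub_eq_zero.1 this, map_neg]
    · refine (telescope_d_snd_apply (X := X) _ i).trans ?_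
      change -X.d 0 - X.inv (x (i + 1)) = z.2 i
      rw [h1, finMap_apply, AddMonoidHom.neg_apply, map_neg, GrMod.inv_inv, map_zero, neg_zero,
        zero_sub, neg_neg]
  · rw [telescopeIn_zero_d, hx, map_zero]
  · rw [telescopeProj_in_zero, map_zero, sub_self]

end MixedMod

end Telescope

end DeRhamMixed

namespace DeRhamMixed

/-! ### Extending equivariant families of jets to the de Rham complex. -/

section Extension

variable {k : Type v} {A : Type u} [Field k] [CommRing A] [Algebra k A]
  {E : CochainComplex (ModuleCat.{u} (DiffOps k A)) ℤ} {N : MixedMod k A}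

/-- Compatibility with the action of the differential operators. -/
def IsEquivariant (J : Tot (resA E) →+ (DiffOps k A →ₗ[A] N.carrier)) : Prop :=
  ∀ P t, J (opAct E P t) = jetAct P (J t)

lemma IsEquivariant.apply_smul {J : Tot (resA E) →+ (DiffOps k A →ₗ[A] N.carrier)}
    (hJ : IsEquivariant J) (a : A) (t : Tot (resA E)) : J (a • t) 1 = a • J t 1 := by
  rw [← opAct_ofFun, hJ, jetAct_apply, one_mul, ← map_smul, diffOps_base_smul, mul_one]

/-- The extension of an equivariant map to the de Rham complex, with signs for a map of
degree `n`. -/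
noncomputable def jetExt (n : ℤ) {J : Tot (resA E) →+ (DiffOps k A →ₗ[A] N.carrier)}
    (hJ : IsEquivariant J) : Forms k A ⊗[A] Tot (resA E) →+ N.carrier :=
  TensorProduct.liftAddHom
    (AddMonoidHom.mk' (fun ω => (DistribSMul.toAddMonoidHom N.carrier (sgnPow k A n ω)).comp
      ((LinearMap.applyₗ (R := A) (1 : DiffOps k A)).toAddMonoidHom.comp J)) fun ω ω' => by
        refine AddMonoidHom.ext fun t => ?_
        change sgnPow k A n (ω + ω') • J t 1 = sgnPow k A n ω • J t 1 + sgnPow k A n ω' • J t 1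
        rw [map_add, add_smul])
    (fun a ω t => by
      change sgnPow k A n (a • ω) • J t 1 = sgnPow k A n ω • J (a • t) 1
      rw [hJ.apply_smul, map_smul, GrMod.smul_comm_base, smul_assoc])

lemma jetExt_tmul (n : ℤ) {J : Tot (resA E) →+ (DiffOps k A →ₗ[A] N.carrier)}
    (hJ : IsEquivariant J) (ω : Forms k A) (t : Tot (resA E)) :
    jetExt n hJ (ω ⊗ₜ t) = sgnPow k A n ω • J t 1 := rfl

lemma jetExt_smul (n : ℤ) {J : Tot (resA E) →+ (DiffOps k A →ₗ[A] N.carrier)}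
    (hJ : IsEquivariant J) (ω : Forms k A) (x : Forms k A ⊗[A] Tot (resA E)) :
    jetExt n hJ (ω • x) = sgnPow k A n ω • jetExt n hJ x := by
  induction x using TensorProduct.induction_on with
  | zero => simp only [smul_zero, map_zero]
  | add x y hx hy => simp only [smul_add, map_add, hx, hy]
  | tmul ω' t =>
    rw [TensorProduct.smul_tmul', jetExt_tmul, jetExt_tmul, smul_eq_mul, map_mul, mul_smul]

lemma jetExt_mem (n : ℤ) {J : Tot (resA E) →+ (DiffOps k A →ₗ[A] N.carrier)}
    (hJ : IsEquivariant J) {a b : ℤ}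
    (hm : ∀ m e, J (inTot E m e) ∈ jets N.toGrMod a (m + b)) {p m : ℤ}
    {x : Forms k A ⊗[A] Tot (resA E)} (hx : x ∈ freeComp k (resA E) p m) :
    jetExt n hJ x ∈ N.comp (p + a) (m + b) := by
  refine freeComp_map (jetExt n hJ) _ (fun q j hp hj ω hω e => ?_) hx
  rw [jetExt_tmul, sgnPow_of_mem n hω, Units.smul_def, GrMod.zsmul_forms_smul]
  have := N.smul_mem hω (hm j e 1)
  rw [hp, hj, add_comm (q : ℤ) a, add_right_comm]
  exact zsmul_mem this _

lemma jetExt_eq_zero {n : ℤ} {J : Tot (resA E) →+ (DiffOps k A →ₗ[A] N.carrier)}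
    (hJ : IsEquivariant J) (h : J = 0) : jetExt n hJ = 0 := by
  subst h
  refine AddMonoidHom.ext fun x => ?_
  induction x using TensorProduct.induction_on with
  | zero => simp only [map_zero]
  | add x y hx hy => simp only [map_add, hx, hy]
  | tmul ω t =>
    rw [jetExt_tmul]
    exact smul_zero _

lemma IsEquivariant.del (c : DualCoords k A) {J : Tot (resA E) →+ (DiffOps k A →ₗ[A] N.carrier)}
    (hJ : IsEquivariant J) : IsEquivariant ((del c N).comp J) := fun P t => by
  rw [AddMonoidHom.comp_apply, AddMonoidHom.comp_apply, hJ, del_jetAct]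

variable (k) in
lemma freeMod_inv_one_tmul {E : CochainComplex (ModuleCat.{u} (DiffOps k A)) ℤ}
    (t : Tot (resA E)) :
    (freeMod k (resA E)).inv ((1 : Forms k A) ⊗ₜ[A] t : Forms k A ⊗[A] Tot (resA E)) =
      ((1 : Forms k A) ⊗ₜ[A] t : Forms k A ⊗[A] Tot (resA E)) := by
  induction t using tot_induction with
  | h0 =>
    rw [TensorProduct.tmul_zero]
    exact map_zero _
  | ha x y hx hy =>
    rw [TensorProduct.tmul_add]
    refine (map_add (freeMod k (resA E)).inv _ _).trans ?_
    rw [hx, hy]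
    rfl
  | h m e =>
    refine (GrMod.inv_of_mem (one_tmul_mem (resA E) m e)).trans ?_
    rw [Int.negOnePow_zero, Units.val_one]
    exact one_smul ℤ _

variable (k) in
lemma freeMod_inv_tmul {E : CochainComplex (ModuleCat.{u} (DiffOps k A)) ℤ} (ω : Forms k A)
    (t : Tot (resA E)) :
    (freeMod k (resA E)).inv (ω ⊗ₜ[A] t : Forms k A ⊗[A] Tot (resA E)) =
      (sgn k A ω ⊗ₜ[A] t : Forms k A ⊗[A] Tot (resA E)) := by
  have h (ω : Forms k A) : (ω ⊗ₜ[A] t : Forms k A ⊗[A] Tot (resA E)) = ω • (1 ⊗ₜ[A] t) := by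
    rw [TensorProduct.smul_tmul', smul_eq_mul, mul_one]
  rw [h]
  refine (GrMod.inv_forms_smul ω _).trans ?_
  rw [freeMod_inv_one_tmul]
  exact (h _).symm

/-- The extension commutes with `ε` up to sign precisely as far as the jets are killed by `del`. The
defect is the extension of `del ∘ J`, which is what the second copies of the resolution will carry.
-/
lemma ε_jetExt (n : ℤ) {J : Tot (resA E) →+ (DiffOps k A →ₗ[A] N.carrier)}
    (hJ : IsEquivariant J) (c : DualCoords k A) (x : Forms k A ⊗[A] Tot (resA E)) :
    N.ε (jetExt n hJ x) = (n.negOnePow : ℤ) • jetExt n hJ (epsOf c E x) +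
      jetExt n (hJ.del c) ((freeMod k (resA E)).inv x) := by
  induction x using TensorProduct.induction_on with
  | zero =>
    rw [map_zero, map_zero, map_zero, map_zero, smul_zero, zero_add]
    exact (map_zero (jetExt n (hJ.del c))).symm.trans (congrArg _ (map_zero _).symm)
  | add x y hx hy =>
    rw [map_add, map_add, map_add, map_add, smul_add, hx, hy]
    have : jetExt n (hJ.del c) ((freeMod k (resA E)).inv (x + y)) =
        jetExt n (hJ.del c) ((freeMod k (resA E)).inv x) +
          jetExt n (hJ.del c) ((freeMod k (resA E)).inv y) :=
      (congrArg _ (map_add (freeMod k (resA E)).inv x y)).trans (map_add (jetExt n (hJ.del c)) _ _)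
    rw [this]
    abel
  | tmul ω t =>
    have h1 (l) : jetExt n hJ (dOne k A (c.x l) ⊗ₜ[A] opAct E (ofDer (c.θ l)) t) =
        (n.negOnePow : ℤ) • dOne k A (c.x l) • J t (ofDer (c.θ l)) := by
      rw [jetExt_tmul, sgnPow_dOne, hJ, jetAct_apply, one_mul, Units.smul_def,
        GrMod.zsmul_forms_smul]
    rw [freeMod_inv_tmul, jetExt_tmul, jetExt_tmul, epsOf_tmul, map_add, jetExt_tmul, jetExt_smul,
      nablaOf_apply, map_sum, MixedMod.ε_forms_smul, sgnPow_dR, sgnPow_sgn,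
      AddMonoidHom.comp_apply, del_apply]
    simp only [h1, mul_one]
    rw [← Finset.smul_sum, smul_add, Units.smul_def, GrMod.zsmul_forms_smul,
      GrMod.forms_smul_zsmul, smul_smul, smul_smul, smul_sub]
    have h2 : (n.negOnePow : ℤ) * (n.negOnePow : ℤ) = 1 := by
      rw [← Units.val_mul, Int.units_mul_self, Units.val_one]
    rw [h2, one_smul, one_smul]
    abel

end Extension

end DeRhamMixed

namespace DeRhamMixed

open CochainComplex.HomComplex

/-! ### Maps of fixed degree, and the generators `1 ⊗ t`. -/

section HomDegree

variable {k : Type v} {A : Type u} [Field k] [CommRing A] [Algebra k A]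

lemma MixedMod.homDeg_forms_smul {M N : MixedMod k A} {n : ℤ} {f : M.carrier →+ N.carrier}
    (hf : f ∈ M.homDeg N n) (ω : Forms k A) (x : M.carrier) :
    f (ω • x) = sgnPow k A n ω • f x := by
  induction ω using GrMod.forms_induction with
  | ha x y hx hy => rw [add_smul, map_add, hx, hy, map_add, add_smul]
  | h q ω hω =>
    rw [hf.2.1 q ω hω, sgnPow_of_mem n hω, Units.smul_def, Units.smul_def, GrMod.zsmul_forms_smul]

lemma MixedMod.homDeg_base_smul {M N : MixedMod k A} {n : ℤ} {f : M.carrier →+ N.carrier}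
    (hf : f ∈ M.homDeg N n) (a : A) (x : M.carrier) : f (a • x) = a • f x := by
  rw [GrMod.base_smul, MixedMod.homDeg_forms_smul hf, AlgHom.commutes]
  rfl

end HomDegree

section OneTmul

variable {k : Type v} {A : Type u} [Field k] [CommRing A] [Algebra k A] [CharZero k]
  (c : DualCoords k A) (E : CochainComplex (ModuleCat.{u} (DiffOps k A)) ℤ)

/-- The map `t ↦ 1 ⊗ t` to the de Rham complex. -/
noncomputable def oneTmul : Tot (resA E) →+ (deRhamObj c E).carrier :=
  (TensorProduct.mk A (Forms k A) (Tot (resA E)) 1).toAddMonoidHom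

lemma tmul_eq_smul_oneTmul (ω : Forms k A) (t : Tot (resA E)) :
    (ω ⊗ₜ[A] t : Forms k A ⊗[A] Tot (resA E)) = ω • oneTmul c E t := by
  refine Eq.trans ?_ (TensorProduct.smul_tmul' ω (1 : Forms k A) t).symm
  rw [smul_eq_mul, mul_one]

lemma oneTmul_mem {m : ℤ} (e : E.X m) : oneTmul c E (inTot E m e) ∈ (deRhamObj c E).comp 0 m :=
  one_tmul_mem (resA E) m e

lemma inv_oneTmul (t : Tot (resA E)) : (deRhamObj c E).inv (oneTmul c E t) = oneTmul c E t :=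
  freeMod_inv_one_tmul k t

lemma d_oneTmul (t : Tot (resA E)) :
    (deRhamObj c E).d (oneTmul c E t) = oneTmul c E (totD (resA E) t) := by
  refine (freeD_tmul (k := k) (resA E) 1 t).trans ?_
  rw [map_one]
  rfl

lemma ε_oneTmul (t : Tot (resA E)) : (deRhamObj c E).ε (oneTmul c E t) =
    ∑ j, dOne k A (c.x j) • oneTmul c E (opAct E (ofDer (c.θ j)) t) :=
  (epsOf_one_tmul c E t).trans (nablaOf_eq_sum_smul c E t)

variable {E} in
lemma deRhamObj_hom_ext {G : Type*} [AddCommGroup G] {f g : (deRhamObj c E).carrier →+ G}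
    (h : ∀ (ω : Forms k A) (t : Tot (resA E)), f (ω • oneTmul c E t) = g (ω • oneTmul c E t)) : f = g := by
  refine AddMonoidHom.ext fun x => ?_
  induction x using TensorProduct.induction_on with
  | zero => exact (map_zero f).trans (map_zero g).symm
  | add x y hx hy =>
    exact (map_add f x y).trans ((congrArg₂ (· + ·) hx hy).trans (map_add g x y).symm)
  | tmul ω t =>
    rw [tmul_eq_smul_oneTmul c E]
    exact h ω t

lemma jetExt_oneTmul {E : CochainComplex (ModuleCat.{u} (DiffOps k A)) ℤ} {N : MixedMod k A}
    (n : ℤ) {J : Tot (resA E) →+ (DiffOps k A →ₗ[A] N.carrier)} (hJ : IsEquivariant J)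
    (t : Tot (resA E)) : jetExt n hJ (oneTmul c E t) = J t 1 :=
  (jetExt_tmul n hJ 1 t).trans (by rw [map_one, one_smul])

lemma negOnePow_mul_self (n : ℤ) : (n.negOnePow : ℤ) * (n.negOnePow : ℤ) = 1 := by
  rw [← Units.val_mul, Int.units_mul_self, Units.val_one]

end OneTmul

/-! ### From cochains with values in jets to maps out of the resolution. -/

section OfCochain

variable {k : Type v} {A : Type u} [Field k] [CommRing A] [Algebra k A] [CharZero k]
  (c : DualCoords k A) {E : CochainComplex (ModuleCat.{u} (DiffOps k A)) ℤ} {N : MixedMod k A}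
  {n : ℤ}

/-- The jets attached to a cochain with values in the complex of jets. -/
noncomputable def cochainJet (z : Cochain E (jetsObj c N) n) (i : ℕ) :
    Tot (resA E) →+ (DiffOps k A →ₗ[A] N.carrier) :=
  DirectSum.toAddMonoid (β := fun m => ((resA E).X m : Type u)) fun m =>
    ({ toFun := fun e => ((z.v m (m + n) rfl).hom e : totJets N.toGrMod (m + n)).1 i
       map_zero' := by rw [map_zero]; rfl
       map_add' := fun e e' => by rw [map_add]; rfl } : E.X m →+ (DiffOps k A →ₗ[A] N.carrier))

lemma cochainJet_inTot (z : Cochain E (jetsObj c N) n) (i : ℕ) {m m' : ℤ} (h : m + n = m')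
    (e : E.X m) :
    cochainJet c z i (inTot E m e) = ((z.v m m' h).hom e : totJets N.toGrMod m').1 i := by
  subst h
  exact DirectSum.toAddMonoid_of _ _ _

lemma isEquivariant_cochainJet (z : Cochain E (jetsObj c N) n) (i : ℕ) :
    IsEquivariant (cochainJet c z i) := fun P t => by
  induction t using tot_induction with
  | h0 => rw [map_zero, map_zero]; rfl
  | ha x y hx hy => rw [map_add, map_add, map_add, hx, hy]; rfl
  | h m e =>
    rw [opAct_inTot, cochainJet_inTot c z i rfl, cochainJet_inTot c z i rfl, map_smul]
    rfl

lemma cochainJet_mem (z : Cochain E (jetsObj c N) n) (i : ℕ) (m : ℤ) (e : E.X m) :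
    cochainJet c z i (inTot E m e) ∈ jets N.toGrMod i (m + n) := by
  rw [cochainJet_inTot c z i rfl]
  exact ((z.v m (m + n) rfl).hom e : totJets N.toGrMod (m + n)).2 i

/-- The map from the resolution of the de Rham complex attached to a cochain with values in the
complex of jets. -/
noncomputable def ofCochain (z : Cochain E (jetsObj c N) n) :
    (deRhamObj c E).telescope.carrier →+ N.carrier :=
  AddMonoidHom.coprod
    (Finsupp.liftAddHom fun i => (jetExt n (isEquivariant_cochainJet c z i) :
      (deRhamObj c E).carrier →+ N.carrier))
    -- The sign is the one of a map of degree `n` commuting with `ε`, since second copies arise from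
    -- first copies by applying `ε`.
    ((n.negOnePow : ℤ) • Finsupp.liftAddHom fun i =>
      (jetExt n ((isEquivariant_cochainJet c z i).del c) : (deRhamObj c E).carrier →+ N.carrier))

lemma ofCochain_in (z : Cochain E (jetsObj c N) n) (i : ℕ) (x : (deRhamObj c E).carrier) :
    ofCochain c z ((deRhamObj c E).telescopeIn i x) =
      jetExt n (isEquivariant_cochainJet c z i) x := by
  refine (AddMonoidHom.coprod_apply _ _ _).trans ?_
  exact (congrArg₂ (fun x y : N.carrier => x + y) (Finsupp.liftAddHom_apply_single _ _ _)
    (map_zero _)).trans (add_zero _)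

lemma ofCochain_in' (z : Cochain E (jetsObj c N) n) (i : ℕ) (x : (deRhamObj c E).carrier) :
    ofCochain c z ((deRhamObj c E).telescopeIn' i x) =
      (n.negOnePow : ℤ) • jetExt n ((isEquivariant_cochainJet c z i).del c) x := by
  refine (AddMonoidHom.coprod_apply _ _ _).trans ?_
  exact (congrArg₂ (fun x y : N.carrier => x + y) (map_zero _)
    (congrArg (fun x : N.carrier => (n.negOnePow : ℤ) • x)
      (Finsupp.liftAddHom_apply_single _ _ _))).trans (zero_add _)

lemma del_del_comp (J : Tot (resA E) →+ (DiffOps k A →ₗ[A] N.carrier)) :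
    (del c N).comp ((del c N).comp J) = 0 :=
  AddMonoidHom.ext fun t => del_del c N (J t)

/-- Compatibility with `ε` on the first copies is `ε_jetExt`, whose defect the second copies account
for. On the second copies there is no defect because `del` squares to zero. -/
lemma ofCochain_mem (z : Cochain E (jetsObj c N) n) :
    ofCochain c z ∈ (deRhamObj c E).telescope.homDeg N n := by
  refine ⟨fun p m x hx => ?_, fun q ω hω x => ?_, fun x => ?_⟩
  · refine add_mem (AddSubgroup.sum_mem _ fun i _ => ?_) ?_
    · have := jetExt_mem n (isEquivariant_cochainJet c z i) (cochainJet_mem c z i) (hx i).1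
      rwa [sub_add_cancel] at this
    · refine zsmul_mem (AddSubgroup.sum_mem _ fun i _ => ?_) _
      have := jetExt_mem n ((isEquivariant_cochainJet c z i).del c) (b := n + 1)
        (fun m e => by
          have := del_mem c (cochainJet_mem c z i m e)
          rwa [add_assoc] at this) (hx i).2
      rwa [show p - i - 1 + (i + 1) = p by ring, show m - 1 + (n + 1) = m + n by ring] at this
  · have h : (ofCochain c z).comp (DistribSMul.toAddMonoidHom _ ω) =
        (DistribSMul.toAddMonoidHom _ (sgnPow k A n ω)).comp (ofCochain c z) := by
      refine MixedMod.telescope_hom_ext (fun i x => ?_) (fun i x => ?_)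
      · change ofCochain c z (ω • (deRhamObj c E).telescopeIn i x) =
          sgnPow k A n ω • ofCochain c z ((deRhamObj c E).telescopeIn i x)
        rw [← MixedMod.telescopeIn_smul, ofCochain_in, ofCochain_in]
        exact jetExt_smul n _ ω x
      · change ofCochain c z (ω • (deRhamObj c E).telescopeIn' i x) =
          sgnPow k A n ω • ofCochain c z ((deRhamObj c E).telescopeIn' i x)
        rw [← MixedMod.telescopeIn'_smul, ofCochain_in', ofCochain_in', GrMod.forms_smul_zsmul]
        exact congrArg _ (jetExt_smul n _ ω x)
    refine (DFunLike.congr_fun h x).trans ?_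
    change sgnPow k A n ω • ofCochain c z x = _
    rw [sgnPow_of_mem n hω, Units.smul_def, Units.smul_def, GrMod.zsmul_forms_smul]
  · have h : (ofCochain c z).comp (deRhamObj c E).telescope.ε =
        (n.negOnePow : ℤ) • N.ε.comp (ofCochain c z) := by
      refine MixedMod.telescope_hom_ext (fun i x => ?_) (fun i x => ?_)
      · change ofCochain c z ((deRhamObj c E).telescope.ε ((deRhamObj c E).telescopeIn i x)) =
          (n.negOnePow : ℤ) • N.ε (ofCochain c z ((deRhamObj c E).telescopeIn i x))
        rw [MixedMod.telescopeIn_ε, map_add, ofCochain_in, ofCochain_in, ofCochain_in']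
        refine Eq.trans ?_ (congrArg (fun y : N.carrier => (n.negOnePow : ℤ) • y)
          (ε_jetExt n (isEquivariant_cochainJet c z i) c x)).symm
        rw [smul_add, smul_smul, negOnePow_mul_self, one_smul]
        rfl
      · change ofCochain c z ((deRhamObj c E).telescope.ε ((deRhamObj c E).telescopeIn' i x)) =
          (n.negOnePow : ℤ) • N.ε (ofCochain c z ((deRhamObj c E).telescopeIn' i x))
        rw [MixedMod.telescopeIn'_ε, ofCochain_in', ofCochain_in', map_zsmul]
        refine congrArg (fun y : N.carrier => (n.negOnePow : ℤ) • y) (Eq.trans ?_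
          (congrArg (fun y : N.carrier => (n.negOnePow : ℤ) • y)
            (ε_jetExt n ((isEquivariant_cochainJet c z i).del c) c x)).symm)
        rw [jetExt_eq_zero _ (del_del_comp c _), smul_add, smul_smul, negOnePow_mul_self,
          one_smul]
        exact (add_zero _).symm.trans (congrArg _ (smul_zero _).symm)
    exact DFunLike.congr_fun h x

end OfCochain

/-! ### From maps out of the resolution to cochains with values in jets. -/

section ToCochain

variable {k : Type v} {A : Type u} [Field k] [CommRing A] [Algebra k A] [CharZero k]
  (c : DualCoords k A) {E : CochainComplex (ModuleCat.{u} (DiffOps k A)) ℤ} {N : MixedMod k A}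
  {n : ℤ} {f : (deRhamObj c E).telescope.carrier →+ N.carrier}

/-- The jets `P ↦ f (1 ⊗ P t)`, with `1 ⊗ P t` in the copy of index `i`. -/
noncomputable def homJet (hf : f ∈ (deRhamObj c E).telescope.homDeg N n) (i : ℕ)
    (t : Tot (resA E)) : DiffOps k A →ₗ[A] N.carrier :=
  ({ f.comp ((deRhamObj c E).telescopeIn i) with
      map_smul' := fun a x => by
        change f ((deRhamObj c E).telescopeIn i (a • x)) = a • f ((deRhamObj c E).telescopeIn i x)
        rw [GrMod.base_smul, MixedMod.telescopeIn_smul]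
        exact MixedMod.homDeg_base_smul hf a _ } :
    (deRhamObj c E).carrier →ₗ[A] N.carrier) ∘ₗ unitJet c E t

lemma homJet_apply (hf : f ∈ (deRhamObj c E).telescope.homDeg N n) (i : ℕ)
    (t : Tot (resA E)) (P : DiffOps k A) : homJet c hf i t P =
      f ((deRhamObj c E).telescopeIn i (oneTmul c E (opAct E P t))) := rfl

lemma homJet_add (hf : f ∈ (deRhamObj c E).telescope.homDeg N n) (i : ℕ)
    (t t' : Tot (resA E)) : homJet c hf i (t + t') = homJet c hf i t + homJet c hf i t' := by
  rw [homJet, map_add, LinearMap.comp_add]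
  rfl

lemma homJet_mem (hf : f ∈ (deRhamObj c E).telescope.homDeg N n) (i : ℕ) {m m' : ℤ}
    (h : m + n = m') (e : E.X m) : homJet c hf i (inTot E m e) ∈ jets N.toGrMod i m' := fun P => by
  subst h
  have := hf.1 _ _ _ (MixedMod.telescopeIn_mem i (unitJet_mem c E e P))
  rwa [zero_add] at this

/-- The cochain with values in the complex of jets attached to a map from the resolution of the
de Rham complex. -/
noncomputable def toCochain (hf : f ∈ (deRhamObj c E).telescope.homDeg N n) :
    Cochain E (jetsObj c N) n :=
  Cochain.mk fun p q hpq => ModuleCat.ofHom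
    { toFun := fun e => (⟨fun i => homJet c hf i (inTot E p e), fun i => homJet_mem c hf i hpq e⟩ :
        totJets N.toGrMod q)
      map_add' := fun e e' => Subtype.ext (funext fun i =>
        (congrArg (homJet c hf i) (map_add _ e e')).trans (homJet_add c hf i _ _))
      map_smul' := fun P e => Subtype.ext (funext fun i => LinearMap.ext fun R => by
        change homJet c hf i (inTot E p (P • e)) R = homJet c hf i (inTot E p e) (R * P)
        rw [homJet_apply, homJet_apply, ← opAct_inTot, opAct_mul]) }

lemma toCochain_apply (hf : f ∈ (deRhamObj c E).telescope.homDeg N n) {p q : ℤ} (h : p + n = q)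
    (e : E.X p) (i : ℕ) :
    (((toCochain c hf).v p q h).hom e : totJets N.toGrMod q).1 i =
      homJet c hf i (inTot E p e) := rfl

lemma cochain_ext {z z' : Cochain E (jetsObj c N) n}
    (h : ∀ (p q : ℤ) (hpq : p + n = q) (e : E.X p) (i : ℕ) (P : DiffOps k A),
      ((z.v p q hpq).hom e : totJets N.toGrMod q).1 i P =
        ((z'.v p q hpq).hom e : totJets N.toGrMod q).1 i P) : z = z' :=
  Cochain.ext _ _ fun p q hpq => ModuleCat.hom_ext (LinearMap.ext fun e =>
    Subtype.ext (funext fun i => LinearMap.ext (h p q hpq e i)))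

/-- The extension remembers values at `1` only, but equivariance recovers the jet: its value at `P`
is the value at `1` of the jet of `P t`. -/
lemma toCochain_ofCochain (z : Cochain E (jetsObj c N) n) :
    toCochain c (ofCochain_mem c z) = z :=
  cochain_ext c fun p q hpq e i P => by
    rw [toCochain_apply, homJet_apply, ofCochain_in, jetExt_oneTmul,
      isEquivariant_cochainJet, jetAct_apply, one_mul, cochainJet_inTot c z i hpq]

/-- Applying `f` to `ε` of a first copy produces the second copy and the terms `dx j ∧ (1 ⊗ θ j P
t)`. Compatibility with `ε` then solves for the value on the second copy, and `del` appears. -/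
lemma homDeg_in' (hf : f ∈ (deRhamObj c E).telescope.homDeg N n) (i : ℕ) (t : Tot (resA E))
    (P : DiffOps k A) : f ((deRhamObj c E).telescopeIn' i (oneTmul c E (opAct E P t))) =
        (n.negOnePow : ℤ) • del c N (homJet c hf i t) P := by
  have h1 := MixedMod.telescopeIn_ε i (oneTmul c E (opAct E P t))
  rw [inv_oneTmul, ε_oneTmul, map_sum] at h1
  have h4 (j) : f ((deRhamObj c E).telescopeIn i
      (dOne k A (c.x j) • oneTmul c E (opAct E (ofDer (c.θ j)) (opAct E P t)))) =
        (n.negOnePow : ℤ) • dOne k A (c.x j) • homJet c hf i t (ofDer (c.θ j) * P) := by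
    rw [MixedMod.telescopeIn_smul, MixedMod.homDeg_forms_smul hf, sgnPow_dOne, Units.smul_def,
      GrMod.zsmul_forms_smul, ← opAct_mul]
    rfl
  have h5 := congrArg f h1
  rw [hf.2.2, map_add, map_sum, Finset.sum_congr rfl fun j _ => h4 j, ← Finset.smul_sum,
    Units.smul_def] at h5
  rw [del_apply, smul_sub]
  exact (sub_eq_of_eq_add' h5).symm

/-- Second copies are determined by first copies through `homDeg_in'`, and first copies by the
generators `1 ⊗ e` through linearity over the forms. This makes `toCochain` injective. -/
lemma homDeg_telescope_ext {g : (deRhamObj c E).telescope.carrier →+ N.carrier}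
    (hf : f ∈ (deRhamObj c E).telescope.homDeg N n)
    (hg : g ∈ (deRhamObj c E).telescope.homDeg N n)
    (h : ∀ (i : ℕ) (p : ℤ) (e : E.X p),
      f ((deRhamObj c E).telescopeIn i (oneTmul c E (inTot E p e))) =
        g ((deRhamObj c E).telescopeIn i (oneTmul c E (inTot E p e)))) : f = g := by
  have h2 (i : ℕ) (t : Tot (resA E)) : f ((deRhamObj c E).telescopeIn i (oneTmul c E t)) =
      g ((deRhamObj c E).telescopeIn i (oneTmul c E t)) := by
    induction t using tot_induction with
    | h0 => simp only [map_zero]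
    | ha x y hx hy => simp only [map_add, hx, hy]
    | h m e => exact h i m e
  have h1 (i : ℕ) (t : Tot (resA E)) : homJet c hf i t = homJet c hg i t :=
    LinearMap.ext fun P => h2 i _
  have h3 (i : ℕ) (t : Tot (resA E)) : f ((deRhamObj c E).telescopeIn' i (oneTmul c E t)) =
      g ((deRhamObj c E).telescopeIn' i (oneTmul c E t)) := by
    have := (homDeg_in' c hf i t 1).trans
      ((congrArg (fun φ => (n.negOnePow : ℤ) • del c N φ 1) (h1 i t)).trans
        (homDeg_in' c hg i t 1).symm)
    rw [map_one] at this
    exact this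
  have h4 (i : ℕ) : f.comp ((deRhamObj c E).telescopeIn i) =
      g.comp ((deRhamObj c E).telescopeIn i) :=
    deRhamObj_hom_ext c fun ω t => by
      rw [AddMonoidHom.comp_apply, AddMonoidHom.comp_apply, MixedMod.telescopeIn_smul,
        MixedMod.homDeg_forms_smul hf, MixedMod.homDeg_forms_smul hg, h2]
  have h5 (i : ℕ) : f.comp ((deRhamObj c E).telescopeIn' i) =
      g.comp ((deRhamObj c E).telescopeIn' i) :=
    deRhamObj_hom_ext c fun ω t => by
      rw [AddMonoidHom.comp_apply, AddMonoidHom.comp_apply, MixedMod.telescopeIn'_smul,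
        MixedMod.homDeg_forms_smul hf, MixedMod.homDeg_forms_smul hg, h3]
  exact MixedMod.telescope_hom_ext (fun i x => DFunLike.congr_fun (h4 i) x)
    (fun i x => DFunLike.congr_fun (h5 i) x)

lemma toCochain_injective {g : (deRhamObj c E).telescope.carrier →+ N.carrier}
    (hf : f ∈ (deRhamObj c E).telescope.homDeg N n)
    (hg : g ∈ (deRhamObj c E).telescope.homDeg N n) (h : toCochain c hf = toCochain c hg) :
    f = g := by
  refine homDeg_telescope_ext c hf hg fun i p e => ?_
  have h1 : homJet c hf i (inTot E p e) 1 = homJet c hg i (inTot E p e) 1 := by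
    rw [← toCochain_apply c hf rfl, h, toCochain_apply]
  rw [homJet_apply, homJet_apply, map_one] at h1
  exact h1

/-- With this compatibility, the complex of maps out of the resolution is identified with the
complex of cochains into the jets. -/
lemma toCochain_diff (hf : f ∈ (deRhamObj c E).telescope.homDeg N n) :
    toCochain c (MixedMod.diff_mem _ N rfl hf) = δ n (n + 1) (toCochain c hf) :=
  cochain_ext c fun p q hpq e i P => by
    rw [δ_v n (n + 1) rfl (toCochain c hf) p q hpq (p + n) (p + 1) (by lia) rfl, toCochain_apply,
      homJet_apply]
    have hu : (deRhamObj c E).d (oneTmul c E (opAct E P (inTot E p e))) =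
        oneTmul c E (opAct E P (inTot E (p + 1) ((E.d p (p + 1)).hom e))) := by
      rw [d_oneTmul, ← opAct_totD, totD_inTot E p (p + 1) rfl]
    have h1 : (((((toCochain c hf).v p (p + n) rfl ≫ (jetsObj c N).d (p + n) q).hom e :
        totJets N.toGrMod q)).1 i P : N.carrier) =
          totDel c N (fun i => homJet c hf i (inTot E p e)) i P :=
      LinearMap.congr_fun (congrFun (jetsObj_d_apply c N (by lia) _) i) P
    have h2 : ((((n + 1).negOnePow • E.d p (p + 1) ≫ (toCochain c hf).v (p + 1) q
        (by lia)).hom e : totJets N.toGrMod q).1 i P : N.carrier) =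
          ((n + 1).negOnePow : ℤ) •
            homJet c hf i (inTot E (p + 1) ((E.d p (p + 1)).hom e)) P := by
      rcases Int.units_eq_one_or (n + 1).negOnePow with h | h
      · rw [h, one_smul, Units.val_one, one_smul]
        rfl
      · rw [h, Units.neg_smul, one_smul, Units.val_neg, Units.val_one, neg_smul, one_smul]
        rfl
    change N.d (f ((deRhamObj c E).telescopeIn i (oneTmul c E (opAct E P (inTot E p e))))) -
        (n.negOnePow : ℤ) • f ((deRhamObj c E).telescope.d ((deRhamObj c E).telescopeIn i
          (oneTmul c E (opAct E P (inTot E p e))))) =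
      (((((toCochain c hf).v p (p + n) rfl ≫ (jetsObj c N).d (p + n) q).hom e :
        totJets N.toGrMod q)).1 i P : N.carrier) +
      ((((n + 1).negOnePow • E.d p (p + 1) ≫ (toCochain c hf).v (p + 1) q
        (by lia)).hom e : totJets N.toGrMod q).1 i P : N.carrier)
    rw [h1, h2, Int.negOnePow_succ, Units.val_neg, neg_smul, ← sub_eq_add_neg]
    rcases i with _ | i
    · rw [MixedMod.telescopeIn_zero_d, hu]
      rfl
    -- The second copy of index `i` in the boundary contributes `del` of the jet of index `i`, by
    -- `homDeg_in'`. This is the extra term of `totDel` in weight `i + 1`, absent in weight `0`.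
    · rw [MixedMod.telescopeIn_succ_d, hu, inv_oneTmul, map_sub, homDeg_in' c hf, smul_sub,
        smul_smul, negOnePow_mul_self, one_smul, totDel_succ, LinearMap.add_apply, homJet_apply,
        sub_sub_eq_add_sub]
      rfl

end ToCochain

end DeRhamMixed

namespace DeRhamMixed

open CochainComplex.HomComplex

/-! ### De Rham complexes in weight zero, and preservation of quasi-isomorphisms. -/

section Morphisms

variable {k : Type v} {A : Type u} [Field k] [CommRing A] [Algebra k A]

namespace MixedMod

lemma lin_mem_homDeg {M N : MixedMod k A} (f : M ⟶ N) :
    (MixedMod.lin f).toAddMonoidHom ∈ M.homDeg N 0 := by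
  refine ⟨fun p m x hx => ?_, fun q ω _ x => ?_, fun x => ?_⟩
  · rw [add_zero]
    exact lin_mem f hx
  · rw [zero_mul, Int.negOnePow_zero, one_smul]
    exact map_smul (MixedMod.lin f) ω x
  · rw [Int.negOnePow_zero, one_smul]
    exact lin_ε f x

/-- The morphism given by a map of degree `0` which commutes with the differentials. -/
noncomputable def homOfDegZero {M N : MixedMod k A} {f : M.carrier →+ N.carrier}
    (hf : f ∈ M.homDeg N 0) (hd : ∀ x, f (M.d x) = N.d (f x)) : M ⟶ N where
  lin := { f with
    map_smul' := fun ω x => by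
      refine (homDeg_forms_smul hf ω x).trans ?_
      rw [sgnPow, if_pos Even.zero]
      rfl }
  map_mem hx := by
    have := hf.1 _ _ _ hx
    rwa [add_zero] at this
  map_d := hd
  map_ε x := by
    have := hf.2.2 x
    rwa [Int.negOnePow_zero, one_smul] at this

end MixedMod

variable [CharZero k] (c : DualCoords k A)

lemma telescope_deRham_hom_ext {E : CochainComplex (ModuleCat.{u} (DiffOps k A)) ℤ}
    {N : MixedMod k A} {f g : (deRhamObj c E).telescope ⟶ N}
    (h : ∀ (i : ℕ) (p : ℤ) (e : E.X p),
      MixedMod.lin f ((deRhamObj c E).telescopeIn i (oneTmul c E (inTot E p e))) =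
        MixedMod.lin g ((deRhamObj c E).telescopeIn i (oneTmul c E (inTot E p e)))) : f = g :=
  MixedMod.hom_ext fun x => DFunLike.congr_fun (homDeg_telescope_ext c
    (MixedMod.lin_mem_homDeg f) (MixedMod.lin_mem_homDeg g) h) x

lemma deRhamMap_oneTmul {E F : CochainComplex (ModuleCat.{u} (DiffOps k A)) ℤ} (f : E ⟶ F)
    {p : ℤ} (e : E.X p) : MixedMod.lin (deRhamMap c f) (oneTmul c E (inTot E p e)) =
      oneTmul c F (inTot F p ((f.f p).hom e)) := by
  refine (formsMap_tmul f 1 _).trans ?_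
  rw [resMap_inTot]
  rfl

section

variable {E : CochainComplex (ModuleCat.{u} (DiffOps k A)) ℤ}

lemma oneTmul_injective : Function.Injective (oneTmul c E) :=
  fun _ _ h => one_tmul_injective (k := k) (resA E) h

lemma d_oneTmul_inTot {n m : ℤ} (h : n + 1 = m) (e : E.X n) :
    (deRhamObj c E).d (oneTmul c E (inTot E n e)) =
      oneTmul c E (inTot E m ((E.d n m).hom e)) := by
  rw [d_oneTmul, totD_inTot E n m h]

lemma exists_oneTmul {n : ℤ} {x : (deRhamObj c E).carrier} (hx : x ∈ (deRhamObj c E).comp 0 n) :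
    ∃ e : E.X n, x = oneTmul c E (inTot E n e) := mem_freeComp_zero hx

lemma oneTmul_inTot_inj {n : ℤ} {e e' : E.X n} :
    oneTmul c E (inTot E n e) = oneTmul c E (inTot E n e') ↔ e = e' :=
  ⟨fun h => inTot_injective E (oneTmul_injective c h), fun h => by rw [h]⟩

lemma d_oneTmul_eq_zero {n m : ℤ} (h : n + 1 = m) {e : E.X n} :
    (deRhamObj c E).d (oneTmul c E (inTot E n e)) = 0 ↔ (E.d n m).hom e = 0 := by
  rw [d_oneTmul_inTot c h, ← map_zero (oneTmul c E), ← map_zero (inTot E m), oneTmul_inTot_inj]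

lemma exists_d_eq_oneTmul {n m : ℤ} (h : n + 1 = m) {e : E.X m} {y : (deRhamObj c E).carrier}
    (hy : (deRhamObj c E).d y = oneTmul c E (inTot E m e)) :
    ∃ e' : E.X n, (E.d n m).hom e' = e := by
  obtain ⟨e', he⟩ := exists_oneTmul c (GrMod.pr_mem 0 n y)
  refine ⟨e', (oneTmul_inTot_inj c).1 ?_⟩
  rw [← d_oneTmul_inTot c h, ← he, ← GrMod.d_pr, hy, h, GrMod.pr_of_mem (oneTmul_mem c E e)]

lemma exists_cl_oneTmul {n m : ℤ} (h : n + 1 = m) {x : (deRhamObj c E).hCarrier}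
    (hx : x ∈ (deRhamObj c E).hComp 0 n) :
    ∃ (e : E.X n) (he : (E.d n m).hom e = 0),
      GrMod.cl (oneTmul c E (inTot E n e)) ((d_oneTmul_eq_zero c h).2 he) = x := by
  obtain ⟨x, hx0, hx', rfl⟩ := GrMod.mem_hComp.1 hx
  obtain ⟨e, rfl⟩ := exists_oneTmul c hx'
  exact ⟨e, (d_oneTmul_eq_zero c h).1 hx0, rfl⟩

end

/-- The weight-zero part of the de Rham complex is the complex itself, and contractions on
cohomology make weight zero decisive. No exactness of the tensor product with the forms has to be
invoked. -/
lemma qis_deRhamMap {E F : CochainComplex (ModuleCat.{u} (DiffOps k A)) ℤ} (f : E ⟶ F)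
    [hf : QuasiIso f] : MixedMod.qis k A (deRhamMap c f) := by
  rw [module_quasiIso_iff] at hf
  refine (GrMod.qis_iff ((MixedMod.forget k A).map (deRhamMap c f))).2 ?_
  refine Contraction.bijective_of_weight_zero (freeCohomologyContraction c (resA E))
    (freeCohomologyContraction c (resA F))
    ((GrMod.hFun k A).map ((MixedMod.forget k A).map (deRhamMap c f))) (fun n x hx h0 => ?_)
    (fun n y hy => ?_)
  · obtain ⟨e, he, rfl⟩ := exists_cl_oneTmul c rfl hx
    obtain ⟨y, hy⟩ := GrMod.cl_eq_zero.1 h0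
    obtain ⟨e', he'⟩ := exists_d_eq_oneTmul c (sub_add_cancel n 1)
      (hy.trans (deRhamMap_oneTmul c f e))
    obtain ⟨e'', he''⟩ := (hf (n - 1) n (n + 1) (sub_add_cancel n 1) rfl).1 e he ⟨e', he'⟩
    refine GrMod.cl_eq_zero.2 ⟨oneTmul c E (inTot E (n - 1) e''), ?_⟩
    exact (d_oneTmul_inTot c (sub_add_cancel n 1) e'').trans (by rw [he''])
  · obtain ⟨e, he, rfl⟩ := exists_cl_oneTmul c rfl hy
    obtain ⟨e', he', e'', he''⟩ := (hf (n - 1) n (n + 1) (sub_add_cancel n 1) rfl).2 e he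
    have hc := (d_oneTmul_eq_zero c rfl).2 he'
    refine ⟨GrMod.cl (oneTmul c E (inTot E n e')) hc, GrMod.cl_mem hc (oneTmul_mem c E e'), ?_⟩
    refine GrMod.cl_eq_cl.2 ⟨-oneTmul c F (inTot F (n - 1) e''), ?_⟩
    have h1 : (deRhamObj c F).d (-oneTmul c F (inTot F (n - 1) e'')) =
        oneTmul c F (inTot F n ((f.f n).hom e')) - oneTmul c F (inTot F n e) := by
      rw [map_neg, d_oneTmul_inTot c (sub_add_cancel n 1), he'', map_sub, map_sub, neg_sub]
    refine h1.trans ?_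
    rw [← deRhamMap_oneTmul c f]
    rfl

end Morphisms

/-! ### The counit: evaluation of jets. -/

section Counit

variable {k : Type v} {A : Type u} [Field k] [CommRing A] [Algebra k A] [CharZero k]
  (c : DualCoords k A)

/-- The correspondence with cochains is injective and compatible with differentials, so cocycles
correspond to maps commuting with `d` up to sign. -/
lemma ofCochain_d_of_δ_eq_zero {E : CochainComplex (ModuleCat.{u} (DiffOps k A)) ℤ}
    {N : MixedMod k A} {n : ℤ} {z : Cochain E (jetsObj c N) n} (hz : δ n (n + 1) z = 0)
    (x : (deRhamObj c E).telescope.carrier) :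
    N.d (ofCochain c z x) = (n.negOnePow : ℤ) • ofCochain c z ((deRhamObj c E).telescope.d x) := by
  have h := toCochain_injective c (MixedMod.diff_mem _ N rfl (ofCochain_mem c z)) (zero_mem _) (by
    rw [toCochain_diff c (ofCochain_mem c z), toCochain_ofCochain, hz]
    rfl)
  exact sub_eq_zero.1 (DFunLike.congr_fun h x)

/-- The evaluation of jets, as a morphism from the resolution of the de Rham complex of the complex
of jets. -/
noncomputable def counitHom (M : MixedMod k A) :
    (deRhamObj c (jetsObj c M)).telescope ⟶ M :=
  MixedMod.homOfDegZero (ofCochain_mem c (Cochain.ofHom (𝟙 (jetsObj c M)))) fun x => by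
    rw [ofCochain_d_of_δ_eq_zero c (δ_ofHom _), Int.negOnePow_zero, Units.val_one, one_smul]

lemma counitHom_in (M : MixedMod k A) (i : ℕ) {p : ℤ} (φ : (jetsObj c M).X p) :
    MixedMod.lin (counitHom c M) ((deRhamObj c (jetsObj c M)).telescopeIn i
      (oneTmul c (jetsObj c M) (inTot (jetsObj c M) p φ))) = (φ : totJets M.toGrMod p).1 i 1 := by
  refine (ofCochain_in c (Cochain.ofHom (𝟙 (jetsObj c M))) i _).trans ?_
  rw [jetExt_oneTmul]
  refine (LinearMap.congr_fun (cochainJet_inTot c _ i (add_zero p) φ) 1).trans ?_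
  rw [Cochain.ofHom_v]
  rfl

/-- The postcomposition of jets with a morphism. -/
noncomputable def jetsMap {M N : MixedMod k A} (f : M ⟶ N) : jetsObj c M ⟶ jetsObj c N :=
  (jetsFun c).map f

lemma counitHom_naturality {M N : MixedMod k A} (f : M ⟶ N) :
    MixedMod.telescopeMap (deRhamMap c (jetsMap c f)) ≫ counitHom c N =
      counitHom c M ≫ f := by
  refine telescope_deRham_hom_ext c fun i p φ => ?_
  rw [MixedMod.lin_comp, MixedMod.lin_comp, MixedMod.telescopeMap_in, deRhamMap_oneTmul]
  exact (counitHom_in c N i _).trans (congrArg _ (counitHom_in c M i φ)).symm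

/-- A triangle identity, up to the augmentation. On the copy of index `0`, the jet `P ↦ 1 ⊗ P e` is
evaluated at `1`; the other copies evaluate components of the unit in positive weight, which are
zero, as is the augmentation there. -/
lemma telescopeMap_unitHom_counitHom (F : CochainComplex (ModuleCat.{u} (DiffOps k A)) ℤ) :
    MixedMod.telescopeMap (deRhamMap c (unitHom c F)) ≫ counitHom c (deRhamObj c F) =
      (deRhamObj c F).telescopeProj := by
  refine telescope_deRham_hom_ext c fun i p e => ?_
  rw [MixedMod.lin_comp, MixedMod.telescopeMap_in, deRhamMap_oneTmul]
  refine (counitHom_in c (deRhamObj c F) i _).trans ?_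
  rcases i with _ | i
  · rw [MixedMod.telescopeProj_in_zero]
    exact unitHom_f_one c F e
  · rw [MixedMod.telescopeProj_in_succ]
    rfl

/-- On cohomology the augmentation is invertible, so the counit becomes a map between modules with
contractions. In weight zero it is evaluation at `1` of jets, which is bijective by
`exists_totDel_eq` and `exists_cycle_of_weight_zero`, and weight zero suffices. -/
lemma qis_counitHom {M : MixedMod k A} (K : Contraction c M.toGrMod.hMod) :
    MixedMod.qis k A (counitHom c M) := by
  let L := jetsObj c M
  let K₀ : Contraction c (deRhamObj c L).toGrMod.hMod := freeCohomologyContraction c (resA L)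
  let π : (deRhamObj c L).telescope.toGrMod.hMod ⟶ (deRhamObj c L).toGrMod.hMod :=
    (GrMod.hFun k A).map ((MixedMod.forget k A).map (deRhamObj c L).telescopeProj)
  have hπ : IsIso π := GrMod.isInvertedBy_hFun _ (MixedMod.qis_telescopeProj _)
  let κ : (deRhamObj c L).telescope.toGrMod.hMod ⟶ M.toGrMod.hMod :=
    (GrMod.hFun k A).map ((MixedMod.forget k A).map (counitHom c M))
  let g : (deRhamObj c L).toGrMod.hMod ⟶ M.toGrMod.hMod := inv π ≫ κ
  have hg : κ = π ≫ g := (IsIso.hom_inv_id_assoc π κ).symm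
  have hd {n : ℤ} {φ : L.X n} (hφ : (L.d n (n + 1)).hom φ = 0) :
      totDel c M (φ : totJets M.toGrMod n).1 = 0 := (jetsObj_d_eq c M rfl φ 0).1 hφ
  have hev {n : ℤ} {φ : L.X n} (hφ : (L.d n (n + 1)).hom φ = 0) :
      M.d ((φ : totJets M.toGrMod n).1 0 1) = 0 :=
    LinearMap.congr_fun (congrFun (hd hφ) 0) 1
  -- The class of `1 ⊗ φ` lifts to the class of its copy of index `0` in the resolution, where the
  -- counit evaluates the weight-zero jet of `φ` at `1`.
  have key {n : ℤ} (φ : L.X n) (hφ : (L.d n (n + 1)).hom φ = 0) :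
      GrMod.lin g (GrMod.cl (oneTmul c L (inTot L n φ)) ((d_oneTmul_eq_zero c rfl).2 hφ)) =
        GrMod.cl ((φ : totJets M.toGrMod n).1 0 1) (hev hφ) := by
    have h3 : (deRhamObj c L).telescope.d
        ((deRhamObj c L).telescopeIn 0 (oneTmul c L (inTot L n φ))) = 0 := by
      rw [MixedMod.telescopeIn_zero_d, (d_oneTmul_eq_zero c rfl).2 hφ, map_zero]
    have h4 : GrMod.lin π (GrMod.cl _ h3) =
        GrMod.cl (oneTmul c L (inTot L n φ)) ((d_oneTmul_eq_zero c rfl).2 hφ) :=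
      GrMod.cl_congr _ (MixedMod.telescopeProj_in_zero _)
    have h5 : GrMod.lin κ (GrMod.cl _ h3) = GrMod.cl _ (hev hφ) :=
      GrMod.cl_congr _ (counitHom_in c M 0 φ)
    rw [hg] at h5
    exact (congrArg (GrMod.lin g) h4).symm.trans h5
  have hb : Function.Bijective (GrMod.lin g) := by
    refine Contraction.bijective_of_weight_zero K₀ K g (fun n x hx h0 => ?_) (fun n y hy => ?_)
    · obtain ⟨φ, hφ, rfl⟩ := exists_cl_oneTmul (E := L) c rfl hx
      obtain ⟨x, hx⟩ := GrMod.cl_eq_zero.1 ((key φ hφ).symm.trans h0)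
      obtain ⟨ψ, hψ, h⟩ := exists_totDel_eq c K (sub_add_cancel n 1)
        (φ : totJets M.toGrMod n).2 (hd hφ) hx
      refine GrMod.cl_eq_zero.2
        ⟨oneTmul c L (inTot L (n - 1) (⟨ψ, hψ⟩ : totJets M.toGrMod (n - 1))), ?_⟩
      refine (d_oneTmul_inTot c (sub_add_cancel n 1) _).trans ((oneTmul_inTot_inj c).2 ?_)
      exact (jetsObj_d_eq c M (sub_add_cancel n 1) _ _).2 h
    · obtain ⟨y, hy0, hy', rfl⟩ := GrMod.mem_hComp.1 hy
      obtain ⟨φ, hφ, h1, h2⟩ := exists_cycle_of_weight_zero c K hy' hy0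
      let φ' : L.X n := (⟨φ, hφ⟩ : totJets M.toGrMod n)
      have h3 : (L.d n (n + 1)).hom φ' = 0 := (jetsObj_d_eq c M rfl _ 0).2 h1
      exact ⟨GrMod.cl (oneTmul c L (inTot L n φ')) ((d_oneTmul_eq_zero c rfl).2 h3),
        GrMod.cl_mem _ (oneTmul_mem c L φ'), (key φ' h3).trans (GrMod.cl_congr _ h2)⟩
  refine (GrMod.qis_iff ((MixedMod.forget k A).map (counitHom c M))).2 ?_
  change Function.Bijective (GrMod.lin κ)
  rw [hg]
  exact hb.comp (GrMod.bijective_of_isIso π)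

end Counit

end DeRhamMixed

namespace DeRhamMixed

/-! ### Cochains from a K-projective complex along quasi-isomorphisms. -/

section KProjectiveComplexes

open CochainComplex CochainComplex.HomComplex

variable {C : Type*} [Category* C] [Abelian C] [HasDerivedCategory C]

/-- Homotopy classes of maps out of a K-projective complex are morphisms in the derived category,
where the shift of `s` is invertible. -/
lemma bijective_comp_shift_of_quasiIso (E : CochainComplex C ℤ) [E.IsKProjective]
    {F G : CochainComplex C ℤ} (s : F ⟶ G) [QuasiIso s] (n : ℤ) :
    Function.Bijective (fun f : (HomotopyCategory.quotient C (.up ℤ)).obj E ⟶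
      (HomotopyCategory.quotient C (.up ℤ)).obj (F⟦n⟧) =>
        f ≫ (HomotopyCategory.quotient C (.up ℤ)).map (s⟦n⟧')) := by
  have h1 : IsIso (DerivedCategory.Q.map (s⟦n⟧')) := by
    have : DerivedCategory.Q.map (s⟦n⟧') =
        ((DerivedCategory.Q (C := C)).commShiftIso n).hom.app F ≫
          (DerivedCategory.Q.map s)⟦n⟧' ≫
            ((DerivedCategory.Q (C := C)).commShiftIso n).inv.app G := by
      simp
    rw [this]
    infer_instance
  have h2 : IsIso (DerivedCategory.Qh.map
      ((HomotopyCategory.quotient C (.up ℤ)).map (s⟦n⟧'))) :=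
    (NatIso.isIso_map_iff (DerivedCategory.quotientCompQhIso C) (s⟦n⟧')).2 h1
  have hF := CochainComplex.IsKProjective.Qh_map_bijective E
    ((HomotopyCategory.quotient C (.up ℤ)).obj (F⟦n⟧))
  have hG := CochainComplex.IsKProjective.Qh_map_bijective E
    ((HomotopyCategory.quotient C (.up ℤ)).obj (G⟦n⟧))
  rw [← hG.of_comp_iff']
  have : DerivedCategory.Qh.map ∘ (fun f : (HomotopyCategory.quotient C (.up ℤ)).obj E ⟶
      (HomotopyCategory.quotient C (.up ℤ)).obj (F⟦n⟧) =>
        f ≫ (HomotopyCategory.quotient C (.up ℤ)).map (s⟦n⟧')) =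
      (fun g => g ≫ DerivedCategory.Qh.map
        ((HomotopyCategory.quotient C (.up ℤ)).map (s⟦n⟧'))) ∘ DerivedCategory.Qh.map := by
    funext f
    exact Functor.map_comp _ _ _
  rw [this]
  refine Function.Bijective.comp ⟨fun f g h => (cancel_mono _).1 h, fun g => ⟨g ≫ inv
    (DerivedCategory.Qh.map ((HomotopyCategory.quotient C (.up ℤ)).map (s⟦n⟧'))), ?_⟩⟩ hF
  simp

variable (E : CochainComplex C ℤ) [E.IsKProjective] {F G : CochainComplex C ℤ} (s : F ⟶ G)
  [QuasiIso s] {n m : ℤ}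

/-- The injective half on cohomology of cochains: a cocycle of degree `n` is a morphism to the
`n`-th shift, and it is a coboundary when its homotopy class is zero. -/
lemma bijective_postcomp_of_quasiIso (n : ℤ) (z : Cocycle E F n)
    (hz : z.postcomp s ∈ coboundaries E G n) : z ∈ coboundaries E F n := by
  rw [← CohomologyClass.toHom_mk_eq_zero_iff, CohomologyClass.toHom_mk] at hz ⊢
  rw [Cocycle.equivHomShift_symm_postcomp, Functor.map_comp] at hz
  refine (bijective_comp_shift_of_quasiIso E s n).1 (hz.trans ?_)
  exact Limits.zero_comp.symm

lemma exists_postcomp_of_quasiIso (n : ℤ) (z : Cocycle E G n) :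
    ∃ w : Cocycle E F n, z - w.postcomp s ∈ coboundaries E G n := by
  obtain ⟨f, hf⟩ := (bijective_comp_shift_of_quasiIso E s n).2
    (CohomologyClass.toHom (CohomologyClass.mk z))
  obtain ⟨w, rfl⟩ := (CohomologyClass.toHom_bijective E F n).2 f
  obtain ⟨w, rfl⟩ := w.mk_surjective
  refine ⟨w, ?_⟩
  rw [← CohomologyClass.toHom_mk_eq_zero_iff, CohomologyClass.mk_sub, map_sub, sub_eq_zero, ← hf,
    CohomologyClass.toHom_mk, CohomologyClass.toHom_mk, Cocycle.equivHomShift_symm_postcomp,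
    Functor.map_comp]

lemma exists_δ_eq_of_postcomp (h : n + 1 = m) {z : Cochain E F m} (hz : δ m (m + 1) z = 0)
    {y : Cochain E G n} (hy : δ n m y = z.comp (Cochain.ofHom s) (add_zero m)) :
    ∃ w : Cochain E F n, δ n m w = z := by
  refine (mem_coboundaries_iff (Cocycle.mk z (m + 1) rfl hz) n h).1 ?_
  exact bijective_postcomp_of_quasiIso E s m _ ((mem_coboundaries_iff _ n h).2 ⟨y, hy⟩)

lemma exists_cocycle_of_postcomp (h : n + 1 = m) {z : Cochain E G m} (hz : δ m (m + 1) z = 0) :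
    ∃ w : Cochain E F m, δ m (m + 1) w = 0 ∧
      ∃ y : Cochain E G n, δ n m y = z - w.comp (Cochain.ofHom s) (add_zero m) := by
  obtain ⟨w, hw⟩ := exists_postcomp_of_quasiIso E s m (Cocycle.mk z (m + 1) rfl hz)
  exact ⟨w.1, w.δ_eq_zero (m + 1), (mem_coboundaries_iff _ n h).1 hw⟩

/-- For acyclic `L` the zero endomorphism is a quasi-isomorphism, and every cochain becomes zero
after postcomposition with it. -/
lemma exists_δ_eq_of_acyclic {L : CochainComplex C ℤ} (hL : L.Acyclic) (h : n + 1 = m)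
    {z : Cochain E L m} (hz : δ m (m + 1) z = 0) : ∃ w : Cochain E L n, δ n m w = z := by
  have : QuasiIso (0 : L ⟶ L) :=
    ⟨fun i => (quasiIsoAt_iff_exactAt _ i (hL i)).2 (hL i)⟩
  refine exists_δ_eq_of_postcomp E (0 : L ⟶ L) h hz (y := 0) ?_
  rw [δ_zero, Cochain.ofHom_zero, Cochain.comp_zero]

end KProjectiveComplexes

end DeRhamMixed

namespace DeRhamMixed

/-! ### Homotopies and K-projective graded mixed modules. -/

section MixedHomotopy

variable {k : Type v} {A : Type u} [Field k] [CommRing A] [Algebra k A]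

namespace MixedMod

variable {M N K : MixedMod k A} {n m : ℤ}

/-- The differential on maps of degree `n`. -/
noncomputable def homDiff (n : ℤ) (f : M.carrier →+ N.carrier) : M.carrier →+ N.carrier :=
  N.d.comp f - n.negOnePow • f.comp M.d

lemma homDiff_apply (n : ℤ) (f : M.carrier →+ N.carrier) (x : M.carrier) :
    homDiff n f x = N.d (f x) - (n.negOnePow : ℤ) • f (M.d x) := rfl

lemma homDiff_mem (h : n + 1 = m) {f : M.carrier →+ N.carrier} (hf : f ∈ M.homDeg N n) :
    homDiff n f ∈ M.homDeg N m := diff_mem M N h hf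

lemma homComplex_d (h : n + 1 = m) (f : M.homDeg N n) :
    ((M.homComplex N).d n m f : M.homDeg N m) = ⟨homDiff n f.1, homDiff_mem h f.2⟩ := by
  simp only [homComplex, dif_pos h]
  rfl

lemma homComplex_d_eq (h : n + 1 = m) (f : M.homDeg N n) (g : M.homDeg N m) :
    (M.homComplex N).d n m f = g ↔ homDiff n f.1 = g.1 := by
  refine Iff.trans ?_ (Subtype.ext_iff (a1 := ⟨homDiff n f.1, homDiff_mem h f.2⟩) (a2 := g))
  rw [← homComplex_d h f]
  exact Iff.rfl

lemma homDiff_add (f g : M.carrier →+ N.carrier) :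
    homDiff n (f + g) = homDiff n f + homDiff n g := by
  ext x
  simp only [homDiff_apply, AddMonoidHom.add_apply, map_add, smul_add]
  abel

lemma homDiff_neg (f : M.carrier →+ N.carrier) : homDiff n (-f) = -homDiff n f := by
  ext x
  simp only [homDiff_apply, AddMonoidHom.neg_apply, map_neg, smul_neg]
  abel

lemma homDiff_comp_lin (f : M.carrier →+ N.carrier) (s : K ⟶ M) :
    homDiff n (f.comp (MixedMod.lin s).toAddMonoidHom) =
      (homDiff n f).comp (MixedMod.lin s).toAddMonoidHom := by
  ext x
  simp only [homDiff_apply, AddMonoidHom.comp_apply, LinearMap.toAddMonoidHom_coe, lin_d]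

lemma isKProjective_iff {Q : MixedMod k A} : Q.IsKProjective ↔
    ∀ N : MixedMod k A, N.IsAcyclic → ∀ n m : ℤ, n + 1 = m → ∀ f ∈ Q.homDeg N m,
      homDiff m f = 0 → ∃ g ∈ Q.homDeg N n, homDiff n g = f := by
  refine forall_congr' fun N => forall_congr' fun _ => ?_
  rw [ab_acyclic_iff]
  constructor
  · intro h n m hnm f hf hf'
    obtain ⟨g, hg⟩ := h n m (m + 1) hnm rfl (⟨f, hf⟩ : Q.homDeg N m)
      ((homComplex_d_eq rfl _ 0).2 hf')
    exact ⟨_, (g : Q.homDeg N n).2, (homComplex_d_eq hnm g ⟨f, hf⟩).1 hg⟩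
  · intro h n m l hnm hml f hf
    obtain ⟨g, hg, h'⟩ := h n m hnm _ (f : Q.homDeg N m).2 ((homComplex_d_eq hml f 0).1 hf)
    exact ⟨(⟨g, hg⟩ : Q.homDeg N n), (homComplex_d_eq hnm ⟨g, hg⟩ f).2 h'⟩

lemma comp_mem {f : M.carrier →+ N.carrier} {g : K.carrier →+ M.carrier}
    (hf : f ∈ M.homDeg N n) (hg : g ∈ K.homDeg M m) : f.comp g ∈ K.homDeg N (m + n) := by
  refine ⟨fun p j x hx => ?_, fun q ω hω x => ?_, fun x => ?_⟩
  · have := hf.1 _ _ _ (hg.1 _ _ _ hx)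
    rwa [add_assoc] at this
  · rw [AddMonoidHom.comp_apply, AddMonoidHom.comp_apply, hg.2.1 q ω hω, Units.smul_def, map_zsmul,
      hf.2.1 q ω hω, ← Units.smul_def, smul_smul, ← Int.negOnePow_add, add_mul]
  · rw [AddMonoidHom.comp_apply, AddMonoidHom.comp_apply, hg.2.2, Units.smul_def, map_zsmul,
      hf.2.2, ← Units.smul_def, smul_smul, ← Int.negOnePow_add]

/-- Homotopy of morphisms of graded mixed dg-modules. -/
def Homotopic (f g : M ⟶ N) : Prop :=
  ∃ h ∈ M.homDeg N (-1), ∀ x, MixedMod.lin f x - MixedMod.lin g x = N.d (h x) + h (M.d x)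

lemma Homotopic.symm {f g : M ⟶ N} (h : Homotopic f g) : Homotopic g f := by
  obtain ⟨h, hh, e⟩ := h
  refine ⟨-h, neg_mem hh, fun x => ?_⟩
  rw [AddMonoidHom.neg_apply, AddMonoidHom.neg_apply, map_neg, ← neg_add, ← e, neg_sub]

lemma Homotopic.trans {f g l : M ⟶ N} (h : Homotopic f g) (h' : Homotopic g l) :
    Homotopic f l := by
  obtain ⟨h, hh, e⟩ := h
  obtain ⟨h', hh', e'⟩ := h'
  refine ⟨h + h', add_mem hh hh', fun x => ?_⟩
  rw [AddMonoidHom.add_apply, AddMonoidHom.add_apply, map_add, add_add_add_comm, ← e, ← e',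
    sub_add_sub_cancel]

lemma Homotopic.comp_left {f g : M ⟶ N} (h : Homotopic f g) (s : K ⟶ M) :
    Homotopic (s ≫ f) (s ≫ g) := by
  obtain ⟨h, hh, e⟩ := h
  refine ⟨_, comp_mem_homDeg s hh, fun x => ?_⟩
  rw [lin_comp, lin_comp, e, AddMonoidHom.comp_apply, AddMonoidHom.comp_apply,
    LinearMap.toAddMonoidHom_coe, lin_d]

lemma Homotopic.comp_right {f g : M ⟶ N} (h : Homotopic f g) (s : N ⟶ K) :
    Homotopic (f ≫ s) (g ≫ s) := by
  obtain ⟨h, hh, e⟩ := h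
  refine ⟨(MixedMod.lin s).toAddMonoidHom.comp h, comp_mem (lin_mem_homDeg s) hh, fun x => ?_⟩
  rw [lin_comp, lin_comp, ← map_sub, e, map_add, lin_d]
  rfl

/-- Homotopic morphisms induce the same map on the cohomology of complexes of maps. -/
lemma Homotopic.exists_homDiff_eq {f g : K ⟶ M} (h : Homotopic f g) (hnm : n + 1 = m)
    {u : M.carrier →+ N.carrier} (hu : u ∈ M.homDeg N m) (hu' : homDiff m u = 0) :
    ∃ v ∈ K.homDeg N n, homDiff n v =
      u.comp (MixedMod.lin f).toAddMonoidHom - u.comp (MixedMod.lin g).toAddMonoidHom := by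
  obtain ⟨h, hh, e⟩ := h
  have hmem := comp_mem hu hh
  rw [show -1 + m = n by lia] at hmem
  have hd (x : M.carrier) : N.d (u x) = (m.negOnePow : ℤ) • u (M.d x) :=
    sub_eq_zero.1 (DFunLike.congr_fun hu' x)
  refine ⟨(m.negOnePow : ℤ) • u.comp h, zsmul_mem hmem _, AddMonoidHom.ext fun x => ?_⟩
  have hn : (n.negOnePow : ℤ) = -(m.negOnePow : ℤ) := by
    rw [← hnm, Int.negOnePow_succ, Units.val_neg, neg_neg]
  have hm : (m.negOnePow : ℤ) * (m.negOnePow : ℤ) = 1 := by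
    rw [← Units.val_mul, Int.units_mul_self, Units.val_one]
  rw [homDiff_apply, hn, neg_smul, sub_neg_eq_add, AddMonoidHom.smul_apply, AddMonoidHom.smul_apply,
    map_zsmul, AddMonoidHom.comp_apply, AddMonoidHom.comp_apply, hd, smul_smul, smul_smul, hm,
    one_smul, one_smul, ← map_add, ← e, map_sub]
  rfl

/-- Morphisms from a K-projective module lift along quasi-isomorphisms, up to homotopy. -/
lemma IsKProjective.exists_lift {P X Y : MixedMod k A} (hP : P.IsKProjective) {f : X ⟶ Y}
    (hf : MixedMod.qis k A f) (g : P ⟶ Y) : ∃ s : P ⟶ X, Homotopic g (s ≫ f) := by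
  -- The map `x ↦ (g x, 0)` is a cycle of degree `0` in the complex of maps to the acyclic cone. The
  -- two coordinates of a primitive are a homotopy and, after a twist by signs, the lift.
  let i : Y.carrier →+ (cone f).carrier := AddMonoidHom.inl _ _
  have hi : i.comp (MixedMod.lin g).toAddMonoidHom ∈ P.homDeg (cone f) 0 := by
    refine ⟨fun p m x hx => ⟨?_, zero_mem _⟩, fun q ω _ x => ?_, fun x => ?_⟩
    · rw [add_zero]
      exact lin_mem g hx
    · rw [zero_mul, Int.negOnePow_zero, one_smul]
      exact Prod.ext (map_smul (MixedMod.lin g) ω x) (smul_zero ω).symm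
    · rw [Int.negOnePow_zero, one_smul]
      exact Prod.ext (lin_ε g x) (map_zero X.ε).symm
  obtain ⟨h, hh, e⟩ := isKProjective_iff.1 hP (cone f) (cone_isAcyclic f hf) (-1) 0 rfl _ hi (by
    refine AddMonoidHom.ext fun x => ?_
    rw [homDiff_apply, Int.negOnePow_zero, Units.val_one, one_smul]
    refine sub_eq_zero.2 (Prod.ext ?_ ?_)
    · change Y.d (MixedMod.lin g x) + MixedMod.lin f (X.inv 0) = MixedMod.lin g (P.d x)
      rw [map_zero, map_zero, add_zero, lin_d]
    · change -X.d 0 = 0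
      rw [map_zero, neg_zero])
  have e' (x : P.carrier) : (MixedMod.lin g x, (0 : X.carrier)) =
      (Y.d (h x).1 + MixedMod.lin f (X.inv (h x).2) + (h (P.d x)).1,
        -X.d (h x).2 + (h (P.d x)).2) := by
    have := DFunLike.congr_fun e x
    rw [homDiff_apply, Int.negOnePow_neg, Int.negOnePow_one, Units.val_neg, Units.val_one,
      neg_smul, one_smul, sub_neg_eq_add] at this
    exact this.symm
  -- The second coordinate has degree `0` as a map to `X` but carries the Koszul signs of degree
  -- `-1`. The sign by weight turns them into those of degree `0`.
  have h2 : X.inv.comp ((AddMonoidHom.snd _ _).comp h : P.carrier →+ X.carrier) ∈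
      P.homDeg X 0 := by
    refine ⟨fun p m x hx => ?_, fun q ω hω x => ?_, fun x => ?_⟩
    · have := (hh.1 p m x hx).2
      rw [show m + -1 + 1 = m + 0 by ring] at this
      exact GrMod.inv_mem this
    · have := congrArg Prod.snd (hh.2.1 q ω hω x)
      change X.inv (h (ω • x)).2 = ((0 * q : ℤ).negOnePow : ℤ) • ω • X.inv (h x).2
      rw [this]
      change X.inv (((-1 * q : ℤ).negOnePow : ℤ) • ω • (h x).2) = _
      rw [map_zsmul, GrMod.inv_forms_smul, sgn_of_mem k A hω, GrMod.zsmul_forms_smul, smul_smul,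
        zero_mul, neg_one_mul, Int.negOnePow_neg, GrMod.negOnePow_natCast, ← mul_pow, neg_one_mul,
        neg_neg, one_pow, Int.negOnePow_zero, Units.val_one]
    · have := congrArg Prod.snd (hh.2.2 x)
      change X.inv (h (P.ε x)).2 = ((0 : ℤ).negOnePow : ℤ) • X.ε (X.inv (h x).2)
      rw [this]
      change X.inv (((-1 : ℤ).negOnePow : ℤ) • X.ε (h x).2) = _
      rw [map_zsmul, inv_ε, Int.negOnePow_neg, Int.negOnePow_one, Int.negOnePow_zero,
        Units.val_neg, Units.val_one, neg_smul, one_smul, one_smul, neg_neg]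
  refine ⟨homOfDegZero h2 fun x => ?_, (AddMonoidHom.fst _ _).comp h, ?_, fun x => ?_⟩
  · change X.inv (h (P.d x)).2 = X.d (X.inv (h x).2)
    rw [← GrMod.inv_d]
    congr 1
    exact (neg_add_eq_zero.1 (congrArg Prod.snd (e' x)).symm).symm
  · refine ⟨fun p m x hx => (hh.1 p m x hx).1, fun q ω hω x => congrArg Prod.fst (hh.2.1 q ω hω x),
      fun x => congrArg Prod.fst (hh.2.2 x)⟩
  · have := congrArg Prod.fst (e' x)
    change MixedMod.lin g x - MixedMod.lin f (X.inv (h x).2) = Y.d (h x).1 + (h (P.d x)).1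
    rw [sub_eq_iff_eq_add]
    refine this.trans ?_
    change Y.d (h x).1 + MixedMod.lin f (X.inv (h x).2) + (h (P.d x)).1 = _
    abel

lemma Homotopic.qis {f g : M ⟶ N} (h : Homotopic f g) (hf : MixedMod.qis k A f) :
    MixedMod.qis k A g := by
  obtain ⟨h, -, e⟩ := h
  have e' (x) (hx : M.d x = 0) : MixedMod.lin f x - MixedMod.lin g x = N.d (h x) := by
    rw [e, hx, map_zero, add_zero]
  rw [qis_iff] at hf ⊢
  refine ⟨fun x hx ⟨y, hy⟩ => hf.1 x hx ⟨h x + y, ?_⟩, fun y hy => ?_⟩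
  · rw [map_add, hy, ← e' x hx, sub_add_cancel]
  · obtain ⟨x, hx, y', hy'⟩ := hf.2 y hy
    refine ⟨x, hx, y' + h x, ?_⟩
    rw [map_add, hy', ← e' x hx, sub_add_sub_cancel]

lemma qis_of_comp {f : K ⟶ M} {g : M ⟶ N} (hg : MixedMod.qis k A g)
    (h : MixedMod.qis k A (f ≫ g)) : MixedMod.qis k A f := by
  rw [qis_iff] at hg h ⊢
  refine ⟨fun x hx ⟨y, hy⟩ => h.1 x hx ⟨MixedMod.lin g y, ?_⟩, fun y hy => ?_⟩
  · rw [← lin_d, hy, lin_comp]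
  · obtain ⟨x, hx, y', hy'⟩ := h.2 (MixedMod.lin g y) (by rw [← lin_d, hy, map_zero])
    obtain ⟨z, hz⟩ := hg.1 (y - MixedMod.lin f x) (by rw [map_sub, hy, ← lin_d, hx, map_zero,
      sub_zero]) ⟨y', by rw [hy', map_sub, lin_comp]⟩
    exact ⟨x, hx, z, hz⟩

lemma qis_id (M : MixedMod k A) : MixedMod.qis k A (𝟙 M) := by
  rw [qis_iff]
  exact ⟨fun x _ ⟨y, hy⟩ => ⟨y, hy⟩, fun y hy => ⟨y, hy, 0, by rw [map_zero, lin_id, sub_self]⟩⟩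

/-- Quasi-isomorphisms between K-projective modules are homotopy equivalences. -/
lemma exists_homotopy_inverse {P Q : MixedMod k A} (hP : P.IsKProjective) (hQ : Q.IsKProjective)
    {s : P ⟶ Q} (hs : MixedMod.qis k A s) :
    ∃ t : Q ⟶ P, Homotopic (t ≫ s) (𝟙 Q) ∧ Homotopic (s ≫ t) (𝟙 P) := by
  obtain ⟨t, ht⟩ := hQ.exists_lift hs (𝟙 Q)
  have ht' : MixedMod.qis k A t := qis_of_comp hs (ht.qis (qis_id Q))
  obtain ⟨s', hs'⟩ := hP.exists_lift ht' (𝟙 P)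
  refine ⟨t, ht.symm, ?_⟩
  -- Comparing `s` with `s' ≫ t ≫ s` in two ways shows that `s` and `s'` are homotopic, so the
  -- one-sided inverse `t` is two-sided.
  have h1 := hs'.comp_right s
  have h2 := ht.symm.comp_left s'
  simp only [Category.assoc, Category.id_comp, Category.comp_id] at h1 h2
  exact ((h1.trans h2).comp_right t).trans hs'.symm

end MixedMod

end MixedHomotopy

end DeRhamMixed

namespace DeRhamMixed

open CochainComplex.HomComplex

/-! ### The comparison of complexes of maps. -/

section FullyFaithful

variable {k : Type v} {A : Type u} [Field k] [CommRing A] [Algebra k A]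

namespace MixedMod

/-- Precomposition with `s` is injective on cohomology: `g` is pulled back along `t`, and the
homotopy from `t ≫ s` to the identity corrects the result. -/
lemma exists_homDiff_eq_of_precomp {P Q N : MixedMod k A} {s : P ⟶ Q} {t : Q ⟶ P}
    (hts : Homotopic (t ≫ s) (𝟙 Q)) {n m : ℤ} (hnm : n + 1 = m) {x : Q.carrier →+ N.carrier}
    (hx : x ∈ Q.homDeg N m) (hx' : homDiff m x = 0) {g : P.carrier →+ N.carrier}
    (hg : g ∈ P.homDeg N n) (h : homDiff n g = x.comp (MixedMod.lin s).toAddMonoidHom) :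
    ∃ g' ∈ Q.homDeg N n, homDiff n g' = x := by
  obtain ⟨v, hv, hv'⟩ := hts.exists_homDiff_eq hnm hx hx'
  refine ⟨g.comp (MixedMod.lin t).toAddMonoidHom + -v,
    add_mem (comp_mem_homDeg t hg) (neg_mem hv), ?_⟩
  rw [homDiff_add, homDiff_neg, homDiff_comp_lin, h, hv', neg_sub]
  refine AddMonoidHom.ext fun y => ?_
  change x (MixedMod.lin s (MixedMod.lin t y)) +
    (x (MixedMod.lin (𝟙 Q) y) - x (MixedMod.lin (t ≫ s) y)) = x y
  rw [lin_comp, lin_id]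
  exact add_sub_cancel _ _

end MixedMod

open MixedMod

variable [CharZero k] (c : DualCoords k A)

section

variable {E : CochainComplex (ModuleCat.{u} (DiffOps k A)) ℤ} {N : MixedMod k A}
  {n : ℤ} {f g : (deRhamObj c E).telescope.carrier →+ N.carrier}

lemma homDiff_eq_iff (hf : f ∈ (deRhamObj c E).telescope.homDeg N n)
    (hg : g ∈ (deRhamObj c E).telescope.homDeg N (n + 1)) :
    homDiff n f = g ↔ δ n (n + 1) (toCochain c hf) = toCochain c hg := by
  rw [← toCochain_diff]
  exact ⟨fun h => by subst h; rfl, fun h => toCochain_injective c _ _ h⟩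

lemma toCochain_sub (hf : f ∈ (deRhamObj c E).telescope.homDeg N n)
    (hg : g ∈ (deRhamObj c E).telescope.homDeg N n) :
    toCochain c (sub_mem hf hg) = toCochain c hf - toCochain c hg :=
  cochain_ext c fun _ _ _ _ _ _ => rfl

lemma toCochain_zero :
    toCochain c (zero_mem ((deRhamObj c E).telescope.homDeg N n)) = 0 :=
  cochain_ext c fun _ _ _ _ _ _ => rfl

lemma δ_toCochain_eq_zero (hf : f ∈ (deRhamObj c E).telescope.homDeg N n)
    (h : homDiff n f = 0) : δ n (n + 1) (toCochain c hf) = 0 :=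
  ((homDiff_eq_iff c hf (zero_mem _)).1 h).trans (toCochain_zero c)

end

variable (E F : CochainComplex (ModuleCat.{u} (DiffOps k A)) ℤ)

variable {E F} in
/-- The map of de Rham complexes attached to a cochain. -/
noncomputable def deRhamCochainHom {n : ℤ} (z : Cochain E F n) :
    (deRhamObj c E).carrier →+ (deRhamObj c F).carrier := (deRhamCochain z).toAddMonoidHom

variable {E F} in
lemma deRhamCochainHom_mem {n : ℤ} (z : Cochain E F n) :
    deRhamCochainHom c z ∈ (deRhamObj c E).homDeg (deRhamObj c F) n := deRhamCochain_mem c z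

variable {E F} in
lemma homDiff_deRhamCochain {n m : ℤ} (h : n + 1 = m) (z : Cochain E F n) :
    homDiff n (deRhamCochainHom c z) =
      deRhamCochainHom c (δ n m z) := by
  subst h
  exact AddMonoidHom.ext fun x => (deRhamCochain_δ z x).symm

variable {E F} in
lemma homDiff_deRhamCochain_eq_zero {n : ℤ} {z : Cochain E F n} (h : δ n (n + 1) z = 0) :
    homDiff n (deRhamCochainHom c z) = 0 := by
  rw [homDiff_deRhamCochain c rfl, h]
  refine AddMonoidHom.ext fun x => ?_
  have := deRhamCochain_add (0 : Cochain E F (n + 1)) 0 x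
  rw [add_zero] at this
  exact left_eq_add.1 this

/-- Precomposing with the augmentation and reading maps out of the resolution as cochains into jets
turns the de Rham functor on complexes of maps into postcomposition with the unit. -/
lemma toCochain_deRhamCochain {n : ℤ} (z : Cochain E F n) :
    toCochain c (comp_mem_homDeg (deRhamObj c E).telescopeProj (deRhamCochainHom_mem c z)) =
      z.comp (Cochain.ofHom (unitHom c F)) (add_zero n) :=
  cochain_ext c fun p q hpq e i P => by
    rw [toCochain_apply, homJet_apply, Cochain.comp_zero_cochain_v, Cochain.ofHom_v]
    change deRhamCochain z (MixedMod.lin (deRhamObj c E).telescopeProj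
      ((deRhamObj c E).telescopeIn i (oneTmul c E (opAct E P (inTot E p e))))) =
        zeroJet (unitJet c F (inTot F q ((z.v p q hpq).hom e))) i P
    rcases i with _ | i
    · rw [telescopeProj_in_zero]
      refine (deRhamCochain_tmul z 1 _).trans ?_
      rw [map_one, resCochain_opAct, resCochain_inTot z p q hpq]
      rfl
    · rw [telescopeProj_in_succ]
      exact map_zero (deRhamCochain z)

section

variable [HasDerivedCategory.{w} (ModuleCat.{u} (DiffOps k A))] {E F}

/-- Maps from the resolution to an acyclic `N` are cochains from `E` to the jets of `N`. That target
is acyclic, and `E` is K-projective. -/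
lemma isKProjective_telescope (hE : E.IsKProjective) :
    (deRhamObj c E).telescope.IsKProjective := by
  rw [isKProjective_iff]
  intro N hN n m hnm f hf hf'
  subst hnm
  obtain ⟨w, hw⟩ := exists_δ_eq_of_acyclic E (jetsObj_acyclic c hN) rfl
    (δ_toCochain_eq_zero c hf hf')
  refine ⟨ofCochain c w, ofCochain_mem c w, (homDiff_eq_iff c (ofCochain_mem c w) hf).2 ?_⟩
  rw [toCochain_ofCochain, hw]

/-- Injectivity on cohomology. The augmentation lifts through `q` up to homotopy, so the given
primitive yields one on the resolution. There the problem is a coboundary equation after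
postcomposition with the unit, a quasi-isomorphism. -/
lemma exists_δ_eq_of_homDiff_eq (hE : E.IsKProjective) {Q : MixedMod k A}
    {q : Q ⟶ deRhamObj c E} {n m : ℤ} (hnm : n + 1 = m)
    (hq : MixedMod.qis k A q) {z : Cochain E F m} (hz : δ m (m + 1) z = 0)
    {y : Q.carrier →+ (deRhamObj c F).carrier} (hy : y ∈ Q.homDeg (deRhamObj c F) n)
    (h : homDiff n y = (deRhamCochainHom c z).comp
      (MixedMod.lin q).toAddMonoidHom) :
    ∃ w : Cochain E F n, δ n m w = z := by
  subst hnm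
  obtain ⟨s, hs⟩ := (isKProjective_telescope c hE).exists_lift hq (deRhamObj c E).telescopeProj
  obtain ⟨v, hv, hv'⟩ := hs.exists_homDiff_eq rfl (deRhamCochainHom_mem c z)
    (homDiff_deRhamCochain_eq_zero c hz)
  have := quasiIso_unitHom c F
  refine exists_δ_eq_of_postcomp E (unitHom c F) rfl hz
    (y := toCochain c (add_mem (comp_mem_homDeg s hy) hv)) ?_
  rw [← toCochain_deRhamCochain]
  refine (homDiff_eq_iff c _ _).1 ?_
  rw [homDiff_add, homDiff_comp_lin, h, hv']
  refine AddMonoidHom.ext fun x => ?_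
  change deRhamCochain z (MixedMod.lin q (MixedMod.lin s x)) +
    (deRhamCochain z (MixedMod.lin (deRhamObj c E).telescopeProj x) -
      deRhamCochain z (MixedMod.lin (s ≫ q) x)) = _
  rw [lin_comp]
  exact add_sub_cancel _ _

/-- Surjectivity on cohomology. The cycle is pulled back to the resolution, where it is cohomologous
to the image of a cocycle `w`; the relation is then transported back to `Q`. -/
lemma exists_deRhamCochain_sub (hE : E.IsKProjective) {Q : MixedMod k A}
    (hQ : Q.IsKProjective) {q : Q ⟶ deRhamObj c E} {n m : ℤ} (hnm : n + 1 = m)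
    (hq : MixedMod.qis k A q)
    {y : Q.carrier →+ (deRhamObj c F).carrier} (hy : y ∈ Q.homDeg (deRhamObj c F) m)
    (hy' : homDiff m y = 0) :
    ∃ w : Cochain E F m, δ m (m + 1) w = 0 ∧ ∃ g ∈ Q.homDeg (deRhamObj c F) n,
      homDiff n g = y - (deRhamCochainHom c w).comp
        (MixedMod.lin q).toAddMonoidHom := by
  subst hnm
  have hP := isKProjective_telescope c hE
  obtain ⟨s, hs⟩ := hP.exists_lift hq (deRhamObj c E).telescopeProj
  -- The lift `s` is itself a quasi-isomorphism, by two out of three, and both its ends are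
  -- K-projective.
  obtain ⟨t, ht, -⟩ := exists_homotopy_inverse hP hQ
    (qis_of_comp hq (hs.qis (qis_telescopeProj _)))
  have := quasiIso_unitHom c F
  have hys : homDiff (n + 1) (y.comp (MixedMod.lin s).toAddMonoidHom) = 0 := by
    rw [homDiff_comp_lin, hy']
    rfl
  obtain ⟨w, hw, u, hu⟩ := exists_cocycle_of_postcomp E (unitHom c F) (rfl : n + 1 = n + 1)
    (δ_toCochain_eq_zero c (comp_mem_homDeg s hy) hys)
  obtain ⟨v, hv, hv'⟩ := hs.exists_homDiff_eq rfl (deRhamCochainHom_mem c w)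
    (homDiff_deRhamCochain_eq_zero c hw)
  refine ⟨w, hw, ?_⟩
  have hmem : (deRhamCochainHom c w).comp
      (MixedMod.lin q).toAddMonoidHom ∈ Q.homDeg (deRhamObj c F) (n + 1) :=
    comp_mem_homDeg q (deRhamCochainHom_mem c w)
  refine exists_homDiff_eq_of_precomp ht rfl (sub_mem hy hmem) ?_
    (add_mem (ofCochain_mem c u) hv) ?_
  · rw [sub_eq_add_neg, homDiff_add, homDiff_neg, hy', zero_add, neg_eq_zero]
    refine (homDiff_comp_lin (deRhamCochainHom c w) q).trans ?_
    rw [homDiff_deRhamCochain_eq_zero c hw]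
    rfl
  · have h1 : homDiff n (ofCochain c u) = y.comp (MixedMod.lin s).toAddMonoidHom -
        (deRhamCochainHom c w).comp
          (MixedMod.lin (deRhamObj c E).telescopeProj).toAddMonoidHom := by
      refine (homDiff_eq_iff c (ofCochain_mem c u) (sub_mem (comp_mem_homDeg s hy)
        (comp_mem_homDeg _ (deRhamCochainHom_mem c w)))).2 ?_
      rw [toCochain_ofCochain, hu, ← toCochain_deRhamCochain]
      exact (toCochain_sub c _ _).symm
    rw [homDiff_add, h1, hv']
    refine AddMonoidHom.ext fun x => ?_
    change (y (MixedMod.lin s x) - deRhamCochainHom c w (MixedMod.lin (deRhamObj c E).telescopeProj x)) +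
      (deRhamCochainHom c w (MixedMod.lin (deRhamObj c E).telescopeProj x) -
        deRhamCochainHom c w (MixedMod.lin (s ≫ q) x)) =
      y (MixedMod.lin s x) - deRhamCochainHom c w (MixedMod.lin q (MixedMod.lin s x))
    rw [lin_comp]
    exact sub_add_sub_cancel _ _ _

lemma quasiIso_deRhamHom_precomp [Algebra.Smooth k A] (hE : E.IsKProjective)
    {Q : MixedMod k A} (hQ : Q.IsKProjective) (q : Q ⟶ (deRham k A).obj E)
    (hq : MixedMod.qis k A q) :
    QuasiIso (deRhamHom E F ≫ MixedMod.precomp q ((deRham k A).obj F)) := by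
  rw [ab_quasiIso_iff]
  intro n m l hnm hml
  subst hml
  refine ⟨fun z hz ⟨y, hy⟩ => ?_, fun y hy => ?_⟩
  · exact exists_δ_eq_of_homDiff_eq (dualCoords k A) hE hnm hq hz y.2
      ((homComplex_d_eq hnm y _).1 hy)
  · obtain ⟨w, hw, g, hg, h⟩ := exists_deRhamCochain_sub (F := F) (dualCoords k A) hE hQ hnm hq
      y.2 ((homComplex_d_eq rfl y 0).1 hy)
    exact ⟨w, hw, (⟨g, hg⟩ : Q.homDeg ((deRham k A).obj F) n),
      (homComplex_d_eq hnm ⟨g, hg⟩ _).2 h⟩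

end

end FullyFaithful

end DeRhamMixed

namespace DeRhamMixed

/-! ### Full faithfulness of functors induced on localizations. -/

section Localizations

variable {C D C' D' : Type*} [Category* C] [Category* D] [Category* C'] [Category* D']

/-- The hypothesis identifies `κ` on objects of the form `Φ.obj Y` with the image of the inverse of
`η`. Naturality of `κ` then exhibits any `f` as the image of `η ≫ Ψ f ≫ η⁻¹`. -/
lemma full_of_counit (Φ : C' ⥤ D') (Ψ : D' ⥤ C') (η : 𝟭 C' ≅ Φ ⋙ Ψ) (κ : Ψ ⋙ Φ ⟶ 𝟭 D')
    (h : ∀ X, Φ.map (η.hom.app X) ≫ κ.app (Φ.obj X) = 𝟙 (Φ.obj X)) : Φ.Full where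
  map_surjective {X Y} f := by
    refine ⟨η.hom.app X ≫ Ψ.map f ≫ η.inv.app Y, ?_⟩
    have h1 : Φ.map (η.inv.app Y) = κ.app (Φ.obj Y) := by
      rw [← cancel_epi (Φ.map (η.hom.app Y)), h, ← Φ.map_comp, Iso.hom_inv_id_app, Φ.map_id]
      rfl
    have h2 := κ.naturality f
    dsimp at h2
    rw [Φ.map_comp, Φ.map_comp, h1, h2, reassoc_of% h X]

variable (L : C ⥤ C') (W : MorphismProperty C) [L.IsLocalization W]
  (L' : D ⥤ D') (W' : MorphismProperty D) [L'.IsLocalization W']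
  (F : C ⥤ D) (G : D ⥤ C) (hF : W.IsInvertedBy (F ⋙ L')) (hG : W'.IsInvertedBy (G ⋙ L))

/-- The isomorphism between the composition of the functors induced on the localizations and the
functor induced by the composition. -/
noncomputable def liftCompIso : L ⋙ Localization.lift (F ⋙ L') hF L ⋙
    Localization.lift (G ⋙ L) hG L' ≅ F ⋙ G ⋙ L :=
  Functor.isoWhiskerRight (Localization.fac (F ⋙ L') hF L) (Localization.lift (G ⋙ L) hG L') ≪≫
    Functor.isoWhiskerLeft F (Localization.fac (G ⋙ L) hG L')

/-- The unit consists of morphisms in `W` and becomes an isomorphism, which already gives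
faithfulness. Fullness comes from `full_of_counit`, where only one triangle identity is needed; the
counit is required only after localizing the target. -/
lemma full_and_faithful_lift_of_unit (hG : W'.IsInvertedBy (G ⋙ L)) (η : 𝟭 C ⟶ F ⋙ G)
    (hη : ∀ X, W (η.app X)) (κ : G ⋙ F ⋙ L' ⟶ L')
    (h : ∀ X, L'.map (F.map (η.app X)) ≫ κ.app (F.obj X) = 𝟙 _) :
    (Localization.lift (F ⋙ L') hF L).Full ∧ (Localization.lift (F ⋙ L') hF L).Faithful := by
  let Φ := Localization.lift (F ⋙ L') hF L
  let Ψ := Localization.lift (G ⋙ L) hG L'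
  let _ : Localization.Lifting L W (F ⋙ G ⋙ L) (Φ ⋙ Ψ) := ⟨liftCompIso L W L' W' F G hF hG⟩
  let _ : Localization.Lifting L' W' (G ⋙ F ⋙ L') (Ψ ⋙ Φ) := ⟨liftCompIso L' W' L W G F hG hF⟩
  let ηL : L ⟶ F ⋙ G ⋙ L := Functor.whiskerRight η L
  have (X : C) : IsIso (ηL.app X) := Localization.inverts L W _ (hη X)
  have : IsIso ηL := NatIso.isIso_of_isIso_app _
  let η' : 𝟭 C' ≅ Φ ⋙ Ψ := Localization.liftNatIso L W L (F ⋙ G ⋙ L) _ _ (asIso ηL)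
  let κ' : Ψ ⋙ Φ ⟶ 𝟭 D' := Localization.liftNatTrans L' W' (G ⋙ F ⋙ L') L' _ _ κ
  refine ⟨full_of_counit Φ Ψ η' κ' fun X => ?_, Functor.Faithful.of_comp_iso η'.symm⟩
  -- Natural transformations out of a localization are determined on objects coming from the
  -- original category. There the triangle identity reduces to `h`, once the comparison isomorphisms
  -- `Localization.fac` cancel.
  have key : Functor.whiskerRight η'.hom Φ ≫ (Functor.whiskerLeft Φ κ' : Φ ⋙ Ψ ⋙ Φ ⟶ Φ) =
      𝟙 Φ := by
    refine Localization.natTrans_ext L W fun X => ?_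
    have h1 : η'.hom.app (L.obj X) = L.map (η.app X) ≫
        (Localization.fac (G ⋙ L) hG L').inv.app (F.obj X) ≫
          Ψ.map ((Localization.fac (F ⋙ L') hF L).inv.app X) := by
      refine (Localization.liftNatTrans_app L W L (F ⋙ G ⋙ L) _ _ _ X).trans ?_
      exact Category.id_comp _
    have h2 (Y : D) : κ'.app (L'.obj Y) = Φ.map ((Localization.fac (G ⋙ L) hG L').hom.app Y) ≫
        (Localization.fac (F ⋙ L') hF L).hom.app (G.obj Y) ≫ κ.app Y := by
      refine (Localization.liftNatTrans_app L' W' (G ⋙ F ⋙ L') L' _ _ _ Y).trans ?_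
      exact (congrArg _ (Category.comp_id _)).trans (Category.assoc _ _ _)
    have h3 := κ'.naturality ((Localization.fac (F ⋙ L') hF L).inv.app X)
    have h4 := (Localization.fac (F ⋙ L') hF L).hom.naturality (η.app X)
    change Φ.map (Ψ.map _) ≫ _ = _ ≫ _ at h3
    change Φ.map (η'.hom.app (L.obj X)) ≫ κ'.app (Φ.obj (L.obj X)) = 𝟙 (Φ.obj (L.obj X))
    have h5 : Φ.map (L.map (η.app X)) = (Localization.fac (F ⋙ L') hF L).hom.app X ≫
        L'.map (F.map (η.app X)) ≫
          (Localization.fac (F ⋙ L') hF L).inv.app (G.obj (F.obj X)) := by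
      have := h4 =≫ (Localization.fac (F ⋙ L') hF L).inv.app (G.obj (F.obj X))
      rw [Category.assoc] at this
      refine Eq.trans ?_ (this.trans (Category.assoc _ _ _))
      exact (Category.comp_id _).symm.trans
        (congrArg _ (Iso.hom_inv_id_app (Localization.fac (F ⋙ L') hF L) _).symm)
    have h6 (Y : D) : Φ.map ((Localization.fac (G ⋙ L) hG L').inv.app Y) ≫
        Φ.map ((Localization.fac (G ⋙ L) hG L').hom.app Y) = 𝟙 _ := by
      rw [← Φ.map_comp, Iso.inv_hom_id_app, Φ.map_id]
    calc _ = Φ.map (L.map (η.app X)) ≫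
          Φ.map ((Localization.fac (G ⋙ L) hG L').inv.app (F.obj X)) ≫
            Φ.map (Ψ.map ((Localization.fac (F ⋙ L') hF L).inv.app X)) ≫
              κ'.app (Φ.obj (L.obj X)) := by
          rw [h1, Φ.map_comp, Φ.map_comp, Category.assoc, Category.assoc]
      _ = Φ.map (L.map (η.app X)) ≫
          Φ.map ((Localization.fac (G ⋙ L) hG L').inv.app (F.obj X)) ≫
            (Φ.map ((Localization.fac (G ⋙ L) hG L').hom.app (F.obj X)) ≫
              (Localization.fac (F ⋙ L') hF L).hom.app (G.obj (F.obj X)) ≫ κ.app (F.obj X)) ≫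
                (Localization.fac (F ⋙ L') hF L).inv.app X := by
          rw [← h2]
          exact congrArg _ (congrArg _ h3)
      _ = Φ.map (L.map (η.app X)) ≫
          ((Localization.fac (F ⋙ L') hF L).hom.app (G.obj (F.obj X)) ≫ κ.app (F.obj X)) ≫
            (Localization.fac (F ⋙ L') hF L).inv.app X := by
          rw [Category.assoc, reassoc_of% h6 (F.obj X)]
      _ = (Localization.fac (F ⋙ L') hF L).hom.app X ≫
          (L'.map (F.map (η.app X)) ≫ κ.app (F.obj X)) ≫
            (Localization.fac (F ⋙ L') hF L).inv.app X := by
          rw [h5]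
          simp only [Category.assoc, Iso.inv_hom_id_app_assoc]
      _ = _ := by
          rw [h]
          exact (congrArg _ (Category.id_comp _)).trans (Iso.hom_inv_id_app _ X)
  exact congr_app key X

lemma mem_essImage_lift {M : D} (κ : G ⋙ F ⋙ L' ⟶ L') (hM : IsIso (κ.app M)) :
    (Localization.lift (F ⋙ L') hF L).essImage (L'.obj M) :=
  ⟨L.obj (G.obj M), ⟨(Localization.fac (F ⋙ L') hF L).app (G.obj M) ≪≫ asIso (κ.app M)⟩⟩

end Localizations

end DeRhamMixed

namespace DeRhamMixed

/-! ### The derived de Rham functor, its counit and its essential image. -/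

section TelescopeIso

variable {k : Type v} {A : Type u} [Field k] [CommRing A] [Algebra k A]

/-- The augmentation of the resolution, as an isomorphism in the localization. -/
noncomputable def telescopeIso (X : MixedMod k A) :
    (MixedMod.qis k A).Q.obj X.telescope ≅ (MixedMod.qis k A).Q.obj X :=
  Localization.isoOfHom (MixedMod.qis k A).Q (MixedMod.qis k A) _ (MixedMod.qis_telescopeProj X)

lemma telescopeIso_hom_naturality {X Y : MixedMod k A} (f : X ⟶ Y) :
    (MixedMod.qis k A).Q.map (MixedMod.telescopeMap f) ≫ (telescopeIso Y).hom =
      (telescopeIso X).hom ≫ (MixedMod.qis k A).Q.map f := by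
  have h := congrArg (MixedMod.qis k A).Q.map ((MixedMod.telescopeProjNat k A).naturality f)
  rw [Functor.map_comp, Functor.map_comp] at h
  exact h

lemma telescopeIso_inv_naturality {X Y : MixedMod k A} (f : X ⟶ Y) :
    (MixedMod.qis k A).Q.map f ≫ (telescopeIso Y).inv =
      (telescopeIso X).inv ≫ (MixedMod.qis k A).Q.map (MixedMod.telescopeMap f) := by
  rw [Iso.comp_inv_eq, Category.assoc, telescopeIso_hom_naturality, Iso.inv_hom_id_assoc]

end TelescopeIso

section DerivedDeRham

variable {k : Type v} {A : Type u} [Field k] [CommRing A] [Algebra k A] [CharZero k]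

section

variable (c : DualCoords k A)

lemma unitHom_naturality {E F : CochainComplex (ModuleCat.{u} (DiffOps k A)) ℤ} (f : E ⟶ F) :
    f ≫ unitHom c F = unitHom c E ≫ (jetsFun c).map (deRhamMap c f) := by
  refine HomologicalComplex.hom_ext _ _ fun n => ModuleCat.hom_ext (LinearMap.ext fun e =>
    Subtype.ext (funext fun i => LinearMap.ext fun P => ?_))
  change zeroJet (unitJet c F (inTot F n ((f.f n).hom e))) i P =
    formsMap f (zeroJet (unitJet c E (inTot E n e)) i P)
  rcases i with _ | i
  · change unitJet c F (inTot F n ((f.f n).hom e)) P = formsMap f (unitJet c E (inTot E n e) P)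
    rw [unitJet_apply, unitJet_apply, formsMap_tmul, resMap_opAct, resMap_inTot]
  · exact (map_zero (formsMap f)).symm

end

variable [Algebra.Smooth k A]

variable (k A) in
/-- The unit, as a natural transformation. -/
noncomputable def unitNat : 𝟭 (CochainComplex (ModuleCat.{u} (DiffOps k A)) ℤ) ⟶
    deRham k A ⋙ jetsFun (dualCoords k A) where
  app F := unitHom (dualCoords k A) F
  naturality _ _ f := unitHom_naturality (dualCoords k A) f

variable (k A) in
/-- The evaluation of jets, as a natural transformation between functors to the localization. -/
noncomputable def counitNat :
    jetsFun (dualCoords k A) ⋙ deRham k A ⋙ (MixedMod.qis k A).Q ⟶ (MixedMod.qis k A).Q where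
  app M := (telescopeIso (deRhamObj (dualCoords k A) (jetsObj (dualCoords k A) M))).inv ≫
    (MixedMod.qis k A).Q.map (counitHom (dualCoords k A) M)
  naturality M N f := by
    refine (Category.assoc _ _ _).symm.trans ((congrArg (· ≫ _)
      (telescopeIso_inv_naturality (deRhamMap (dualCoords k A)
        (jetsMap (dualCoords k A) f)))).trans ?_)
    refine (Category.assoc _ _ _).trans ((congrArg _ ?_).trans (Category.assoc _ _ _).symm)
    rw [← Functor.map_comp, ← Functor.map_comp, counitHom_naturality]

/-- By naturality of the inverse of the augmentation this becomes `telescopeMap_unitHom_counitHom`,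
after which the augmentation cancels against its inverse. -/
lemma map_unitHom_counitNat (F : CochainComplex (ModuleCat.{u} (DiffOps k A)) ℤ) :
    (MixedMod.qis k A).Q.map ((deRham k A).map ((unitNat k A).app F)) ≫
      (counitNat k A).app ((deRham k A).obj F) = 𝟙 _ := by
  refine (Category.assoc _ _ _).symm.trans ((congrArg (· ≫ _)
    (telescopeIso_inv_naturality (deRhamMap (dualCoords k A)
      (unitHom (dualCoords k A) F)))).trans ?_)
  refine (Category.assoc _ _ _).trans (Eq.trans (congrArg _ ?_) (telescopeIso _).inv_hom_id)
  refine (Functor.map_comp _ _ _).symm.trans (congrArg _ ?_)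
  exact telescopeMap_unitHom_counitHom (dualCoords k A) F

variable (k A) in
lemma isInvertedBy_deRham : (HomologicalComplex.quasiIso (ModuleCat.{u} (DiffOps k A))
    (ComplexShape.up ℤ)).IsInvertedBy (deRham k A ⋙ (MixedMod.qis k A).Q) := fun _ _ f hf => by
  have : QuasiIso f := hf
  exact Localization.inverts (MixedMod.qis k A).Q (MixedMod.qis k A) _ (qis_deRhamMap (dualCoords k A) f)

/-- The cohomology of a graded mixed module whose underlying module is free up to
quasi-isomorphism is contractible. -/
noncomputable def contractionOfIso {M : MixedMod k A} {E₀ : CochainComplex (ModuleCat.{u} A) ℤ}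
    (e : (GrMod.qis k A).Q.obj ((MixedMod.forget k A).obj M) ≅
      (GrMod.qis k A).Q.obj (freeMod k E₀)) : Contraction (dualCoords k A) M.toGrMod.hMod :=
  -- The isomorphism lives in the localization only. The cohomology functor, being defined there,
  -- turns it into an isomorphism of cohomology along which the contractions are transported.
  (freeCohomologyContraction (dualCoords k A) E₀).ofIso
    (((Localization.fac _ GrMod.isInvertedBy_hFun (GrMod.qis k A).Q).app _).symm ≪≫
      (Localization.lift (GrMod.hFun k A) GrMod.isInvertedBy_hFun (GrMod.qis k A).Q).mapIso
        e.symm ≪≫ (Localization.fac _ GrMod.isInvertedBy_hFun (GrMod.qis k A).Q).app _)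

lemma isIso_counitNat_app {M : MixedMod k A}
    (K : Contraction (dualCoords k A) M.toGrMod.hMod) : IsIso ((counitNat k A).app M) := by
  have h := Localization.inverts (MixedMod.qis k A).Q (MixedMod.qis k A) _
    (qis_counitHom (dualCoords k A) K)
  exact IsIso.comp_isIso' (telescopeIso _).isIso_inv h

variable [HasDerivedCategory.{w} (ModuleCat.{u} (DiffOps k A))]

/-- Every object of the derived category comes from a complex `E`. Forgetting the mixed structure
preserves quasi-isomorphisms and takes the de Rham complex of `E` to the free module on the
underlying complex of `A`-modules, `resA E`. -/
lemma exists_iso_of_mem_essImage {M : MixedMod k A}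
    (h : (Localization.lift (deRham k A ⋙ (MixedMod.qis k A).Q) (isInvertedBy_deRham k A)
      DerivedCategory.Q).essImage ((MixedMod.qis k A).Q.obj M)) :
    ∃ E₀ : CochainComplex (ModuleCat.{u} A) ℤ,
      Nonempty ((GrMod.qis k A).Q.obj ((MixedMod.forget k A).obj M) ≅
        (GrMod.qis k A).Q.obj (freeMod k E₀)) := by
  obtain ⟨Y, ⟨e⟩⟩ := h
  let E := DerivedCategory.Q.objPreimage Y
  let Φ := Localization.lift (deRham k A ⋙ (MixedMod.qis k A).Q) (isInvertedBy_deRham k A)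
    DerivedCategory.Q
  let e' : (MixedMod.qis k A).Q.obj M ≅ (MixedMod.qis k A).Q.obj ((deRham k A).obj E) :=
    e.symm ≪≫ Φ.mapIso (DerivedCategory.Q.objObjPreimageIso Y).symm ≪≫
      (Localization.fac (deRham k A ⋙ (MixedMod.qis k A).Q) (isInvertedBy_deRham k A)
        DerivedCategory.Q).app E
  have hU : (MixedMod.qis k A).IsInvertedBy (MixedMod.forget k A ⋙ (GrMod.qis k A).Q) :=
    fun _ _ f hf => Localization.inverts (GrMod.qis k A).Q (GrMod.qis k A) _ hf
  exact ⟨resA E, ⟨((Localization.fac _ hU (MixedMod.qis k A).Q).app M).symm ≪≫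
    (Localization.lift _ hU (MixedMod.qis k A).Q).mapIso e' ≪≫
      (Localization.fac _ hU (MixedMod.qis k A).Q).app ((deRham k A).obj E)⟩⟩

end DerivedDeRham

end DeRhamMixed

/-- For a smooth affine variety `Spec A` over a field `k` of characteristic zero, the de Rham functor
is fully faithful from the dg-category of modules over the differential operators to the dg-category
of graded mixed modules over the de Rham algebra (hence also on derived categories), and its
essential image consists of the graded mixed modules whose underlying graded dg-module is free. -/
theorem propositionp1 {k : Type v} {A : Type u} [Field k] [CharZero k] [CommRing A] [Algebra k A]
    [Algebra.Smooth k A] [HasDerivedCategory.{w} (ModuleCat.{u} (DeRhamMixed.DiffOps k A))] :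
    (∀ E F : CochainComplex (ModuleCat.{u} (DeRhamMixed.DiffOps k A)) ℤ, E.IsKProjective →
      (∃ (Q : DeRhamMixed.MixedMod k A) (q : Q ⟶ (DeRhamMixed.deRham k A).obj E),
        Q.IsKProjective ∧ DeRhamMixed.MixedMod.qis k A q) ∧
      ∀ (Q : DeRhamMixed.MixedMod k A) (q : Q ⟶ (DeRhamMixed.deRham k A).obj E),
        Q.IsKProjective → DeRhamMixed.MixedMod.qis k A q →
          QuasiIso (DeRhamMixed.deRhamHom E F ≫
            DeRhamMixed.MixedMod.precomp q ((DeRhamMixed.deRham k A).obj F))) ∧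
    ∃ h : (HomologicalComplex.quasiIso (ModuleCat.{u} (DeRhamMixed.DiffOps k A))
        (ComplexShape.up ℤ)).IsInvertedBy
          (DeRhamMixed.deRham k A ⋙ (DeRhamMixed.MixedMod.qis k A).Q),
      (Localization.lift (DeRhamMixed.deRham k A ⋙ (DeRhamMixed.MixedMod.qis k A).Q) h
        DerivedCategory.Q).Full ∧
      (Localization.lift (DeRhamMixed.deRham k A ⋙ (DeRhamMixed.MixedMod.qis k A).Q) h
        DerivedCategory.Q).Faithful ∧
      ∀ M : DeRhamMixed.MixedMod k A,
        (Localization.lift (DeRhamMixed.deRham k A ⋙ (DeRhamMixed.MixedMod.qis k A).Q) h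
          DerivedCategory.Q).essImage ((DeRhamMixed.MixedMod.qis k A).Q.obj M) ↔
        ∃ E₀ : CochainComplex (ModuleCat.{u} A) ℤ,
          Nonempty ((DeRhamMixed.GrMod.qis k A).Q.obj ((DeRhamMixed.MixedMod.forget k A).obj M) ≅
            (DeRhamMixed.GrMod.qis k A).Q.obj (DeRhamMixed.freeMod k E₀)) := by
  open DeRhamMixed in
  have hG : (MixedMod.qis k A).IsInvertedBy (jetsFun (dualCoords k A) ⋙ DerivedCategory.Q) :=
    fun _ _ f hf => by
      have := quasiIso_jetsFun_map (dualCoords k A) hf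
      exact inferInstanceAs (IsIso (DerivedCategory.Q.map ((jetsFun (dualCoords k A)).map f)))
  obtain ⟨h1, h2⟩ := full_and_faithful_lift_of_unit DerivedCategory.Q
    (HomologicalComplex.quasiIso (ModuleCat.{u} (DiffOps k A)) (ComplexShape.up ℤ))
    (MixedMod.qis k A).Q (MixedMod.qis k A) (deRham k A) (jetsFun (dualCoords k A))
    (isInvertedBy_deRham k A) hG (unitNat k A) (quasiIso_unitHom (dualCoords k A))
    (counitNat k A) map_unitHom_counitNat
  -- The resolution of the de Rham complex with its augmentation serves as the K-projective
  -- replacement.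
  refine ⟨fun E F hE => ⟨⟨_, (deRhamObj (dualCoords k A) E).telescopeProj,
    isKProjective_telescope (dualCoords k A) hE, MixedMod.qis_telescopeProj _⟩,
    fun Q q hQ hq => quasiIso_deRhamHom_precomp hE hQ q hq⟩, isInvertedBy_deRham k A, h1, h2,
    fun M => ⟨exists_iso_of_mem_essImage, fun ⟨E₀, ⟨e⟩⟩ => ?_⟩⟩
  exact mem_essImage_lift DerivedCategory.Q _ (MixedMod.qis k A).Q (deRham k A)
    (jetsFun (dualCoords k A)) (isInvertedBy_deRham k A) (counitNat k A)
    (isIso_counitNat_app (contractionOfIso e))
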